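/- **Setting.** Let $T>0$ and $r>0$, let $S\in C_0^\infty(\mathbb R)$ with $\operatorname{supp}S\subset[-r,r]$, and put $\phi=S'$. For $f:\mathbb R\to\mathbb R$ (bounded, measurable and constant near $-\infty$) let $$\mathbf S[f](x)=f(x)\,(\phi\star f)(x)-\int_{-\infty}^x f(z)\,(\phi'\star f)(z)\,dz ,$$ and $\mathbf S[F](t,x)=\mathbf S[F(t,\cdot)](x)$. A *flux* is an element $A\in C([0,T];\mathrm{Lip}([-\tfrac12,\tfrac12]))$; $|\cdot|_{\mathrm{Lip}}$ is the Lipschitz seminorm on $[-\frac12,\frac12]$, and $A(t,\cdot)$ is extended to $\mathbb R$ by constants. An *initial datum with radius $R>0$* is a nondecreasing $F^{\mathrm{in}}\in BV(\mathbb R)$ (finite total variation) with $F^{\mathrm{in}}(\pm x)=\pm\frac12$ for all $x\ge R$. A function $F:[0,T]\times\mathbb R\to\mathbb R$ is an *entropy solution with radius $R$* of $$\partial_tF+\partial_x(A(t,F))=\mathbf S[F]\qquad(\ast)$$ with initial datum $F^{\mathrm{in}}$ if $F\in L^1_{\mathrm{loc}}$, its distributional gradient on $(0,T)\times\mathbb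 R$ is a finite measure, and 1. $F(t,\pm x)=\pm\frac12$ for all $t\in[0,T]$ and $x\ge R$; 2. $F(t,\cdot)$ is nondecreasing for every $t\in[0,T]$; 3. $F(t,\cdot)\to F^{\mathrm{in}}$ in the sense of distributions as $t\to0^+$; 4. for every $0\le\chi\in C_0^\infty((0,T)\times\mathbb R)$ and every $\alpha\in\mathbb R$, $$\int_0^T\!\!\int_{\mathbb R}\Big(|F-\alpha|\,\partial_t\chi+\mathrm{sgn}(F-\alpha)\big(A(t,F)-A(t,\alpha)\big)\partial_x\chi+\mathrm{sgn}(F-\alpha)\,\chi\,\mathbf S[F]\Big)dx\,dt\ \ge 0,$$ with $\mathrm{sgn}(0)=0$. It is called *time-continuous* if $F-F^{\mathrm{in}}\in C([0,T];L^1(\mathbb R))$. **Theorem.** 1. *(Well-posedness)* Let $A$ be a flux and $F^{\mathrm{in}}$ an initial datum with radius $R$. If $S$ is odd, there are $R'\ge R$ and a time-continuous entropy solution of $(\ast)$ with radius $R'$ and initial datum $F^{\mathrm{in}}$. Moreover (for any $S$ as above), any two entropy solutions $F,G$ with this flux and this initial datum, with arbitrary radii, coincide: for a.e. $t\in[0,T]$,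 $F(t,\cdot)=G(t,\cdot)$ a.e. 2. *(Stability)* There is a constant $C=C(r,R,\|\phi'\|_\infty,\|\phi\|_\infty)>0$ such that for all $T$, $S$ as above, all fluxes $A,\widetilde A$ and all entropy solutions $F,\widetilde F$ with radius $R$, fluxes $A$, $\widetilde A$ and initial data $F^{\mathrm{in}},\widetilde F^{\mathrm{in}}$ with radius $R$, $$\|F(t,\cdot)-\widetilde F(t,\cdot)\|_1\le e^{Ct}\Big(\|F^{\mathrm{in}}-\widetilde F^{\mathrm{in}}\|_1+t\sup_{s\in[0,T]}|A(s,\cdot)-\widetilde A(s,\cdot)|_{\mathrm{Lip}}\Big)$$ for a.e. $t\in[0,T]$, and for every $t\in[0,T]$ if $F$ and $\widetilde F$ are time-continuous. 3. *(Mean field limit)* Let $S$ be odd, let $A(t,v)=-v^2$, and let $F$ be the time-continuous entropy solution of $(\ast)$ with an initial datum $F^{\mathrm{in}}$. For each $N\ge1$ let $(x_i,m_i)_{i=1}^N=(x_i^N,m_i^N)_{i=1}^N$ be an absolutely continuous solution on $[0,T]$ of $$\dot x_i=\frac1N\sum_{j=1}^N m_j\,\mathrm{sgn}(x_j-x_i),\qquad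 \dot m_i=\frac1N\sum_{j=1}^N m_im_j\,S(x_i-x_j),$$ satisfied for a.e. $t$ (equivalently, in integrated form), with $x_1(0)<\dots<x_N(0)$, $m_i(0)>0$ and $\frac1N\sum_i m_i(0)=1$, and let $F_N(t,x)=-\frac12+\frac1N\sum_{k=1}^N m_k(t)H(x-x_k(t))$ with $H=\mathbf 1_{[0,\infty)}$. If $\|F_N(0,\cdot)-F^{\mathrm{in}}\|_1\to0$, then $F_N-F\in C([0,T];L^1(\mathbb R))$ for every $N$ and $$\sup_{t\in[0,T]}\|F_N(t,\cdot)-F(t,\cdot)\|_1\to0\qquad(N\to\infty).$$ -/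

import Mathlib

open Filter Topology MeasureTheory Set
open scoped ContDiff ENNReal

noncomputable section

namespace OpinionBurgers

/-- The convolution `(φ ⋆ f)(x) = ∫ φ(x - y) f(y) dy` on the real line. -/
def conv (φ f : ℝ → ℝ) (x : ℝ) : ℝ := ∫ y, φ (x - y) * f y

/-- The nonlocal source term, with `φ = S'`, of a function `f` of the space variable:
`𝐒[f](x) = f(x) (φ ⋆ f)(x) - ∫_{-∞}^x f(z) (φ' ⋆ f)(z) dz`. -/
def source (S f : ℝ → ℝ) (x : ℝ) : ℝ :=
  f x * conv (deriv S) f x - ∫ z in Iic x, f z * conv (deriv (deriv S)) f z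

/-- The interval `[-1/2, 1/2]` on which fluxes are defined. -/
def fluxDomain : Set ℝ := Icc (-1 / 2) (1 / 2)

/-- The Lipschitz seminorm on `[-1/2, 1/2]`, as an extended nonnegative real
(the pairs `v = w` contribute `0 / 0 = 0`). -/
def lipSeminorm (g : ℝ → ℝ) : ℝ≥0∞ :=
  ⨆ v ∈ fluxDomain, ⨆ w ∈ fluxDomain, ENNReal.ofReal (|g v - g w| / |v - w|)

/-- The norm of `Lip([-1/2, 1/2])`: supremum norm plus Lipschitz seminorm. -/
def lipNorm (g : ℝ → ℝ) : ℝ≥0∞ :=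
  (⨆ v ∈ fluxDomain, ENNReal.ofReal |g v|) + lipSeminorm g

/-- `A ∈ C([0,T]; Lip([-1/2, 1/2]))`. The values of `A t v` for `t ∉ [0,T]` or
`v ∉ [-1/2, 1/2]` are irrelevant. -/
structure IsFlux (T : ℝ) (A : ℝ → ℝ → ℝ) : Prop where
  lip : ∀ t ∈ Icc 0 T, lipNorm (A t) < ⊤
  cont : ∀ t₀ ∈ Icc 0 T,
    Tendsto (fun t => lipNorm (fun v => A t v - A t₀ v)) (𝓝[Icc 0 T] t₀) (𝓝 0)

/-- Extension of a function on `[-1/2, 1/2]` to the line, constant on each side. It gives a meaning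
to `A(t, α)` for every real `α` in the entropy inequality; since `∫ ∂ₓχ dx = 0`, the extended values
do not influence that inequality. -/
def fluxExt (g : ℝ → ℝ) (v : ℝ) : ℝ := g (max (-1 / 2) (min v (1 / 2)))

/-- Locally integrable functions of finite total variation on an open set `Ω` of
the plane: `u ∈ L¹_loc(Ω)` and
`sup { ∫_Ω u div(p, q) : (p, q) ∈ C_c^∞(Ω; ℝ²), |(p, q)| ≤ 1 } < ∞`,
that is, the distributional gradient of `u` is a finite vector measure. -/
def IsBV (Ω : Set (ℝ × ℝ)) (u : ℝ × ℝ → ℝ) : Prop :=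
  LocallyIntegrableOn u Ω volume ∧
  ∃ M : ℝ, ∀ p q : ℝ × ℝ → ℝ,
    ContDiff ℝ ∞ p → HasCompactSupport p → tsupport p ⊆ Ω →
    ContDiff ℝ ∞ q → HasCompactSupport q → tsupport q ⊆ Ω →
    (∀ z, p z ^ 2 + q z ^ 2 ≤ 1) →
    ∫ z in Ω, u z * (fderiv ℝ p z (1, 0) + fderiv ℝ q z (0, 1)) ≤ M

/-- Admissible initial data: nondecreasing, of bounded variation, and equal to `±1/2` at `±x` for
all `x ≥ R`. -/
structure IsInitialDatum (R : ℝ) (F₀ : ℝ → ℝ) : Prop where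
  mono : Monotone F₀
  bv : BoundedVariationOn F₀ univ
  tails : ∀ x, R ≤ x → F₀ x = 1 / 2 ∧ F₀ (-x) = -1 / 2

/-- `F` is an entropy solution on `[0,T] × ℝ`, with radius `R`, of
`∂ₜF + ∂ₓ(A(t,F)) = 𝐒[F]`, with initial datum `F₀`. -/
structure IsEntropySolution (T : ℝ) (A : ℝ → ℝ → ℝ) (S F₀ : ℝ → ℝ) (R : ℝ)
    (F : ℝ → ℝ → ℝ) : Prop where
  bv : IsBV (Ioo 0 T ×ˢ univ) (fun z => F z.1 z.2)
  tails : ∀ t ∈ Icc 0 T, ∀ x, R ≤ x → F t x = 1 / 2 ∧ F t (-x) = -1 / 2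
  mono : ∀ t ∈ Icc 0 T, Monotone (F t)
  initial : ∀ η : ℝ → ℝ, ContDiff ℝ ∞ η → HasCompactSupport η →
    Tendsto (fun t => ∫ x, F t x * η x) (𝓝[>] 0) (𝓝 (∫ x, F₀ x * η x))
  entropy : ∀ χ : ℝ × ℝ → ℝ, ContDiff ℝ ∞ χ → HasCompactSupport χ →
    tsupport χ ⊆ Ioo 0 T ×ˢ univ → (∀ z, 0 ≤ χ z) → ∀ α : ℝ,
    0 ≤ ∫ z in Ioo 0 T ×ˢ univ,
      (|F z.1 z.2 - α| * fderiv ℝ χ z (1, 0)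
        + Real.sign (F z.1 z.2 - α)
            * (fluxExt (A z.1) (F z.1 z.2) - fluxExt (A z.1) α) * fderiv ℝ χ z (0, 1)
        + Real.sign (F z.1 z.2 - α) * χ z * source S (F z.1) z.2)

/-- The `L¹(ℝ)` norm, as an extended nonnegative real. -/
def normL1 (f : ℝ → ℝ) : ℝ≥0∞ := eLpNorm f 1 volume

/-- `D ∈ C([0,T]; L¹(ℝ))`. -/
def InCL1 (T : ℝ) (D : ℝ → ℝ → ℝ) : Prop :=
  (∀ t ∈ Icc 0 T, Integrable (D t)) ∧
  ∀ t₀ ∈ Icc 0 T, Tendsto (fun t => normL1 (fun x => D t x - D t₀ x)) (𝓝[Icc 0 T] t₀) (𝓝 0)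

/-- The stability estimate at time `t`, with constant `K`, for solutions `F`, `G` with fluxes `A`, `A'`
and initial data `F₀`, `G₀`:
`‖F(t) - G(t)‖₁ ≤ e^{Kt} (‖F₀ - G₀‖₁ + t sup_{s ∈ [0,T]} |A(s,·) - A'(s,·)|_Lip)`. -/
def StabilityEstimate (T K : ℝ) (A A' : ℝ → ℝ → ℝ) (F₀ G₀ : ℝ → ℝ) (F G : ℝ → ℝ → ℝ)
    (t : ℝ) : Prop :=
  normL1 (fun x => F t x - G t x) ≤
    ENNReal.ofReal (Real.exp (K * t)) *
      (normL1 (fun x => F₀ x - G₀ x)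
        + ENNReal.ofReal t * ⨆ s ∈ Icc 0 T, lipSeminorm (fun v => A s v - A' s v))

/-- The supremum norm of a bounded function. -/
def supNorm (f : ℝ → ℝ) : ℝ := ⨆ z, |f z|

/-- `(x, m)` is a classical (absolutely continuous) solution on `[0,T]`, in integrated form, of
`xᵢ' = (1/N) ∑ⱼ mⱼ sgn(xⱼ - xᵢ)`, `mᵢ' = (1/N) ∑ⱼ mᵢ mⱼ S(xᵢ - xⱼ)`. -/
structure IsParticleSolution (N : ℕ) (T : ℝ) (S : ℝ → ℝ) (x m : ℝ → Fin N → ℝ) : Prop where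
  cont_x : ContinuousOn x (Icc 0 T)
  cont_m : ContinuousOn m (Icc 0 T)
  eq_x : ∀ t ∈ Icc 0 T, ∀ i, x t i = x 0 i
    + ∫ s in (0 : ℝ)..t, (1 / (N : ℝ)) * ∑ j, m s j * Real.sign (x s j - x s i)
  eq_m : ∀ t ∈ Icc 0 T, ∀ i, m t i = m 0 i
    + ∫ s in (0 : ℝ)..t, (1 / (N : ℝ)) * ∑ j, m s i * m s j * S (x s i - x s j)

/-- Admissible initial particle configurations: separated and ordered opinions, positive weights of
mean one. -/
structure IsParticleDatum (N : ℕ) (x₀ m₀ : Fin N → ℝ) : Prop where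
  ordered : StrictMono x₀
  pos : ∀ i, 0 < m₀ i
  mean_one : (1 / (N : ℝ)) * ∑ i, m₀ i = 1

/-- The Heaviside function. -/
def heaviside (x : ℝ) : ℝ := if 0 ≤ x then 1 else 0

/-- The shifted weighted empirical cumulative distribution function
`-1/2 + (1/N) ∑ₖ mₖ H(y - xₖ)`. -/
def empiricalCDF (N : ℕ) (x m : Fin N → ℝ) (y : ℝ) : ℝ :=
  -1 / 2 + (1 / (N : ℝ)) * ∑ k, m k * heaviside (y - x k)

end OpinionBurgers

end

open OpinionBurgers

/-!
The solutions in question are, at every time, *profiles*: nondecreasing functions equal to `-1/2`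
far on the left and to `1/2` far on the right. Profiles differ only on a bounded interval, so that
all `L¹` distances are finite, and the nonlocal source acts on them as a Lipschitz perturbation of a
scalar conservation law.

**Stability and uniqueness.** An entropy solution has a jointly measurable representative that is a
profile at every time (`IsPreSolution.exists_isRegularSolution`). For two of them Kruzhkov's
doubling of variables applies, with separate mollifiers in space and in time. Doubling in space
turns the entropy inequalities with constants `G(y)` into a differential inequality in time for a
mollified `L¹` distance (`IsRegularSolution.integral_doubled_nonneg`). In the sum of the dissipation
rates of the two solutions the fluxes enter only through their difference, and the sources only
through the `L¹` norm of their difference (`IsMollifier.doubledRate_add_le`). The second mollifier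
then identifies the times (`IsRegularSolution.integral_stability_nonneg`), and Gronwall's argument
gives the estimate (`IsRegularSolution.ae_integral_abs_sub_le`). Two facts make this work for the
present equation. The source is Lipschitz from `L¹` to `L¹`, with a constant that involves the
radius of only one of the two profiles (`IsProfile.integral_abs_source_sub_le`). This uses that the
source vanishes where the profile equals `1/2`, beyond its radius, which the equation itself forces
for almost every time (`IsRegularSolution.source_eq_zero`), whether or not `S` is odd. And the
initial datum, assumed only in the sense of distributions, is attained in `L¹`, because
distributional convergence of monotone functions to a monotone function implies convergence at its
points of continuity (`IsProfile.tendsto_integral_abs_sub_of_distrib`).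

**Existence.** The Lax–Friedrichs scheme, preceded in every step by an explicit Euler step for the
source, maps profiles to profiles: for small time steps both are monotone, and for odd `S` the
source vanishes beyond the radius of the profile (`IsProfile.source_eq_zero_of_odd`), so that the
value `1/2` on the right is kept. The scheme is `L¹`-Lipschitz in time up to the time step and
satisfies a discrete entropy inequality (`integral_schemeIntegrand_nonneg`), so Helly's theorem
yields a limit (`exists_subseq_tendsto_profile`). The entropy inequality passes to the limit for
those constants `α` whose level set is null, which are all but countably many; for the others one
averages the inequalities for `α ± ε`, since `sgn 0 = 0` is the mean of the one-sided limits of the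
sign (`integral_entropyIntegrand_nonneg_of_forall_null`).

**Mean field limit.** The empirical distribution function of the particles is itself an entropy
solution for the flux `-v²`. In its jumps the prescribed velocities are the Rankine–Hugoniot speeds,
and the jumps are upward, hence admissible for a concave flux; where particles have met, the
convexity of `|· - α|` gives the sign of the entropy production (`entropyProduction_nonneg`). The
change of the masses is the source of the step function (`source_stepFun`). Particles never overtake
each other and their masses stay positive (`IsParticleSolution.exists_isParticlePath`). The mean
field limit is therefore an instance of stability, applied with equal fluxes and with the constant
attached to the radius of the limit solution, which does not depend on `N` (`tendsto_iSup_normL1`);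
the radii of the particle systems need not be bounded.
-/

namespace OpinionBurgers

/-! ### Profiles -/

/-- Nondecreasing functions on the line equal to `±1/2` at `±x` for `x ≥ R`: the functions of the
space variable among which all solutions take their values. -/
structure IsProfile (R : ℝ) (f : ℝ → ℝ) : Prop where
  mono : Monotone f
  tails : ∀ x, R ≤ x → f x = 1 / 2 ∧ f (-x) = -1 / 2

namespace IsProfile

variable {R R' : ℝ} {f g : ℝ → ℝ}

lemma radius_pos (hf : IsProfile R f) : 0 < R := by
  by_contra h
  have := hf.tails 0 (not_lt.1 h)
  norm_num at this
  linarith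

lemma of_le (hf : IsProfile R f) (h : R ≤ R') : IsProfile R' f :=
  ⟨hf.mono, fun x hx => hf.tails x (h.trans hx)⟩

lemma eq_right (hf : IsProfile R f) {x : ℝ} (hx : R ≤ x) : f x = 1 / 2 := (hf.tails x hx).1

lemma eq_left (hf : IsProfile R f) {x : ℝ} (hx : x ≤ -R) : f x = -1 / 2 := by
  simpa using (hf.tails (-x) (by linarith)).2

lemma le_half (hf : IsProfile R f) (x : ℝ) : f x ≤ 1 / 2 :=
  (hf.mono (le_max_left x R)).trans_eq (hf.eq_right (le_max_right x R))

lemma neg_half_le (hf : IsProfile R f) (x : ℝ) : -1 / 2 ≤ f x :=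
  (hf.eq_left (min_le_right x (-R))).symm.trans_le (hf.mono (min_le_left x (-R)))

lemma mem_fluxDomain (hf : IsProfile R f) (x : ℝ) : f x ∈ fluxDomain :=
  ⟨hf.neg_half_le x, hf.le_half x⟩

lemma abs_le_half (hf : IsProfile R f) (x : ℝ) : |f x| ≤ 1 / 2 :=
  abs_le.2 ⟨by linarith [hf.neg_half_le x], hf.le_half x⟩

lemma measurable (hf : IsProfile R f) : Measurable f := hf.mono.measurable

lemma sub_eq_zero_of_notMem (hf : IsProfile R f) (hg : IsProfile R g) {x : ℝ}
    (hx : x ∉ Icc (-R) R) :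
    f x - g x = 0 := by
  rw [mem_Icc, not_and_or, not_le, not_le] at hx
  rcases hx with hx | hx
  · rw [hf.eq_left hx.le, hg.eq_left hx.le, sub_self]
  · rw [hf.eq_right hx.le, hg.eq_right hx.le, sub_self]

lemma locallyIntegrable (hf : IsProfile R f) : LocallyIntegrable f :=
  hf.mono.locallyIntegrable

lemma integrable_sub (hf : IsProfile R f) (hg : IsProfile R' g) :
    Integrable (fun x => f x - g x) := by
  wlog h : R = R' generalizing R R'
  · exact this (hf.of_le (le_max_left R R')) (hg.of_le (le_max_right R R')) rfl
  subst h
  have h1 : IntegrableOn (fun x => f x - g x) (Icc (-R) R) :=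
    ((hf.locallyIntegrable.sub hg.locallyIntegrable).integrableOn_isCompact isCompact_Icc)
  exact h1.integrable_of_forall_notMem_eq_zero fun x hx => hf.sub_eq_zero_of_notMem hg hx

lemma comp_add (hf : IsProfile R f) (a : ℝ) : IsProfile (R + |a|) (fun x => f (x + a)) := by
  refine ⟨fun x y h => hf.mono (by linarith), fun x hx => ⟨hf.eq_right ?_, hf.eq_left ?_⟩⟩
  · linarith [neg_abs_le a]
  · linarith [le_abs_self a]

lemma half_heaviside : IsProfile 1 (fun x => heaviside x - 1 / 2) := by
  refine ⟨fun x y h => ?_, fun x hx => ?_⟩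
  · simp only [heaviside]
    split_ifs <;> linarith
  · rw [heaviside, heaviside, if_pos (by linarith), if_neg (by linarith)]
    norm_num

/-- The total variation of a profile is one. -/
lemma integral_comp_add_sub (hf : IsProfile R f) (a : ℝ) : ∫ x, (f (x + a) - f x) = a := by
  set e : ℝ → ℝ := fun x => heaviside x - 1 / 2 with he
  have hi := hf.integrable_sub half_heaviside
  have hE : IsProfile 1 e := half_heaviside
  have h1 : ∫ x, ((f (x + a) - e (x + a)) - (f x - e x)) = 0 := by
    rw [integral_sub (hi.comp_add_right a) hi,
      integral_add_right_eq_self (fun x => f x - e x), sub_self]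
  have h2 : ∫ x, (e (x + a) - e x) = a := by
    rcases le_total 0 a with h | h
    · have : (fun x => e (x + a) - e x) = (Ico (-a) 0).indicator 1 := by
        ext x
        simp only [he, heaviside, indicator, mem_Ico, Pi.one_apply]
        split_ifs <;> first | linarith | (norm_num; done) | grind
      rw [this, integral_indicator_one measurableSet_Ico]
      simp [h]
    · have : (fun x => e (x + a) - e x) = fun x => - (Ico 0 (-a)).indicator 1 x := by
        ext x
        simp only [he, heaviside, indicator, mem_Ico, Pi.one_apply]
        split_ifs <;> first | linarith | (norm_num; done) | grind
      rw [this, integral_neg, integral_indicator_one measurableSet_Ico]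
      simp [h]
  have h3 : (fun x => f (x + a) - f x)
      = fun x => ((f (x + a) - e (x + a)) - (f x - e x)) + (e (x + a) - e x) := by
    ext x; ring
  have i1 : Integrable (fun x => (f (x + a) - e (x + a)) - (f x - e x)) :=
    (hi.comp_add_right a).sub hi
  rw [h3, integral_add i1 ((hE.comp_add a).integrable_sub hE), h1, h2, zero_add]

lemma integrable_abs_comp_add_sub (hf : IsProfile R f) (a : ℝ) :
    Integrable (fun x => |f (x + a) - f x|) :=
  ((hf.comp_add a).integrable_sub hf).abs

lemma integral_abs_comp_add_sub (hf : IsProfile R f) (a : ℝ) :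
    ∫ x, |f (x + a) - f x| = |a| := by
  rcases le_total 0 a with h | h
  · rw [abs_of_nonneg h]
    refine Eq.trans ?_ (hf.integral_comp_add_sub a)
    exact integral_congr_ae (.of_forall fun x =>
      abs_of_nonneg (sub_nonneg.2 (hf.mono (by linarith))))
  · rw [abs_of_nonpos h]
    refine Eq.trans ?_ (congrArg Neg.neg (hf.integral_comp_add_sub a))
    rw [← integral_neg]
    exact integral_congr_ae (.of_forall fun x =>
      abs_of_nonpos (sub_nonpos.2 (hf.mono (by linarith))))

/-- Two profiles which are close in the Lévy sense are close in `L¹`. -/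
lemma integral_abs_sub_le (hf : IsProfile R f) (hg : IsProfile R g) {δ η : ℝ}
    (h1 : ∀ x, f x ≤ g (x + δ) + η) (h2 : ∀ x, g (x - δ) - η ≤ f x) (hδ : 0 ≤ δ) :
    ∫ x, |f x - g x| ≤ 2 * δ + 2 * R * η := by
  have hR := hf.radius_pos
  have hη : ∫ x, (Icc (-R) R).indicator (fun _ => η) x = 2 * R * η := by
    rw [integral_indicator_const _ measurableSet_Icc]
    simp only [measureReal_def, Real.volume_Icc, smul_eq_mul]
    rw [ENNReal.toReal_ofReal (by linarith)]; ring
  have hηi : Integrable ((Icc (-R) R).indicator (fun _ => η)) :=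
    (integrable_indicator_iff measurableSet_Icc).2 (integrableOn_const (by simp))
  have i1 := (hg.comp_add δ).integrable_sub hg
  have i2 := (hg.comp_add (-δ)).integrable_sub hg
  have : 2 * δ + 2 * R * η = ∫ x, (((g (x + δ) - g x) - (g (x + -δ) - g x))
      + (Icc (-R) R).indicator (fun _ => η) x) := by
    have i3 : Integrable (fun x => (g (x + δ) - g x) - (g (x + -δ) - g x)) := i1.sub i2
    rw [integral_add i3 hηi, integral_sub i1 i2, hη, hg.integral_comp_add_sub,
      hg.integral_comp_add_sub]
    ring
  rw [this]
  refine integral_mono (hf.integrable_sub hg).abs ((i1.sub i2).add hηi) fun x => ?_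
  have m1 : g x ≤ g (x + δ) := hg.mono (by linarith)
  have m2 : g (x + -δ) ≤ g x := hg.mono (by linarith)
  by_cases hx : x ∈ Icc (-R) R
  · simp only [indicator_of_mem hx]
    have k1 := h1 x
    have k2 := h2 x
    rw [sub_eq_add_neg x δ] at k2
    rw [abs_le']
    constructor <;> linarith
  · simp only [indicator_of_notMem hx, hf.sub_eq_zero_of_notMem hg hx, abs_zero]
    linarith

/-- Convergence of profiles in the Lévy sense implies convergence in `L¹`. -/
lemma tendsto_integral_abs_sub {ι : Type*} {l : Filter ι} {F : ι → ℝ → ℝ}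
    (hF : ∀ᶠ i in l, IsProfile R (F i)) (hg : IsProfile R g)
    (h : ∀ x, ∀ δ > 0, ∀ η > 0, ∀ᶠ i in l, F i x ≤ g (x + δ) + η ∧ g (x - δ) - η ≤ F i x) :
    Tendsto (fun i => ∫ x, |F i x - g x|) l (𝓝 0) := by
  have hR := hg.radius_pos
  rw [Metric.tendsto_nhds]
  intro ε hε
  set δ : ℝ := ε / 16 with hδ
  set η : ℝ := ε / (8 * R) with hη
  have hδ0 : 0 < δ := by positivity
  have hη0 : 0 < η := by positivity
  obtain ⟨n, hn⟩ := exists_nat_gt ((2 * R + 2 * δ) / δ)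
  have key : ∀ᶠ i in l, ∀ k ∈ Finset.range (n + 1),
      F i (-R - δ + k * δ) ≤ g ((-R - δ + k * δ) + δ) + η ∧
        g ((-R - δ + k * δ) - δ) - η ≤ F i (-R - δ + k * δ) :=
    (Filter.eventually_all_finset _).2 fun k _ => h _ δ hδ0 η hη0
  filter_upwards [hF, key] with i hi hk
  have hgrid : ∀ x ∈ Icc (-R) R, ∃ k ∈ Finset.range (n + 1),
      -R - δ + k * δ ≤ x ∧ x ≤ -R - δ + k * δ + δ := by
    intro x hx
    have h0 : 0 ≤ (x + R + δ) / δ := div_nonneg (by linarith [hx.1]) hδ0.le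
    refine ⟨⌊(x + R + δ) / δ⌋₊, ?_, ?_, ?_⟩
    · rw [Finset.mem_range, Nat.lt_succ_iff]
      refine Nat.floor_le_of_le (le_trans ?_ hn.le)
      exact div_le_div_of_nonneg_right (by linarith [hx.2]) hδ0.le
    · have := Nat.floor_le h0
      rw [le_div_iff₀ hδ0] at this
      linarith
    · have := (Nat.lt_floor_add_one ((x + R + δ) / δ)).le
      rw [div_le_iff₀ hδ0] at this
      linarith
  rw [Real.dist_eq, sub_zero, abs_of_nonneg (integral_nonneg fun _ => abs_nonneg _)]
  refine (hi.integral_abs_sub_le hg (δ := 2 * δ) (η := η) ?_ ?_ (by linarith)).trans_lt ?_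
  · intro x
    by_cases hx : x ∈ Icc (-R) R
    · obtain ⟨k, hk1, hk2, hk3⟩ := hgrid x hx
      by_cases hkn : k + 1 ∈ Finset.range (n + 1)
      · have := (hk _ hkn).1
        push_cast at this
        have a1 : F i x ≤ F i (-R - δ + (k + 1) * δ) := hi.mono (by linarith)
        have a2 : g (-R - δ + (k + 1) * δ + δ) ≤ g (x + 2 * δ) := hg.mono (by linarith)
        linarith
      · have hkn' : k = n := by simp at hkn hk1; omega
        have : R ≤ x + 2 * δ := by
          rw [div_lt_iff₀ hδ0] at hn
          rw [hkn'] at hk2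
          linarith
        rw [hg.eq_right this]
        linarith [hi.le_half x]
    · rw [sub_eq_zero.1 (hi.sub_eq_zero_of_notMem hg hx)]
      linarith [hg.mono (show x ≤ x + 2 * δ by linarith)]
  · intro x
    by_cases hx : x ∈ Icc (-R) R
    · obtain ⟨k, hk1, hk2, hk3⟩ := hgrid x hx
      have := (hk _ hk1).2
      have a1 : F i (-R - δ + k * δ) ≤ F i x := hi.mono (by linarith)
      have a2 : g (x - 2 * δ) ≤ g (-R - δ + k * δ - δ) := hg.mono (by linarith)
      linarith
    · rw [sub_eq_zero.1 (hi.sub_eq_zero_of_notMem hg hx)]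
      linarith [hg.mono (show x - 2 * δ ≤ x by linarith)]
  · have : 2 * R * η = ε / 4 := by rw [hη]; field_simp; norm_num
    rw [this, hδ]
    linarith

end IsProfile
end OpinionBurgers

namespace OpinionBurgers

/-! ### Convolution with a compactly supported kernel -/

/-- Smooth kernels supported in `[-r, r]`. -/
structure IsKernel (r : ℝ) (φ : ℝ → ℝ) : Prop where
  smooth : ContDiff ℝ ∞ φ
  supp : tsupport φ ⊆ Icc (-r) r

namespace IsKernel

variable {r : ℝ} {φ : ℝ → ℝ}

lemma deriv (hφ : IsKernel r φ) : IsKernel r (deriv φ) :=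
  ⟨hφ.smooth.iterate_deriv 1, tsupport_deriv_subset.trans hφ.supp⟩

lemma continuous (hφ : IsKernel r φ) : Continuous φ := hφ.smooth.continuous

lemma hasCompactSupport (hφ : IsKernel r φ) : HasCompactSupport φ :=
  isCompact_Icc.of_isClosed_subset (isClosed_tsupport φ) hφ.supp

lemma integrable (hφ : IsKernel r φ) : Integrable φ :=
  hφ.continuous.integrable_of_hasCompactSupport hφ.hasCompactSupport

lemma eq_zero (hφ : IsKernel r φ) {x : ℝ} (hx : x ∉ Icc (-r) r) : φ x = 0 :=
  image_eq_zero_of_notMem_tsupport fun h => hx (hφ.supp h)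

lemma hasDerivAt (hφ : IsKernel r φ) (x : ℝ) : HasDerivAt φ (_root_.deriv φ x) x :=
  (hφ.smooth.differentiable (by simp) x).hasDerivAt

lemma integral_deriv (hφ : IsKernel r φ) : ∫ x, _root_.deriv φ x = 0 :=
  integral_eq_zero_of_hasDerivAt_of_integrable hφ.hasDerivAt hφ.deriv.integrable hφ.integrable

lemma abs_le_supNorm (hφ : IsKernel r φ) (x : ℝ) : |φ x| ≤ supNorm φ := by
  obtain ⟨C, hC⟩ := hφ.hasCompactSupport.exists_bound_of_continuous hφ.continuous
  exact le_ciSup (f := fun z => |φ z|) ⟨C, by rintro _ ⟨z, rfl⟩; exact hC z⟩ x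

lemma supNorm_nonneg (hφ : IsKernel r φ) : 0 ≤ supNorm φ :=
  (abs_nonneg _).trans (hφ.abs_le_supNorm 0)

lemma integral_abs_le (hφ : IsKernel r φ) (hr : 0 < r) :
    ∫ x, |φ x| ≤ 2 * r * supNorm φ := by
  have : 2 * r * supNorm φ = ∫ x, (Icc (-r) r).indicator (fun _ => supNorm φ) x := by
    rw [integral_indicator_const _ measurableSet_Icc]
    simp only [measureReal_def, Real.volume_Icc, smul_eq_mul]
    rw [ENNReal.toReal_ofReal (by linarith)]; ring
  rw [this]
  refine integral_mono hφ.integrable.abs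
    ((integrable_indicator_iff measurableSet_Icc).2 (integrableOn_const (by simp))) fun x => ?_
  by_cases hx : x ∈ Icc (-r) r
  · simpa only [indicator_of_mem hx] using hφ.abs_le_supNorm x
  · simp only [indicator_of_notMem hx, hφ.eq_zero hx, abs_zero, le_refl]

lemma integrable_conv_integrand (hφ : IsKernel r φ) {f : ℝ → ℝ} (hf : Measurable f) {M : ℝ}
    (hM : ∀ x, |f x| ≤ M) (x : ℝ) : Integrable (fun y => φ (x - y) * f y) :=
  (hφ.integrable.comp_sub_left x).mul_bdd (c := M) hf.aestronglyMeasurable (.of_forall hM)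

lemma abs_conv_le (hφ : IsKernel r φ) {f : ℝ → ℝ} {M : ℝ}
    (hM : ∀ x, |f x| ≤ M) (x : ℝ) : |conv φ f x| ≤ M * ∫ y, |φ y| := by
  calc |conv φ f x| ≤ ∫ y, M * |φ (x - y)| := by
        rw [← Real.norm_eq_abs, conv]
        refine norm_integral_le_of_norm_le (((hφ.integrable.comp_sub_left x).abs).const_mul M)
          (.of_forall fun y => ?_)
        rw [Real.norm_eq_abs, abs_mul, mul_comm]
        exact mul_le_mul_of_nonneg_right (hM y) (abs_nonneg _)
    _ = M * ∫ y, |φ y| := by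
        rw [integral_const_mul, integral_sub_left_eq_self (fun y => |φ y|)]

lemma conv_eq_convolution (φ f : ℝ → ℝ) :
    conv φ f = convolution f φ (ContinuousLinearMap.mul ℝ ℝ) volume := by
  ext x
  simp [conv, convolution, mul_comm]

lemma hasDerivAt_conv (hφ : IsKernel r φ) {f : ℝ → ℝ} (hf : LocallyIntegrable f) (x : ℝ) :
    HasDerivAt (conv φ f) (conv (_root_.deriv φ) f x) x := by
  rw [conv_eq_convolution, conv_eq_convolution]
  exact hφ.hasCompactSupport.hasDerivAt_convolution_right _ hf (hφ.smooth.of_le (by simp)) x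

lemma continuous_conv (hφ : IsKernel r φ) {f : ℝ → ℝ} (hf : LocallyIntegrable f) :
    Continuous (conv φ f) :=
  continuous_iff_continuousAt.2 fun x => (hφ.hasDerivAt_conv hf x).continuousAt

/-- A kernel does not see beyond distance `r`. -/
lemma conv_eq_of_eqOn (hφ : IsKernel r φ) {f : ℝ → ℝ} {x c : ℝ}
    (h : ∀ y ∈ Icc (x - r) (x + r), f y = c) : conv φ f x = c * ∫ y, φ y := by
  rw [← integral_sub_left_eq_self φ _ x, ← integral_const_mul]
  refine integral_congr_ae (.of_forall fun y => ?_)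
  by_cases hy : y ∈ Icc (x - r) (x + r)
  · simp only [h y hy]; ring
  · have : φ (x - y) = 0 := hφ.eq_zero fun h' => hy ⟨by linarith [h'.2], by linarith [h'.1]⟩
    simp only [this]; ring

lemma integrable_conv_abs (hφ : IsKernel r φ) {g : ℝ → ℝ} (hg : Integrable g) :
    Integrable (conv (fun y => |φ y|) (fun y => |g y|)) := by
  rw [conv_eq_convolution]
  exact hg.abs.integrable_convolution _ hφ.integrable.abs

lemma integral_conv_abs (hφ : IsKernel r φ) {g : ℝ → ℝ} (hg : Integrable g) :
    ∫ x, conv (fun y => |φ y|) (fun y => |g y|) x = (∫ y, |φ y|) * ∫ y, |g y| := by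
  rw [conv_eq_convolution, integral_convolution _ hg.abs hφ.integrable.abs]
  simp [mul_comm]

lemma abs_conv_le_conv_abs (φ g : ℝ → ℝ) (x : ℝ) :
    |conv φ g x| ≤ conv (fun y => |φ y|) (fun y => |g y|) x := by
  simp only [conv, ← abs_mul]
  exact abs_integral_le_integral_abs

lemma integrable_conv (hφ : IsKernel r φ) {g : ℝ → ℝ} (hg : Integrable g) :
    Integrable (conv φ g) := by
  rw [conv_eq_convolution]
  exact hg.integrable_convolution _ hφ.integrable

lemma integral_abs_conv_le (hφ : IsKernel r φ) {g : ℝ → ℝ} (hg : Integrable g) :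
    ∫ x, |conv φ g x| ≤ (∫ y, |φ y|) * ∫ y, |g y| := by
  rw [← hφ.integral_conv_abs hg]
  exact integral_mono (hφ.integrable_conv hg).abs (hφ.integrable_conv_abs hg)
    fun x => abs_conv_le_conv_abs φ g x

end IsKernel

lemma conv_congr_ae {φ f g : ℝ → ℝ} (h : f =ᵐ[volume] g) : conv φ f = conv φ g := by
  ext x
  exact integral_congr_ae (h.mono fun y hy => by simp only [hy])

/-! ### The nonlocal source on profiles -/

/-- The source depends on `f` almost everywhere only through its values. -/
lemma source_congr_ae {S f g : ℝ → ℝ} (h : f =ᵐ[volume] g) {x : ℝ} (hx : f x = g x) :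
    source S f x = source S g x := by
  rw [source, source, conv_congr_ae h, conv_congr_ae h, hx]
  congr 1
  exact setIntegral_congr_ae measurableSet_Iic (h.mono fun y hy _ => by rw [hy])

namespace IsProfile

variable {R R' r : ℝ} {f g S : ℝ → ℝ}

lemma conv_eq_zero (hf : IsProfile R f) {φ : ℝ → ℝ} (hφ : IsKernel r φ) (h0 : ∫ y, φ y = 0)
    {x : ℝ} (hx : x ∉ Ioo (-R - r) (R + r)) : conv φ f x = 0 := by
  rw [mem_Ioo, not_and_or, not_lt, not_lt] at hx
  rcases hx with hx | hx
  · rw [hφ.conv_eq_of_eqOn (c := -1 / 2) fun y hy => hf.eq_left (by linarith [hy.2]), h0, mul_zero]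
  · rw [hφ.conv_eq_of_eqOn (c := 1 / 2) fun y hy => hf.eq_right (by linarith [hy.1]), h0, mul_zero]

lemma abs_conv_le (hf : IsProfile R f) {φ : ℝ → ℝ} (hφ : IsKernel r φ) (x : ℝ) :
    |conv φ f x| ≤ (∫ y, |φ y|) / 2 := by
  have := hφ.abs_conv_le hf.abs_le_half x
  linarith

lemma integrable_mul_conv (hf : IsProfile R f) (hS : IsKernel r S) :
    Integrable (fun z => f z * conv (deriv (deriv S)) f z) := by
  have hc : Continuous (conv (deriv (deriv S)) f) := hS.deriv.deriv.continuous_conv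
    hf.locallyIntegrable
  have h1 : IntegrableOn (fun z => f z * conv (deriv (deriv S)) f z) (Icc (-R - r) (R + r)) :=
    (hf.locallyIntegrable.integrableOn_isCompact isCompact_Icc).mul_continuousOn hc.continuousOn
      isCompact_Icc
  refine h1.integrable_of_forall_notMem_eq_zero fun x hx => ?_
  rw [hf.conv_eq_zero hS.deriv.deriv hS.deriv.integral_deriv
    (fun h => hx (Ioo_subset_Icc_self h)), mul_zero]

lemma source_sub (hf : IsProfile R f) (hS : IsKernel r S) (x y : ℝ) :
    source S f y - source S f x = f y * conv (deriv S) f y - f x * conv (deriv S) f x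
      - ∫ z in x..y, f z * conv (deriv (deriv S)) f z := by
  rw [source, source, ← intervalIntegral.integral_Iic_sub_Iic
    (hf.integrable_mul_conv hS).integrableOn (hf.integrable_mul_conv hS).integrableOn]
  ring

lemma integral_conv_deriv (hf : IsProfile R f) (hS : IsKernel r S) (x y : ℝ) :
    ∫ z in x..y, conv (deriv (deriv S)) f z = conv (deriv S) f y - conv (deriv S) f x :=
  intervalIntegral.integral_eq_sub_of_hasDerivAt
    (fun z _ => hS.deriv.hasDerivAt_conv hf.locallyIntegrable z)
    ((hS.deriv.deriv.continuous_conv hf.locallyIntegrable).intervalIntegrable _ _)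

/-- A first estimate of the increments of the source, sharp only on short intervals. -/
lemma abs_source_sub_le_aux (hf : IsProfile R f) (hS : IsKernel r S) {x y : ℝ} (hxy : x ≤ y) :
    |source S f y - source S f x| ≤
      (f y - f x) * ((∫ z, |deriv S z|) / 2 + (∫ z, |deriv (deriv S) z|) / 2 * (y - x)) := by
  have hc : Continuous (conv (deriv (deriv S)) f) := hS.deriv.deriv.continuous_conv
    hf.locallyIntegrable
  have hfi : IntervalIntegrable (fun z => f z * conv (deriv (deriv S)) f z) volume x y :=
    (hf.integrable_mul_conv hS).intervalIntegrable
  have e : source S f y - source S f x = (f y - f x) * conv (deriv S) f y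
      - ∫ z in x..y, (f z - f x) * conv (deriv (deriv S)) f z := by
    have : ∫ z in x..y, (f z - f x) * conv (deriv (deriv S)) f z
        = (∫ z in x..y, f z * conv (deriv (deriv S)) f z)
          - f x * (conv (deriv S) f y - conv (deriv S) f x) := by
      rw [← hf.integral_conv_deriv hS, ← intervalIntegral.integral_const_mul,
        ← intervalIntegral.integral_sub hfi ((hc.intervalIntegrable _ _).const_mul _)]
      simp only [sub_mul]
    rw [this, hf.source_sub hS]
    ring
  have hfx : 0 ≤ f y - f x := sub_nonneg.2 (hf.mono hxy)
  have h2 : |∫ z in x..y, (f z - f x) * conv (deriv (deriv S)) f z|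
      ≤ ((f y - f x) * ((∫ z, |deriv (deriv S) z|) / 2)) * |y - x| := by
    rw [← Real.norm_eq_abs]
    refine intervalIntegral.norm_integral_le_of_norm_le_const fun z hz => ?_
    rw [uIoc_of_le hxy] at hz
    rw [Real.norm_eq_abs, abs_mul, abs_of_nonneg (sub_nonneg.2 (hf.mono hz.1.le))]
    exact mul_le_mul (by linarith [hf.mono hz.2]) (hf.abs_conv_le hS.deriv.deriv z)
      (abs_nonneg _) hfx
  rw [e]
  refine (abs_sub _ _).trans ?_
  rw [abs_mul, abs_of_nonneg hfx]
  rw [abs_of_nonneg (sub_nonneg.2 hxy)] at h2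
  have h3 := mul_le_mul_of_nonneg_left (hf.abs_conv_le hS.deriv y) hfx
  linarith

/-- As a measure, `d𝐒[f] = (φ ⋆ f) df`; hence the increments of the source are controlled by
those of the profile. -/
lemma abs_source_sub_le (hf : IsProfile R f) (hS : IsKernel r S) {x y : ℝ} (hxy : x ≤ y) :
    |source S f y - source S f x| ≤ (∫ z, |deriv S z|) / 2 * (f y - f x) := by
  set K := (∫ z, |deriv S z|) / 2
  set M := (∫ z, |deriv (deriv S) z|) / 2
  have key : ∀ n : ℕ, |source S f y - source S f x|
      ≤ (f y - f x) * (K + M * ((y - x) / (n + 1 : ℝ))) := by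
    intro n
    set d := (y - x) / (n + 1 : ℝ) with hd
    have hd0 : 0 ≤ d := div_nonneg (by linarith) (by positivity)
    let p : ℕ → ℝ := fun i => x + i * d
    have hp0 : p 0 = x := by simp [p]
    have hpn : p (n + 1) = y := by
      simp only [p, hd]; push_cast; field_simp; ring
    have hstep : ∀ i, p (i + 1) - p i = d := fun i => by simp only [p]; push_cast; ring
    rw [← hp0, ← hpn, ← Finset.sum_range_sub (fun i => source S f (p i)),
      ← Finset.sum_range_sub (fun i => f (p i)), Finset.sum_mul]
    refine (Finset.abs_sum_le_sum_abs _ _).trans (Finset.sum_le_sum fun i _ => ?_)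
    have := hf.abs_source_sub_le_aux hS (x := p i) (y := p (i + 1)) (by linarith [hstep i])
    rwa [hstep] at this
  have hlim : Tendsto (fun n : ℕ => (f y - f x) * (K + M * ((y - x) / (n + 1 : ℝ)))) atTop
      (𝓝 ((f y - f x) * (K + M * 0))) := by
    refine ((Tendsto.const_mul M ?_).const_add K).const_mul _
    exact tendsto_const_nhds.div_atTop (tendsto_natCast_atTop_atTop.atTop_add tendsto_const_nhds)
  have := ge_of_tendsto' hlim key
  linarith

lemma source_eq_zero_left (hf : IsProfile R f) (hS : IsKernel r S) {x : ℝ} (hx : x ≤ -R) :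
    source S f x = 0 := by
  have h1 : source S f (min x (-R - r)) = 0 := by
    rw [source, hf.conv_eq_zero hS.deriv hS.integral_deriv
      (fun h => by linarith [h.1, min_le_right x (-R - r)]), mul_zero, zero_sub, neg_eq_zero]
    refine setIntegral_eq_zero_of_forall_eq_zero fun z hz => ?_
    rw [hf.conv_eq_zero hS.deriv.deriv hS.deriv.integral_deriv
      (fun h => by linarith [h.1, min_le_right x (-R - r), mem_Iic.1 hz]), mul_zero]
  have := hf.abs_source_sub_le hS (min_le_left x (-R - r))
  rw [h1, hf.eq_left hx, hf.eq_left ((min_le_left _ _).trans hx), sub_self, mul_zero, sub_zero]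
    at this
  exact abs_nonpos_iff.1 this

lemma source_eq_right (hf : IsProfile R f) (hS : IsKernel r S) {x y : ℝ} (hx : R ≤ x)
    (hy : R ≤ y) : source S f x = source S f y := by
  wlog h : x ≤ y generalizing x y
  · exact (this hy hx (le_of_not_ge h)).symm
  have := hf.abs_source_sub_le hS h
  rw [hf.eq_right hx, hf.eq_right hy, sub_self, mul_zero] at this
  linarith [abs_nonpos_iff.1 this]

lemma abs_source_le (hf : IsProfile R f) (hS : IsKernel r S) (x : ℝ) :
    |source S f x| ≤ (∫ z, |deriv S z|) / 2 := by
  have := hf.abs_source_sub_le hS (min_le_left x (-R))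
  rw [hf.source_eq_zero_left hS (min_le_right x (-R)), sub_zero] at this
  refine this.trans ((mul_le_mul_of_nonneg_left (b := f x - f (min x (-R))) (c := 1) ?_
    (by positivity)).trans_eq (mul_one _))
  linarith [hf.le_half x, hf.neg_half_le (min x (-R))]

lemma measurable_source (hf : IsProfile R f) (hS : IsKernel r S) : Measurable (source S f) := by
  have h1 : Measurable (conv (deriv S) f) :=
    (hS.deriv.continuous_conv hf.locallyIntegrable).measurable
  refine (hf.measurable.mul h1).sub (Continuous.measurable ?_)
  have hi := hf.integrable_mul_conv hS
  have : (fun x => ∫ z in Iic x, f z * conv (deriv (deriv S)) f z) = fun x =>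
      (∫ z in (0:ℝ)..x, f z * conv (deriv (deriv S)) f z)
        + ∫ z in Iic 0, f z * conv (deriv (deriv S)) f z := by
    ext x
    rw [← intervalIntegral.integral_Iic_sub_Iic hi.integrableOn hi.integrableOn]
    ring
  rw [this]
  exact (intervalIntegral.continuous_primitive (fun a b => hi.intervalIntegrable) 0).add
    continuous_const

lemma source_eq_zero_of_le (hf : IsProfile R f) (hS : IsKernel r S) {y : ℝ} (hy : R ≤ y)
    (h0 : source S f y = 0) {x : ℝ} (hx : x ∉ Ioo (-R) R) : source S f x = 0 := by
  rw [mem_Ioo, not_and_or, not_lt, not_lt] at hx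
  rcases hx with hx | hx
  · exact hf.source_eq_zero_left hS hx
  · rw [hf.source_eq_right hS hx hy, h0]

end IsProfile
end OpinionBurgers

namespace OpinionBurgers

lemma IsKernel.conv_sub {r : ℝ} {φ f g : ℝ → ℝ} (hφ : IsKernel r φ) (hf : Measurable f)
    (hg : Measurable g) {M : ℝ} (hfM : ∀ x, |f x| ≤ M) (hgM : ∀ x, |g x| ≤ M) (x : ℝ) :
    conv φ f x - conv φ g x = conv φ (fun y => f y - g y) x := by
  rw [conv, conv, conv, ← integral_sub (hφ.integrable_conv_integrand hf hfM x)
    (hφ.integrable_conv_integrand hg hgM x)]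
  simp only [mul_sub]

namespace IsProfile

variable {R R' r : ℝ} {f g S : ℝ → ℝ}

lemma integrable_source (hf : IsProfile R f) (hS : IsKernel r S)
    (h0 : ∀ x, R ≤ x → source S f x = 0) : Integrable (source S f) := by
  have : IntegrableOn (source S f) (Icc (-R) R) :=
    IntegrableOn.of_bound (by simp) (hf.measurable_source hS).aestronglyMeasurable
      ((∫ z, |deriv S z|) / 2) (.of_forall fun x => hf.abs_source_le hS x)
  exact this.integrable_of_forall_notMem_eq_zero fun x hx =>
    hf.source_eq_zero_of_le hS le_rfl (h0 R le_rfl) fun h => hx (Ioo_subset_Icc_self h)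

/-- The source is Lipschitz in `L¹`. Only the radius of one of the two profiles enters: where
that one is constant its source vanishes, and the other source is controlled by the total variation
of the other profile on that side, that is, by the difference of the two. -/
lemma integral_abs_source_sub_le (hf : IsProfile R f) (hg : IsProfile R' g) (hS : IsKernel r S)
    (hf0 : ∀ x, R ≤ x → source S f x = 0) (hg0 : ∀ x, R' ≤ x → source S g x = 0) :
    ∫ x, |source S f x - source S g x| ≤
      ((∫ z, |deriv S z|) + 2 * R * ∫ z, |deriv (deriv S) z|) * ∫ x, |f x - g x| := by
  have hR := hf.radius_pos
  set K := ∫ z, |deriv S z| with hK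
  set M := ∫ z, |deriv (deriv S) z| with hM
  set D := ∫ x, |f x - g x| with hD
  have hK0 : 0 ≤ K := by positivity
  have hM0 : 0 ≤ M := by positivity
  have hD0 : 0 ≤ D := by positivity
  have hi := hf.integrable_sub hg
  have hci := hS.deriv.integrable_conv hi
  have hci' := hS.deriv.deriv.integrable_conv hi
  have hsub := hS.deriv.conv_sub hf.measurable hg.measurable hf.abs_le_half hg.abs_le_half
  have hsub' := hS.deriv.deriv.conv_sub hf.measurable hg.measurable hf.abs_le_half hg.abs_le_half
  set b : ℝ → ℝ := fun x => K / 2 * |f x - g x| + 1 / 2 * |conv (deriv S) (fun y => f y - g y) x|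
    + (Icc (-R) R).indicator (fun _ => M * D) x with hb
  -- the nonlocal parts of the two sources differ by at most `M * D`, uniformly in `x`
  have hint : ∀ x, |∫ z in Iic x, (f z * conv (deriv (deriv S)) f z
      - g z * conv (deriv (deriv S)) g z)| ≤ M * D := by
    intro x
    have hi1 : Integrable (fun z => M / 2 * |f z - g z|
        + 1 / 2 * |conv (deriv (deriv S)) (fun y => f y - g y) z|) :=
      (hi.abs.const_mul _).add (hci'.abs.const_mul _)
    calc _ ≤ ∫ z in Iic x, |f z * conv (deriv (deriv S)) f z
          - g z * conv (deriv (deriv S)) g z| := abs_integral_le_integral_abs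
      _ ≤ ∫ z, |f z * conv (deriv (deriv S)) f z - g z * conv (deriv (deriv S)) g z| :=
        setIntegral_le_integral ((hf.integrable_mul_conv hS).sub (hg.integrable_mul_conv hS)).abs
          (.of_forall fun _ => abs_nonneg _)
      _ ≤ ∫ z, (M / 2 * |f z - g z|
          + 1 / 2 * |conv (deriv (deriv S)) (fun y => f y - g y) z|) := by
        refine integral_mono ((hf.integrable_mul_conv hS).sub (hg.integrable_mul_conv hS)).abs
          hi1 fun z => ?_
        have e : f z * conv (deriv (deriv S)) f z - g z * conv (deriv (deriv S)) g z
            = conv (deriv (deriv S)) f z * (f z - g z)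
              + g z * conv (deriv (deriv S)) (fun y => f y - g y) z := by
          rw [← hsub' z]; ring
        simp only [e]
        refine (abs_add_le _ _).trans ?_
        rw [abs_mul, abs_mul]
        exact add_le_add (mul_le_mul_of_nonneg_right (hf.abs_conv_le hS.deriv.deriv z)
          (abs_nonneg _)) (mul_le_mul_of_nonneg_right (hg.abs_le_half z) (abs_nonneg _))
      _ = M / 2 * D + 1 / 2 * ∫ z, |conv (deriv (deriv S)) (fun y => f y - g y) z| := by
        rw [integral_add (hi.abs.const_mul _) (hci'.abs.const_mul _), integral_const_mul,
          integral_const_mul]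
      _ ≤ M * D := by linarith [hS.deriv.deriv.integral_abs_conv_le hi]
  have hpt : ∀ x, |source S f x - source S g x| ≤ b x := by
    intro x
    have p1 : 0 ≤ 1 / 2 * |conv (deriv S) (fun y => f y - g y) x| := by positivity
    by_cases hx : x ∈ Icc (-R) R
    · simp only [hb, indicator_of_mem hx]
      have e : source S f x - source S g x = conv (deriv S) f x * (f x - g x)
          + g x * conv (deriv S) (fun y => f y - g y) x
          - ∫ z in Iic x, (f z * conv (deriv (deriv S)) f z
            - g z * conv (deriv (deriv S)) g z) := by
        rw [← hsub x, integral_sub (hf.integrable_mul_conv hS).integrableOn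
          (hg.integrable_mul_conv hS).integrableOn, source, source]
        ring
      rw [e]
      refine (abs_sub _ _).trans (add_le_add ((abs_add_le _ _).trans ?_) (hint x))
      rw [abs_mul, abs_mul]
      exact add_le_add (mul_le_mul_of_nonneg_right (hf.abs_conv_le hS.deriv x)
          (abs_nonneg _)) (mul_le_mul_of_nonneg_right (hg.abs_le_half x) (abs_nonneg _))
    · simp only [hb, indicator_of_notMem hx]
      have hf1 : source S f x = 0 := hf.source_eq_zero_of_le hS le_rfl (hf0 R le_rfl)
        fun h => hx (Ioo_subset_Icc_self h)
      have : |source S g x| ≤ K / 2 * |f x - g x| := by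
        rw [mem_Icc, not_and_or, not_le, not_le] at hx
        rcases hx with hx | hx
        · have h1 := hg.abs_source_sub_le hS (min_le_left x (-R'))
          rw [hg.source_eq_zero_left hS (min_le_right x (-R')), sub_zero,
            hg.eq_left (min_le_right x (-R'))] at h1
          rw [hf.eq_left hx.le, abs_sub_comm,
            abs_of_nonneg (show 0 ≤ g x - -1 / 2 by linarith [hg.neg_half_le x])]
          exact h1
        · have h1 := hg.abs_source_sub_le hS (le_max_left x R')
          rw [hg0 _ (le_max_right x R'), zero_sub, abs_neg,
            hg.eq_right (le_max_right x R')] at h1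
          rw [hf.eq_right hx.le, abs_of_nonneg (show 0 ≤ 1 / 2 - g x by linarith [hg.le_half x])]
          exact h1
      rw [hf1, zero_sub, abs_neg]
      linarith
  have hind : Integrable ((Icc (-R) R).indicator (fun _ => M * D)) :=
    (integrable_indicator_iff measurableSet_Icc).2 (integrableOn_const (by simp))
  have hI : ∫ x, (Icc (-R) R).indicator (fun _ => M * D) x = 2 * R * (M * D) := by
    rw [integral_indicator_const _ measurableSet_Icc]
    simp only [measureReal_def, Real.volume_Icc, smul_eq_mul]
    rw [ENNReal.toReal_ofReal (by linarith)]; ring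
  have hb1 : Integrable (fun x => K / 2 * |f x - g x|
      + 1 / 2 * |conv (deriv S) (fun y => f y - g y) x|) :=
    (hi.abs.const_mul _).add (hci.abs.const_mul _)
  calc _ ≤ ∫ x, b x := integral_mono
        ((hf.integrable_source hS hf0).sub (hg.integrable_source hS hg0)).abs (hb1.add hind) hpt
    _ = K / 2 * D + 1 / 2 * (∫ x, |conv (deriv S) (fun y => f y - g y) x|)
        + 2 * R * (M * D) := by
      rw [hb, integral_add hb1 hind, integral_add (hi.abs.const_mul _) (hci.abs.const_mul _),
        integral_const_mul, integral_const_mul, hI]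
    _ ≤ _ := by
      have := hS.deriv.integral_abs_conv_le hi
      nlinarith

/-- Interaction energies with an odd kernel are antisymmetric. -/
lemma _root_.OpinionBurgers.integral_mul_conv_antisymm {ψ u v : ℝ → ℝ} (hψ : IsKernel r ψ)
    (hodd : ∀ x, ψ (-x) = -ψ x) (hu : Measurable u) {M : ℝ} (huM : ∀ x, |u x| ≤ M)
    (hv : Integrable v) : ∫ x, u x * conv ψ v x = -∫ x, v x * conv ψ u x := by
  have hi : Integrable (Function.uncurry fun x y => u x * (ψ (x - y) * v y))
      (volume.prod volume) := by
    have := hv.convolution_integrand (ContinuousLinearMap.mul ℝ ℝ) hψ.integrable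
    have h2 := this.bdd_mul (c := M) (f := fun p : ℝ × ℝ => u p.1)
      (hu.comp measurable_fst).aestronglyMeasurable (.of_forall fun p => huM p.1)
    refine h2.congr (.of_forall fun p => ?_)
    simp [Function.uncurry, mul_comm]
  have h1 : ∀ x, u x * conv ψ v x = ∫ y, u x * (ψ (x - y) * v y) := fun x => by
    rw [integral_const_mul, conv]
  have h2 : ∀ y, -(v y * conv ψ u y) = ∫ x, u x * (ψ (x - y) * v y) := fun y => by
    rw [conv, ← integral_const_mul, ← integral_neg]
    refine integral_congr_ae (.of_forall fun x => ?_)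
    have := hodd (x - y)
    rw [neg_sub] at this
    simp only [this]; ring
  simp only [h1]
  rw [← integral_neg, integral_integral_swap hi]
  simp only [h2]

/-- For odd `S` the source vanishes to the right of the transition region of a profile: it preserves
the total mass. -/
lemma source_eq_zero_of_odd (hf : IsProfile R f) (hS : IsKernel r S)
    (hodd : ∀ x, S (-x) = -S x) {x : ℝ} (hx : R ≤ x) : source S f x = 0 := by
  -- the second derivative of an odd function is odd
  have hS1 : ∀ x, deriv S (-x) = deriv S x := fun x => by
    have h : (fun y => S (-y)) = fun y => -S y := funext hodd
    have := congrArg (fun u => deriv u x) h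
    simp only [deriv_comp_neg, deriv.fun_neg] at this
    linarith
  have hS2 : ∀ x, deriv (deriv S) (-x) = -deriv (deriv S) x := fun x => by
    have h : (fun y => deriv S (-y)) = fun y => deriv S y := funext hS1
    have := congrArg (fun u => deriv u x) h
    simp only [deriv_comp_neg] at this
    linarith
  set ψ := deriv (deriv S) with hψd
  have hψ : IsKernel r ψ := hS.deriv.deriv
  -- split off an odd step function: the difference to it is integrable, so that the antisymmetry
  -- of the form `∫ u * conv ψ v` can be used
  set e : ℝ → ℝ := fun x => heaviside x - 1 / 2 with he
  have hE : IsProfile 1 e := half_heaviside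
  have heodd : ∀ᵐ x : ℝ, e (-x) = -e x := by
    have : ∀ᵐ x : ℝ, x ≠ 0 := by simp [ae_iff]
    filter_upwards [this] with x hx
    simp only [he, heaviside]
    rcases lt_or_gt_of_ne hx with h | h
    · rw [if_pos (by linarith), if_neg (by linarith)]; norm_num
    · rw [if_neg (by linarith), if_pos (by linarith)]; norm_num
  set g : ℝ → ℝ := fun x => f x - e x with hg
  have hgi : Integrable g := hf.integrable_sub hE
  have hgm : Measurable g := hf.measurable.sub hE.measurable
  have hgM : ∀ x, |g x| ≤ 1 := fun x => by
    have := abs_sub (f x) (e x)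
    linarith [hf.abs_le_half x, hE.abs_le_half x]
  -- the integrand is odd
  have hee : ∫ x, e x * conv ψ e x = 0 := by
    have h1 : ∀ x, conv ψ e (-x) = conv ψ e x := fun x => by
      rw [conv, ← integral_neg_eq_self, conv]
      refine integral_congr_ae (heodd.mono fun y hy => ?_)
      have := hS2 (x - y)
      simp only [hy, show -x - -y = -(x - y) by ring, this]; ring
    have h2 : ∫ x, e x * conv ψ e x = -∫ x, e x * conv ψ e x := by
      conv_lhs => rw [← integral_neg_eq_self]
      rw [← integral_neg]
      refine integral_congr_ae (heodd.mono fun y hy => ?_)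
      simp only [hy, h1]; ring
    linarith
  have hmul : ∀ {v : ℝ → ℝ}, Integrable v → ∀ {u : ℝ → ℝ}, Measurable u → ∀ {M : ℝ},
      (∀ x, |u x| ≤ M) → Integrable (fun x => u x * conv ψ v x) := fun hv u hu M huM =>
    (hψ.integrable_conv hv).bdd_mul (c := M) hu.aestronglyMeasurable (.of_forall huM)
  have hmul' : Integrable (fun x => g x * conv ψ e x) :=
    hgi.mul_bdd (c := (∫ y, |ψ y|) / 2)
      (hψ.continuous_conv hE.locallyIntegrable).aestronglyMeasurable
      (.of_forall fun x => hE.abs_conv_le hψ x)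
  -- expand the quadratic form at `f = e + g`
  have htot : ∫ z, f z * conv ψ f z = 0 := by
    have e1 : ∀ z, f z * conv ψ f z = e z * conv ψ e z + e z * conv ψ g z
        + (g z * conv ψ e z + g z * conv ψ g z) := fun z => by
      have := hψ.conv_sub hf.measurable hE.measurable hf.abs_le_half hE.abs_le_half z
      rw [show (fun y => f y - e y) = g from rfl] at this
      have h3 : f z = e z + g z := by simp [hg]
      have h4 : conv ψ f z = conv ψ e z + conv ψ g z := by linarith
      rw [h4, h3]; ring
    simp only [e1]
    have i1 : Integrable (fun z => e z * conv ψ e z) := hE.integrable_mul_conv hS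
    have i2 := hmul hgi hE.measurable hE.abs_le_half
    have i3 := hmul hgi hgm hgM
    have i12 : Integrable (fun z => e z * conv ψ e z + e z * conv ψ g z) := i1.add i2
    have i34 : Integrable (fun z => g z * conv ψ e z + g z * conv ψ g z) := hmul'.add i3
    rw [integral_add i12 i34, integral_add i1 i2, integral_add hmul' i3, hee]
    have a1 := integral_mul_conv_antisymm hψ hS2 hE.measurable hE.abs_le_half hgi
    have a2 := integral_mul_conv_antisymm hψ hS2 hgm hgM hgi
    linarith
  have hb : R ≤ max R (R + r) := le_max_left _ _
  rw [hf.source_eq_right hS hx hb, source, hf.conv_eq_zero hS.deriv hS.integral_deriv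
    (fun h => by linarith [h.2, le_max_right R (R + r)]), mul_zero, zero_sub, neg_eq_zero]
  rw [← htot]
  refine setIntegral_eq_integral_of_forall_compl_eq_zero fun z hz => ?_
  rw [hf.conv_eq_zero hψ hS.deriv.integral_deriv
    (fun h => hz (mem_Iic.2 (by linarith [h.2, le_max_right R (R + r)]))), mul_zero]

end IsProfile
end OpinionBurgers

namespace OpinionBurgers

/-! ### Entropy inequalities on the whole plane -/

lemma integrable_of_bounded_of_support {α : Type*} [MeasurableSpace α] {μ : Measure α}
    {f : α → ℝ} {K : Set α} {C : ℝ} (hμ : μ K < ⊤) (hf : AEStronglyMeasurable f μ)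
    (hC : ∀ x, |f x| ≤ C) (h0 : ∀ x, x ∉ K → f x = 0) : Integrable f μ :=
  (IntegrableOn.of_bound hμ hf.restrict C (.of_forall fun x => hC x) :
    IntegrableOn f K μ).integrable_of_forall_notMem_eq_zero h0

lemma measurable_sign : Measurable Real.sign := by
  unfold Real.sign
  exact Measurable.ite measurableSet_Iio measurable_const
    (Measurable.ite measurableSet_Ioi measurable_const measurable_const)

lemma abs_sign_le (x : ℝ) : |Real.sign x| ≤ 1 := by
  rcases Real.sign_apply_eq x with h | h | h <;> simp [h]

/-- The integrand of the entropy inequality, for a flux `B` defined on the whole line. -/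
noncomputable def entropyIntegrand (S : ℝ → ℝ) (B F : ℝ → ℝ → ℝ) (χ : ℝ × ℝ → ℝ) (α : ℝ)
    (z : ℝ × ℝ) : ℝ :=
  |F z.1 z.2 - α| * fderiv ℝ χ z (1, 0)
    + Real.sign (F z.1 z.2 - α) * (B z.1 (F z.1 z.2) - B z.1 α) * fderiv ℝ χ z (0, 1)
    + Real.sign (F z.1 z.2 - α) * χ z * source S (F z.1) z.2

/-- Time-dependent fluxes on the whole line, continuous and Lipschitz in the state variable,
uniformly in time. -/
structure IsRegularFlux (L : NNReal) (B : ℝ → ℝ → ℝ) : Prop where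
  cont : Continuous (Function.uncurry B)
  lip : ∀ t, LipschitzWith L (B t)

/-- Entropy solutions with all the pointwise properties one may ask for: jointly measurable, and a
profile at every time. -/
structure IsRegularSolution (T : ℝ) (B : ℝ → ℝ → ℝ) (S : ℝ → ℝ) (R : ℝ) (F : ℝ → ℝ → ℝ) :
    Prop where
  meas : Measurable (Function.uncurry F)
  profile : ∀ t, IsProfile R (F t)
  entropy : ∀ χ : ℝ × ℝ → ℝ, ContDiff ℝ ∞ χ → HasCompactSupport χ →
    tsupport χ ⊆ Ioo 0 T ×ˢ univ → (∀ z, 0 ≤ χ z) → ∀ α : ℝ,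
    0 ≤ ∫ z, entropyIntegrand S B F χ α z

lemma measurable_conv {φ : ℝ → ℝ} (hφ : Continuous φ) {F : ℝ → ℝ → ℝ}
    (hF : Measurable (Function.uncurry F)) : Measurable (fun z : ℝ × ℝ => conv φ (F z.1) z.2) := by
  have : StronglyMeasurable (fun q : (ℝ × ℝ) × ℝ => φ (q.1.2 - q.2) * F q.1.1 q.2) := by
    refine Measurable.stronglyMeasurable ?_
    refine (hφ.measurable.comp (by fun_prop)).mul ?_
    exact hF.comp (f := fun q : (ℝ × ℝ) × ℝ => (q.1.1, q.2)) (by fun_prop)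
  exact (this.integral_prod_right' (ν := volume)).measurable

lemma measurable_source {S : ℝ → ℝ} {r : ℝ} (hS : IsKernel r S) {F : ℝ → ℝ → ℝ}
    (hF : Measurable (Function.uncurry F)) :
    Measurable (fun z : ℝ × ℝ => source S (F z.1) z.2) := by
  refine (hF.mul (measurable_conv hS.deriv.continuous hF)).sub ?_
  have hm : Measurable (fun q : (ℝ × ℝ) × ℝ =>
      F q.1.1 q.2 * conv (deriv (deriv S)) (F q.1.1) q.2) := by
    refine Measurable.mul ?_ ?_
    · exact hF.comp (f := fun q : (ℝ × ℝ) × ℝ => (q.1.1, q.2)) (by fun_prop)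
    · exact (measurable_conv hS.deriv.deriv.continuous hF).comp
        (f := fun q : (ℝ × ℝ) × ℝ => (q.1.1, q.2)) (by fun_prop)
  have hs : MeasurableSet {q : (ℝ × ℝ) × ℝ | q.2 ≤ q.1.2} :=
    measurableSet_le (by fun_prop) (by fun_prop)
  have := (hm.indicator hs).stronglyMeasurable.integral_prod_right' (ν := volume)
  have e : (fun z : ℝ × ℝ => ∫ x in Iic z.2, F z.1 x * conv (deriv (deriv S)) (F z.1) x)
      = fun z => ∫ y, {q : (ℝ × ℝ) × ℝ | q.2 ≤ q.1.2}.indicator (fun q : (ℝ × ℝ) × ℝ =>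
        F q.1.1 q.2 * conv (deriv (deriv S)) (F q.1.1) q.2) (z, y) := by
    ext z
    rw [← integral_indicator measurableSet_Iic]
    rfl
  exact e ▸ this.measurable

lemma hasFDerivAt_mul_prod {a b : ℝ → ℝ} {a' b' : ℝ} {z : ℝ × ℝ} (ha : HasDerivAt a a' z.1)
    (hb : HasDerivAt b b' z.2) : HasFDerivAt (fun z : ℝ × ℝ => a z.1 * b z.2)
      (a z.1 • (b' • ContinuousLinearMap.snd ℝ ℝ ℝ)
        + b z.2 • (a' • ContinuousLinearMap.fst ℝ ℝ ℝ)) z := by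
  have h1 : HasFDerivAt (fun z : ℝ × ℝ => a z.1) (a' • ContinuousLinearMap.fst ℝ ℝ ℝ) z :=
    ha.comp_hasFDerivAt z hasFDerivAt_fst
  have h2 : HasFDerivAt (fun z : ℝ × ℝ => b z.2) (b' • ContinuousLinearMap.snd ℝ ℝ ℝ) z :=
    hb.comp_hasFDerivAt z hasFDerivAt_snd
  exact h1.mul h2

/-- Smooth nonnegative functions with compact support in `(0, T)`: test functions of time. -/
structure IsTimeTest (T : ℝ) (ψ : ℝ → ℝ) : Prop where
  smooth : ContDiff ℝ ∞ ψ
  compact : HasCompactSupport ψ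
  supp : tsupport ψ ⊆ Ioo 0 T
  nonneg : ∀ t, 0 ≤ ψ t

lemma IsTimeTest.hasDerivAt {T : ℝ} {ψ : ℝ → ℝ} (h : IsTimeTest T ψ) (t : ℝ) :
    HasDerivAt ψ (deriv ψ t) t :=
  (h.smooth.differentiable (by simp) t).hasDerivAt

lemma IsTimeTest.continuous_deriv {T : ℝ} {ψ : ℝ → ℝ} (h : IsTimeTest T ψ) :
    Continuous (deriv ψ) := (h.smooth.iterate_deriv 1).continuous

/-- Even mollifiers of width `δ`. -/
structure IsMollifier (δ : ℝ) (ρ : ℝ → ℝ) : Prop extends IsKernel δ ρ where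
  nonneg : ∀ x, 0 ≤ ρ x
  even : ∀ x, ρ (-x) = ρ x
  mass : ∫ x, ρ x = 1

lemma exists_isMollifier {δ : ℝ} (hδ : 0 < δ) : ∃ ρ, IsMollifier δ ρ := by
  let b : ContDiffBump (0 : ℝ) := ⟨δ / 2, δ, by linarith, by linarith⟩
  refine ⟨b.normed volume, ⟨⟨b.contDiff_normed, ?_⟩, b.nonneg_normed, b.normed_neg,
    b.integral_normed⟩⟩
  rw [b.tsupport_normed_eq, Real.closedBall_eq_Icc]
  simp [b]

section OneSided

variable {T R r δ : ℝ} {L : NNReal} {B F : ℝ → ℝ → ℝ} {S g ρ ψ : ℝ → ℝ}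

lemma IsProfile.eq_of_far {f g : ℝ → ℝ} (hf : IsProfile R f) (hg : IsProfile R g) {x y : ℝ}
    (hxy : x - y ∈ Icc (-δ) δ)
    (h : (x, y) ∉ Icc (-(R + δ)) (R + δ) ×ˢ Icc (-(R + δ)) (R + δ)) : f x = g y := by
  rw [mem_Icc] at hxy
  have hc : x ≤ -R ∧ y ≤ -R ∨ R ≤ x ∧ R ≤ y := by
    simp only [mem_prod, mem_Icc] at h
    by_contra hcon
    refine h ⟨⟨?_, ?_⟩, ⟨?_, ?_⟩⟩ <;> by_contra h' <;> refine hcon ?_ <;>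
      first
      | exact Or.inl ⟨by linarith, by linarith⟩
      | exact Or.inr ⟨by linarith, by linarith⟩
  rcases hc with h | h
  · rw [hf.eq_left h.1, hg.eq_left h.2]
  · rw [hf.eq_right h.1, hg.eq_right h.2]

/-- The doubled distance `∬ |f(x) - g(y)| ρ(x - y) dx dy`. -/
noncomputable def doubledDist (ρ f g : ℝ → ℝ) : ℝ := ∫ p : ℝ × ℝ, |f p.1 - g p.2| * ρ (p.1 - p.2)

/-- The dissipation, due to the flux `b` and the source of `f`, of the doubled distance to `g`. -/
noncomputable def doubledRate (S b ρ f g : ℝ → ℝ) : ℝ :=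
  ∫ p : ℝ × ℝ, Real.sign (f p.1 - g p.2) *
    ((b (f p.1) - b (g p.2)) * deriv ρ (p.1 - p.2) + ρ (p.1 - p.2) * source S f p.1)

lemma IsProfile.integrable_doubledDist {f : ℝ → ℝ} (hf : IsProfile R f) (hg : IsProfile R g)
    (hρ : IsKernel δ ρ) : Integrable (fun p : ℝ × ℝ => |f p.1 - g p.2| * ρ (p.1 - p.2)) := by
  refine integrable_of_bounded_of_support (K := Icc (-(R + δ)) (R + δ) ×ˢ Icc (-(R + δ)) (R + δ))
    (C := 1 * supNorm ρ) (isCompact_Icc.prod isCompact_Icc).measure_lt_top ?_ ?_ ?_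
  · have := hf.measurable; have := hg.measurable; have := hρ.continuous.measurable
    exact Measurable.aestronglyMeasurable (by fun_prop)
  · intro p
    rw [abs_mul, abs_abs]
    refine mul_le_mul ?_ (hρ.abs_le_supNorm _) (abs_nonneg _) zero_le_one
    have := abs_sub (f p.1) (g p.2)
    linarith [hf.abs_le_half p.1, hg.abs_le_half p.2]
  · intro p hp
    by_cases h : p.1 - p.2 ∈ Icc (-δ) δ
    · rw [hf.eq_of_far hg h hp, sub_self, abs_zero, zero_mul]
    · rw [hρ.eq_zero h, mul_zero]

lemma IsProfile.integrable_doubledRate {b f : ℝ → ℝ} (hf : IsProfile R f) (hg : IsProfile R g)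
    (hρ : IsKernel δ ρ) (hS : IsKernel r S) (hb : LipschitzWith L b) :
    Integrable (fun p : ℝ × ℝ => Real.sign (f p.1 - g p.2) *
    ((b (f p.1) - b (g p.2)) * deriv ρ (p.1 - p.2) + ρ (p.1 - p.2) * source S f p.1)) := by
  refine integrable_of_bounded_of_support (K := Icc (-(R + δ)) (R + δ) ×ˢ Icc (-(R + δ)) (R + δ))
    (C := 1 * (L * supNorm (deriv ρ) + supNorm ρ * ((∫ z, |deriv S z|) / 2)))
    (isCompact_Icc.prod isCompact_Icc).measure_lt_top ?_ ?_ ?_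
  · have := hf.measurable; have := hg.measurable; have := hρ.continuous.measurable
    have := hρ.deriv.continuous.measurable; have := hb.continuous.measurable
    have := measurable_sign; have := hf.measurable_source hS
    exact Measurable.aestronglyMeasurable (by fun_prop)
  · intro p
    rw [abs_mul]
    refine mul_le_mul (abs_sign_le _) ((abs_add_le _ _).trans ?_) (abs_nonneg _) zero_le_one
    rw [abs_mul, abs_mul]
    refine add_le_add (mul_le_mul ?_ (hρ.deriv.abs_le_supNorm _) (abs_nonneg _) L.2)
      (mul_le_mul (hρ.abs_le_supNorm _) (hf.abs_source_le hS _) (abs_nonneg _)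
        hρ.supNorm_nonneg)
    refine (hb.dist_le_mul _ _).trans ?_
    rw [Real.dist_eq]
    have := abs_sub (f p.1) (g p.2)
    exact mul_le_of_le_one_right L.2 (by linarith [hf.abs_le_half p.1, hg.abs_le_half p.2])
  · intro p hp
    by_cases h : p.1 - p.2 ∈ Icc (-δ) δ
    · rw [hf.eq_of_far hg h hp, sub_self, Real.sign_zero, zero_mul]
    · rw [hρ.eq_zero h, hρ.deriv.eq_zero h]
      simp

/-- The entropy inequalities with constants `α = g(y)`, integrated in `y`. -/
lemma IsRegularSolution.integral_doubled_nonneg (hF : IsRegularSolution T B S R F)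
    (hB : IsRegularFlux L B) (hS : IsKernel r S) (hg : IsProfile R g) (hρ : IsMollifier δ ρ)
    (hψ : IsTimeTest T ψ) :
    0 ≤ ∫ s, (doubledDist ρ (F s) g * deriv ψ s + doubledRate S (B s) ρ (F s) g * ψ s) := by
  have hρ' := hρ.toIsKernel
  -- the entropy integrand of the test function `ψ(t) ρ(x - y)` with constant `g y`, at
  -- `((t, x), y)`
  set E : (ℝ × ℝ) × ℝ → ℝ := fun q =>
    |F q.1.1 q.1.2 - g q.2| * ρ (q.1.2 - q.2) * deriv ψ q.1.1
    + Real.sign (F q.1.1 q.1.2 - g q.2) *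
      ((B q.1.1 (F q.1.1 q.1.2) - B q.1.1 (g q.2)) * deriv ρ (q.1.2 - q.2)
        + ρ (q.1.2 - q.2) * source S (F q.1.1) q.1.2) * ψ q.1.1 with hE
  obtain ⟨C₁, hC₁⟩ := hψ.compact.exists_bound_of_continuous hψ.smooth.continuous
  obtain ⟨C₂, hC₂⟩ := hψ.compact.deriv.exists_bound_of_continuous hψ.continuous_deriv
  have hEi : Integrable E ((volume.prod volume).prod volume) := by
    refine integrable_of_bounded_of_support
      (K := (tsupport ψ ×ˢ Icc (-(R + δ)) (R + δ)) ×ˢ Icc (-(R + δ)) (R + δ))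
      (C := 1 * supNorm ρ * C₂
        + 1 * (L * supNorm (deriv ρ) + supNorm ρ * ((∫ z, |deriv S z|) / 2)) * C₁)
      ((hψ.compact.isCompact.prod isCompact_Icc).prod isCompact_Icc).measure_lt_top ?_ ?_ ?_
    · have h1 : Measurable (fun q : (ℝ × ℝ) × ℝ => F q.1.1 q.1.2) := hF.meas.comp measurable_fst
      have h2 := hg.measurable
      have h3 := hρ.continuous.measurable
      have h4 := hρ'.deriv.continuous.measurable
      have h5 := measurable_sign
      have h6 : Measurable (fun q : (ℝ × ℝ) × ℝ => source S (F q.1.1) q.1.2) :=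
        (measurable_source hS hF.meas).comp measurable_fst
      have h7 := hψ.smooth.continuous.measurable
      have h8 := hψ.continuous_deriv.measurable
      have h9 : Measurable (fun q : (ℝ × ℝ) × ℝ => B q.1.1 (F q.1.1 q.1.2)) :=
        hB.cont.measurable.comp (f := fun q : (ℝ × ℝ) × ℝ => (q.1.1, F q.1.1 q.1.2))
          (Measurable.prodMk (by fun_prop) h1)
      have h10 : Measurable (fun q : (ℝ × ℝ) × ℝ => B q.1.1 (g q.2)) :=
        hB.cont.measurable.comp (f := fun q : (ℝ × ℝ) × ℝ => (q.1.1, g q.2)) (by fun_prop)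
      have ha : Measurable (fun q : (ℝ × ℝ) × ℝ => F q.1.1 q.1.2 - g q.2) :=
        h1.sub (h2.comp measurable_snd)
      have hd : Measurable (fun q : (ℝ × ℝ) × ℝ => q.1.2 - q.2) := by fun_prop
      have ht : Measurable (fun q : (ℝ × ℝ) × ℝ => q.1.1) := by fun_prop
      exact (((ha.abs.mul (h3.comp hd)).mul (h8.comp ht)).add
        (((h5.comp ha).mul (((h9.sub h10).mul (h4.comp hd)).add ((h3.comp hd).mul h6))).mul
          (h7.comp ht))).aestronglyMeasurable
    · intro q
      have hsub : |F q.1.1 q.1.2 - g q.2| ≤ 1 := by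
        have := abs_sub (F q.1.1 q.1.2) (g q.2)
        linarith [(hF.profile q.1.1).abs_le_half q.1.2, hg.abs_le_half q.2]
      have hs0 := hρ'.supNorm_nonneg
      have hs1 := hρ'.deriv.supNorm_nonneg
      refine (abs_add_le _ _).trans ?_
      simp only [abs_mul, abs_abs]
      refine add_le_add (mul_le_mul (mul_le_mul hsub (hρ'.abs_le_supNorm _) (abs_nonneg _)
        zero_le_one) (hC₂ _) (abs_nonneg _) (by positivity)) (mul_le_mul (mul_le_mul
        (abs_sign_le _) ((abs_add_le _ _).trans ?_) (abs_nonneg _) zero_le_one) (hC₁ _)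
        (abs_nonneg _) (by positivity))
      rw [abs_mul, abs_mul]
      refine add_le_add (mul_le_mul ?_ (hρ'.deriv.abs_le_supNorm _) (abs_nonneg _) L.2)
        (mul_le_mul (hρ'.abs_le_supNorm _) ((hF.profile _).abs_source_le hS _) (abs_nonneg _)
        hρ'.supNorm_nonneg)
      refine ((hB.lip q.1.1).dist_le_mul _ _).trans ?_
      exact mul_le_of_le_one_right L.2 hsub
    · intro q hq
      by_cases h1 : q.1.1 ∈ tsupport ψ
      · by_cases h : q.1.2 - q.2 ∈ Icc (-δ) δ
        · have := (hF.profile q.1.1).eq_of_far hg h fun h' => hq ⟨⟨h1, h'.1⟩, h'.2⟩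
          simp only [hE, this, sub_self, abs_zero, Real.sign_zero, zero_mul, add_zero]
        · simp only [hE, hρ'.eq_zero h, hρ'.deriv.eq_zero h]
          simp
      · have h2 : deriv ψ q.1.1 = 0 :=
          image_eq_zero_of_notMem_tsupport fun h => h1 (tsupport_deriv_subset h)
        simp only [hE, image_eq_zero_of_notMem_tsupport h1, h2, mul_zero, add_zero]
  have hpos : ∀ y, 0 ≤ ∫ z : ℝ × ℝ, E (z, y) := by
    intro y
    have hρd : ∀ x, HasDerivAt (fun x => ρ (x - y)) (deriv ρ (x - y)) x := fun x =>
      (hρ.hasDerivAt (x - y)).comp_sub_const x y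
    have hsub : tsupport (fun z : ℝ × ℝ => ψ z.1 * ρ (z.2 - y))
        ⊆ tsupport ψ ×ˢ Icc (y - δ) (y + δ) := by
      refine closure_minimal (fun z hz => ⟨?_, ?_⟩)
        ((isClosed_tsupport ψ).prod isClosed_Icc)
      · exact subset_tsupport ψ fun h => hz (by simp only [h, zero_mul])
      · by_contra h
        refine hz ?_
        have : ρ (z.2 - y) = 0 := hρ'.eq_zero fun h' => h ⟨by linarith [h'.1], by linarith [h'.2]⟩
        simp only [this, mul_zero]
    have key := hF.entropy (fun z => ψ z.1 * ρ (z.2 - y))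
      ((hψ.smooth.comp contDiff_fst).mul
        (hρ.smooth.comp (contDiff_snd.sub contDiff_const)))
      ((hψ.compact.isCompact.prod isCompact_Icc).of_isClosed_subset (isClosed_tsupport _) hsub)
      (fun z hz => ⟨hψ.supp (hsub hz).1, trivial⟩)
      (fun z => mul_nonneg (hψ.nonneg _) (hρ.nonneg _)) (g y)
    refine key.trans_eq (integral_congr_ae (.of_forall fun z => ?_))
    have hd := (hasFDerivAt_mul_prod (z := z) (hψ.hasDerivAt z.1) (hρd z.2)).fderiv
    simp only [entropyIntegrand, hE, hd]
    simp
    ring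
  -- integrate over `y`, and exchange the order of integration
  have h3 : 0 ≤ ∫ q, E q ∂((volume.prod volume).prod volume) := by
    rw [integral_prod_symm _ hEi]
    exact integral_nonneg hpos
  have hmp := (measurePreserving_prodAssoc (volume : Measure ℝ) (volume : Measure ℝ)
    (volume : Measure ℝ)).symm
  rw [← hmp.integral_comp'] at h3
  have hEi' : Integrable (fun q => E (MeasurableEquiv.prodAssoc.symm q))
      (volume.prod (volume.prod volume)) := hmp.integrable_comp_of_integrable hEi
  rw [integral_prod _ hEi'] at h3
  refine h3.trans_eq (integral_congr_ae (.of_forall fun s => ?_))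
  have i1 := (hF.profile s).integrable_doubledDist hg hρ'
  have i2 := (hF.profile s).integrable_doubledRate hg hρ' hS (hB.lip s)
  simp only [doubledDist, doubledRate]
  rw [← integral_mul_const, ← integral_mul_const, ← integral_add (i1.mul_const _)
    (i2.mul_const _)]
  rfl

end OneSided
end OpinionBurgers

namespace OpinionBurgers

/-! ### Estimates of the doubled quantities -/

lemma IsMollifier.deriv_neg {δ : ℝ} {ρ : ℝ → ℝ} (hρ : IsMollifier δ ρ) (x : ℝ) :
    deriv ρ (-x) = -deriv ρ x := by
  have h : (fun y => ρ (-y)) = fun y => ρ y := funext hρ.even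
  have := congrArg (fun u => deriv u x) h
  simp only [deriv_comp_neg] at this
  linarith

/-- Mollification by a nonnegative kernel preserves monotonicity. -/
lemma IsMollifier.conv_deriv_nonneg {δ : ℝ} {ρ M : ℝ → ℝ} (hρ : IsMollifier δ ρ)
    (hM : Monotone M) {C : ℝ} (hC : ∀ x, |M x| ≤ C) (y : ℝ) : 0 ≤ conv (deriv ρ) M y := by
  have hmono : Monotone (conv ρ M) := by
    intro a b hab
    have e : ∀ y, conv ρ M y = ∫ u, ρ u * M (y - u) := fun y => by
      rw [conv, ← integral_sub_left_eq_self _ _ y]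
      simp
    have hi : ∀ y, Integrable (fun u => ρ u * M (y - u)) := fun y =>
      hρ.integrable.mul_bdd (c := C)
        (hM.measurable.comp (measurable_const.sub measurable_id)).aestronglyMeasurable
        (.of_forall fun u => hC _)
    rw [e, e]
    exact integral_mono (hi a) (hi b) fun u =>
      mul_le_mul_of_nonneg_left (hM (by linarith)) (hρ.nonneg u)
  rw [← (hρ.hasDerivAt_conv hM.locallyIntegrable y).deriv]
  exact hmono.deriv_nonneg

lemma lipschitz_sign_mul {b : ℝ → ℝ} {Λ : NNReal} (hb : LipschitzWith Λ b) (k v w : ℝ) :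
    |Real.sign (v - k) * (b v - b k) - Real.sign (w - k) * (b w - b k)| ≤ Λ * |v - w| := by
  have h : ∀ p q, |b p - b q| ≤ Λ * |p - q| := fun p q => hb.dist_le_mul p q
  have h1 := h v w
  have h2 := h v k
  have h3 := h w k
  have hΛ : (0:ℝ) ≤ Λ := Λ.2
  rcases lt_trichotomy v k with hv | hv | hv <;> rcases lt_trichotomy w k with hw | hw | hw
  · rw [Real.sign_of_neg (by linarith), Real.sign_of_neg (by linarith), abs_sub_comm]
    convert h1 using 2; ring
  · subst hw
    simp only [sub_self, Real.sign_zero, mul_zero, sub_zero, abs_mul]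
    exact (mul_le_of_le_one_left (abs_nonneg _) (abs_sign_le _)).trans h2
  · rw [Real.sign_of_neg (by linarith), Real.sign_of_pos (by linarith)]
    rw [abs_of_neg (by linarith : v - w < 0)]
    rw [abs_of_neg (by linarith : v - k < 0)] at h2
    rw [abs_of_pos (by linarith : 0 < w - k)] at h3
    refine (abs_sub _ _).trans ?_
    rw [neg_one_mul, abs_neg, one_mul]
    linarith
  · subst hv
    simp only [sub_self, Real.sign_zero, mul_zero, zero_sub, abs_mul, abs_neg]
    rw [abs_sub_comm v w]
    exact (mul_le_of_le_one_left (abs_nonneg _) (abs_sign_le _)).trans h3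
  · subst hv; subst hw; simp
  · subst hv
    simp only [sub_self, Real.sign_zero, mul_zero, zero_sub, abs_mul, abs_neg]
    rw [abs_sub_comm v w]
    exact (mul_le_of_le_one_left (abs_nonneg _) (abs_sign_le _)).trans h3
  · rw [Real.sign_of_pos (by linarith), Real.sign_of_neg (by linarith)]
    rw [abs_of_pos (by linarith : 0 < v - w)]
    rw [abs_of_pos (by linarith : 0 < v - k)] at h2
    rw [abs_of_neg (by linarith : w - k < 0)] at h3
    refine (abs_sub _ _).trans ?_
    rw [neg_one_mul, abs_neg, one_mul]
    linarith
  · subst hw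
    simp only [sub_self, Real.sign_zero, mul_zero, sub_zero, abs_mul]
    exact (mul_le_of_le_one_left (abs_nonneg _) (abs_sign_le _)).trans h2
  · rw [Real.sign_of_pos (by linarith), Real.sign_of_pos (by linarith)]
    convert h1 using 2; ring

lemma IsMollifier.integral_conv_deriv {δ R : ℝ} {ρ f : ℝ → ℝ} (hρ : IsMollifier δ ρ)
    (hδ : 0 < δ) (hf : IsProfile R f) :
    Integrable (conv (deriv ρ) f) ∧ ∫ y, conv (deriv ρ) f y = 1 := by
  have hR := hf.radius_pos
  have hρ' := hρ.toIsKernel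
  have hc : Continuous (conv (deriv ρ) f) := hρ'.deriv.continuous_conv hf.locallyIntegrable
  have h0 : ∀ y, y ∉ Ioo (-R - δ) (R + δ) → conv (deriv ρ) f y = 0 := fun y hy =>
    hf.conv_eq_zero hρ'.deriv hρ'.integral_deriv hy
  refine ⟨(hc.integrableOn_Icc (a := -R - δ)
    (b := R + δ)).integrable_of_forall_notMem_eq_zero
    fun x hx => h0 x fun h => hx (Ioo_subset_Icc_self h), ?_⟩
  have h1 : ∫ y in (-R - δ)..(R + δ), conv (deriv ρ) f y = 1 := by
    rw [intervalIntegral.integral_eq_sub_of_hasDerivAt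
      (fun z _ => hρ'.hasDerivAt_conv hf.locallyIntegrable z) (hc.intervalIntegrable _ _),
      hρ'.conv_eq_of_eqOn (c := 1 / 2) fun y hy => hf.eq_right (by linarith [hy.1]),
      hρ'.conv_eq_of_eqOn (c := -1 / 2) fun y hy => hf.eq_left (by linarith [hy.2]), hρ.mass]
    norm_num
  rw [← h1, intervalIntegral.integral_of_le (by linarith)]
  refine (setIntegral_eq_integral_of_forall_compl_eq_zero fun x hx => h0 x fun h => hx ?_).symm
  exact ⟨h.1, h.2.le⟩

section TwoProfiles

variable {R R' r δ : ℝ} {L L' Λ : NNReal} {S f g b b' ρ : ℝ → ℝ}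

lemma IsMollifier.integrable_mul_abs {v : ℝ → ℝ} (hρ : IsMollifier δ ρ) (hv : Integrable v) :
    Integrable (fun p : ℝ × ℝ => ρ (p.1 - p.2) * |v p.1|) := by
  have := (hv.abs.convolution_integrand (ContinuousLinearMap.mul ℝ ℝ) hρ.integrable).swap
  refine this.congr (.of_forall fun p => ?_)
  have := hρ.even (p.1 - p.2)
  simp only [neg_sub] at this
  simp [this, mul_comm]

lemma IsMollifier.integral_mul_abs {v : ℝ → ℝ} (hρ : IsMollifier δ ρ) (hv : Integrable v) :
    ∫ p : ℝ × ℝ, ρ (p.1 - p.2) * |v p.1| = ∫ x, |v x| := by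
  rw [Measure.volume_eq_prod, integral_prod _ (hρ.integrable_mul_abs hv)]
  refine integral_congr_ae (.of_forall fun x => ?_)
  simp only
  rw [integral_mul_const, integral_sub_left_eq_self ρ, hρ.mass, one_mul]

lemma IsMollifier.doubledDist_self_le (hρ : IsMollifier δ ρ) (hδ : 0 < δ) (hg : IsProfile R g) :
    doubledDist ρ g g ≤ 2 * δ := by
  have hi : Integrable (fun x => g (x + δ) - g (x + -δ)) :=
    (hg.comp_add δ).integrable_sub (hg.comp_add (-δ))
  have e : ∫ x, |g (x + δ) - g (x + -δ)| = 2 * δ := by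
    have h1 := hg.integral_comp_add_sub δ
    have h2 := hg.integral_comp_add_sub (-δ)
    have i1 := (hg.comp_add δ).integrable_sub hg
    have i2 := (hg.comp_add (-δ)).integrable_sub hg
    have : ∫ x, |g (x + δ) - g (x + -δ)| = ∫ x, ((g (x + δ) - g x) - (g (x + -δ) - g x)) := by
      refine integral_congr_ae (.of_forall fun x => ?_)
      simp only
      rw [abs_of_nonneg (sub_nonneg.2 (hg.mono (by linarith)))]
      ring
    rw [this, integral_sub i1 i2, h1, h2]
    ring
  rw [← e, ← hρ.integral_mul_abs hi]
  refine integral_mono (hg.integrable_doubledDist hg hρ.toIsKernel)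
    (hρ.integrable_mul_abs hi) fun p => ?_
  simp only
  by_cases h : p.1 - p.2 ∈ Icc (-δ) δ
  · rw [mul_comm]
    refine mul_le_mul_of_nonneg_left ?_ (hρ.nonneg _)
    have a1 : g p.2 ≤ g (p.1 + δ) := hg.mono (by linarith [h.1])
    have a2 : g (p.1 + -δ) ≤ g p.2 := hg.mono (by linarith [h.2])
    have a3 : g p.1 ≤ g (p.1 + δ) := hg.mono (by linarith)
    have a4 : g (p.1 + -δ) ≤ g p.1 := hg.mono (by linarith)
    rw [abs_of_nonneg (a := g (p.1 + δ) - g (p.1 + -δ)) (by linarith), abs_le]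
    constructor <;> linarith
  · simp [hρ.toIsKernel.eq_zero h]

lemma IsMollifier.abs_doubledDist_sub_le (hρ : IsMollifier δ ρ) (hδ : 0 < δ)
    (hf : IsProfile R f) (hg : IsProfile R g) :
    |doubledDist ρ f g - (∫ x, |f x - g x|)| ≤ 2 * δ := by
  have hi := hf.integrable_sub hg
  rw [← hρ.integral_mul_abs hi, doubledDist, ← integral_sub
    (hf.integrable_doubledDist hg hρ.toIsKernel) (hρ.integrable_mul_abs hi)]
  refine abs_integral_le_integral_abs.trans (le_trans ?_ (hρ.doubledDist_self_le hδ hg))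
  refine integral_mono ((hf.integrable_doubledDist hg hρ.toIsKernel).sub
    (hρ.integrable_mul_abs hi)).abs (hg.integrable_doubledDist hg hρ.toIsKernel) fun p => ?_
  simp only
  rw [mul_comm (ρ _), ← sub_mul, abs_mul, abs_of_nonneg (hρ.nonneg _)]
  refine mul_le_mul_of_nonneg_right ?_ (hρ.nonneg _)
  refine (abs_abs_sub_abs_le _ _).trans (le_of_eq ?_)
  congr 1; ring

lemma IsMollifier.doubledDist_comm (hρ : IsMollifier δ ρ) (f g : ℝ → ℝ) :
    doubledDist ρ g f = doubledDist ρ f g := by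
  rw [doubledDist, doubledDist, Measure.volume_eq_prod, ← integral_prod_swap]
  refine integral_congr_ae (.of_forall fun p => ?_)
  have := hρ.even (p.1 - p.2)
  rw [neg_sub] at this
  simp [this, abs_sub_comm]

lemma IsMollifier.doubledRate_swap (hρ : IsMollifier δ ρ) (S b f g : ℝ → ℝ) :
    doubledRate S b ρ g f = ∫ p : ℝ × ℝ, Real.sign (f p.1 - g p.2) *
      (-(b (f p.1) - b (g p.2)) * deriv ρ (p.1 - p.2)
        - ρ (p.1 - p.2) * source S g p.2) := by
  rw [doubledRate, Measure.volume_eq_prod, ← integral_prod_swap]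
  refine integral_congr_ae (.of_forall fun p => ?_)
  have h1 := hρ.even (p.1 - p.2)
  have h2 := hρ.deriv_neg (p.1 - p.2)
  rw [neg_sub] at h1 h2
  have h3 := Real.sign_neg (r := f p.1 - g p.2)
  rw [neg_sub] at h3
  simp only [Prod.fst_swap, Prod.snd_swap, h1, h2, h3]
  ring

/-- The flux part of the dissipation is controlled by the Lipschitz constant of the difference of
the fluxes, since the total variation of a profile is one. -/
lemma IsMollifier.integral_flux_le {D : ℝ → ℝ} (hρ : IsMollifier δ ρ) (hδ : 0 < δ)
    (hf : IsProfile R f) (hg : IsProfile R g) (hD : LipschitzWith Λ D)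
    (hi : Integrable (fun p : ℝ × ℝ => Real.sign (f p.1 - g p.2) *
      ((D (f p.1) - D (g p.2)) * deriv ρ (p.1 - p.2)))) :
    ∫ p : ℝ × ℝ, Real.sign (f p.1 - g p.2) *
      ((D (f p.1) - D (g p.2)) * deriv ρ (p.1 - p.2)) ≤ Λ := by
  have hρ' := hρ.toIsKernel
  rw [Measure.volume_eq_prod] at hi ⊢
  rw [integral_prod_symm _ hi]
  have hconv := hρ.integral_conv_deriv hδ hf
  have : (Λ : ℝ) = ∫ y, Λ * conv (deriv ρ) f y := by rw [integral_const_mul, hconv.2, mul_one]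
  rw [this]
  refine integral_mono hi.integral_prod_right (hconv.1.const_mul _) fun y => ?_
  simp only
  set h : ℝ → ℝ := fun v => Real.sign (v - g y) * (D v - D (g y)) with hh
  have hLip := lipschitz_sign_mul hD (g y)
  have hΛ : (0:ℝ) ≤ Λ := Λ.2
  have hM : Monotone (fun x => Λ * f x + h (f x)) := by
    intro x x' hx
    have h1 := (abs_le.1 (hLip (f x') (f x))).1
    rw [abs_of_nonneg (sub_nonneg.2 (hf.mono hx))] at h1
    simp only [hh]
    linarith
  have hhm : Measurable (fun x => h (f x)) := by
    have := hf.measurable; have := measurable_sign; have := hD.continuous.measurable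
    fun_prop
  have hhb : ∀ x, |h (f x)| ≤ Λ * 1 := fun x => by
    have := hLip (f x) (g y)
    simp only [sub_self, Real.sign_zero, zero_mul, sub_zero] at this
    refine this.trans (mul_le_mul_of_nonneg_left ?_ hΛ)
    have := abs_sub (f x) (g y)
    linarith [hf.abs_le_half x, hg.abs_le_half y]
  have hb : ∀ x, |Λ * f x + h (f x)| ≤ Λ * (1 / 2) + Λ * 1 := fun x => by
    refine (abs_add_le _ _).trans (add_le_add ?_ (hhb x))
    rw [abs_mul, abs_of_nonneg hΛ]
    exact mul_le_mul_of_nonneg_left (hf.abs_le_half x) hΛ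
  have h0 := hρ.conv_deriv_nonneg hM hb y
  have i1 := hρ'.deriv.integrable_conv_integrand hf.measurable hf.abs_le_half y
  have i2 := hρ'.deriv.integrable_conv_integrand hhm hhb y
  have e : conv (deriv ρ) (fun x => Λ * f x + h (f x)) y
      = Λ * conv (deriv ρ) f y + conv (deriv ρ) (fun x => h (f x)) y := by
    rw [conv, conv, conv, ← integral_const_mul, ← integral_add (i1.const_mul _) i2]
    refine integral_congr_ae (.of_forall fun x => ?_)
    simp only; ring
  have e2 : ∫ x, Real.sign (f x - g y) * ((D (f x) - D (g y)) * deriv ρ (x - y))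
      = -conv (deriv ρ) (fun x => h (f x)) y := by
    rw [conv, ← integral_neg]
    refine integral_congr_ae (.of_forall fun x => ?_)
    have := hρ.deriv_neg (y - x)
    rw [neg_sub] at this
    simp only [this, hh]; ring
  rw [e2]
  linarith

/-- The sum of the two dissipation rates: the flux terms see only the difference of the fluxes,
the source terms only the difference of the sources. -/
lemma IsMollifier.doubledRate_add_le (hρ : IsMollifier δ ρ) (hδ : 0 < δ) (hS : IsKernel r S)
    (hf : IsProfile R f) (hg : IsProfile R g) (hfR : IsProfile R' f)
    (hf0 : ∀ x, R ≤ x → source S f x = 0) (hg0 : ∀ x, R ≤ x → source S g x = 0)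
    (hb : LipschitzWith L b) (hb' : LipschitzWith L' b')
    (hD : LipschitzWith Λ (fun v => b v - b' v)) :
    doubledRate S b ρ f g + doubledRate S b' ρ g f ≤ Λ
      + ((∫ z, |deriv S z|) + 2 * R' * ∫ z, |deriv (deriv S) z|) * (∫ x, |f x - g x|)
      + (∫ z, |deriv S z|) * δ := by
  have hρ' := hρ.toIsKernel
  have i1 := hf.integrable_doubledRate hg hρ' hS hb
  -- the rate with exchanged arguments, written in the variables of the other one
  have i2 : Integrable (fun p : ℝ × ℝ => Real.sign (f p.1 - g p.2) *
      (-(b' (f p.1) - b' (g p.2)) * deriv ρ (p.1 - p.2)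
        - ρ (p.1 - p.2) * source S g p.2)) := by
    have := (hg.integrable_doubledRate hf hρ' hS hb').swap
    refine this.congr (.of_forall fun p => ?_)
    have h1 := hρ.even (p.1 - p.2)
    have h2 := hρ.deriv_neg (p.1 - p.2)
    rw [neg_sub] at h1 h2
    have h3 := Real.sign_neg (r := f p.1 - g p.2)
    rw [neg_sub] at h3
    simp only [Function.comp, Prod.fst_swap, Prod.snd_swap, h1, h2, h3]
    ring
  have i3 : Integrable (fun p : ℝ × ℝ => Real.sign (f p.1 - g p.2) *
      (((fun v => b v - b' v) (f p.1) - (fun v => b v - b' v) (g p.2)) * deriv ρ (p.1 - p.2))) := by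
    have hS0 : IsKernel r (fun _ : ℝ => (0 : ℝ)) :=
      ⟨contDiff_const, by simp [tsupport, Function.support]⟩
    have := hf.integrable_doubledRate hg hρ' hS0 hD
    refine this.congr (.of_forall fun p => ?_)
    simp [source, conv]
  have i4 : Integrable (fun p : ℝ × ℝ => Real.sign (f p.1 - g p.2) *
      (ρ (p.1 - p.2) * (source S f p.1 - source S g p.2))) := by
    refine ((i1.add i2).sub i3).congr (.of_forall fun p => ?_)
    simp only [Pi.add_apply, Pi.sub_apply]
    ring
  have hv : Integrable (fun x => source S f x - source S g x) :=
    (hf.integrable_source hS hf0).sub (hg.integrable_source hS hg0)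
  have i5 := hρ.integrable_mul_abs hv
  have i6 := (hg.integrable_doubledDist hg hρ').const_mul ((∫ z, |deriv S z|) / 2)
  -- the two variables differ by at most `δ` on the support of `ρ`: moving the source of `g` from
  -- one to the other costs the variation of `g` over that distance
  have hsrc : ∫ p : ℝ × ℝ, Real.sign (f p.1 - g p.2) *
      (ρ (p.1 - p.2) * (source S f p.1 - source S g p.2))
      ≤ (∫ x, |source S f x - source S g x|) + (∫ z, |deriv S z|) * δ := by
    calc _ ≤ ∫ p : ℝ × ℝ, (ρ (p.1 - p.2) * |source S f p.1 - source S g p.1|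
          + (∫ z, |deriv S z|) / 2 * (|g p.1 - g p.2| * ρ (p.1 - p.2))) := by
          refine integral_mono i4 (i5.add i6) fun p => ?_
          have h1 : |source S g p.1 - source S g p.2|
              ≤ (∫ z, |deriv S z|) / 2 * |g p.1 - g p.2| := by
            rcases le_total p.1 p.2 with h | h
            · rw [abs_sub_comm, abs_sub_comm (g p.1),
                abs_of_nonneg (sub_nonneg.2 (hg.mono h))]
              exact hg.abs_source_sub_le hS h
            · rw [abs_of_nonneg (sub_nonneg.2 (hg.mono h))]
              exact hg.abs_source_sub_le hS h
          have h2 : |source S f p.1 - source S g p.2| ≤ |source S f p.1 - source S g p.1|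
              + (∫ z, |deriv S z|) / 2 * |g p.1 - g p.2| :=
            (abs_sub_le _ (source S g p.1) _).trans (by linarith)
          have h3 := mul_le_mul_of_nonneg_left h2 (hρ.nonneg (p.1 - p.2))
          simp only
          refine (le_abs_self _).trans ?_
          rw [abs_mul, abs_mul, abs_of_nonneg (hρ.nonneg _)]
          refine (mul_le_of_le_one_left (by have := hρ.nonneg (p.1 - p.2); positivity)
            (abs_sign_le _)).trans ?_
          linarith
      _ = (∫ x, |source S f x - source S g x|)
          + (∫ z, |deriv S z|) / 2 * doubledDist ρ g g := by
          rw [integral_add i5 i6, hρ.integral_mul_abs hv, integral_const_mul, doubledDist]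
      _ ≤ _ := by
          have := mul_le_mul_of_nonneg_left (hρ.doubledDist_self_le hδ hg)
            (show 0 ≤ (∫ z, |deriv S z|) / 2 by positivity)
          linarith
  have hsum : doubledRate S b ρ f g + doubledRate S b' ρ g f
      = (∫ p : ℝ × ℝ, Real.sign (f p.1 - g p.2) *
          (((fun v => b v - b' v) (f p.1) - (fun v => b v - b' v) (g p.2))
            * deriv ρ (p.1 - p.2)))
        + ∫ p : ℝ × ℝ, Real.sign (f p.1 - g p.2) *
          (ρ (p.1 - p.2) * (source S f p.1 - source S g p.2)) := by
    rw [hρ.doubledRate_swap S b' f g, doubledRate, ← integral_add i1 i2, ← integral_add i3 i4]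
    refine integral_congr_ae (.of_forall fun p => ?_)
    simp only; ring
  rw [hsum]
  have hfl := hρ.integral_flux_le hδ hf hg hD i3
  have hR' := hfR.radius_pos
  have hf0' : ∀ x, R' ≤ x → source S f x = 0 := fun x hx => by
    rw [hfR.source_eq_right hS hx (le_max_right R R')]
    exact hf0 _ (le_max_left R R')
  have := hfR.integral_abs_source_sub_le hg hS hf0' hg0
  linarith

end TwoProfiles
end OpinionBurgers

namespace OpinionBurgers

/-! ### Distributional inequalities in time -/

lemma exists_mollifier_seq : ∃ ρ : ℕ → ℝ → ℝ, (∀ n : ℕ, IsMollifier (1 / (n + 1 : ℝ)) (ρ n)) ∧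
    ∀ w : ℝ → ℝ, LocallyIntegrable w →
      ∀ᵐ x, Tendsto (fun n => conv (ρ n) w x) atTop (𝓝 (w x)) := by
  have hp : ∀ n : ℕ, 0 < 1 / (n + 1 : ℝ) := fun n => by positivity
  let b : ℕ → ContDiffBump (0 : ℝ) := fun n => ⟨1 / (n + 1 : ℝ) / 2, 1 / (n + 1 : ℝ),
    by linarith [hp n], by linarith [hp n]⟩
  refine ⟨fun n => (b n).normed volume, fun n => ⟨⟨(b n).contDiff_normed, ?_⟩,
    (b n).nonneg_normed, (b n).normed_neg, (b n).integral_normed⟩, fun w hw => ?_⟩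
  · rw [(b n).tsupport_normed_eq, Real.closedBall_eq_Icc]
    simp [b]
  · have := ContDiffBump.ae_convolution_tendsto_right_of_locallyIntegrable (φ := b) (l := atTop)
      (K := 2) tendsto_one_div_add_atTop_nhds_zero_nat
      (.of_forall fun n => by simp only [b]; linarith) hw
    filter_upwards [this] with x hx
    refine hx.congr fun n => ?_
    rw [convolution_eq_swap]
    rfl

lemma IsMollifier.isTimeTest_sub {T δ t : ℝ} {ρ : ℝ → ℝ} (hρ : IsMollifier δ ρ)
    (h0 : δ < t) (hT : t + δ < T) : IsTimeTest T (fun s => ρ (t - s)) := by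
  have hsub : tsupport (fun s => ρ (t - s)) ⊆ Icc (t - δ) (t + δ) :=
    closure_minimal (fun s hs => by
      by_contra h
      exact hs (hρ.toIsKernel.eq_zero fun h' => h ⟨by linarith [h'.2], by linarith [h'.1]⟩))
      isClosed_Icc
  exact ⟨hρ.smooth.comp (contDiff_const.sub contDiff_id),
    isCompact_Icc.of_isClosed_subset (isClosed_tsupport _) hsub,
    fun s hs => ⟨by linarith [(hsub hs).1], by linarith [(hsub hs).2]⟩, fun s => hρ.nonneg _⟩

/-- A smooth approximation of the indicator function of `[s, t]`. -/
lemma IsMollifier.exists_isTimeTest {T δ s t : ℝ} {ρ : ℝ → ℝ} (hρ : IsMollifier δ ρ)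
    (hs : δ < s) (hst : s < t) (ht : t + δ < T) :
    ∃ ψ, IsTimeTest T ψ ∧ ∀ τ, deriv ψ τ = ρ (s - τ) - ρ (t - τ) := by
  have hρ' := hρ.toIsKernel
  set P : ℝ → ℝ := fun x => ∫ u in Iic x, ρ u with hP
  have hPd : ∀ x, HasDerivAt P (ρ x) x := fun x => by
    have h1 := (intervalIntegral.integral_hasDerivAt_right (hρ.integrable.intervalIntegrable
      (a := 0) (b := x)) hρ.continuous.aestronglyMeasurable.stronglyMeasurableAtFilter
      hρ.continuous.continuousAt).add_const (∫ u in Iic 0, ρ u)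
    refine h1.congr_of_eventuallyEq (.of_forall fun y => ?_)
    have := intervalIntegral.integral_Iic_sub_Iic (μ := volume) (f := ρ) (a := 0) (b := y)
      hρ.integrable.integrableOn hρ.integrable.integrableOn
    simp only [hP]; linarith
  have hPm : Monotone P := monotone_of_deriv_nonneg (fun x => (hPd x).differentiableAt)
    fun x => by rw [(hPd x).deriv]; exact hρ.nonneg x
  have hPs : ContDiff ℝ ∞ P := by
    rw [contDiff_infty_iff_deriv]
    refine ⟨fun x => (hPd x).differentiableAt, ?_⟩
    rw [funext fun x => (hPd x).deriv]
    exact hρ.smooth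
  have hP0 : ∀ x, x < -δ → P x = 0 := fun x hx =>
    setIntegral_eq_zero_of_forall_eq_zero fun u hu =>
      hρ'.eq_zero fun h => by linarith [h.1, mem_Iic.1 hu]
  have hP1 : ∀ x, δ ≤ x → P x = 1 := fun x hx => by
    rw [← hρ.mass]
    exact setIntegral_eq_integral_of_forall_compl_eq_zero fun u hu =>
      hρ'.eq_zero fun h => hu (mem_Iic.2 (h.2.trans hx))
  have hsub : tsupport (fun τ => P (τ - s) - P (τ - t)) ⊆ Icc (s - δ) (t + δ) :=
    closure_minimal (fun τ hτ => by
      by_contra h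
      rw [mem_Icc, not_and_or, not_le, not_le] at h
      refine hτ ?_
      rcases h with h | h
      · simp only [hP0 (τ - s) (by linarith), hP0 (τ - t) (by linarith), sub_self]
      · simp only [hP1 (τ - s) (by linarith), hP1 (τ - t) (by linarith), sub_self])
      isClosed_Icc
  refine ⟨fun τ => P (τ - s) - P (τ - t), ⟨?_, ?_, ?_, ?_⟩, fun τ => ?_⟩
  · exact (hPs.comp (contDiff_id.sub contDiff_const)).sub
      (hPs.comp (contDiff_id.sub contDiff_const))
  · exact isCompact_Icc.of_isClosed_subset (isClosed_tsupport _) hsub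
  · exact fun τ hτ => ⟨by linarith [(hsub hτ).1], by linarith [(hsub hτ).2]⟩
  · exact fun τ => sub_nonneg.2 (hPm (by linarith))
  · have hd : HasDerivAt (fun τ => P (τ - s) - P (τ - t)) (ρ (τ - s) - ρ (τ - t)) τ :=
      ((hPd (τ - s)).comp_sub_const τ s).sub ((hPd (τ - t)).comp_sub_const τ t)
    rw [hd.deriv, ← hρ.even (τ - s), ← hρ.even (τ - t), neg_sub, neg_sub]

/-- A function with nonpositive distributional derivative on `(0, T)` is bounded by its limit
superior at `0`. -/
lemma ae_le_of_integral_mul_deriv_nonneg {T w₀ : ℝ} {w : ℝ → ℝ} (hw : LocallyIntegrable w)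
    (h : ∀ ψ, IsTimeTest T ψ → 0 ≤ ∫ s, w s * deriv ψ s)
    (h0 : ∀ ε > 0, ∃ a > 0, ∀ᵐ s, s ∈ Ioo 0 a → w s ≤ w₀ + ε) :
    ∀ᵐ t, t ∈ Ioo 0 T → w t ≤ w₀ := by
  obtain ⟨ρ, hρ, hlim⟩ := exists_mollifier_seq
  have key : ∀ s t, Tendsto (fun n => conv (ρ n) w s) atTop (𝓝 (w s)) →
      Tendsto (fun n => conv (ρ n) w t) atTop (𝓝 (w t)) → 0 < s → s < t → t < T →
      w t ≤ w s := by
    intro s t hs ht h1 h2 h3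
    refine le_of_tendsto_of_tendsto ht hs ?_
    have hsmall : ∀ᶠ n : ℕ in atTop, 1 / (n + 1 : ℝ) < min s (T - t) :=
      tendsto_one_div_add_atTop_nhds_zero_nat.eventually_lt_const
        (lt_min h1 (by linarith))
    filter_upwards [hsmall] with n hn
    obtain ⟨ψ, hψ, hψd⟩ := (hρ n).exists_isTimeTest (T := T) (hn.trans_le (min_le_left _ _)) h2
      (by linarith [hn.trans_le (min_le_right s (T - t))])
    have := h ψ hψ
    have hi : ∀ x, Integrable (fun y => ρ n (x - y) * w y) := fun x => by
      have hsupp : HasCompactSupport (fun y => ρ n (x - y)) :=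
        (hρ n).hasCompactSupport.comp_homeomorph (Homeomorph.subLeft x)
      have := hw.integrable_smul_left_of_hasCompactSupport
        ((hρ n).continuous.comp (continuous_const.sub continuous_id : Continuous (fun y => x - y)))
        hsupp
      simpa [smul_eq_mul] using this
    have e : ∀ y, w y * deriv ψ y = ρ n (s - y) * w y - ρ n (t - y) * w y := fun y => by
      rw [hψd]; ring
    simp only [e] at this
    rw [integral_sub (hi s) (hi t)] at this
    simp only [conv]
    linarith
  filter_upwards [hlim w hw] with t ht htT
  refine le_of_forall_pos_le_add fun ε hε => ?_
  obtain ⟨a, ha, hsub⟩ := h0 ε hε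
  -- some good time lies in every right neighbourhood of zero
  have hpos : volume (Ioo 0 (min a t)) ≠ 0 := by
    rw [Real.volume_Ioo]; simpa using ⟨ha, htT.1⟩
  obtain ⟨s, hs1, hs2, hs3⟩ : ∃ s ∈ Ioo 0 (min a t),
      Tendsto (fun n => conv (ρ n) w s) atTop (𝓝 (w s)) ∧ (s ∈ Ioo 0 a → w s ≤ w₀ + ε) := by
    by_contra hcon
    push Not at hcon
    refine hpos (measure_mono_null (fun s hs => ?_) ((hlim w hw).and hsub))
    simp only [mem_compl_iff, mem_ofPred_eq, not_and]
    intro h1 h2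
    have h3 := hcon s hs h1
    exact absurd (h2 h3.1) (not_le.2 h3.2)
  exact (key s t hs2 ht hs1.1 (hs1.2.trans_le (min_le_right _ _)) htT.2).trans
    (hs3 ⟨hs1.1, hs1.2.trans_le (min_le_left _ _)⟩)

lemma integrable_of_timeTest {T : ℝ} {ψ σ : ℝ → ℝ} {C : ℝ} (hψ : IsTimeTest T ψ)
    (hσ : Measurable σ) (hC : ∀ s, |σ s| ≤ C) : Integrable (fun s => ψ s * σ s) :=
  (hψ.smooth.continuous.integrable_of_hasCompactSupport hψ.compact).mul_bdd (c := C)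
    hσ.aestronglyMeasurable (.of_forall hC)

lemma measurable_locallyIntegrable {w : ℝ → ℝ} {C : ℝ} (hw : Measurable w)
    (hC : ∀ x, |w x| ≤ C) : LocallyIntegrable w :=
  (locallyIntegrable_const C).mono hw.aestronglyMeasurable (.of_forall fun x =>
    (hC x).trans (le_abs_self C))

/-- The weak form of the equation, to the right of the transition region of an entropy solution,
says that its source vanishes there. -/
lemma IsRegularSolution.source_eq_zero {T R r : ℝ} {B F : ℝ → ℝ → ℝ} {S : ℝ → ℝ} {L : NNReal}
    (hF : IsRegularSolution T B S R F) (hB : IsRegularFlux L B) (hS : IsKernel r S) :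
    ∀ᵐ t, t ∈ Ioo 0 T → ∀ x, R ≤ x → source S (F t) x = 0 := by
  -- a bump in space of mass one, supported where the solution takes the value `1 / 2`
  obtain ⟨η₀, hη₀⟩ := exists_isMollifier (δ := 1) one_pos
  set η : ℝ → ℝ := fun x => η₀ (x - (R + 1)) with hη
  have hη0 : ∀ x, x < R → η x = 0 := fun x hx => hη₀.toIsKernel.eq_zero fun h => by
    linarith [h.1]
  have hηd : ∀ x, HasDerivAt η (deriv η₀ (x - (R + 1))) x := fun x =>
    (hη₀.hasDerivAt _).comp_sub_const x _
  have hηd0 : ∀ x, x < R → deriv η₀ (x - (R + 1)) = 0 := fun x hx =>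
    hη₀.toIsKernel.deriv.eq_zero fun h => by linarith [h.1]
  have hηi : Integrable η := hη₀.integrable.comp_sub_right _
  have hηm : ∫ x, η x = 1 := by rw [← hη₀.mass]; exact integral_sub_right_eq_self η₀ (R + 1)
  have hηdi : Integrable (fun x => deriv η₀ (x - (R + 1))) :=
    hη₀.toIsKernel.deriv.integrable.comp_sub_right _
  have hηdm : ∫ x, deriv η₀ (x - (R + 1)) = 0 := by
    rw [← hη₀.toIsKernel.integral_deriv]
    exact integral_sub_right_eq_self (deriv η₀) (R + 1)
  have hηsub : tsupport η ⊆ Icc R (R + 2) :=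
    closure_minimal (fun x hx => by
      by_contra h
      exact hx (hη₀.toIsKernel.eq_zero fun h' => h ⟨by linarith [h'.1], by linarith [h'.2]⟩))
      isClosed_Icc
  set σ : ℝ → ℝ := fun s => source S (F s) R with hσ
  have hσm : Measurable σ :=
    (measurable_source hS hF.meas).comp (f := fun s : ℝ => (s, R)) (by fun_prop)
  have hσb : ∀ s, |σ s| ≤ (∫ z, |deriv S z|) / 2 := fun s => (hF.profile s).abs_source_le hS R
  -- tested with `ψ(t) η(x)`, the terms with derivatives vanish and only the source term remains
  have htest : ∀ ψ, IsTimeTest T ψ → ∀ α, α ≠ 1 / 2 →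
      0 ≤ Real.sign (1 / 2 - α) * ∫ s, ψ s * σ s := by
    intro ψ hψ α hα
    have hsub : tsupport (fun z : ℝ × ℝ => ψ z.1 * η z.2) ⊆ tsupport ψ ×ˢ Icc R (R + 2) := by
      refine closure_minimal (fun z hz => ⟨?_, hηsub ?_⟩) ((isClosed_tsupport ψ).prod isClosed_Icc)
      · exact subset_tsupport ψ fun h => hz (by simp only [h, zero_mul])
      · exact subset_tsupport η fun h => hz (by simp only [h, mul_zero])
    have key := hF.entropy (fun z => ψ z.1 * η z.2)
      ((hψ.smooth.comp contDiff_fst).mul (hη₀.smooth.comp (contDiff_snd.sub contDiff_const)))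
      ((hψ.compact.isCompact.prod isCompact_Icc).of_isClosed_subset (isClosed_tsupport _) hsub)
      (fun z hz => ⟨hψ.supp (hsub hz).1, trivial⟩)
      (fun z => mul_nonneg (hψ.nonneg _) (hη₀.nonneg _)) α
    have e : ∀ z : ℝ × ℝ, entropyIntegrand S B F (fun z => ψ z.1 * η z.2) α z
        = (|1 / 2 - α| * deriv ψ z.1) * η z.2
          + (Real.sign (1 / 2 - α) * (B z.1 (1 / 2) - B z.1 α) * ψ z.1)
              * deriv η₀ (z.2 - (R + 1))
          + (Real.sign (1 / 2 - α) * (ψ z.1 * σ z.1)) * η z.2 := by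
      intro z
      have hd := (hasFDerivAt_mul_prod (z := z) (hψ.hasDerivAt z.1) (hηd z.2)).fderiv
      simp only [entropyIntegrand, hd]
      rcases lt_or_ge z.2 R with hz | hz
      · simp [hη0 _ hz, hηd0 _ hz]
      · rw [(hF.profile z.1).eq_right hz, (hF.profile z.1).source_eq_right hS hz le_rfl]
        simp
        ring
    have i1 : Integrable (fun s => |1 / 2 - α| * deriv ψ s) :=
      (hψ.continuous_deriv.integrable_of_hasCompactSupport hψ.compact.deriv).const_mul _
    have i2 : Integrable (fun s => Real.sign (1 / 2 - α) * (B s (1 / 2) - B s α) * ψ s) := by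
      have hc : Continuous (fun s => Real.sign (1 / 2 - α) * (B s (1 / 2) - B s α) * ψ s) := by
        have c1 : Continuous (fun s => B s (1 / 2)) :=
          hB.cont.comp (f := fun s : ℝ => (s, (1 / 2 : ℝ))) (by fun_prop)
        have c2 : Continuous (fun s => B s α) :=
          hB.cont.comp (f := fun s : ℝ => (s, α)) (by fun_prop)
        have c3 := hψ.smooth.continuous
        fun_prop
      exact hc.integrable_of_hasCompactSupport hψ.compact.mul_left
    have i3 : Integrable (fun s => Real.sign (1 / 2 - α) * (ψ s * σ s)) :=
      (integrable_of_timeTest hψ hσm hσb).const_mul _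
    simp only [e] at key
    have j1 := i1.mul_prod hηi
    have j2 := i2.mul_prod hηdi
    have j3 := i3.mul_prod hηi
    rw [Measure.volume_eq_prod] at key
    have j12 : Integrable (fun z : ℝ × ℝ => (|1 / 2 - α| * deriv ψ z.1) * η z.2
          + (Real.sign (1 / 2 - α) * (B z.1 (1 / 2) - B z.1 α) * ψ z.1)
              * deriv η₀ (z.2 - (R + 1))) (volume.prod volume) := j1.add j2
    rw [integral_add j12 j3, integral_add j1 j2,
      integral_prod_mul (fun s => |1 / 2 - α| * deriv ψ s), integral_prod_mul
      (fun s => Real.sign (1 / 2 - α) * (B s (1 / 2) - B s α) * ψ s)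
      (fun x => deriv η₀ (x - (R + 1))), integral_prod_mul
      (fun s => Real.sign (1 / 2 - α) * (ψ s * σ s)), integral_const_mul, hηm, hηdm,
      integral_eq_zero_of_hasDerivAt_of_integrable hψ.hasDerivAt
      (hψ.continuous_deriv.integrable_of_hasCompactSupport hψ.compact.deriv)
      (hψ.smooth.continuous.integrable_of_hasCompactSupport hψ.compact), integral_const_mul] at key
    linarith
  -- the constants `0 < 1 / 2` and `1 > 1 / 2` give opposite signs
  have hzero : ∀ ψ, IsTimeTest T ψ → ∫ s, ψ s * σ s = 0 := fun ψ hψ => by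
    have h1 := htest ψ hψ 0 (by norm_num)
    have h2 := htest ψ hψ 1 (by norm_num)
    rw [Real.sign_of_pos (by norm_num)] at h1
    rw [Real.sign_of_neg (by norm_num)] at h2
    linarith
  -- mollifiers centred at a Lebesgue point are admissible tests
  obtain ⟨ρ, hρ, hlim⟩ := exists_mollifier_seq
  filter_upwards [hlim σ (measurable_locallyIntegrable hσm hσb)] with t ht htT x hx
  rw [(hF.profile t).source_eq_right hS hx le_rfl]
  refine tendsto_nhds_unique ht (tendsto_const_nhds.congr' ?_)
  have hsmall : ∀ᶠ n : ℕ in atTop, 1 / (n + 1 : ℝ) < min t (T - t) :=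
    tendsto_one_div_add_atTop_nhds_zero_nat.eventually_lt_const
      (lt_min htT.1 (by linarith [htT.2]))
  filter_upwards [hsmall] with n hn
  exact (hzero _ ((hρ n).isTimeTest_sub (hn.trans_le (min_le_left _ _))
    (by linarith [hn.trans_le (min_le_right t (T - t))]))).symm

end OpinionBurgers

namespace OpinionBurgers

/-! ### Doubling of the time variable -/

lemma abs_integral_le_of_bounded_of_support {α : Type*} [MeasurableSpace α] {μ : Measure α}
    {f : α → ℝ} {K : Set α} {C : ℝ} (hμ : μ K < ⊤) (hC : ∀ x, |f x| ≤ C)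
    (h0 : ∀ x, x ∉ K → f x = 0) : |∫ x, f x ∂μ| ≤ C * μ.real K := by
  rw [← setIntegral_eq_integral_of_forall_compl_eq_zero h0, ← Real.norm_eq_abs]
  exact norm_setIntegral_le_of_norm_le_const hμ fun x _ => hC x

/-- The constant in the `L¹` estimate of the source. -/
noncomputable def sourceConst (S : ℝ → ℝ) (R : ℝ) : ℝ :=
  (∫ z, |deriv S z|) + 2 * R * ∫ z, |deriv (deriv S) z|

lemma sourceConst_nonneg {S : ℝ → ℝ} {R : ℝ} (hR : 0 < R) : 0 ≤ sourceConst S R := by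
  unfold sourceConst; positivity

section Bounds

variable {R r δ : ℝ} {L : NNReal} {S f g b ρ : ℝ → ℝ}

lemma IsProfile.integral_abs_sub_le_diam (hf : IsProfile R f) (hg : IsProfile R g) :
    ∫ x, |f x - g x| ≤ 2 * R := by
  have hR := hf.radius_pos
  have h := abs_integral_le_of_bounded_of_support (μ := volume) (f := fun x => |f x - g x|)
    (K := Icc (-R) R) (C := 1) (by simp) (fun x => by
      rw [abs_abs]
      have := abs_sub (f x) (g x)
      linarith [hf.abs_le_half x, hg.abs_le_half x])
    (fun x hx => by rw [hf.sub_eq_zero_of_notMem hg hx, abs_zero])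
  rw [measureReal_def, Real.volume_Icc, ENNReal.toReal_ofReal (by linarith)] at h
  linarith [le_abs_self (∫ x, |f x - g x|)]

lemma exists_abs_doubledRate_le (hρ : IsKernel δ ρ) (hS : IsKernel r S) (R : ℝ) (L : NNReal) :
    ∃ C, ∀ f g b : ℝ → ℝ, IsProfile R f → IsProfile R g → LipschitzWith L b →
      |doubledRate S b ρ f g| ≤ C := by
  refine ⟨_, fun f g b hf hg hb => abs_integral_le_of_bounded_of_support
    (K := Icc (-(R + δ)) (R + δ) ×ˢ Icc (-(R + δ)) (R + δ))
    (C := 1 * (L * supNorm (deriv ρ) + supNorm ρ * ((∫ z, |deriv S z|) / 2)))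
    (isCompact_Icc.prod isCompact_Icc).measure_lt_top ?_ ?_⟩
  · intro p
    rw [abs_mul]
    refine mul_le_mul (abs_sign_le _) ((abs_add_le _ _).trans ?_) (abs_nonneg _) zero_le_one
    rw [abs_mul, abs_mul]
    refine add_le_add (mul_le_mul ?_ (hρ.deriv.abs_le_supNorm _) (abs_nonneg _) L.2)
      (mul_le_mul (hρ.abs_le_supNorm _) (hf.abs_source_le hS _) (abs_nonneg _)
        hρ.supNorm_nonneg)
    refine (hb.dist_le_mul _ _).trans ?_
    rw [Real.dist_eq]
    have := abs_sub (f p.1) (g p.2)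
    exact mul_le_of_le_one_right L.2 (by linarith [hf.abs_le_half p.1, hg.abs_le_half p.2])
  · intro p hp
    by_cases h : p.1 - p.2 ∈ Icc (-δ) δ
    · rw [hf.eq_of_far hg h hp, sub_self, Real.sign_zero, zero_mul]
    · rw [hρ.eq_zero h, hρ.deriv.eq_zero h]
      simp

end Bounds

section Doubling

variable {T R R' r δ h : ℝ} {L L' : NNReal} {B B' F G : ℝ → ℝ → ℝ} {S ρ κ θ : ℝ → ℝ}

lemma measurable_doubledDist (hρ : Continuous ρ) (hF : Measurable (Function.uncurry F))
    (hG : Measurable (Function.uncurry G)) :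
    Measurable (fun q : ℝ × ℝ => doubledDist ρ (F q.1) (G q.2)) := by
  have h1 : Measurable (fun w : (ℝ × ℝ) × (ℝ × ℝ) => F w.1.1 w.2.1) :=
    hF.comp (f := fun w : (ℝ × ℝ) × (ℝ × ℝ) => (w.1.1, w.2.1)) (by fun_prop)
  have h2 : Measurable (fun w : (ℝ × ℝ) × (ℝ × ℝ) => G w.1.2 w.2.2) :=
    hG.comp (f := fun w : (ℝ × ℝ) × (ℝ × ℝ) => (w.1.2, w.2.2)) (by fun_prop)
  have h3 : Measurable (fun w : (ℝ × ℝ) × (ℝ × ℝ) => ρ (w.2.1 - w.2.2)) :=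
    hρ.measurable.comp (by fun_prop)
  exact ((h1.sub h2).abs.mul h3).stronglyMeasurable.integral_prod_right'.measurable

lemma measurable_doubledRate (hρ : IsKernel δ ρ) (hS : IsKernel r S) (hB : IsRegularFlux L B)
    (hF : Measurable (Function.uncurry F)) (hG : Measurable (Function.uncurry G)) :
    Measurable (fun q : ℝ × ℝ => doubledRate S (B q.1) ρ (F q.1) (G q.2)) := by
  have h1 : Measurable (fun w : (ℝ × ℝ) × (ℝ × ℝ) => F w.1.1 w.2.1) :=
    hF.comp (f := fun w : (ℝ × ℝ) × (ℝ × ℝ) => (w.1.1, w.2.1)) (by fun_prop)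
  have h2 : Measurable (fun w : (ℝ × ℝ) × (ℝ × ℝ) => G w.1.2 w.2.2) :=
    hG.comp (f := fun w : (ℝ × ℝ) × (ℝ × ℝ) => (w.1.2, w.2.2)) (by fun_prop)
  have hd : Measurable (fun w : (ℝ × ℝ) × (ℝ × ℝ) => w.2.1 - w.2.2) := by fun_prop
  have h4 : Measurable (fun w : (ℝ × ℝ) × (ℝ × ℝ) => B w.1.1 (F w.1.1 w.2.1)) :=
    hB.cont.measurable.comp (f := fun w : (ℝ × ℝ) × (ℝ × ℝ) => (w.1.1, F w.1.1 w.2.1))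
      (Measurable.prodMk (by fun_prop) h1)
  have h5 : Measurable (fun w : (ℝ × ℝ) × (ℝ × ℝ) => B w.1.1 (G w.1.2 w.2.2)) :=
    hB.cont.measurable.comp (f := fun w : (ℝ × ℝ) × (ℝ × ℝ) => (w.1.1, G w.1.2 w.2.2))
      (Measurable.prodMk (by fun_prop) h2)
  have h6 : Measurable (fun w : (ℝ × ℝ) × (ℝ × ℝ) => source S (F w.1.1) w.2.1) :=
    (measurable_source hS hF).comp
      (f := fun w : (ℝ × ℝ) × (ℝ × ℝ) => (w.1.1, w.2.1)) (by fun_prop)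
  exact ((measurable_sign.comp (h1.sub h2)).mul
    (((h4.sub h5).mul (hρ.deriv.continuous.measurable.comp hd)).add
      ((hρ.continuous.measurable.comp hd).mul
        h6))).stronglyMeasurable.integral_prod_right'.measurable

/-- The `L¹` distance of two solutions at different times. -/
lemma measurable_dist (hF : Measurable (Function.uncurry F))
    (hG : Measurable (Function.uncurry G)) :
    Measurable (fun q : ℝ × ℝ => ∫ x, |F q.1 x - G q.2 x|) := by
  have h1 : Measurable (fun w : (ℝ × ℝ) × ℝ => F w.1.1 w.2) :=
    hF.comp (f := fun w : (ℝ × ℝ) × ℝ => (w.1.1, w.2)) (by fun_prop)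
  have h2 : Measurable (fun w : (ℝ × ℝ) × ℝ => G w.1.2 w.2) :=
    hG.comp (f := fun w : (ℝ × ℝ) × ℝ => (w.1.2, w.2)) (by fun_prop)
  exact (h1.sub h2).abs.stronglyMeasurable.integral_prod_right'.measurable

/-- Kruzhkov's doubling of variables, after the space variables have been identified. -/
lemma IsRegularSolution.integral_time_doubled_nonneg
    (hF : IsRegularSolution T B S R F) (hG : IsRegularSolution T B' S R G)
    (hFR : ∀ t, IsProfile R' (F t)) (hB : IsRegularFlux L B) (hB' : IsRegularFlux L' B')
    (hS : IsKernel r S) (hκ : IsMollifier h κ) (hθ : IsTimeTest T θ)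
    (hh : ∀ t ∈ tsupport θ, Icc (t - h) (t + h) ⊆ Ioo 0 T) {Λ : NNReal}
    (hΛ : ∀ s ∈ Ioo 0 T, ∀ t ∈ Ioo 0 T, |s - t| ≤ h →
      LipschitzWith Λ (fun v => B s v - B' t v)) :
    0 ≤ ∫ q : ℝ × ℝ, ((∫ x, |F q.1 x - G q.2 x|) * deriv θ q.2
      + (Λ + sourceConst S R' * ∫ x, |F q.1 x - G q.2 x|) * θ q.2) * κ (q.1 - q.2) := by
  have hR := (hF.profile 0).radius_pos
  have hR' := (hFR 0).radius_pos
  have hC0 := sourceConst_nonneg (S := S) hR'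
  set C := sourceConst S R' with hC
  set K := ∫ z, |deriv S z| with hK
  set u : ℝ × ℝ → ℝ := fun q => ∫ x, |F q.1 x - G q.2 x| with hu
  have hκ' := hκ.toIsKernel
  have hh0 : 0 ≤ h := by
    by_contra hneg
    have hκ0 : ∀ x, κ x = 0 := fun x => hκ'.eq_zero fun h' => by linarith [h'.1, h'.2]
    have := hκ.mass
    simp [hκ0] at this
  have hu0 : ∀ q, 0 ≤ u q := fun q => integral_nonneg fun _ => abs_nonneg _
  have huR : ∀ q, u q ≤ 2 * R := fun q =>
    (hF.profile q.1).integral_abs_sub_le_diam (hG.profile q.2)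
  have hum : Measurable u := measurable_dist hF.meas hG.meas
  obtain ⟨C₁, hC₁⟩ := hθ.compact.exists_bound_of_continuous hθ.smooth.continuous
  obtain ⟨C₂, hC₂⟩ := hθ.compact.deriv.exists_bound_of_continuous hθ.continuous_deriv
  have hC₁0 : 0 ≤ C₁ := (norm_nonneg _).trans (hC₁ 0)
  have hC₂0 : 0 ≤ C₂ := (norm_nonneg _).trans (hC₂ 0)
  have hθ0 : ∀ t, t ∉ tsupport θ → θ t = 0 := fun t ht => image_eq_zero_of_notMem_tsupport ht
  have hθd0 : ∀ t, t ∉ tsupport θ → deriv θ t = 0 := fun t ht =>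
    image_eq_zero_of_notMem_tsupport fun h => ht (tsupport_deriv_subset h)
  -- all the integrands below live on the compact set `W`
  set W : Set (ℝ × ℝ) := (fun p : ℝ × ℝ => (p.1 + p.2, p.2)) '' (Icc (-h) h ×ˢ tsupport θ)
  have hW : volume W < ⊤ :=
    ((isCompact_Icc.prod hθ.compact.isCompact).image (by fun_prop)).measure_lt_top
  have hWmem : ∀ q : ℝ × ℝ, q ∉ W → q.2 ∈ tsupport θ → q.1 - q.2 ∉ Icc (-h) h :=
    fun q hq h1 h2 => hq ⟨(q.1 - q.2, q.2), ⟨h2, h1⟩, by simp⟩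
  have hm1 : Measurable (fun q : ℝ × ℝ => θ q.2) :=
    hθ.smooth.continuous.measurable.comp measurable_snd
  have hm2 : Measurable (fun q : ℝ × ℝ => deriv θ q.2) :=
    hθ.continuous_deriv.measurable.comp measurable_snd
  have hm3 : Measurable (fun q : ℝ × ℝ => κ (q.1 - q.2)) :=
    hκ.continuous.measurable.comp (by fun_prop)
  have hm4 : Measurable (fun q : ℝ × ℝ => deriv κ (q.1 - q.2)) :=
    hκ'.deriv.continuous.measurable.comp (by fun_prop)
  have hint : ∀ a : ℝ × ℝ → ℝ, Measurable a → ∀ M, (∀ q, |a q| ≤ M) →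
      Integrable (fun q => a q * θ q.2 * κ (q.1 - q.2)) ∧
      Integrable (fun q => a q * deriv θ q.2 * κ (q.1 - q.2)) ∧
      Integrable (fun q => a q * θ q.2 * deriv κ (q.1 - q.2)) := by
    intro a ha M hM
    have hM0 : 0 ≤ M := (abs_nonneg _).trans (hM 0)
    refine ⟨integrable_of_bounded_of_support (C := M * C₁ * supNorm κ) hW
      ((ha.mul hm1).mul hm3).aestronglyMeasurable ?_ ?_,
      integrable_of_bounded_of_support (C := M * C₂ * supNorm κ) hW
      ((ha.mul hm2).mul hm3).aestronglyMeasurable ?_ ?_,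
      integrable_of_bounded_of_support (C := M * C₁ * supNorm (deriv κ)) hW
      ((ha.mul hm1).mul hm4).aestronglyMeasurable ?_ ?_⟩
    · intro q
      rw [abs_mul, abs_mul]
      exact mul_le_mul (mul_le_mul (hM q) (hC₁ _) (abs_nonneg _) hM0)
        (hκ'.abs_le_supNorm _) (abs_nonneg _) (by positivity)
    · intro q hq
      by_cases h1 : q.2 ∈ tsupport θ
      · rw [hκ'.eq_zero (hWmem q hq h1), mul_zero]
      · rw [hθ0 _ h1, mul_zero, zero_mul]
    · intro q
      rw [abs_mul, abs_mul]
      exact mul_le_mul (mul_le_mul (hM q) (hC₂ _) (abs_nonneg _) hM0)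
        (hκ'.abs_le_supNorm _) (abs_nonneg _) (by positivity)
    · intro q hq
      by_cases h1 : q.2 ∈ tsupport θ
      · rw [hκ'.eq_zero (hWmem q hq h1), mul_zero]
      · rw [hθd0 _ h1, mul_zero, zero_mul]
    · intro q
      rw [abs_mul, abs_mul]
      exact mul_le_mul (mul_le_mul (hM q) (hC₁ _) (abs_nonneg _) hM0)
        (hκ'.deriv.abs_le_supNorm _) (abs_nonneg _) (by positivity)
    · intro q hq
      by_cases h1 : q.2 ∈ tsupport θ
      · rw [hκ'.deriv.eq_zero (hWmem q hq h1), mul_zero]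
      · rw [hθ0 _ h1, mul_zero, zero_mul]
  have hubd : ∀ q, |u q| ≤ 2 * R := fun q => by rw [abs_of_nonneg (hu0 q)]; exact huR q
  have hΛCm : Measurable (fun q => (Λ : ℝ) + C * u q) := (hum.const_mul C).const_add _
  have hΛCb : ∀ q, |(Λ : ℝ) + C * u q| ≤ Λ + C * (2 * R) := fun q => by
    rw [abs_of_nonneg (add_nonneg Λ.coe_nonneg (mul_nonneg hC0 (hu0 q)))]
    linarith [mul_le_mul_of_nonneg_left (huR q) hC0]
  have iu := (hint u hum _ hubd).2.1
  have iC := (hint _ hΛCm _ hΛCb).1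
  have hsrcF := hF.source_eq_zero hB hS
  have hsrcG := hG.source_eq_zero hB' hS
  -- the inequality up to an error proportional to the width of the space mollifier
  set E₀ : ℝ × ℝ → ℝ := fun q => 2 * |deriv θ q.2| * κ (q.1 - q.2) + K * θ q.2 * κ (q.1 - q.2)
    with hE₀
  have iE₀ : Integrable E₀ := by
    have a1 := ((hint (fun _ => 2) measurable_const 2 (by simp)).2.1).abs
    have a2 := (hint (fun _ => K) measurable_const |K| (fun _ => le_rfl)).1
    refine (a1.add a2).congr (.of_forall fun q => ?_)
    simp only [Pi.add_apply, hE₀, abs_mul, abs_of_nonneg (hκ.nonneg _), abs_two]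
  have key : ∀ δ > 0, 0 ≤ (∫ q : ℝ × ℝ, (u q * deriv θ q.2
      + (Λ + C * u q) * θ q.2) * κ (q.1 - q.2)) + δ * ∫ q, E₀ q := by
    intro δ hδ
    obtain ⟨ρ, hρ⟩ := exists_isMollifier hδ
    have hρ' := hρ.toIsKernel
    set Φ : ℝ × ℝ → ℝ := fun q => doubledDist ρ (F q.1) (G q.2) with hΦ
    set P : ℝ × ℝ → ℝ := fun q => doubledRate S (B q.1) ρ (F q.1) (G q.2) with hP
    set Q : ℝ × ℝ → ℝ := fun q => doubledRate S (B' q.2) ρ (G q.2) (F q.1) with hQ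
    have hΦu : ∀ q, |Φ q - u q| ≤ 2 * δ := fun q =>
      hρ.abs_doubledDist_sub_le hδ (hF.profile q.1) (hG.profile q.2)
    have hΦm : Measurable Φ := measurable_doubledDist hρ.continuous hF.meas hG.meas
    have hPm : Measurable P := measurable_doubledRate hρ' hS hB hF.meas hG.meas
    have hQm : Measurable Q :=
      (measurable_doubledRate hρ' hS hB' hG.meas hF.meas).comp measurable_swap
    obtain ⟨CP, hCP⟩ := exists_abs_doubledRate_le hρ' hS R L
    obtain ⟨CQ, hCQ⟩ := exists_abs_doubledRate_le hρ' hS R L'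
    have hΦb : ∀ q, |Φ q| ≤ 2 * δ + 2 * R := fun q => by
      have := abs_add_le (Φ q - u q) (u q)
      rw [sub_add_cancel] at this
      linarith [hΦu q, hubd q]
    have iΦ := hint Φ hΦm _ hΦb
    have iP := (hint P hPm CP fun q => hCP _ _ _ (hF.profile _) (hG.profile _) (hB.lip _)).1
    have iQ := (hint Q hQm CQ fun q => hCQ _ _ _ (hG.profile _) (hF.profile _) (hB'.lip _)).1
    have hi1 : Integrable (fun q : ℝ × ℝ => Φ q * θ q.2 * deriv κ (q.1 - q.2)
        + P q * θ q.2 * κ (q.1 - q.2)) := iΦ.2.2.add iP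
    have hi2 : Integrable (fun q : ℝ × ℝ => Φ q * deriv θ q.2 * κ (q.1 - q.2)
        - Φ q * θ q.2 * deriv κ (q.1 - q.2) + Q q * θ q.2 * κ (q.1 - q.2)) :=
      (iΦ.2.1.sub iΦ.2.2).add iQ
    -- the inequality of `F` in its own time `s`, with the time `t` of `G` as a parameter
    have h1 : 0 ≤ ∫ q : ℝ × ℝ, (Φ q * θ q.2 * deriv κ (q.1 - q.2)
        + P q * θ q.2 * κ (q.1 - q.2)) := by
      have hi := hi1
      rw [Measure.volume_eq_prod] at hi ⊢
      rw [integral_prod_symm _ hi]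
      refine integral_nonneg fun t => ?_
      by_cases ht : t ∈ tsupport θ
      · have htest : IsTimeTest T (fun s => κ (t - s)) := hκ.isTimeTest_sub
          (by
            linarith [(hh t ht ⟨le_rfl, by linarith⟩).1])
          (by
            exact (hh t ht ⟨by linarith, le_rfl⟩).2)
        have := hF.integral_doubled_nonneg hB hS (hG.profile t) hρ htest
        have hd : ∀ s, deriv (fun s => κ (t - s)) s = deriv κ (s - t) := fun s => by
          have h1 : HasDerivAt (fun s => κ (t - s)) (-deriv κ (t - s)) s :=
            (hκ.hasDerivAt (t - s)).comp_const_sub t s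
          have h2 := hκ.deriv_neg (s - t)
          rw [neg_sub] at h2
          rw [h1.deriv, h2, neg_neg]
        have h3 := mul_nonneg (hθ.nonneg t) this
        rw [← integral_const_mul] at h3
        refine h3.trans_eq (integral_congr_ae (.of_forall fun s => ?_))
        have h4 := hκ.even (s - t)
        rw [neg_sub] at h4
        simp only [hd, hΦ, hP, h4]
        ring
      · simp [hθ0 t ht]
    -- the inequality of `G` in its own time `t`, with the time `s` of `F` as a parameter
    have h2 : 0 ≤ ∫ q : ℝ × ℝ, (Φ q * deriv θ q.2 * κ (q.1 - q.2)
        - Φ q * θ q.2 * deriv κ (q.1 - q.2) + Q q * θ q.2 * κ (q.1 - q.2)) := by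
      have hi := hi2
      rw [Measure.volume_eq_prod] at hi ⊢
      rw [integral_prod _ hi]
      refine integral_nonneg fun s => ?_
      have hsub : tsupport (fun t => θ t * κ (s - t)) ⊆ tsupport θ :=
        closure_mono fun t ht h' => ht (by simp only [h', zero_mul])
      have htest : IsTimeTest T (fun t => θ t * κ (s - t)) :=
        ⟨hθ.smooth.mul (hκ.smooth.comp (contDiff_const.sub contDiff_id)), hθ.compact.mul_right,
          hsub.trans hθ.supp, fun t => mul_nonneg (hθ.nonneg t) (hκ.nonneg _)⟩
      have := hG.integral_doubled_nonneg hB' hS (hF.profile s) hρ htest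
      refine this.trans_eq (integral_congr_ae (.of_forall fun t => ?_))
      have hd : HasDerivAt (fun t => θ t * κ (s - t))
          (deriv θ t * κ (s - t) + θ t * -deriv κ (s - t)) t :=
        (hθ.hasDerivAt t).mul ((hκ.hasDerivAt (s - t)).comp_const_sub s t)
      simp only [hd.deriv, hΦ, hQ, hρ.doubledDist_comm (F s) (G t)]
      ring
    -- in the sum the derivatives of the time mollifier cancel
    have h3 : 0 ≤ ∫ q : ℝ × ℝ, (Φ q * deriv θ q.2 * κ (q.1 - q.2)
        + (P q * θ q.2 * κ (q.1 - q.2) + Q q * θ q.2 * κ (q.1 - q.2))) := by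
      have := add_nonneg h1 h2
      rw [← integral_add hi1 hi2] at this
      refine this.trans_eq (integral_congr_ae (.of_forall fun q => ?_))
      simp only; ring
    have iR : Integrable (fun q : ℝ × ℝ => (u q * deriv θ q.2
        + (Λ + C * u q) * θ q.2) * κ (q.1 - q.2)) := by
      refine (iu.add iC).congr (.of_forall fun q => ?_)
      simp only [Pi.add_apply]; ring
    rw [← integral_const_mul, ← integral_add iR (iE₀.const_mul δ)]
    refine h3.trans (integral_mono_ae (iΦ.2.1.add (iP.add iQ)) (iR.add (iE₀.const_mul δ)) ?_)
    have e1 : ∀ᵐ q : ℝ × ℝ, q.1 ∈ Ioo 0 T → ∀ x, R ≤ x → source S (F q.1) x = 0 := by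
      rw [Measure.volume_eq_prod]
      exact Measure.quasiMeasurePreserving_fst.ae hsrcF
    have e2 : ∀ᵐ q : ℝ × ℝ, q.2 ∈ Ioo 0 T → ∀ x, R ≤ x → source S (G q.2) x = 0 := by
      rw [Measure.volume_eq_prod]
      exact Measure.quasiMeasurePreserving_snd.ae hsrcG
    filter_upwards [e1, e2] with q q1 q2
    simp only [hE₀]
    by_cases ht : q.2 ∈ tsupport θ
    · by_cases hst : q.1 - q.2 ∈ Icc (-h) h
      · have hq2 := hθ.supp ht
        have hq1 : q.1 ∈ Ioo 0 T := hh _ ht ⟨by linarith [hst.1], by linarith [hst.2]⟩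
        have hPQ : P q + Q q ≤ Λ + C * u q + K * δ :=
          hρ.doubledRate_add_le hδ hS (hF.profile q.1) (hG.profile q.2) (hFR q.1) (q1 hq1)
            (q2 hq2) (hB.lip _) (hB'.lip _) (hΛ _ hq1 _ hq2 (abs_le.2 hst))
        have hw := hκ.nonneg (q.1 - q.2)
        have a1 : Φ q * deriv θ q.2 ≤ u q * deriv θ q.2 + 2 * δ * |deriv θ q.2| := by
          have := mul_le_mul_of_nonneg_right (hΦu q) (abs_nonneg (deriv θ q.2))
          rw [← abs_mul] at this
          linarith [le_abs_self ((Φ q - u q) * deriv θ q.2)]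
        have a2 := mul_le_mul_of_nonneg_right hPQ (hθ.nonneg q.2)
        have a3 := mul_le_mul_of_nonneg_right (add_le_add a1 a2) hw
        linarith
      · simp [hκ'.eq_zero hst]
    · simp [hθ0 _ ht, hθd0 _ ht]
  have hlim : Tendsto (fun δ : ℝ => (∫ q : ℝ × ℝ, (u q * deriv θ q.2
      + (Λ + C * u q) * θ q.2) * κ (q.1 - q.2)) + δ * ∫ q, E₀ q) (𝓝[>] 0)
      (𝓝 ((∫ q : ℝ × ℝ, (u q * deriv θ q.2
      + (Λ + C * u q) * θ q.2) * κ (q.1 - q.2)) + 0 * ∫ q, E₀ q)) :=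
    ((tendsto_id.mul_const _).const_add _).mono_left nhdsWithin_le_nhds
  rw [zero_mul, add_zero] at hlim
  exact ge_of_tendsto hlim (eventually_mem_nhdsWithin.mono fun δ hδ => key δ hδ)

end Doubling
end OpinionBurgers

namespace OpinionBurgers

/-! ### Continuity of translations and the stability inequality -/

lemma tendsto_integral_abs_translate_sub {f : ℝ × ℝ → ℝ} (hf : Integrable f) :
    Tendsto (fun τ : ℝ => ∫ z : ℝ × ℝ, |f (z.1 + τ, z.2) - f z|) (𝓝 0) (𝓝 0) := by
  have htr : ∀ τ : ℝ, ∀ z : ℝ × ℝ, (z.1 + τ, z.2) = z + (τ, 0) := fun τ z => by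
    ext <;> simp
  simp only [htr]
  rw [Metric.tendsto_nhds]
  intro ε hε
  -- approximate by a continuous function with compact support
  obtain ⟨g, hgc, hgε, hgcont, hgi⟩ :=
    hf.exists_hasCompactSupport_integral_sub_le (ε := ε / 4) (by positivity)
  obtain ⟨C, hC⟩ := hgc.exists_bound_of_continuous hgcont
  set K := Metric.cthickening 1 (tsupport g) with hK
  have hKc : IsCompact K := hgc.isCompact.cthickening
  have hg0 : Tendsto (fun τ : ℝ => ∫ z : ℝ × ℝ, |g (z + (τ, 0)) - g z|) (𝓝 0) (𝓝 0) := by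
    have hb : Integrable (K.indicator fun _ : ℝ × ℝ => 2 * C) :=
      (integrable_indicator_iff hKc.measurableSet).2
        (integrableOn_const hKc.measure_lt_top.ne)
    have := tendsto_integral_filter_of_dominated_convergence (l := 𝓝 (0 : ℝ))
      (F := fun τ z => |g (z + (τ, 0)) - g z|) (f := fun _ : ℝ × ℝ => (0 : ℝ)) _
      (.of_forall fun τ => ?_) ?_ hb (.of_forall fun z => ?_)
    · simpa using this
    · exact (by fun_prop : Continuous fun z : ℝ × ℝ => |g (z + (τ, 0)) - g z|).aestronglyMeasurable
    · filter_upwards [Metric.ball_mem_nhds (0 : ℝ) one_pos] with τ hτ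
      refine .of_forall fun z => ?_
      rw [Real.norm_eq_abs, abs_abs]
      by_cases hz : z ∈ K
      · rw [indicator_of_mem hz]
        have := abs_sub (g (z + (τ, 0))) (g z)
        have h1 := hC (z + (τ, 0))
        have h2 := hC z
        rw [Real.norm_eq_abs] at h1 h2
        linarith
      · rw [indicator_of_notMem hz]
        have h1 : z ∉ tsupport g := fun h => hz (Metric.self_subset_cthickening _ h)
        have h2 : z + (τ, 0) ∉ tsupport g := fun h => by
          refine hz (Metric.mem_cthickening_of_dist_le z _ 1 _ h ?_)
          rw [dist_self_add_right]
          rw [Metric.mem_ball, dist_zero_right] at hτ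
          simpa [Prod.norm_def] using hτ.le
        rw [image_eq_zero_of_notMem_tsupport h1, image_eq_zero_of_notMem_tsupport h2]
        simp
    · have hc : Continuous fun τ : ℝ => |g (z + (τ, 0)) - g z| := by fun_prop
      have := hc.tendsto 0
      simpa [← Prod.zero_eq_mk] using this
  rw [Metric.tendsto_nhds] at hg0
  filter_upwards [hg0 (ε / 4) (by positivity)] with τ hτ
  rw [Real.dist_eq, sub_zero, abs_of_nonneg (integral_nonneg fun _ => abs_nonneg _)] at hτ ⊢
  have i1 : Integrable (fun z => |f z - g z|) := (hf.sub hgi).abs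
  have i2 : Integrable (fun z => |f (z + (τ, 0)) - g (z + (τ, 0))|) := i1.comp_add_right (τ, 0)
  have i3 : Integrable (fun z => |g (z + (τ, 0)) - g z|) :=
    ((hgi.comp_add_right (τ, 0)).sub hgi).abs
  have i23 : Integrable (fun z => |f (z + (τ, 0)) - g (z + (τ, 0))| + |g (z + (τ, 0)) - g z|) :=
    i2.add i3
  have e2 : ∫ z, |f (z + (τ, 0)) - g (z + (τ, 0))| = ∫ z, |f z - g z| :=
    integral_add_right_eq_self (fun z => |f z - g z|) (τ, (0 : ℝ))
  calc ∫ z, |f (z + (τ, 0)) - f z|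
      ≤ ∫ z, (|f (z + (τ, 0)) - g (z + (τ, 0))| + |g (z + (τ, 0)) - g z| + |f z - g z|) := by
        refine integral_mono ((hf.comp_add_right (τ, 0)).sub hf).abs (i23.add i1) fun z => ?_
        have e : f (z + (τ, 0)) - f z = (f (z + (τ, 0)) - g (z + (τ, 0)))
          + (g (z + (τ, 0)) - g z) - (f z - g z) := by ring
        simp only [e]
        exact (abs_sub _ _).trans (by gcongr; exact abs_add_le _ _)
    _ = (∫ z, |f z - g z|) + (∫ z, |g (z + (τ, 0)) - g z|) + ∫ z, |f z - g z| := by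
        rw [integral_add i23 i1, integral_add i2 i3, e2]
    _ < ε := by
        simp only [Real.norm_eq_abs] at hgε
        linarith

/-- The reverse triangle inequality for the `L¹` distance. -/
lemma IsProfile.abs_integral_sub_le {R R' : ℝ} {f g k : ℝ → ℝ} (hf : IsProfile R f)
    (hg : IsProfile R g) (hk : IsProfile R' k) :
    |(∫ x, |f x - k x|) - (∫ x, |g x - k x|)| ≤ ∫ x, |f x - g x| := by
  have hf' := hf.of_le (le_max_left R R')
  have hg' := hg.of_le (le_max_left R R')
  have hk' := hk.of_le (le_max_right R R')
  have i1 : Integrable (fun x => |f x - k x|) := (hf'.integrable_sub hk').abs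
  have i2 : Integrable (fun x => |g x - k x|) := (hg'.integrable_sub hk').abs
  have i3 : Integrable (fun x => |f x - g x|) := (hf.integrable_sub hg).abs
  rw [← integral_sub i1 i2]
  refine abs_integral_le_integral_abs.trans (integral_mono (i1.sub i2).abs i3 fun x => ?_)
  refine (abs_abs_sub_abs_le_abs_sub _ _).trans (le_of_eq ?_)
  congr 1; ring

section Localization

variable {T R R' r h : ℝ} {L L' : NNReal} {B B' F G : ℝ → ℝ → ℝ} {S κ θ : ℝ → ℝ}

lemma exists_integral_time_translate_le (hFm : Measurable (Function.uncurry F))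
    (hF : ∀ t, IsProfile R (F t)) (a b : ℝ) {ε : ℝ} (hε : 0 < ε) :
    ∃ h₀ > 0, ∀ τ, |τ| ≤ h₀ → ∫ t in Icc a b, ∫ x, |F (t + τ) x - F t x| ≤ ε := by
  set e : ℝ → ℝ := fun x => heaviside x - 1 / 2 with he
  have hE : IsProfile 1 e := IsProfile.half_heaviside
  set R₁ := max R 1
  set f : ℝ × ℝ → ℝ := fun z => (Icc (a - 1) (b + 1)).indicator (fun t => F t z.2 - e z.2) z.1
    with hf
  have hfm : Measurable f := by
    have h1 : Measurable (fun z : ℝ × ℝ => F z.1 z.2 - e z.2) :=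
      hFm.sub (hE.measurable.comp measurable_snd)
    exact h1.indicator (measurable_fst (measurableSet_Icc (a := a - 1) (b := b + 1)))
  have hfi : Integrable f := by
    refine integrable_of_bounded_of_support (K := Icc (a - 1) (b + 1) ×ˢ Icc (-R₁) R₁) (C := 1)
      (isCompact_Icc.prod isCompact_Icc).measure_lt_top hfm.aestronglyMeasurable ?_ ?_
    · intro z
      by_cases hz : z.1 ∈ Icc (a - 1) (b + 1)
      · simp only [hf, indicator_of_mem hz]
        have := abs_sub (F z.1 z.2) (e z.2)
        linarith [(hF z.1).abs_le_half z.2, hE.abs_le_half z.2]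
      · simp [hf, indicator_of_notMem hz]
    · intro z hz
      by_cases h1 : z.1 ∈ Icc (a - 1) (b + 1)
      · simp only [hf, indicator_of_mem h1]
        exact ((hF z.1).of_le (le_max_left _ _)).sub_eq_zero_of_notMem
          (hE.of_le (le_max_right _ _)) fun h2 => hz ⟨h1, h2⟩
      · simp [hf, indicator_of_notMem h1]
  have hlim := tendsto_integral_abs_translate_sub hfi
  obtain ⟨h₁, hh₁, hball⟩ := Metric.mem_nhds_iff.1 (hlim.eventually_lt_const hε)
  refine ⟨min (h₁ / 2) 1, by positivity, fun τ hτ => ?_⟩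
  have hτ1 : |τ| ≤ 1 := hτ.trans (min_le_right _ _)
  have hlt : ∫ z : ℝ × ℝ, |f (z.1 + τ, z.2) - f z| < ε := by
    refine hball ?_
    rw [Metric.mem_ball, Real.dist_eq, sub_zero]
    linarith [hτ.trans (min_le_left _ _)]
  refine le_trans ?_ hlt.le
  have htr : (fun z : ℝ × ℝ => f (z.1 + τ, z.2)) = fun z => f (z + (τ, 0)) := by
    ext z; congr 1; ext <;> simp
  have hi : Integrable (fun z : ℝ × ℝ => |f (z.1 + τ, z.2) - f z|) := by
    refine Integrable.abs (Integrable.sub ?_ hfi)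
    rw [htr]
    exact hfi.comp_add_right (τ, 0)
  rw [Measure.volume_eq_prod] at hi ⊢
  rw [integral_prod _ hi]
  refine le_trans (le_of_eq ?_) (setIntegral_le_integral (s := Icc a b) hi.integral_prod_left
    (.of_forall fun t => integral_nonneg fun _ => abs_nonneg _))
  refine setIntegral_congr_fun measurableSet_Icc fun t ht => ?_
  refine integral_congr_ae (.of_forall fun x => ?_)
  have h1 : t ∈ Icc (a - 1) (b + 1) := ⟨by linarith [ht.1], by linarith [ht.2]⟩
  have h2 : t + τ ∈ Icc (a - 1) (b + 1) :=
    ⟨by linarith [ht.1, neg_abs_le τ], by linarith [ht.2, le_abs_self τ]⟩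
  simp only [hf, indicator_of_mem h1, indicator_of_mem h2, sub_sub_sub_cancel_right]

lemma IsMollifier.integrable_mul_snd {v : ℝ → ℝ} (hκ : IsMollifier h κ) (hv : Integrable v) :
    Integrable (fun q : ℝ × ℝ => v q.2 * κ (q.1 - q.2)) :=
  hv.convolution_integrand (ContinuousLinearMap.mul ℝ ℝ) hκ.integrable

lemma IsMollifier.integral_mul_snd {v : ℝ → ℝ} (hκ : IsMollifier h κ) (hv : Integrable v) :
    ∫ q : ℝ × ℝ, v q.2 * κ (q.1 - q.2) = ∫ t, v t := by
  have := hκ.integrable_mul_snd hv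
  rw [Measure.volume_eq_prod] at this ⊢
  rw [integral_prod_symm _ this]
  refine integral_congr_ae (.of_forall fun t => ?_)
  simp only
  rw [integral_const_mul, integral_sub_right_eq_self κ, hκ.mass, mul_one]

/-- The error committed when the two times are identified. -/
lemma IsMollifier.integral_time_shift_le (hκ : IsMollifier h κ)
    (hFm : Measurable (Function.uncurry F)) (hF : ∀ t, IsProfile R (F t)) {a b ε : ℝ}
    (hε : ∀ τ, |τ| ≤ h → ∫ t in Icc a b, ∫ x, |F (t + τ) x - F t x| ≤ ε) :
    Integrable (fun q : ℝ × ℝ => (Icc a b).indicator (fun t => ∫ x, |F q.1 x - F t x|) q.2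
      * κ (q.1 - q.2)) ∧
    ∫ q : ℝ × ℝ, (Icc a b).indicator (fun t => ∫ x, |F q.1 x - F t x|) q.2 * κ (q.1 - q.2)
      ≤ ε := by
  have hκ' := hκ.toIsKernel
  have hR := (hF 0).radius_pos
  set d : ℝ × ℝ → ℝ := fun q => (Icc a b).indicator (fun t => ∫ x, |F q.1 x - F t x|) q.2 with hd
  have hdm : Measurable d := by
    exact (measurable_dist hFm hFm).indicator
      (measurable_snd (measurableSet_Icc (a := a) (b := b)))
  have hdb : ∀ q, |d q| ≤ 2 * R := fun q => by
    by_cases hq : q.2 ∈ Icc a b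
    · simp only [hd, indicator_of_mem hq]
      rw [abs_of_nonneg (integral_nonneg fun _ => abs_nonneg _)]
      exact (hF q.1).integral_abs_sub_le_diam (hF q.2)
    · simp only [hd, indicator_of_notMem hq, abs_zero]
      linarith
  have hd0 : ∀ q : ℝ × ℝ, q.2 ∉ Icc a b → d q = 0 := fun q hq => by
    simp only [hd, indicator_of_notMem hq]
  have hi : Integrable (fun q : ℝ × ℝ => d q * κ (q.1 - q.2)) := by
    refine integrable_of_bounded_of_support (C := 2 * R * supNorm κ)
      (K := (fun p : ℝ × ℝ => (p.1 + p.2, p.2)) '' (Icc (-h) h ×ˢ Icc a b))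
      ((isCompact_Icc.prod isCompact_Icc).image (by fun_prop)).measure_lt_top ?_ ?_ ?_
    · exact (hdm.mul (hκ.continuous.measurable.comp (by fun_prop))).aestronglyMeasurable
    · intro q
      rw [abs_mul]
      exact mul_le_mul (hdb q) (hκ'.abs_le_supNorm _) (abs_nonneg _) (by positivity)
    · intro q hq
      by_cases h1 : q.2 ∈ Icc a b
      · rw [hκ'.eq_zero fun h2 => hq ⟨(q.1 - q.2, q.2), ⟨h2, h1⟩, by simp⟩, mul_zero]
      · rw [hd0 q h1, zero_mul]
  refine ⟨hi, ?_⟩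
  have hi2 : Integrable (fun q : ℝ × ℝ => d (q.2 + q.1, q.1) * κ q.2) (volume.prod volume) := by
    refine integrable_of_bounded_of_support (C := 2 * R * supNorm κ)
      (K := Icc a b ×ˢ Icc (-h) h)
      (by rw [← Measure.volume_eq_prod]
          exact (isCompact_Icc.prod isCompact_Icc).measure_lt_top) ?_ ?_ ?_
    · exact ((hdm.comp (by fun_prop)).mul
        (hκ.continuous.measurable.comp measurable_snd)).aestronglyMeasurable
    · intro q
      rw [abs_mul]
      exact mul_le_mul (hdb _) (hκ'.abs_le_supNorm _) (abs_nonneg _) (by positivity)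
    · intro q hq
      by_cases h1 : q.1 ∈ Icc a b
      · rw [hκ'.eq_zero fun h2 => hq ⟨h1, h2⟩, mul_zero]
      · rw [hd0 _ h1, zero_mul]
  rw [Measure.volume_eq_prod] at hi ⊢
  rw [integral_prod_symm _ hi]
  -- with `s = t + τ`, the mollifier averages the `L¹` modulus of continuity over `|τ| ≤ h`
  have e1 : ∀ t, ∫ s, d (s, t) * κ (s - t) = ∫ τ, d (τ + t, t) * κ τ := fun t => by
    rw [← integral_add_right_eq_self _ t]
    simp
  simp only [e1]
  rw [integral_integral_swap hi2]
  have e2 : ∫ τ, ε * κ τ = ε := by rw [integral_const_mul, hκ.mass, mul_one]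
  rw [← e2]
  refine integral_mono hi2.integral_prod_right (hκ.integrable.const_mul ε) fun τ => ?_
  simp only
  rw [integral_mul_const]
  by_cases hτ : τ ∈ Icc (-h) h
  · refine mul_le_mul_of_nonneg_right (le_trans (le_of_eq ?_) (hε τ (abs_le.2 hτ))) (hκ.nonneg τ)
    rw [← integral_indicator measurableSet_Icc]
    refine integral_congr_ae (.of_forall fun t => ?_)
    simp only [hd, indicator, add_comm τ t]
  · rw [hκ'.eq_zero hτ, mul_zero, mul_zero]

/-- The stability inequality in distributional form. -/
lemma IsRegularSolution.integral_stability_nonneg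
    (hF : IsRegularSolution T B S R F) (hG : IsRegularSolution T B' S R G)
    (hFR : ∀ t, IsProfile R' (F t)) (hB : IsRegularFlux L B) (hB' : IsRegularFlux L' B')
    (hS : IsKernel r S) (hθ : IsTimeTest T θ) {l : NNReal}
    (hl : ∀ ε : NNReal, 0 < ε → ∃ h₀ > 0, ∀ s ∈ Ioo 0 T, ∀ t ∈ Ioo 0 T, |s - t| ≤ h₀ →
      LipschitzWith (l + ε) (fun v => B s v - B' t v)) :
    0 ≤ ∫ t, ((∫ x, |F t x - G t x|) * deriv θ t
      + (l + sourceConst S R' * ∫ x, |F t x - G t x|) * θ t) := by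
  have hR := (hF.profile 0).radius_pos
  have hC0 := sourceConst_nonneg (S := S) (hFR 0).radius_pos
  set C := sourceConst S R' with hC
  set u : ℝ → ℝ := fun t => ∫ x, |F t x - G t x| with hu
  have hu0 : ∀ t, 0 ≤ u t := fun t => integral_nonneg fun _ => abs_nonneg _
  have huR : ∀ t, u t ≤ 2 * R := fun t =>
    (hF.profile t).integral_abs_sub_le_diam (hG.profile t)
  have hubd : ∀ t, |u t| ≤ 2 * R := fun t => by rw [abs_of_nonneg (hu0 t)]; exact huR t
  have hum : Measurable u :=
    (measurable_dist hF.meas hG.meas).comp (f := fun t : ℝ => (t, t)) (by fun_prop)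
  obtain ⟨C₁, hC₁⟩ := hθ.compact.exists_bound_of_continuous hθ.smooth.continuous
  obtain ⟨C₂, hC₂⟩ := hθ.compact.deriv.exists_bound_of_continuous hθ.continuous_deriv
  have hC₁0 : 0 ≤ C₁ := (norm_nonneg _).trans (hC₁ 0)
  have hC₂0 : 0 ≤ C₂ := (norm_nonneg _).trans (hC₂ 0)
  have hθi : Integrable θ := hθ.smooth.continuous.integrable_of_hasCompactSupport hθ.compact
  have hθdi : Integrable (deriv θ) :=
    hθ.continuous_deriv.integrable_of_hasCompactSupport hθ.compact.deriv
  have iθ : ∀ c : ℝ, Integrable (fun t => u t * deriv θ t + (c + C * u t) * θ t) := fun c => by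
    refine (hθdi.bdd_mul (c := 2 * R) hum.aestronglyMeasurable (.of_forall hubd)).add
      (hθi.bdd_mul (c := |c| + C * (2 * R))
        ((hum.const_mul C).const_add c).aestronglyMeasurable (.of_forall fun t => ?_))
    refine (norm_add_le _ _).trans (add_le_add le_rfl ?_)
    rw [Real.norm_eq_abs, abs_mul, abs_of_nonneg hC0]
    exact mul_le_mul_of_nonneg_left (hubd t) hC0
  rcases eq_empty_or_nonempty (tsupport θ) with hemp | hne
  · have h0 : ∀ t, θ t = 0 := fun t => image_eq_zero_of_notMem_tsupport (by simp [hemp])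
    have : θ = fun _ => 0 := funext h0
    simp [this]
  -- the support of the test function keeps away from the end points
  obtain ⟨a, ha, hamin⟩ := hθ.compact.isCompact.exists_isLeast hne
  obtain ⟨b, hb, hbmax⟩ := hθ.compact.isCompact.exists_isGreatest hne
  have ha0 := (hθ.supp ha).1
  have hbT := (hθ.supp hb).2
  have key : ∀ ε : NNReal, 0 < ε → 0 ≤ (∫ t, (u t * deriv θ t + (l + C * u t) * θ t))
      + ε * ((∫ t, θ t) + (C₂ + C * C₁)) := by
    intro ε hε
    obtain ⟨h₀, hh₀, hLip⟩ := hl ε hε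
    obtain ⟨h₁, hh₁, htr⟩ := exists_integral_time_translate_le hF.meas hF.profile a b
      (ε := ε) (by exact_mod_cast hε)
    set h := min (min h₀ h₁) (min (a / 2) ((T - b) / 2)) with hh
    have hpos : 0 < h := by
      simp only [hh, lt_min_iff]
      exact ⟨⟨hh₀, hh₁⟩, by linarith, by linarith⟩
    obtain ⟨κ, hκ⟩ := exists_isMollifier hpos
    have hle1 : h ≤ h₀ := (min_le_left _ _).trans (min_le_left _ _)
    have hle2 : h ≤ h₁ := (min_le_left _ _).trans (min_le_right _ _)
    have hle3 : h ≤ a / 2 := (min_le_right _ _).trans (min_le_left _ _)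
    have hle4 : h ≤ (T - b) / 2 := (min_le_right _ _).trans (min_le_right _ _)
    have hdbl := hF.integral_time_doubled_nonneg hG hFR hB hB' hS hκ hθ
      (fun t ht s hs => ⟨by linarith [hs.1, hamin ht], by linarith [hs.2, hbmax ht]⟩)
      (fun s hs t ht hst => hLip s hs t ht (hst.trans hle1))
    obtain ⟨iE, hE⟩ := hκ.integral_time_shift_le hF.meas hF.profile
      (fun τ hτ => htr τ (hτ.trans hle2))
    set E : ℝ × ℝ → ℝ := fun q => (Icc a b).indicator (fun t => ∫ x, |F q.1 x - F t x|) q.2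
      * κ (q.1 - q.2) with hEdef
    have iv := hκ.integrable_mul_snd (iθ (l + ε))
    have hint : ∫ q : ℝ × ℝ, (u q.2 * deriv θ q.2 + ((l + ε) + C * u q.2) * θ q.2)
        * κ (q.1 - q.2) = (∫ t, (u t * deriv θ t + (l + C * u t) * θ t)) + ε * ∫ t, θ t := by
      rw [hκ.integral_mul_snd (iθ (l + ε)), ← integral_const_mul, ← integral_add (iθ l)
        (hθi.const_mul _)]
      refine integral_congr_ae (.of_forall fun t => ?_)
      simp only; ring
    have hκm : Measurable (fun q : ℝ × ℝ => κ (q.1 - q.2)) :=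
      hκ.continuous.measurable.comp (by fun_prop)
    have hθm : Measurable (fun q : ℝ × ℝ => θ q.2) :=
      hθ.smooth.continuous.measurable.comp measurable_snd
    have hθdm : Measurable (fun q : ℝ × ℝ => deriv θ q.2) :=
      hθ.continuous_deriv.measurable.comp measurable_snd
    -- the error made in replacing the distance at two times by the distance at one
    set D : ℝ × ℝ → ℝ := fun q => ((∫ x, |F q.1 x - G q.2 x|) - u q.2)
      * (deriv θ q.2 + C * θ q.2) * κ (q.1 - q.2) with hD
    have hDm : Measurable D :=
      (((measurable_dist hF.meas hG.meas).sub (hum.comp measurable_snd)).mul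
        (hθdm.add (hθm.const_mul C))).mul hκm
    have hDE : ∀ q, |D q| ≤ (C₂ + C * C₁) * E q := by
      intro q
      by_cases ht : q.2 ∈ tsupport θ
      · have hq : q.2 ∈ Icc a b := ⟨hamin ht, hbmax ht⟩
        have h1 := (hF.profile q.1).abs_integral_sub_le (hF.profile q.2) (hG.profile q.2)
        have h2 : |deriv θ q.2 + C * θ q.2| ≤ C₂ + C * C₁ := by
          refine (abs_add_le _ _).trans (add_le_add (hC₂ _) ?_)
          rw [abs_mul, abs_of_nonneg hC0]
          exact mul_le_mul_of_nonneg_left (hC₁ _) hC0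
        simp only [hD, hEdef, indicator_of_mem hq, abs_mul, abs_of_nonneg (hκ.nonneg _)]
        rw [← mul_assoc, mul_comm (C₂ + C * C₁)]
        exact mul_le_mul_of_nonneg_right (mul_le_mul h1 h2 (abs_nonneg _)
          (integral_nonneg fun _ => abs_nonneg _)) (hκ.nonneg _)
      · have h1 : θ q.2 = 0 := image_eq_zero_of_notMem_tsupport ht
        have h2 : deriv θ q.2 = 0 :=
          image_eq_zero_of_notMem_tsupport fun h => ht (tsupport_deriv_subset h)
        have h3 : 0 ≤ E q := mul_nonneg (indicator_nonneg
          (fun _ _ => integral_nonneg fun _ => abs_nonneg _) _) (hκ.nonneg _)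
        simp only [hD, h1, h2, mul_zero, add_zero, zero_mul, abs_zero]
        positivity
    have iD : Integrable D := (iE.const_mul (C₂ + C * C₁)).mono' hDm.aestronglyMeasurable
      (.of_forall hDE)
    have hsplit : ∫ q : ℝ × ℝ, ((∫ x, |F q.1 x - G q.2 x|) * deriv θ q.2
        + (((l + ε : NNReal) : ℝ) + C * ∫ x, |F q.1 x - G q.2 x|) * θ q.2) * κ (q.1 - q.2)
        = (∫ q : ℝ × ℝ, (u q.2 * deriv θ q.2 + ((l + ε) + C * u q.2) * θ q.2)
        * κ (q.1 - q.2)) + ∫ q, D q := by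
      rw [← integral_add iv iD]
      refine integral_congr_ae (.of_forall fun q => ?_)
      simp only [hD, NNReal.coe_add]; ring
    have hDle : ∫ q, D q ≤ (C₂ + C * C₁) * ∫ q, E q := by
      rw [← integral_const_mul]
      exact integral_mono iD (iE.const_mul _) fun q => (le_abs_self _).trans (hDE q)
    rw [hsplit, hint] at hdbl
    have := mul_le_mul_of_nonneg_left hE (by positivity : 0 ≤ C₂ + C * C₁)
    linarith
  refine le_of_forall_pos_le_add fun η hη => ?_
  set M := (∫ t, θ t) + (C₂ + C * C₁) with hM
  have hM0 : 0 ≤ M := add_nonneg (integral_nonneg hθ.nonneg) (by positivity)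
  have := key (η / (M + 1)).toNNReal (Real.toNNReal_pos.2 (by positivity))
  rw [Real.coe_toNNReal _ (by positivity)] at this
  have h2 : η / (M + 1) * M ≤ η := by
    rw [div_mul_eq_mul_div, div_le_iff₀ (by positivity)]
    nlinarith
  linarith
end Localization
end OpinionBurgers

namespace OpinionBurgers

section Gronwall

variable {T R R' r : ℝ} {L L' : NNReal} {B B' F G : ℝ → ℝ → ℝ} {S : ℝ → ℝ}

/-- Gronwall's inequality for the `L¹` distance of two entropy solutions. -/
lemma IsRegularSolution.ae_integral_abs_sub_le
    (hF : IsRegularSolution T B S R F) (hG : IsRegularSolution T B' S R G)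
    (hFR : ∀ t, IsProfile R' (F t)) (hB : IsRegularFlux L B) (hB' : IsRegularFlux L' B')
    (hS : IsKernel r S) {l : NNReal}
    (hl : ∀ ε : NNReal, 0 < ε → ∃ h₀ > 0, ∀ s ∈ Ioo 0 T, ∀ t ∈ Ioo 0 T, |s - t| ≤ h₀ →
      LipschitzWith (l + ε) (fun v => B s v - B' t v)) {u₀ : ℝ}
    (h0 : ∀ ε > 0, ∃ a > 0, ∀ᵐ s, s ∈ Ioo 0 a → ∫ x, |F s x - G s x| ≤ u₀ + ε) :
    ∀ᵐ t, t ∈ Ioo 0 T →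
      ∫ x, |F t x - G t x| ≤ Real.exp (sourceConst S R' * t) * (u₀ + t * l) := by
  have hR := (hF.profile 0).radius_pos
  have hC0 := sourceConst_nonneg (S := S) (hFR 0).radius_pos
  set C := sourceConst S R' with hC
  set u : ℝ → ℝ := fun t => ∫ x, |F t x - G t x| with hu
  have hu0 : ∀ t, 0 ≤ u t := fun t => integral_nonneg fun _ => abs_nonneg _
  have hubd : ∀ t, |u t| ≤ 2 * R := fun t => by
    rw [abs_of_nonneg (hu0 t)]
    exact (hF.profile t).integral_abs_sub_le_diam (hG.profile t)
  have hum : Measurable u :=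
    (measurable_dist hF.meas hG.meas).comp (f := fun t : ℝ => (t, t)) (by fun_prop)
  have hexp : Continuous fun s : ℝ => Real.exp (-(C * s)) := by fun_prop
  -- the stability inequality says that this function is nonincreasing
  set w : ℝ → ℝ := fun s => Real.exp (-(C * s)) * u s - l * s with hw
  have hwl : LocallyIntegrable w := by
    refine LocallyIntegrable.sub ?_
      (by fun_prop : Continuous fun s : ℝ => (l : ℝ) * s).locallyIntegrable
    have := ((measurable_locallyIntegrable hum hubd).locallyIntegrableOn univ).continuousOn_mul
      hexp.continuousOn isOpen_univ.isLocallyClosed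
    exact locallyIntegrableOn_univ.1 this
  have key : ∀ ψ, IsTimeTest T ψ → 0 ≤ ∫ s, w s * deriv ψ s := by
    intro ψ hψ
    have hderiv : ∀ s, HasDerivAt (fun s => Real.exp (-(C * s)) * ψ s)
        (Real.exp (-(C * s)) * (-C) * ψ s + Real.exp (-(C * s)) * deriv ψ s) s := fun s => by
      have h1 : HasDerivAt (fun s => -(C * s)) (-C) s := by
        simpa using ((hasDerivAt_id' s).const_mul C).fun_neg
      exact h1.exp.mul (hψ.hasDerivAt s)
    have hsub : tsupport (fun s => Real.exp (-(C * s)) * ψ s) ⊆ tsupport ψ :=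
      closure_mono fun t ht h' => ht (by simp only [h', mul_zero])
    have htest : IsTimeTest T (fun s => Real.exp (-(C * s)) * ψ s) :=
      ⟨(Real.contDiff_exp.comp (contDiff_const.mul contDiff_id).neg).mul hψ.smooth,
        hψ.compact.mul_left, hsub.trans hψ.supp,
        fun s => mul_nonneg (Real.exp_pos _).le (hψ.nonneg s)⟩
    have h1 := hF.integral_stability_nonneg hG hFR hB hB' hS htest hl
    have hψi : Integrable ψ := hψ.smooth.continuous.integrable_of_hasCompactSupport hψ.compact
    have hψdi : Integrable (deriv ψ) :=
      hψ.continuous_deriv.integrable_of_hasCompactSupport hψ.compact.deriv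
    have hsψ : Integrable (fun s => s * deriv ψ s) :=
      (continuous_id.mul hψ.continuous_deriv).integrable_of_hasCompactSupport
        hψ.compact.deriv.mul_left
    have heψd : Integrable (fun s => Real.exp (-(C * s)) * deriv ψ s) :=
      (hexp.mul hψ.continuous_deriv).integrable_of_hasCompactSupport hψ.compact.deriv.mul_left
    have heψ : Integrable (fun s => Real.exp (-(C * s)) * ψ s) :=
      (hexp.mul hψ.smooth.continuous).integrable_of_hasCompactSupport hψ.compact.mul_left
    have i1 : Integrable (fun s => u s * (Real.exp (-(C * s)) * deriv ψ s)) :=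
      heψd.bdd_mul (c := 2 * R) hum.aestronglyMeasurable (.of_forall hubd)
    have hparts : ∫ s, s * deriv ψ s = - ∫ s, ψ s := by
      have h2 := integral_mul_deriv_eq_deriv_mul_of_integrable (u := fun s : ℝ => s)
        (v := ψ) (u' := fun _ => 1) (v' := deriv ψ) (fun s _ => hasDerivAt_id s)
        (fun s _ => hψ.hasDerivAt s) hsψ (by simpa [Pi.mul_def] using hψi)
        ((continuous_id.mul hψ.smooth.continuous).integrable_of_hasCompactSupport
          hψ.compact.mul_left)
      simpa using h2
    have h3 : ∫ s, w s * deriv ψ s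
        = ∫ s, (u s * (Real.exp (-(C * s)) * deriv ψ s) + l * ψ s) := by
      have e1 : (fun s => w s * deriv ψ s)
          = fun s => u s * (Real.exp (-(C * s)) * deriv ψ s) - l * (s * deriv ψ s) := by
        ext s; simp only [hw]; ring
      rw [e1, integral_sub i1 (hsψ.const_mul _), integral_add i1 (hψi.const_mul _),
        integral_const_mul, integral_const_mul, hparts]
      ring
    rw [h3]
    have i2 : Integrable (fun s => u s * (Real.exp (-(C * s)) * deriv ψ s)
        + l * (Real.exp (-(C * s)) * ψ s)) := i1.add (heψ.const_mul _)
    have h4 : ∀ s, u s * deriv (fun s => Real.exp (-(C * s)) * ψ s) s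
        + (l + C * u s) * (Real.exp (-(C * s)) * ψ s)
        = u s * (Real.exp (-(C * s)) * deriv ψ s) + l * (Real.exp (-(C * s)) * ψ s) := fun s => by
      rw [(hderiv s).deriv]; ring
    have h5 : 0 ≤ ∫ s, (u s * (Real.exp (-(C * s)) * deriv ψ s)
        + l * (Real.exp (-(C * s)) * ψ s)) :=
      h1.trans_eq (integral_congr_ae (.of_forall fun s => h4 s))
    refine h5.trans (integral_mono i2 (i1.add (hψi.const_mul _)) fun s => ?_)
    simp only
    gcongr
    by_cases hs : s ∈ tsupport ψ
    · refine mul_le_of_le_one_left (hψ.nonneg s) (Real.exp_le_one_iff.2 ?_)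
      have := mul_nonneg hC0 (hψ.supp hs).1.le
      linarith
    · simp [image_eq_zero_of_notMem_tsupport hs]
  have hinit : ∀ ε > 0, ∃ a > 0, ∀ᵐ s, s ∈ Ioo 0 a → w s ≤ u₀ + ε := fun ε hε => by
    obtain ⟨a, ha, hs⟩ := h0 ε hε
    refine ⟨a, ha, ?_⟩
    filter_upwards [hs] with s hs hsa
    have hs0 : 0 < s := hsa.1
    replace hs := hs hsa
    have h1 : Real.exp (-(C * s)) * u s ≤ u s :=
      mul_le_of_le_one_left (hu0 s) (Real.exp_le_one_iff.2 (by
        have := mul_nonneg hC0 (le_of_lt hs0)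
        linarith))
    have h2 : 0 ≤ (l : ℝ) * s := mul_nonneg l.2 (le_of_lt hs0)
    simp only [hw]
    linarith
  filter_upwards [ae_le_of_integral_mul_deriv_nonneg hwl key hinit] with t ht htT
  have h1 := ht htT
  simp only [hw] at h1
  have h2 : u t = Real.exp (C * t) * (Real.exp (-(C * t)) * u t) := by
    rw [← mul_assoc, ← Real.exp_add]; simp
  rw [show (∫ x, |F t x - G t x|) = u t from rfl, h2]
  exact mul_le_mul_of_nonneg_left (by linarith) (Real.exp_pos _).le

end Gronwall

/-! ### Regular representatives -/

/-- Functions satisfying the entropy inequality on `(0, T)` which are a profile at every time, but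
of which only measurability up to null sets is known. -/
structure IsPreSolution (T : ℝ) (B : ℝ → ℝ → ℝ) (S : ℝ → ℝ) (R : ℝ) (F : ℝ → ℝ → ℝ) : Prop where
  meas : AEStronglyMeasurable (fun z : ℝ × ℝ => F z.1 z.2) (volume.restrict (Ioo 0 T ×ˢ univ))
  profile : ∀ t ∈ Ioo 0 T, IsProfile R (F t)
  entropy : ∀ χ : ℝ × ℝ → ℝ, ContDiff ℝ ∞ χ → HasCompactSupport χ →
    tsupport χ ⊆ Ioo 0 T ×ˢ univ → (∀ z, 0 ≤ χ z) → ∀ α : ℝ,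
    0 ≤ ∫ z in Ioo 0 T ×ˢ univ, entropyIntegrand S B F χ α z

lemma IsRegularSolution.of_le {T R R' : ℝ} {B F : ℝ → ℝ → ℝ} {S : ℝ → ℝ}
    (hF : IsRegularSolution T B S R F) (h : R ≤ R') : IsRegularSolution T B S R' F :=
  ⟨hF.meas, fun t => (hF.profile t).of_le h, hF.entropy⟩

lemma IsProfile.rightLim {R : ℝ} {f : ℝ → ℝ} (hf : IsProfile R f) :
    IsProfile (R + 1) (Function.rightLim f) := by
  refine ⟨hf.mono.rightLim, fun x hx => ⟨le_antisymm ?_ ?_, le_antisymm ?_ ?_⟩⟩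
  · exact (hf.mono.rightLim_le (lt_add_one x)).trans (hf.le_half _)
  · exact (hf.eq_right (by linarith)).symm.trans_le (hf.mono.le_rightLim le_rfl)
  · exact (hf.mono.rightLim_le (lt_add_one (-x))).trans_eq (hf.eq_left (by linarith))
  · exact (hf.neg_half_le (-x)).trans (hf.mono.le_rightLim le_rfl)

lemma Monotone.rightLim_ae_eq {f : ℝ → ℝ} (hf : Monotone f) :
    Function.rightLim f =ᵐ[volume] f := by
  filter_upwards [measure_eq_zero_iff_ae_notMem.1
    (hf.countable_not_continuousAt.measure_zero volume)] with x hx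
  exact (not_not.1 hx).continuousWithinAt.rightLim_eq

/-- The averages of a monotone function on the right of a point decrease to the right limit. -/
lemma tendsto_average_rightLim {f : ℝ → ℝ} (hf : Monotone f) (x : ℝ) :
    Tendsto (fun n : ℕ => (n + 1 : ℝ) * ∫ y in Ioc x (x + 1 / (n + 1 : ℝ)), f y) atTop
      (𝓝 (Function.rightLim f x)) := by
  have hp : ∀ n : ℕ, (0 : ℝ) < n + 1 := fun n => by positivity
  have hconst : ∀ (n : ℕ) (c : ℝ), (n + 1 : ℝ) * ∫ y in Ioc x (x + 1 / (n + 1 : ℝ)), c = c := by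
    intro n c
    rw [setIntegral_const, measureReal_def, Real.volume_Ioc, ENNReal.toReal_ofReal
      (by have := hp n; rw [add_sub_cancel_left]; positivity), smul_eq_mul]
    have := (hp n).ne'
    field_simp
    ring
  have hi : ∀ n : ℕ, IntegrableOn f (Ioc x (x + 1 / (n + 1 : ℝ))) := fun n =>
    (hf.locallyIntegrable.integrableOn_isCompact isCompact_Icc).mono_set Ioc_subset_Icc_self
  have hic : ∀ (n : ℕ) (c : ℝ), IntegrableOn (fun _ => c) (Ioc x (x + 1 / (n + 1 : ℝ))) :=
    fun n c => integrableOn_const (by simp)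
  have hup : Tendsto (fun n : ℕ => f (x + 1 / (n + 1 : ℝ))) atTop (𝓝 (Function.rightLim f x)) := by
    refine (hf.tendsto_rightLim x).comp (tendsto_nhdsWithin_iff.2 ⟨?_, .of_forall fun n => ?_⟩)
    · simpa using tendsto_one_div_add_atTop_nhds_zero_nat.const_add x
    · have := hp n
      simp only [mem_Ioi, lt_add_iff_pos_right]
      positivity
  refine tendsto_of_tendsto_of_tendsto_of_le_of_le tendsto_const_nhds hup (fun n => ?_) fun n => ?_
  · simp only
    rw [← hconst n (Function.rightLim f x)]
    exact mul_le_mul_of_nonneg_left (setIntegral_mono_on (hic _ _) (hi n) measurableSet_Ioc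
      fun y hy => hf.rightLim_le hy.1) (hp n).le
  · simp only
    rw [← hconst n (f (x + 1 / (n + 1 : ℝ)))]
    exact mul_le_mul_of_nonneg_left (setIntegral_mono_on (hi n) (hic _ _) measurableSet_Ioc
      fun y hy => hf hy.2) (hp n).le

lemma entropyIntegrand_eq_zero {S : ℝ → ℝ} {B F : ℝ → ℝ → ℝ} {χ : ℝ × ℝ → ℝ} {z : ℝ × ℝ}
    (hz : z ∉ tsupport χ) (α : ℝ) : entropyIntegrand S B F χ α z = 0 := by
  have h1 : χ z = 0 := image_eq_zero_of_notMem_tsupport hz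
  have h2 : fderiv ℝ χ z = 0 :=
    image_eq_zero_of_notMem_tsupport fun h => hz (tsupport_fderiv_subset ℝ h)
  simp [entropyIntegrand, h1, h2]

lemma IsPreSolution.exists_isRegularSolution {T R : ℝ} {B F : ℝ → ℝ → ℝ} {S : ℝ → ℝ}
    (hT : 0 < T) (hF : IsPreSolution T B S R F) : ∃ F', IsRegularSolution T B S (R + 1) F' ∧
      ∀ᵐ t, t ∈ Ioo 0 T → F' t =ᵐ[volume] F t := by
  classical
  have hR := (hF.profile (T / 2) ⟨by linarith, by linarith⟩).radius_pos
  set μ := (volume.restrict (Ioo 0 T ×ˢ (univ : Set ℝ)) : Measure (ℝ × ℝ)) with hμ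
  have hμ' : μ = (volume.restrict (Ioo 0 T)).prod volume := by
    rw [hμ, Measure.volume_eq_prod, ← Measure.prod_restrict, Measure.restrict_univ]
  set f := hF.meas.mk _ with hf
  have hfm : Measurable f := hF.meas.stronglyMeasurable_mk.measurable
  have hfF : (fun z : ℝ × ℝ => F z.1 z.2) =ᵐ[μ] f := hF.meas.ae_eq_mk
  have hgood : ∀ᵐ t ∂volume.restrict (Ioo 0 T), ∀ᵐ x, F t x = f (t, x) := by
    rw [hμ'] at hfF
    exact Measure.ae_ae_of_ae_prod hfF
  -- a measurable set of full measure of times at which the representative `f` is right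
  obtain ⟨N, hNm, hN0, hN⟩ : ∃ N : Set ℝ, MeasurableSet N ∧
      (∀ᵐ t, t ∈ Ioo 0 T → t ∈ N) ∧ ∀ t ∈ N, t ∈ Ioo 0 T ∧ ∀ᵐ x, F t x = f (t, x) := by
    obtain ⟨Z, hZ1, hZ2, hZ3⟩ := exists_measurable_superset_of_null (ae_iff.1 hgood)
    refine ⟨Ioo 0 T \ Z, measurableSet_Ioo.diff hZ2, ?_, fun t ht => ⟨ht.1, ?_⟩⟩
    · rw [← ae_restrict_iff' measurableSet_Ioo]
      filter_upwards [measure_eq_zero_iff_ae_notMem.1 hZ3, ae_restrict_mem measurableSet_Ioo]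
        with t h1 h2 using ⟨h2, h1⟩
    · by_contra h
      exact ht.2 (hZ1 h)
  -- the averages over short intervals on the right are measurable in both variables
  set a : ℕ → ℝ × ℝ → ℝ := fun n z =>
    (n + 1 : ℝ) * ∫ y in Ioc z.2 (z.2 + 1 / (n + 1 : ℝ)), f (z.1, y) with ha
  have ham : ∀ n, Measurable (a n) := fun n => by
    refine Measurable.const_mul ?_ _
    have hs : MeasurableSet {q : (ℝ × ℝ) × ℝ | q.1.2 < q.2 ∧ q.2 ≤ q.1.2 + 1 / (n + 1 : ℝ)} :=
      MeasurableSet.inter (s₁ := {q : (ℝ × ℝ) × ℝ | q.1.2 < q.2})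
        (s₂ := {q : (ℝ × ℝ) × ℝ | q.2 ≤ q.1.2 + 1 / (n + 1 : ℝ)})
        (measurableSet_lt (by fun_prop) (by fun_prop))
        (measurableSet_le (by fun_prop) (by fun_prop))
    have h1 : Measurable fun q : (ℝ × ℝ) × ℝ => f (q.1.1, q.2) := hfm.comp (by fun_prop)
    have h2 := (h1.indicator hs).stronglyMeasurable.integral_prod_right' (ν := volume)
    have e : (fun z : ℝ × ℝ => ∫ y in Ioc z.2 (z.2 + 1 / (n + 1 : ℝ)), f (z.1, y))
        = fun z => ∫ y, {q : (ℝ × ℝ) × ℝ | q.1.2 < q.2 ∧ q.2 ≤ q.1.2 + 1 / (n + 1 : ℝ)}.indicator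
          (fun q : (ℝ × ℝ) × ℝ => f (q.1.1, q.2)) (z, y) := by
      ext z
      rw [← integral_indicator measurableSet_Ioc]
      rfl
    exact e ▸ h2.measurable
  have hlim : ∀ t ∈ N, ∀ x, Tendsto (fun n => a n (t, x)) atTop
      (𝓝 (Function.rightLim (F t) x)) := by
    intro t ht x
    refine (tendsto_average_rightLim (hF.profile t (hN t ht).1).mono x).congr fun n => ?_
    simp only [ha]
    congr 1
    exact setIntegral_congr_ae measurableSet_Ioc ((hN t ht).2.mono fun y hy _ => hy)
  -- right limits at good times, and an arbitrary profile at the others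
  set F' : ℝ → ℝ → ℝ := fun t x =>
    if t ∈ N then limsup (fun n => a n (t, x)) atTop else heaviside x - 1 / 2 with hF'
  have hF'N : ∀ t ∈ N, F' t = Function.rightLim (F t) := fun t ht => by
    ext x
    simp only [hF', if_pos ht]
    exact (hlim t ht x).limsup_eq
  have hF'm : Measurable (Function.uncurry F') := by
    refine Measurable.ite (measurable_fst hNm) (Measurable.limsup ham) ?_
    exact IsProfile.half_heaviside.measurable.comp measurable_snd
  have hF'p : ∀ t, IsProfile (R + 1) (F' t) := fun t => by
    by_cases ht : t ∈ N
    · rw [hF'N t ht]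
      exact (hF.profile t (hN t ht).1).rightLim
    · have : F' t = fun x => heaviside x - 1 / 2 := by ext x; simp only [hF', if_neg ht]
      rw [this]
      exact IsProfile.half_heaviside.of_le (by linarith)
  have hae : ∀ t ∈ N, F' t =ᵐ[volume] F t := fun t ht => by
    rw [hF'N t ht]
    exact Monotone.rightLim_ae_eq (hF.profile t (hN t ht).1).mono
  have hprod : ∀ᵐ z ∂μ, F' z.1 z.2 = F z.1 z.2 := by
    have h1 : ∀ᵐ z ∂μ, F' z.1 z.2 = f z := by
      have hs : MeasurableSet {z : ℝ × ℝ | F' z.1 z.2 = f z} := measurableSet_eq_fun hF'm hfm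
      rw [hμ', Measure.ae_prod_iff_ae_ae hs,
        ae_restrict_iff' measurableSet_Ioo]
      filter_upwards [hN0] with t ht htT
      filter_upwards [hae t (ht htT), (hN t (ht htT)).2] with x h1 h2
      exact h1.trans h2
    filter_upwards [h1, hfF] with z h1 h2
    exact h1.trans h2.symm
  have hprod' : ∀ᵐ z ∂μ, F' z.1 =ᵐ[volume] F z.1 := by
    rw [hμ']
    refine Measure.quasiMeasurePreserving_fst.ae (p := fun t => F' t =ᵐ[volume] F t) ?_
    rw [ae_restrict_iff' measurableSet_Ioo]
    filter_upwards [hN0] with t ht htT using hae t (ht htT)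
  refine ⟨F', ⟨hF'm, hF'p, fun χ h1 h2 h3 h4 α => ?_⟩, ?_⟩
  · refine (hF.entropy χ h1 h2 h3 h4 α).trans_eq ?_
    rw [← setIntegral_eq_integral_of_forall_compl_eq_zero (s := Ioo 0 T ×ˢ (univ : Set ℝ))
      (f := entropyIntegrand S B F' χ α)
      (fun z hz => entropyIntegrand_eq_zero (fun h => hz (h3 h)) α)]
    refine integral_congr_ae ?_
    filter_upwards [hprod, hprod'] with z h5 h6
    simp only [entropyIntegrand, h5, source_congr_ae h6 h5]
  · filter_upwards [hN0] with t ht htT using hae t (ht htT)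

end OpinionBurgers

namespace OpinionBurgers

/-! ### The Lipschitz seminorm and the regularity of fluxes -/

lemma lipSeminorm_le_iff {g : ℝ → ℝ} {L : NNReal} : lipSeminorm g ≤ L ↔
    ∀ v ∈ fluxDomain, ∀ w ∈ fluxDomain, |g v - g w| ≤ L * |v - w| := by
  simp only [lipSeminorm, iSup_le_iff]
  refine forall₄_congr fun v _ w _ => ?_
  rw [← ENNReal.ofReal_coe_nnreal, ENNReal.ofReal_le_ofReal_iff L.coe_nonneg]
  rcases eq_or_ne v w with rfl | h
  · simp
  · rw [div_le_iff₀ (abs_pos.2 (sub_ne_zero.2 h))]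

lemma lipSeminorm_le_add {f g h : ℝ → ℝ}
    (H : ∀ v w, |f v - f w| ≤ |g v - g w| + |h v - h w|) :
    lipSeminorm f ≤ lipSeminorm g + lipSeminorm h := by
  rw [lipSeminorm]
  refine iSup₂_le fun v hv => iSup₂_le fun w hw => ?_
  calc ENNReal.ofReal (|f v - f w| / |v - w|)
      ≤ ENNReal.ofReal (|g v - g w| / |v - w| + |h v - h w| / |v - w|) := by
        refine ENNReal.ofReal_le_ofReal ?_
        rw [← add_div]
        exact div_le_div_of_nonneg_right (H v w) (abs_nonneg _)
    _ = ENNReal.ofReal (|g v - g w| / |v - w|) + ENNReal.ofReal (|h v - h w| / |v - w|) :=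
        ENNReal.ofReal_add (by positivity) (by positivity)
    _ ≤ _ := by
        have H : ∀ k : ℝ → ℝ, ENNReal.ofReal (|k v - k w| / |v - w|) ≤ lipSeminorm k := fun k =>
          (le_iSup₂ (f := fun w (_ : w ∈ fluxDomain) =>
            ENNReal.ofReal (|k v - k w| / |v - w|)) w hw).trans
          (le_iSup₂ (f := fun v (_ : v ∈ fluxDomain) => ⨆ w ∈ fluxDomain,
            ENNReal.ofReal (|k v - k w| / |v - w|)) v hv)
        exact add_le_add (H g) (H h)

lemma lipSeminorm_le_lipNorm (g : ℝ → ℝ) : lipSeminorm g ≤ lipNorm g := le_add_self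

lemma ofReal_abs_le_lipNorm (g : ℝ → ℝ) {v : ℝ} (hv : v ∈ fluxDomain) :
    ENNReal.ofReal |g v| ≤ lipNorm g :=
  (le_iSup₂_of_le (f := fun v (_ : v ∈ fluxDomain) => ENNReal.ofReal |g v|) v hv le_rfl).trans
    le_self_add

/-- The projection onto the interval on which fluxes are defined. -/
lemma clamp_mem_fluxDomain (v : ℝ) : max (-1 / 2) (min v (1 / 2)) ∈ fluxDomain :=
  ⟨le_max_left _ _, max_le (by norm_num) (min_le_right _ _)⟩

lemma clamp_eq_self {v : ℝ} (hv : v ∈ fluxDomain) : max (-1 / 2) (min v (1 / 2)) = v := by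
  rw [min_eq_left hv.2, max_eq_right hv.1]

lemma fluxExt_eq (g : ℝ → ℝ) {v : ℝ} (hv : v ∈ fluxDomain) : fluxExt g v = g v := by
  rw [fluxExt, clamp_eq_self hv]

lemma lipschitzWith_fluxExt {g : ℝ → ℝ} {L : NNReal} (h : lipSeminorm g ≤ L) :
    LipschitzWith L (fluxExt g) := by
  have h1 : LipschitzWith 1 (fun v : ℝ => max (-1 / 2) (min v (1 / 2))) :=
    (LipschitzWith.id.min_const _).const_max _
  refine LipschitzWith.of_dist_le_mul fun v w => ?_
  rw [Real.dist_eq]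
  refine (lipSeminorm_le_iff.1 h _ (clamp_mem_fluxDomain v) _ (clamp_mem_fluxDomain w)).trans ?_
  refine mul_le_mul_of_nonneg_left ?_ L.coe_nonneg
  simpa [Real.dist_eq] using h1.dist_le_mul v w

namespace IsFlux

variable {T : ℝ} {A A' : ℝ → ℝ → ℝ}

lemma exists_lipSeminorm_le (hA : IsFlux T A) :
    ∃ L : NNReal, ∀ t ∈ Icc 0 T, lipSeminorm (A t) ≤ L := by
  refine isCompact_Icc.induction_on (s := Icc (0 : ℝ) T)
    (p := fun s => ∃ L : NNReal, ∀ t ∈ s, lipSeminorm (A t) ≤ L) ⟨0, by simp⟩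
    (fun s s' hs ⟨L, hL⟩ => ⟨L, fun t ht => hL t (hs ht)⟩) ?_ ?_
  · rintro s s' ⟨L, hL⟩ ⟨L', hL'⟩
    refine ⟨max L L', fun t ht => ?_⟩
    rcases ht with ht | ht
    · exact (hL t ht).trans (by exact_mod_cast le_max_left L L')
    · exact (hL' t ht).trans (by exact_mod_cast le_max_right L L')
  · intro t₀ ht₀
    have h0 : lipSeminorm (A t₀) < ⊤ := (lipSeminorm_le_lipNorm _).trans_lt (hA.lip t₀ ht₀)
    lift lipSeminorm (A t₀) to NNReal using h0.ne with L hL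
    refine ⟨_, (hA.cont t₀ ht₀).eventually_le_const one_pos, L + 1, fun t ht => ?_⟩
    have h1 : lipSeminorm (A t) ≤ lipSeminorm (A t₀) + lipSeminorm (fun v => A t v - A t₀ v) :=
      lipSeminorm_le_add fun v w => by
        have := abs_add_le (A t₀ v - A t₀ w) ((A t v - A t₀ v) - (A t w - A t₀ w))
        ring_nf at this ⊢; exact this
    refine h1.trans ?_
    rw [← hL]
    push_cast
    exact add_le_add le_rfl ((lipSeminorm_le_lipNorm _).trans ht)

lemma exists_lipSeminorm_sub_le (hA : IsFlux T A) {ε : NNReal} (hε : 0 < ε) :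
    ∃ h₀ > 0, ∀ s ∈ Icc 0 T, ∀ t ∈ Icc 0 T, |s - t| ≤ h₀ →
      lipSeminorm (fun v => A s v - A t v) ≤ ε := by
  have hev : ∀ t₀ : Icc (0 : ℝ) T, ∃ u, IsOpen u ∧ t₀.1 ∈ u ∧ ∀ t ∈ u ∩ Icc 0 T,
      lipNorm (fun v => A t v - A t₀ v) ≤ (ε / 2 : NNReal) := fun t₀ => by
    have := (hA.cont t₀ t₀.2).eventually_le_const
      (show (0 : ℝ≥0∞) < (ε / 2 : NNReal) by exact_mod_cast half_pos hε)
    obtain ⟨u, hu1, hu2, hu3⟩ := mem_nhdsWithin.1 this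
    exact ⟨u, hu1, hu2, hu3⟩
  choose u hu1 hu2 hu3 using hev
  obtain ⟨δ, hδ, hleb⟩ := lebesgue_number_lemma_of_metric (isCompact_Icc (a := (0 : ℝ)) (b := T))
    hu1 (fun t ht => mem_iUnion.2 ⟨⟨t, ht⟩, hu2 ⟨t, ht⟩⟩)
  refine ⟨δ / 2, by positivity, fun s hs t ht hst => ?_⟩
  obtain ⟨i, hi⟩ := hleb s hs
  have h1 := (lipSeminorm_le_lipNorm _).trans (hu3 i s ⟨hi (Metric.mem_ball_self hδ), hs⟩)
  have h2 := (lipSeminorm_le_lipNorm _).trans (hu3 i t ⟨hi (by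
    rw [Metric.mem_ball, dist_comm, Real.dist_eq]; linarith), ht⟩)
  have h3 : lipSeminorm (fun v => A s v - A t v)
      ≤ lipSeminorm (fun v => A s v - A i v) + lipSeminorm (fun v => A t v - A i v) :=
    lipSeminorm_le_add fun v w => by
      have := abs_sub ((A s v - A i v) - (A s w - A i w)) ((A t v - A i v) - (A t w - A i w))
      ring_nf at this ⊢; exact this
  refine h3.trans ((add_le_add h1 h2).trans_eq ?_)
  rw [← ENNReal.coe_add, add_halves]

lemma continuousOn (hA : IsFlux T A) {v : ℝ} (hv : v ∈ fluxDomain) :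
    ContinuousOn (fun t => A t v) (Icc 0 T) := by
  intro t₀ ht₀
  rw [ContinuousWithinAt, tendsto_iff_edist_tendsto_0]
  refine tendsto_of_tendsto_of_tendsto_of_le_of_le tendsto_const_nhds (hA.cont t₀ ht₀)
    (fun t => zero_le) fun t => ?_
  simp only [edist_dist, Real.dist_eq]
  exact ofReal_abs_le_lipNorm (fun v => A t v - A t₀ v) hv

end IsFlux

/-- The extension of a flux, defined for times in `[0, T]` and states in `[-1/2, 1/2]`, by constants
in both variables. -/
noncomputable def clampFlux (T : ℝ) (A : ℝ → ℝ → ℝ) (t v : ℝ) : ℝ := fluxExt (A (max 0 (min t T))) v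

lemma clampFlux_eq {T t : ℝ} (A : ℝ → ℝ → ℝ) (ht : t ∈ Icc 0 T) :
    clampFlux T A t = fluxExt (A t) := by
  ext v
  rw [clampFlux, min_eq_left ht.2, max_eq_right ht.1]

lemma clamp_mem_Icc {T : ℝ} (hT : 0 ≤ T) (t : ℝ) : max 0 (min t T) ∈ Icc 0 T :=
  ⟨le_max_left _ _, max_le hT (min_le_right _ _)⟩

namespace IsFlux

variable {T : ℝ} {A A' : ℝ → ℝ → ℝ}

lemma exists_isRegularFlux (hA : IsFlux T A) (hT : 0 ≤ T) :
    ∃ L, IsRegularFlux L (clampFlux T A) := by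
  obtain ⟨L, hL⟩ := hA.exists_lipSeminorm_le
  have hlip : ∀ t, LipschitzWith L (clampFlux T A t) := fun t =>
    lipschitzWith_fluxExt (hL _ (clamp_mem_Icc hT t))
  refine ⟨L, continuous_prod_of_continuous_lipschitzWith' _ L hlip fun v => ?_, hlip⟩
  exact (hA.continuousOn (clamp_mem_fluxDomain v)).comp_continuous (by fun_prop)
    fun t => clamp_mem_Icc hT t

lemma exists_lipschitzWith_sub (hA' : IsFlux T A') {l : NNReal}
    (hl : ∀ s ∈ Icc 0 T, lipSeminorm (fun v => A s v - A' s v) ≤ l) (ε : NNReal) (hε : 0 < ε) :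
    ∃ h₀ > 0, ∀ s ∈ Ioo 0 T, ∀ t ∈ Ioo 0 T, |s - t| ≤ h₀ →
      LipschitzWith (l + ε) (fun v => clampFlux T A s v - clampFlux T A' t v) := by
  obtain ⟨h₀, hh₀, h⟩ := hA'.exists_lipSeminorm_sub_le hε
  refine ⟨h₀, hh₀, fun s hs t ht hst => ?_⟩
  have hs' := Ioo_subset_Icc_self hs
  have ht' := Ioo_subset_Icc_self ht
  rw [clampFlux_eq A hs', clampFlux_eq A' ht']
  refine lipschitzWith_fluxExt (g := fun v => A s v - A' t v) ?_
  push_cast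
  refine le_trans (lipSeminorm_le_add fun v w => ?_) (add_le_add (hl s hs') (h s hs' t ht' hst))
  have := abs_add_le ((A s v - A' s v) - (A s w - A' s w)) ((A' s v - A' t v) - (A' s w - A' t w))
  ring_nf at this ⊢; exact this

end IsFlux

/-! ### The initial trace -/

lemma IsInitialDatum.isProfile {R : ℝ} {F₀ : ℝ → ℝ} (h : IsInitialDatum R F₀) : IsProfile R F₀ :=
  ⟨h.mono, h.tails⟩

/-- For profiles, convergence in the sense of distributions implies convergence in `L¹`. -/
lemma IsProfile.tendsto_integral_abs_sub_of_distrib {ι : Type*} {k : Filter ι} {R : ℝ}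
    {F : ι → ℝ → ℝ} {g : ℝ → ℝ} (hF : ∀ᶠ i in k, IsProfile R (F i)) (hg : IsProfile R g)
    (h : ∀ η : ℝ → ℝ, ContDiff ℝ ∞ η → HasCompactSupport η →
      Tendsto (fun i => ∫ x, F i x * η x) k (𝓝 (∫ x, g x * η x))) :
    Tendsto (fun i => ∫ x, |F i x - g x|) k (𝓝 0) := by
  refine IsProfile.tendsto_integral_abs_sub hF hg fun x δ hδ η hη => ?_
  obtain ⟨ρ, hρ⟩ := exists_isMollifier (half_pos hδ)
  have hsm : ∀ a, ContDiff ℝ ∞ (fun y => ρ (y - a)) := fun a =>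
    hρ.smooth.comp (contDiff_id.sub contDiff_const)
  have hcp : ∀ a, HasCompactSupport (fun y => ρ (y - a)) := fun a =>
    hρ.toIsKernel.hasCompactSupport.comp_homeomorph (Homeomorph.subRight a)
  have hint : ∀ f : ℝ → ℝ, IsProfile R f → ∀ a, Integrable (fun y => f y * ρ (y - a)) :=
    fun f hf a => (hρ.integrable.comp_sub_right a).bdd_mul (c := 1 / 2)
      hf.measurable.aestronglyMeasurable (.of_forall hf.abs_le_half)
  have hmass : ∀ c a : ℝ, ∫ y, c * ρ (y - a) = c := fun c a => by
    rw [integral_const_mul, integral_sub_right_eq_self ρ, hρ.mass, mul_one]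
  -- the averages of a profile around `a` lie between its values at `a ± δ/2`
  have hbd : ∀ f : ℝ → ℝ, IsProfile R f → ∀ a,
      f (a - δ / 2) ≤ ∫ y, f y * ρ (y - a) ∧ ∫ y, f y * ρ (y - a) ≤ f (a + δ / 2) := by
    intro f hf a
    have hc : ∀ c, Integrable (fun y => c * ρ (y - a)) := fun c =>
      (hρ.integrable.comp_sub_right a).const_mul c
    constructor
    · rw [← hmass (f (a - δ / 2)) a]
      refine integral_mono (hc _) (hint f hf a) fun y => ?_
      by_cases hy : y - a ∈ Icc (-(δ / 2)) (δ / 2)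
      · exact mul_le_mul_of_nonneg_right (hf.mono (by linarith [hy.1])) (hρ.nonneg _)
      · simp only [hρ.toIsKernel.eq_zero hy, mul_zero, le_refl]
    · rw [← hmass (f (a + δ / 2)) a]
      refine integral_mono (hint f hf a) (hc _) fun y => ?_
      by_cases hy : y - a ∈ Icc (-(δ / 2)) (δ / 2)
      · exact mul_le_mul_of_nonneg_right (hf.mono (by linarith [hy.2])) (hρ.nonneg _)
      · simp only [hρ.toIsKernel.eq_zero hy, mul_zero, le_refl]
  have t1 := h _ (hsm (x + δ / 2)) (hcp _)
  have t2 := h _ (hsm (x - δ / 2)) (hcp _)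
  filter_upwards [hF, t1.eventually_lt_const (lt_add_of_pos_right _ hη),
    t2.eventually_const_lt (sub_lt_self _ hη)] with i hi h1 h2
  have a1 := (hbd _ hi (x + δ / 2)).1
  have a2 := (hbd _ hi (x - δ / 2)).2
  have a3 := (hbd _ hg (x + δ / 2)).2
  have a4 := (hbd _ hg (x - δ / 2)).1
  rw [add_sub_cancel_right] at a1
  rw [sub_add_cancel] at a2
  rw [add_assoc, add_halves] at a3
  rw [sub_sub, add_halves] at a4
  constructor <;> linarith

namespace IsEntropySolution

variable {T R R₀ : ℝ} {A F : ℝ → ℝ → ℝ} {S F₀ : ℝ → ℝ}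

lemma isProfile (hF : IsEntropySolution T A S F₀ R F) {t : ℝ} (ht : t ∈ Icc 0 T) :
    IsProfile R (F t) := ⟨hF.mono t ht, hF.tails t ht⟩

lemma isPreSolution (hF : IsEntropySolution T A S F₀ R F) :
    IsPreSolution T (clampFlux T A) S R F := by
  refine ⟨hF.bv.1.aestronglyMeasurable, fun t ht => hF.isProfile (Ioo_subset_Icc_self ht),
    fun χ h1 h2 h3 h4 α => (hF.entropy χ h1 h2 h3 h4 α).trans_eq ?_⟩
  refine setIntegral_congr_fun (measurableSet_Ioo.prod MeasurableSet.univ) fun z hz => ?_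
  simp only [entropyIntegrand, clampFlux_eq A (Ioo_subset_Icc_self hz.1)]

lemma tendsto_initial (hF : IsEntropySolution T A S F₀ R F) (hT : 0 < T)
    (h₀ : IsProfile R₀ F₀) : Tendsto (fun t => ∫ x, |F t x - F₀ x|) (𝓝[>] 0) (𝓝 0) := by
  refine IsProfile.tendsto_integral_abs_sub_of_distrib (R := max R R₀) ?_
    (h₀.of_le (le_max_right _ _)) hF.initial
  filter_upwards [Ioo_mem_nhdsGT hT] with t ht
  exact (hF.isProfile (Ioo_subset_Icc_self ht)).of_le (le_max_left _ _)

end IsEntropySolution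

/-! ### Stability -/

/-- The `L¹` stability of entropy solutions. The constant depends on the radius of the first one
only. -/
lemma IsPreSolution.ae_integral_abs_sub_le {T r R R' R₀ R₀' : ℝ} {L L' : NNReal}
    {B B' F G : ℝ → ℝ → ℝ} {S F₀ G₀ : ℝ → ℝ} (hT : 0 < T) (hS : IsKernel r S)
    (hF : IsPreSolution T B S R F) (hG : IsPreSolution T B' S R' G)
    (hB : IsRegularFlux L B) (hB' : IsRegularFlux L' B')
    (hF₀ : IsProfile R₀ F₀) (hG₀ : IsProfile R₀' G₀)
    (hF0 : Tendsto (fun t => ∫ x, |F t x - F₀ x|) (𝓝[>] 0) (𝓝 0))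
    (hG0 : Tendsto (fun t => ∫ x, |G t x - G₀ x|) (𝓝[>] 0) (𝓝 0)) {l : NNReal}
    (hl : ∀ ε : NNReal, 0 < ε → ∃ h₀ > 0, ∀ s ∈ Ioo 0 T, ∀ t ∈ Ioo 0 T, |s - t| ≤ h₀ →
      LipschitzWith (l + ε) (fun v => B s v - B' t v)) :
    ∀ᵐ t, t ∈ Ioo 0 T → ∫ x, |F t x - G t x| ≤
      Real.exp (sourceConst S (R + 1) * t) * ((∫ x, |F₀ x - G₀ x|) + t * l) := by
  obtain ⟨F', hF', hFF'⟩ := hF.exists_isRegularSolution hT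
  obtain ⟨G', hG', hGG'⟩ := hG.exists_isRegularSolution hT
  have hae : ∀ᵐ t, t ∈ Ioo 0 T → ∫ x, |F' t x - G' t x| = ∫ x, |F t x - G t x| := by
    filter_upwards [hFF', hGG'] with t h1 h2 ht
    refine integral_congr_ae ?_
    filter_upwards [h1 ht, h2 ht] with x h3 h4
    rw [h3, h4]
  -- the initial distance, by the triangle inequality through the two initial profiles
  have hinit : ∀ ε > 0, ∃ a > 0, ∀ᵐ s, s ∈ Ioo 0 a →
      ∫ x, |F' s x - G' s x| ≤ (∫ x, |F₀ x - G₀ x|) + ε := by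
    intro ε hε
    have hev : ∀ᶠ s in 𝓝[>] (0 : ℝ), s ∈ Ioo 0 T ∧ ∫ x, |F s x - F₀ x| < ε / 2 ∧
        ∫ x, |G s x - G₀ x| < ε / 2 :=
      Filter.Eventually.and (Ioo_mem_nhdsGT hT) ((hF0.eventually_lt_const (half_pos hε)).and
        (hG0.eventually_lt_const (half_pos hε)))
    rw [eventually_iff, mem_nhdsGT_iff_exists_Ioo_subset] at hev
    obtain ⟨a, ha, hsub⟩ := hev
    refine ⟨a, ha, ?_⟩
    filter_upwards [hae] with s hs hsa
    obtain ⟨h1, h2, h3⟩ := hsub hsa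
    rw [hs h1]
    have i1 := ((hF.profile s h1).integrable_sub hF₀).abs
    have i2 := (hF₀.integrable_sub hG₀).abs
    have i3 := ((hG.profile s h1).integrable_sub hG₀).abs
    have i12 : Integrable (fun x => |F s x - F₀ x| + |F₀ x - G₀ x|) := i1.add i2
    calc ∫ x, |F s x - G s x|
        ≤ ∫ x, (|F s x - F₀ x| + |F₀ x - G₀ x| + |G s x - G₀ x|) := by
          refine integral_mono ((hF.profile s h1).integrable_sub (hG.profile s h1)).abs
            (i12.add i3) fun x => ?_
          simp only
          rw [show F s x - G s x = (F s x - F₀ x) + (F₀ x - G₀ x) - (G s x - G₀ x) by ring]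
          exact (abs_sub _ _).trans (add_le_add (abs_add_le _ _) le_rfl)
      _ = (∫ x, |F s x - F₀ x|) + (∫ x, |F₀ x - G₀ x|) + ∫ x, |G s x - G₀ x| := by
          rw [integral_add i12 i3, integral_add i1 i2]
      _ ≤ _ := by linarith
  have := (hF'.of_le (le_max_left (R + 1) (R' + 1))).ae_integral_abs_sub_le
    (hG'.of_le (le_max_right (R + 1) (R' + 1))) hF'.profile hB hB' hS hl hinit
  filter_upwards [this, hae] with t h1 h2 ht
  rw [← h2 ht]
  exact h1 ht

lemma normL1_eq {f : ℝ → ℝ} (hf : Integrable f) : normL1 f = ENNReal.ofReal (∫ x, |f x|) := by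
  rw [normL1, eLpNorm_one_eq_lintegral_enorm, ← ofReal_integral_norm_eq_lintegral_enorm hf]
  rfl

lemma inCL1_iff {T : ℝ} {D : ℝ → ℝ → ℝ} : InCL1 T D ↔ (∀ t ∈ Icc 0 T, Integrable (D t)) ∧
    ∀ t₀ ∈ Icc 0 T, Tendsto (fun t => ∫ x, |D t x - D t₀ x|) (𝓝[Icc 0 T] t₀) (𝓝 0) := by
  refine and_congr_right fun hi => forall₂_congr fun t₀ ht₀ => ?_
  have hev : (fun t => normL1 (fun x => D t x - D t₀ x))
      =ᶠ[𝓝[Icc 0 T] t₀] fun t => ENNReal.ofReal (∫ x, |D t x - D t₀ x|) := by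
    filter_upwards [self_mem_nhdsWithin] with t ht
    exact normL1_eq ((hi t ht).sub (hi t₀ ht₀))
  rw [tendsto_congr' hev]
  constructor
  · intro h
    have := (ENNReal.tendsto_toReal ENNReal.zero_ne_top).comp h
    refine this.congr fun t => ?_
    exact ENNReal.toReal_ofReal (integral_nonneg fun _ => abs_nonneg _)
  · intro h
    simpa using ENNReal.tendsto_ofReal h

namespace InCL1

variable {T : ℝ} {D E : ℝ → ℝ → ℝ}

lemma sub (hD : InCL1 T D) (hE : InCL1 T E) : InCL1 T (fun t x => D t x - E t x) := by
  rw [inCL1_iff] at *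
  refine ⟨fun t ht => (hD.1 t ht).sub (hE.1 t ht), fun t₀ ht₀ => ?_⟩
  have := (hD.2 t₀ ht₀).add (hE.2 t₀ ht₀)
  rw [add_zero] at this
  refine tendsto_of_tendsto_of_tendsto_of_le_of_le' tendsto_const_nhds this
    (.of_forall fun t => integral_nonneg fun _ => abs_nonneg _) ?_
  filter_upwards [self_mem_nhdsWithin] with t ht
  have i1 : Integrable (fun x => D t x - D t₀ x) := (hD.1 t ht).sub (hD.1 t₀ ht₀)
  have i2 : Integrable (fun x => E t x - E t₀ x) := (hE.1 t ht).sub (hE.1 t₀ ht₀)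
  rw [← integral_add i1.abs i2.abs]
  refine integral_mono (((hD.1 t ht).sub (hE.1 t ht)).sub ((hD.1 t₀ ht₀).sub (hE.1 t₀ ht₀))).abs
    (i1.abs.add i2.abs) fun x => ?_
  simp only
  rw [show D t x - E t x - (D t₀ x - E t₀ x) = (D t x - D t₀ x) - (E t x - E t₀ x) by ring]
  exact abs_sub _ _

lemma sub_const {g : ℝ → ℝ} (hD : InCL1 T D) (hg : Integrable g) :
    InCL1 T (fun t x => D t x - g x) :=
  hD.sub (inCL1_iff.2 ⟨fun _ _ => hg, fun _ _ => by simpa using tendsto_const_nhds⟩)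

lemma continuousOn (hD : InCL1 T D) : ContinuousOn (fun t => ∫ x, |D t x|) (Icc 0 T) := by
  rw [inCL1_iff] at hD
  intro t₀ ht₀
  rw [ContinuousWithinAt, tendsto_iff_dist_tendsto_zero]
  refine tendsto_of_tendsto_of_tendsto_of_le_of_le' tendsto_const_nhds (hD.2 t₀ ht₀)
    (.of_forall fun t => dist_nonneg) ?_
  filter_upwards [self_mem_nhdsWithin] with t ht
  rw [Real.dist_eq, ← integral_sub (hD.1 t ht).abs (hD.1 t₀ ht₀).abs]
  refine abs_integral_le_integral_abs.trans
    (integral_mono ((hD.1 t ht).abs.sub (hD.1 t₀ ht₀).abs).abs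
    ((hD.1 t ht).sub (hD.1 t₀ ht₀)).abs fun x => ?_)
  exact abs_abs_sub_abs_le_abs_sub _ _

end InCL1

lemma le_on_Icc_of_ae {T : ℝ} {f g : ℝ → ℝ} (hT : 0 < T) (hf : ContinuousOn f (Icc 0 T))
    (hg : ContinuousOn g (Icc 0 T)) (h : ∀ᵐ t, t ∈ Ioo 0 T → f t ≤ g t) :
    ∀ t ∈ Icc 0 T, f t ≤ g t := by
  intro t ht
  by_contra hcon
  have hev : ∀ᶠ s in 𝓝[Icc 0 T] t, g s < f s :=
    (hg t ht).eventually_lt (hf t ht) (not_le.1 hcon)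
  obtain ⟨u, hu1, hu2, hu3⟩ := mem_nhdsWithin.1 hev
  have hne : (u ∩ Ioo 0 T).Nonempty := by
    rw [← closure_Ioo hT.ne] at ht
    exact mem_closure_iff.1 ht u hu1 hu2
  refine (hu1.inter isOpen_Ioo).measure_ne_zero volume hne (measure_mono_null (fun s hs => ?_) h)
  simp only [mem_compl_iff, mem_ofPred_eq, Classical.not_imp, not_le]
  exact ⟨hs.2, hu3 ⟨hs.1, Ioo_subset_Icc_self hs.2⟩⟩

/-- The stability estimate in terms of real numbers. -/
lemma stabilityEstimate_of_le {T K R R₀ R₀' t : ℝ} {A A' F G : ℝ → ℝ → ℝ} {F₀ G₀ : ℝ → ℝ}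
    {l : NNReal} (hl : (l : ℝ≥0∞) = ⨆ s ∈ Icc 0 T, lipSeminorm (fun v => A s v - A' s v))
    (hF : IsProfile R (F t)) (hG : IsProfile R (G t)) (hF₀ : IsProfile R₀ F₀)
    (hG₀ : IsProfile R₀' G₀) (ht : 0 ≤ t)
    (h : ∫ x, |F t x - G t x| ≤ Real.exp (K * t) * ((∫ x, |F₀ x - G₀ x|) + t * l)) :
    StabilityEstimate T K A A' F₀ G₀ F G t := by
  rw [StabilityEstimate, ← hl, normL1_eq (hF.integrable_sub hG),
    normL1_eq (hF₀.integrable_sub hG₀), ← ENNReal.ofReal_coe_nnreal, ← ENNReal.ofReal_mul ht,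
    ← ENNReal.ofReal_add (integral_nonneg fun _ => abs_nonneg _)
      (mul_nonneg ht l.coe_nonneg), ← ENNReal.ofReal_mul (Real.exp_pos _).le]
  exact ENNReal.ofReal_le_ofReal h

lemma IsFlux.iSup_lipSeminorm_sub_ne_top {T : ℝ} {A A' : ℝ → ℝ → ℝ} (hA : IsFlux T A)
    (hA' : IsFlux T A') : (⨆ s ∈ Icc 0 T, lipSeminorm (fun v => A s v - A' s v)) ≠ ⊤ := by
  obtain ⟨L, hL⟩ := hA.exists_lipSeminorm_le
  obtain ⟨L', hL'⟩ := hA'.exists_lipSeminorm_le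
  refine ne_top_of_le_ne_top (b := (L + L' : NNReal)) ENNReal.coe_ne_top
    (iSup₂_le fun s hs => ?_)
  push_cast
  refine (lipSeminorm_le_add fun v w => ?_).trans (add_le_add (hL s hs) (hL' s hs))
  have := abs_sub (A s v - A s w) (A' s v - A' s w)
  ring_nf at this ⊢; exact this

lemma IsEntropySolution.stability {T r R R' R₀ R₀' : ℝ} {A A' F G : ℝ → ℝ → ℝ}
    {S F₀ G₀ : ℝ → ℝ} (hT : 0 < T) (hS : IsKernel r S) (hA : IsFlux T A) (hA' : IsFlux T A')
    (hF : IsEntropySolution T A S F₀ R F) (hG : IsEntropySolution T A' S G₀ R' G)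
    (hF₀ : IsProfile R₀ F₀) (hG₀ : IsProfile R₀' G₀) {K : ℝ} (hK : sourceConst S (R + 1) ≤ K) :
    (∀ᵐ t ∂(volume.restrict (Icc 0 T)), StabilityEstimate T K A A' F₀ G₀ F G t) ∧
    (InCL1 T (fun t x => F t x - F₀ x) → InCL1 T (fun t x => G t x - G₀ x) →
      ∀ t ∈ Icc 0 T, StabilityEstimate T K A A' F₀ G₀ F G t) := by
  obtain ⟨L, hB⟩ := hA.exists_isRegularFlux hT.le
  obtain ⟨L', hB'⟩ := hA'.exists_isRegularFlux hT.le
  obtain ⟨l, hl⟩ := WithTop.ne_top_iff_exists.1 (hA.iSup_lipSeminorm_sub_ne_top hA')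
  have hl' : ∀ s ∈ Icc 0 T, lipSeminorm (fun v => A s v - A' s v) ≤ l := fun s hs =>
    (le_iSup₂ (f := fun s (_ : s ∈ Icc 0 T) => lipSeminorm (fun v => A s v - A' s v))
      s hs).trans hl.ge
  have hFp : ∀ t ∈ Icc 0 T, IsProfile (max R R') (F t) := fun t ht =>
    (hF.isProfile ht).of_le (le_max_left _ _)
  have hGp : ∀ t ∈ Icc 0 T, IsProfile (max R R') (G t) := fun t ht =>
    (hG.isProfile ht).of_le (le_max_right _ _)
  have hae : ∀ᵐ t, t ∈ Ioo 0 T → ∫ x, |F t x - G t x| ≤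
      Real.exp (K * t) * ((∫ x, |F₀ x - G₀ x|) + t * l) := by
    filter_upwards [hF.isPreSolution.ae_integral_abs_sub_le hT hS hG.isPreSolution hB hB' hF₀ hG₀
      (hF.tendsto_initial hT hF₀) (hG.tendsto_initial hT hG₀) (hA'.exists_lipschitzWith_sub hl')]
      with t h ht
    refine (h ht).trans (mul_le_mul_of_nonneg_right
      (Real.exp_le_exp.2 (mul_le_mul_of_nonneg_right hK ht.1.le)) ?_)
    exact add_nonneg (integral_nonneg fun _ => abs_nonneg _) (mul_nonneg ht.1.le l.coe_nonneg)
  constructor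
  · rw [← Measure.restrict_congr_set Ioo_ae_eq_Icc, ae_restrict_iff' measurableSet_Ioo]
    filter_upwards [hae] with t h ht
    have ht' := Ioo_subset_Icc_self ht
    exact stabilityEstimate_of_le hl (hFp t ht') (hGp t ht') hF₀ hG₀ ht.1.le (h ht)
  · intro hCF hCG t ht
    refine stabilityEstimate_of_le hl (hFp t ht) (hGp t ht) hF₀ hG₀ ht.1
      (le_on_Icc_of_ae hT ?_ (by fun_prop) hae t ht)
    have := ((hCF.sub hCG).sub_const (hG₀.integrable_sub hF₀)).continuousOn
    refine this.congr fun t _ => integral_congr_ae (.of_forall fun x => ?_)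
    simp only
    congr 1; ring

/-- Uniqueness of entropy solutions. -/
lemma IsEntropySolution.ae_eq {T r R R' R₀ : ℝ} {A F G : ℝ → ℝ → ℝ}
    {S F₀ : ℝ → ℝ} (hT : 0 < T) (hS : IsKernel r S) (hA : IsFlux T A)
    (hF : IsEntropySolution T A S F₀ R F) (hG : IsEntropySolution T A S F₀ R' G)
    (hF₀ : IsProfile R₀ F₀) : ∀ᵐ t ∂(volume.restrict (Icc 0 T)), F t =ᵐ[volume] G t := by
  filter_upwards [(hF.stability hT hS hA hA hG hF₀ hF₀ le_rfl).1,
    ae_restrict_mem measurableSet_Icc] with t h ht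
  have h0 : (⨆ s ∈ Icc 0 T, lipSeminorm (fun v => A s v - A s v)) = 0 := by
    simp [lipSeminorm]
  have h1 : normL1 (fun x => F₀ x - F₀ x) = 0 := by simp [normL1]
  rw [StabilityEstimate, h0, h1, mul_zero, add_zero, mul_zero, nonpos_iff_eq_zero, normL1,
    eLpNorm_eq_zero_iff _ one_ne_zero] at h
  · filter_upwards [h] with x hx
    exact sub_eq_zero.1 hx
  · exact ((hF.isProfile ht).integrable_sub (hG.isProfile ht)).aestronglyMeasurable

/-- A bound on the constant in the stability estimate by the quantities on which it may depend. -/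
lemma IsKernel.sourceConst_le {S : ℝ → ℝ} {r R : ℝ} (hS : IsKernel r S) (hr : 0 < r) (hR : 0 < R) :
    sourceConst S R ≤
      2 * r * supNorm (_root_.deriv S)
        + 2 * R * (2 * r * supNorm (_root_.deriv (_root_.deriv S))) :=
  add_le_add (hS.deriv.integral_abs_le hr)
    (mul_le_mul_of_nonneg_left (hS.deriv.deriv.integral_abs_le hr) (by linarith))

end OpinionBurgers

namespace OpinionBurgers

/-! ### The Lax–Friedrichs scheme -/

/-- The entropy flux `sgn(v - α) (b(v) - b(α))`. -/
noncomputable def entropyFlux (b : ℝ → ℝ) (α v : ℝ) : ℝ := Real.sign (v - α) * (b v - b α)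

/-- One step of the Lax–Friedrichs scheme for `∂ₜu + ∂ₓ(b(u)) = 0`, with mesh width `δ` and time
step `δ / L`. -/
noncomputable def laxFriedrichs (L δ : ℝ) (b u : ℝ → ℝ) (x : ℝ) : ℝ :=
  ((u (x + δ) - b (u (x + δ)) / L) + (u (x - δ) + b (u (x - δ)) / L)) / 2

/-- One explicit Euler step of length `h` for `∂ₜu = 𝐒[u]`. -/
noncomputable def sourceStep (S : ℝ → ℝ) (h : ℝ) (f : ℝ → ℝ) (x : ℝ) : ℝ := f x + h * source S f x

lemma sign_mul_self (x : ℝ) : Real.sign x * x = |x| := by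
  rcases lt_trichotomy x 0 with h | h | h
  · rw [Real.sign_of_neg h, abs_of_neg h]; ring
  · simp [h]
  · rw [Real.sign_of_pos h, abs_of_pos h]; ring

section Step

variable {R r h δ α : ℝ} {L : NNReal} {S b f u η : ℝ → ℝ}

lemma monotone_sub_div (hb : LipschitzWith L b) (hL : 0 < L) : Monotone fun v => v - b v / L := by
  intro v w hvw
  have h1 := hb.dist_le_mul w v
  rw [Real.dist_eq, Real.dist_eq, abs_of_nonneg (sub_nonneg.2 hvw)] at h1
  have hL' : (0 : ℝ) < L := hL
  have h2 : (b w - b v) / L ≤ w - v := by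
    rw [div_le_iff₀ hL', mul_comm]
    exact (le_abs_self _).trans h1
  rw [sub_div] at h2
  simp only
  linarith

lemma monotone_add_div (hb : LipschitzWith L b) (hL : 0 < L) : Monotone fun v => v + b v / L := by
  have := monotone_sub_div (b := fun v => -b v) hb.neg hL
  simpa [neg_div] using this

lemma Monotone.abs_sub_eq {p : ℝ → ℝ} (hp : Monotone p) (v : ℝ) :
    |p v - p α| = Real.sign (v - α) * (p v - p α) := by
  rcases lt_trichotomy v α with h | h | h
  · rw [Real.sign_of_neg (sub_neg.2 h), abs_of_nonpos (sub_nonpos.2 (hp h.le))]; ring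
  · simp [h]
  · rw [Real.sign_of_pos (sub_pos.2 h), abs_of_nonneg (sub_nonneg.2 (hp h.le))]; ring

/-- The scheme does not increase Kruzhkov's entropies: it is monotone and preserves constants. -/
lemma abs_laxFriedrichs_sub_le (hb : LipschitzWith L b) (hL : 0 < L) (u : ℝ → ℝ) (α x : ℝ) :
    |laxFriedrichs L δ b u x - α| ≤
      ((|u (x + δ) - α| - entropyFlux b α (u (x + δ)) / L)
        + (|u (x - δ) - α| + entropyFlux b α (u (x - δ)) / L)) / 2 := by
  have h1 := Monotone.abs_sub_eq (α := α) (monotone_sub_div hb hL) (u (x + δ))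
  have h2 := Monotone.abs_sub_eq (α := α) (monotone_add_div hb hL) (u (x - δ))
  have e1 : |u (x + δ) - α| - entropyFlux b α (u (x + δ)) / L
      = |(u (x + δ) - b (u (x + δ)) / L) - (α - b α / L)| := by
    rw [h1, ← sign_mul_self, entropyFlux]; ring
  have e2 : |u (x - δ) - α| + entropyFlux b α (u (x - δ)) / L
      = |(u (x - δ) + b (u (x - δ)) / L) - (α + b α / L)| := by
    rw [h2, ← sign_mul_self, entropyFlux]; ring
  rw [e1, e2]
  have e3 : laxFriedrichs L δ b u x - α = (((u (x + δ) - b (u (x + δ)) / L) - (α - b α / L))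
      + ((u (x - δ) + b (u (x - δ)) / L) - (α + b α / L))) / 2 := by
    rw [laxFriedrichs]; ring
  rw [e3, abs_div, abs_two]
  exact div_le_div_of_nonneg_right (abs_add_le _ _) zero_le_two

lemma IsProfile.isProfile_laxFriedrichs (hu : IsProfile R u) (hb : LipschitzWith L b) (hL : 0 < L)
    (hδ : 0 ≤ δ) : IsProfile (R + δ) (laxFriedrichs L δ b u) := by
  refine ⟨fun x y hxy => ?_, fun x hx => ⟨?_, ?_⟩⟩
  · have h1 := monotone_sub_div hb hL (hu.mono (add_le_add_left hxy δ))
    have h2 := monotone_add_div hb hL (hu.mono (sub_le_sub_right hxy δ))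
    simp only [laxFriedrichs] at *
    linarith
  · rw [laxFriedrichs, hu.eq_right (by linarith), hu.eq_right (by linarith)]
    ring
  · rw [laxFriedrichs, hu.eq_left (by linarith), hu.eq_left (by linarith)]
    ring

/-- For small time steps the source does not destroy monotonicity. -/
lemma IsProfile.isProfile_sourceStep (hf : IsProfile R f) (hS : IsKernel r S)
    (hodd : ∀ x, S (-x) = -S x)
    (h0 : 0 ≤ h) (h1 : h * ((∫ z, |deriv S z|) / 2) ≤ 1) : IsProfile R (sourceStep S h f) := by
  refine ⟨fun x y hxy => ?_, fun x hx => ⟨?_, ?_⟩⟩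
  · have h2 := (abs_le.1 (hf.abs_source_sub_le hS hxy)).1
    have h3 := mul_le_mul_of_nonneg_left h2 h0
    have h4 := mul_le_mul_of_nonneg_right h1 (sub_nonneg.2 (hf.mono hxy))
    simp only [sourceStep]
    nlinarith
  · rw [sourceStep, hf.source_eq_zero_of_odd hS hodd hx, hf.eq_right hx]; ring
  · rw [sourceStep, hf.source_eq_zero_left hS (by linarith),
      hf.eq_left (by linarith)]; ring

lemma abs_sourceStep_sub_le (S : ℝ → ℝ) (h : ℝ) (f : ℝ → ℝ) (α x : ℝ) :
    |sourceStep S h f x - α| ≤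
      |f x - α| + h * (Real.sign (sourceStep S h f x - α) * source S f x) := by
  have h1 : Real.sign (sourceStep S h f x - α) * (f x - α) ≤ |f x - α| := by
    refine (le_abs_self _).trans ?_
    rw [abs_mul]
    exact mul_le_of_le_one_left (abs_nonneg _) (abs_sign_le _)
  rw [← sign_mul_self]
  have e : sourceStep S h f x - α = (f x - α) + h * source S f x := by rw [sourceStep]; ring
  calc Real.sign (sourceStep S h f x - α) * (sourceStep S h f x - α)
      = Real.sign (sourceStep S h f x - α) * ((f x - α) + h * source S f x) := by rw [← e]
    _ ≤ _ := by linarith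

lemma measurable_entropyFlux (hb : Continuous b) (α : ℝ) : Measurable (entropyFlux b α) :=
  (measurable_sign.comp (measurable_id.sub_const α)).mul (hb.measurable.sub_const _)

lemma abs_entropyFlux_le (hb : LipschitzWith L b) (α v : ℝ) :
    |entropyFlux b α v| ≤ L * |v - α| := by
  rw [entropyFlux, abs_mul]
  refine (mul_le_of_le_one_left (abs_nonneg _) (abs_sign_le _)).trans ?_
  simpa [Real.dist_eq] using hb.dist_le_mul v α

/-- The entropy inequality of the scheme, in the space variable. -/
lemma IsProfile.integral_entropy_laxFriedrichs_nonneg (hf : IsProfile R f) (hS : IsKernel r S)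
    (hodd : ∀ x, S (-x) = -S x) (hb : LipschitzWith L b) (hL : 0 < L)
    (h0 : 0 ≤ h) (h1 : h * ((∫ z, |deriv S z|) / 2) ≤ 1) (hδ : 0 ≤ δ)
    (hη : Continuous η) (hηc : HasCompactSupport η) (hη0 : ∀ x, 0 ≤ η x) (α : ℝ) :
    0 ≤ ∫ x, ((|f x - α| - |laxFriedrichs L δ b (sourceStep S h f) x - α|) * η x
      + h * (Real.sign (sourceStep S h f x - α) * source S f x * η x)
      + |sourceStep S h f x - α| * ((η (x + δ) + η (x - δ)) / 2 - η x)
      + entropyFlux b α (sourceStep S h f x) / L * ((η (x + δ) - η (x - δ)) / 2)) := by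
  have hE := hf.isProfile_sourceStep hS hodd h0 h1
  set E := sourceStep S h f with hEdef
  have hG := hE.isProfile_laxFriedrichs hb hL hδ
  set G := laxFriedrichs L δ b E with hGdef
  have hL' : (0 : ℝ) < L := hL
  set K := (∫ z, |deriv S z|) / 2
  -- products of bounded functions with translates of the test function are integrable
  have hI : ∀ w : ℝ → ℝ, Measurable w → ∀ C, (∀ x, |w x| ≤ C) → ∀ a : ℝ,
      Integrable (fun x => w x * η (x + a)) := fun w hw C hC a =>
    ((hη.integrable_of_hasCompactSupport hηc).comp_add_right a).bdd_mul (c := C)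
      hw.aestronglyMeasurable (.of_forall hC)
  have hI0 : ∀ w : ℝ → ℝ, Measurable w → ∀ C, (∀ x, |w x| ≤ C) →
      Integrable (fun x => w x * η x) := fun w hw C hC => by simpa using hI w hw C hC 0
  have habs : ∀ g R', IsProfile R' g → ∀ x, |g x - α| ≤ 1 / 2 + |α| := fun g R' hg x =>
    (abs_sub _ _).trans (add_le_add (hg.abs_le_half x) le_rfl)
  set q : ℝ → ℝ := fun x => entropyFlux b α (E x) / L with hq
  have hqm : Measurable q :=
    ((measurable_entropyFlux hb.continuous α).comp hE.measurable).div_const _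
  have hqb : ∀ x, |q x| ≤ 1 / 2 + |α| := fun x => by
    simp only [hq]
    rw [abs_div, abs_of_pos hL', div_le_iff₀ hL', mul_comm]
    exact (abs_entropyFlux_le hb α _).trans (mul_le_mul_of_nonneg_left (habs E R hE x) hL'.le)
  have hEm : Measurable fun x => |E x - α| := (hE.measurable.sub_const α).abs
  -- the two halves of the scheme transport `U` and `V`, of which the next entropy is at most the
  -- mean
  set U : ℝ → ℝ := fun x => |E x - α| - q x with hU
  set V : ℝ → ℝ := fun x => |E x - α| + q x with hV
  have hUm : Measurable U := hEm.sub hqm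
  have hVm : Measurable V := hEm.add hqm
  have hUb : ∀ x, |U x| ≤ 1 / 2 + |α| + (1 / 2 + |α|) := fun x =>
    (abs_sub _ _).trans (add_le_add (by rw [abs_abs]; exact habs E R hE x) (hqb x))
  have hVb : ∀ x, |V x| ≤ 1 / 2 + |α| + (1 / 2 + |α|) := fun x =>
    (abs_add_le _ _).trans (add_le_add (by rw [abs_abs]; exact habs E R hE x) (hqb x))
  have iU : Integrable (fun x => U x * η (x - δ)) := by
    simpa [sub_eq_add_neg] using hI U hUm _ hUb (-δ)
  have iV : Integrable (fun x => V x * η (x + δ)) := hI V hVm _ hVb δ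
  have iG := hI0 (fun x => |G x - α|) (hG.measurable.sub_const α).abs _ (fun x => by
    rw [abs_abs]; exact habs G _ hG x)
  have iE := hI0 (fun x => |E x - α|) hEm _ (fun x => by rw [abs_abs]; exact habs E _ hE x)
  have ieq := hI (fun x => |E x - α|) hEm _ (fun x => by rw [abs_abs]; exact habs E _ hE x)
  have iF := hI0 (fun x => |f x - α|) (hf.measurable.sub_const α).abs _ (fun x => by
    rw [abs_abs]; exact habs f _ hf x)
  have iS := hI0 (fun x => Real.sign (E x - α) * source S f x)
    ((measurable_sign.comp (hE.measurable.sub_const α)).mul (hf.measurable_source hS)) K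
    (fun x => by
      rw [abs_mul]
      exact (mul_le_of_le_one_left (abs_nonneg _) (abs_sign_le _)).trans (hf.abs_source_le hS x))
  have hGle : ∫ x, |G x - α| * η x ≤ (∫ x, U x * η (x - δ)) / 2 + (∫ x, V x * η (x + δ)) / 2 := by
    have e1 : ∫ x, U x * η (x - δ) = ∫ x, U (x + δ) * η x := by
      rw [← integral_add_right_eq_self _ δ]; simp
    have e2 : ∫ x, V x * η (x + δ) = ∫ x, V (x - δ) * η x := by
      rw [← integral_sub_right_eq_self _ δ]; simp
    have i1 : Integrable (fun x => U (x + δ) * η x) := by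
      simpa using iU.comp_add_right δ
    have i2 : Integrable (fun x => V (x - δ) * η x) := by
      simpa using iV.comp_sub_right δ
    rw [e1, e2, ← integral_div, ← integral_div, ← integral_add (i1.div_const 2) (i2.div_const 2)]
    refine integral_mono iG ((i1.div_const 2).add (i2.div_const 2)) fun x => ?_
    have := mul_le_mul_of_nonneg_right
      (abs_laxFriedrichs_sub_le (δ := δ) hb hL E α x) (hη0 x)
    simp only [hU, hV, hq] at *
    linarith
  have hmain : 0 ≤ ∫ x, (U x * η (x - δ) / 2 + V x * η (x + δ) / 2 - |G x - α| * η x) := by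
    have i12 : Integrable (fun x => U x * η (x - δ) / 2 + V x * η (x + δ) / 2) :=
      (iU.div_const 2).add (iV.div_const 2)
    rw [integral_sub i12 iG, integral_add (iU.div_const 2) (iV.div_const 2), integral_div,
      integral_div]
    linarith
  -- the explicit source step, by convexity of the entropy
  have hrest : 0 ≤ ∫ x, (|f x - α| * η x + h * (Real.sign (E x - α) * source S f x * η x)
      - |E x - α| * η x) := by
    refine integral_nonneg fun x => ?_
    have := mul_le_mul_of_nonneg_right (abs_sourceStep_sub_le S h f α x) (hη0 x)
    simp only [Pi.zero_apply]
    linarith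
  have j1 : Integrable (fun x => U x * η (x - δ) / 2 + V x * η (x + δ) / 2 - |G x - α| * η x) :=
    ((iU.div_const 2).add (iV.div_const 2)).sub iG
  have j2 : Integrable (fun x => |f x - α| * η x
      + h * (Real.sign (E x - α) * source S f x * η x) - |E x - α| * η x) :=
    (iF.add (iS.const_mul h)).sub iE
  have := add_nonneg hmain hrest
  rw [← integral_add j1 j2] at this
  refine this.trans_eq (integral_congr_ae (.of_forall fun x => ?_))
  simp only [hU, hV, hq]
  ring

lemma IsProfile.integral_abs_laxFriedrichs_sub_le (hu : IsProfile R u) (hb : LipschitzWith L b)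
    (hL : 0 < L) (hδ : 0 ≤ δ) : ∫ x, |laxFriedrichs L δ b u x - u x| ≤ 2 * δ := by
  have hL' : (0 : ℝ) < L := hL
  have hq : ∀ v w : ℝ, |b v - b w| / L ≤ |v - w| := fun v w => by
    rw [div_le_iff₀ hL', mul_comm]
    simpa [Real.dist_eq] using hb.dist_le_mul v w
  have i1 := hu.integrable_abs_comp_add_sub δ
  have i2 := hu.integrable_abs_comp_add_sub (-δ)
  calc ∫ x, |laxFriedrichs L δ b u x - u x|
      ≤ ∫ x, (|u (x + δ) - u x| + |u (x + -δ) - u x|) := by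
        refine integral_mono (((hu.isProfile_laxFriedrichs hb hL hδ).integrable_sub hu).abs)
          (i1.add i2) fun x => ?_
        simp only [laxFriedrichs, ← sub_eq_add_neg]
        have h1 := hq (u (x + δ)) (u x)
        have h2 := hq (u (x - δ)) (u x)
        rw [← abs_of_pos hL', ← abs_div, sub_div] at h1 h2
        replace h1 := abs_le.1 h1
        replace h2 := abs_le.1 h2
        have h3 := abs_le.1 (le_refl |u (x + δ) - u x|)
        have h4 := abs_le.1 (le_refl |u (x - δ) - u x|)
        rw [abs_le]
        constructor <;> linarith [h1.1, h1.2, h2.1, h2.2, h3.1, h3.2, h4.1, h4.2]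
    _ = 2 * δ := by
        rw [integral_add i1 i2, hu.integral_abs_comp_add_sub, hu.integral_abs_comp_add_sub,
          abs_neg, abs_of_nonneg hδ]
        ring

lemma IsProfile.integral_abs_sourceStep_sub_le (hf : IsProfile R f) (hS : IsKernel r S)
    (hodd : ∀ x, S (-x) = -S x) (h0 : 0 ≤ h) :
    ∫ x, |sourceStep S h f x - f x| ≤ h * (R * ∫ z, |deriv S z|) := by
  have hR := hf.radius_pos
  have := abs_integral_le_of_bounded_of_support (μ := volume)
    (f := fun x => |sourceStep S h f x - f x|)
    (K := Icc (-R) R) (C := h * ((∫ z, |deriv S z|) / 2)) (by simp) (fun x => by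
      rw [abs_abs, sourceStep, add_sub_cancel_left, abs_mul, abs_of_nonneg h0]
      exact mul_le_mul_of_nonneg_left (hf.abs_source_le hS x) h0)
    (fun x hx => by
      rw [sourceStep, hf.source_eq_zero_of_le hS le_rfl
        (hf.source_eq_zero_of_odd hS hodd le_rfl) fun h' => hx (Ioo_subset_Icc_self h')]
      simp)
  rw [measureReal_def, Real.volume_Icc, ENNReal.toReal_ofReal (by linarith)] at this
  refine (le_abs_self _).trans (this.trans_eq ?_)
  ring

end Step
end OpinionBurgers

namespace OpinionBurgers

section Scheme

variable {T R r h : ℝ} {L : NNReal} {S F₀ : ℝ → ℝ} {B : ℝ → ℝ → ℝ}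

/-- The iterates of the scheme with time step `h`: an Euler step for the source followed by a
Lax–Friedrichs step for the flux. -/
noncomputable def scheme (S : ℝ → ℝ) (B : ℝ → ℝ → ℝ) (L h : ℝ) (F₀ : ℝ → ℝ) : ℕ → ℝ → ℝ
  | 0 => F₀
  | k + 1 => laxFriedrichs L (h * L) (B (k * h)) (sourceStep S h (scheme S B L h F₀ k))

/-- The index of the iterate used at time `t`, where `t` is first projected onto `[0, T]`. -/
noncomputable def stepIndex (T h t : ℝ) : ℕ := ⌊max 0 (min t T) / h⌋₊

lemma stepIndex_mul_le (hT : 0 ≤ T) (hh : 0 < h) (t : ℝ) :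
    stepIndex T h t * h ≤ max 0 (min t T) := by
  rw [← le_div_iff₀ hh]
  exact Nat.floor_le (div_nonneg (clamp_mem_Icc hT t).1 hh.le)

lemma lt_stepIndex_add_one_mul (hh : 0 < h) (t : ℝ) :
    max 0 (min t T) < stepIndex T h t * h + h := by
  have := Nat.lt_floor_add_one (max 0 (min t T) / h)
  rw [div_lt_iff₀ hh] at this
  rw [stepIndex]; linarith

lemma scheme_isProfile (hF₀ : IsProfile R F₀) (hS : IsKernel r S) (hodd : ∀ x, S (-x) = -S x)
    (hB : IsRegularFlux L B) (hL : 0 < L) (h0 : 0 ≤ h) (h1 : h * ((∫ z, |deriv S z|) / 2) ≤ 1)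
    (k : ℕ) : IsProfile (R + k * h * L) (scheme S B L h F₀ k) := by
  induction k with
  | zero => simpa [scheme] using hF₀
  | succ k ih =>
    refine ((ih.isProfile_sourceStep hS hodd h0 h1).isProfile_laxFriedrichs (hB.lip (k * h)) hL
      (mul_nonneg h0 L.coe_nonneg)).of_le (le_of_eq ?_)
    push_cast; ring

/-- The constant of time-equicontinuity of the scheme. -/
noncomputable def schemeConst (S : ℝ → ℝ) (R : ℝ) (L : NNReal) : ℝ := 2 * L + R * ∫ z, |deriv S z|

lemma integral_abs_scheme_succ_sub_le (hF₀ : IsProfile R F₀) (hS : IsKernel r S)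
    (hodd : ∀ x, S (-x) = -S x) (hB : IsRegularFlux L B) (hL : 0 < L) (h0 : 0 ≤ h)
    (h1 : h * ((∫ z, |deriv S z|) / 2) ≤ 1) {k : ℕ} (hk : k * h ≤ T) :
    ∫ x, |scheme S B L h F₀ (k + 1) x - scheme S B L h F₀ k x|
      ≤ h * schemeConst S (R + T * L) L := by
  have hp := (scheme_isProfile hF₀ hS hodd hB hL h0 h1 k).of_le
    (show R + k * h * L ≤ R + T * L by
      have := mul_le_mul_of_nonneg_right hk L.coe_nonneg
      linarith)
  set f := scheme S B L h F₀ k with hf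
  have hE := hp.isProfile_sourceStep hS hodd h0 h1
  have hδ : 0 ≤ h * L := mul_nonneg h0 L.coe_nonneg
  have hG := hE.isProfile_laxFriedrichs (hB.lip (k * h)) hL hδ
  have e1 := hE.integral_abs_laxFriedrichs_sub_le (hB.lip (k * h)) hL hδ
  have e2 := hp.integral_abs_sourceStep_sub_le hS hodd h0
  have i1 := (hG.integrable_sub hE).abs
  have i2 := (hE.integrable_sub hp).abs
  have : ∫ x, |scheme S B L h F₀ (k + 1) x - f x| ≤
      ∫ x, (|laxFriedrichs L (h * L) (B (k * h)) (sourceStep S h f) x - sourceStep S h f x|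
        + |sourceStep S h f x - f x|) := by
    refine integral_mono (hG.integrable_sub hp).abs (i1.add i2) fun x => ?_
    exact abs_sub_le _ _ _
  rw [integral_add i1 i2] at this
  rw [schemeConst]
  linarith

lemma integral_abs_scheme_sub_le (hF₀ : IsProfile R F₀) (hS : IsKernel r S)
    (hodd : ∀ x, S (-x) = -S x) (hB : IsRegularFlux L B) (hL : 0 < L) (h0 : 0 ≤ h)
    (h1 : h * ((∫ z, |deriv S z|) / 2) ≤ 1) {j : ℕ} (n : ℕ) (hk : (j + n : ℕ) * h ≤ T) :
    ∫ x, |scheme S B L h F₀ (j + n) x - scheme S B L h F₀ j x|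
      ≤ n * h * schemeConst S (R + T * L) L := by
  have hp := scheme_isProfile hF₀ hS hodd hB hL h0 h1
  induction n with
  | zero => simp
  | succ n ih =>
    push_cast at hk ih
    have hn := ih (by linarith)
    have h2 := integral_abs_scheme_succ_sub_le (T := T) hF₀ hS hodd hB hL h0 h1 (k := j + n)
      (by push_cast; linarith)
    have i1 := ((hp (j + n + 1)).integrable_sub (hp (j + n))).abs
    have i2 := ((hp (j + n)).integrable_sub (hp j)).abs
    have : ∫ x, |scheme S B L h F₀ (j + (n + 1)) x - scheme S B L h F₀ j x| ≤
        ∫ x, (|scheme S B L h F₀ (j + n + 1) x - scheme S B L h F₀ (j + n) x|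
        + |scheme S B L h F₀ (j + n) x - scheme S B L h F₀ j x|) :=
      integral_mono ((hp _).integrable_sub (hp j)).abs (i1.add i2) fun x => abs_sub_le _ _ _
    rw [integral_add i1 i2] at this
    push_cast
    linarith

/-- The piecewise constant interpolation in time of the scheme. -/
noncomputable def schemeInterp (T : ℝ) (S : ℝ → ℝ) (B : ℝ → ℝ → ℝ) (L : NNReal) (F₀ : ℝ → ℝ)
    (h t : ℝ) : ℝ → ℝ := scheme S B L h F₀ (stepIndex T h t)

lemma schemeInterp_isProfile (hT : 0 ≤ T) (hF₀ : IsProfile R F₀) (hS : IsKernel r S)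
    (hodd : ∀ x, S (-x) = -S x) (hB : IsRegularFlux L B) (hL : 0 < L) (h0 : 0 < h)
    (h1 : h * ((∫ z, |deriv S z|) / 2) ≤ 1) (t : ℝ) :
    IsProfile (R + T * L) (schemeInterp T S B L F₀ h t) := by
  refine (scheme_isProfile hF₀ hS hodd hB hL h0.le h1 _).of_le ?_
  have := mul_le_mul_of_nonneg_right ((stepIndex_mul_le hT h0 t).trans (clamp_mem_Icc hT t).2)
    L.coe_nonneg
  linarith

lemma measurable_stepIndex (T h : ℝ) : Measurable (stepIndex T h) :=
  Nat.measurable_floor.comp (by fun_prop)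

lemma measurable_schemeInterp (hF₀ : IsProfile R F₀) (hS : IsKernel r S)
    (hodd : ∀ x, S (-x) = -S x) (hB : IsRegularFlux L B) (hL : 0 < L) (h0 : 0 ≤ h)
    (h1 : h * ((∫ z, |deriv S z|) / 2) ≤ 1) :
    Measurable (Function.uncurry (schemeInterp T S B L F₀ h)) := by
  have h2 : Measurable (fun p : ℕ × ℝ => scheme S B L h F₀ p.1 p.2) :=
    measurable_from_prod_countable_right fun k =>
      (scheme_isProfile hF₀ hS hodd hB hL h0 h1 k).measurable
  exact h2.comp (f := fun z : ℝ × ℝ => (stepIndex T h z.1, z.2))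
    (((measurable_stepIndex T h).comp measurable_fst).prodMk measurable_snd)

lemma integral_abs_schemeInterp_sub_le (hT : 0 ≤ T) (hF₀ : IsProfile R F₀) (hS : IsKernel r S)
    (hodd : ∀ x, S (-x) = -S x) (hB : IsRegularFlux L B) (hL : 0 < L) (h0 : 0 < h)
    (h1 : h * ((∫ z, |deriv S z|) / 2) ≤ 1) (s t : ℝ) :
    ∫ x, |schemeInterp T S B L F₀ h t x - schemeInterp T S B L F₀ h s x|
      ≤ schemeConst S (R + T * L) L * (|t - s| + h) := by
  wlog hst : s ≤ t generalizing s t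
  · have := this t s (le_of_not_ge hst)
    rw [abs_sub_comm s t] at this
    simpa only [abs_sub_comm] using this
  have hR := hF₀.radius_pos
  have hC : 0 ≤ schemeConst S (R + T * L) L := by
    unfold schemeConst; positivity
  have hmono : stepIndex T h s ≤ stepIndex T h t := by
    refine Nat.floor_le_floor (div_le_div_of_nonneg_right ?_ h0.le)
    exact max_le_max le_rfl (min_le_min hst le_rfl)
  obtain ⟨n, hn⟩ := Nat.exists_eq_add_of_le hmono
  have hle := stepIndex_mul_le hT h0 t
  have := integral_abs_scheme_sub_le (T := T) hF₀ hS hodd hB hL h0.le h1 n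
    (j := stepIndex T h s) (by rw [← hn]; exact hle.trans (clamp_mem_Icc hT t).2)
  rw [schemeInterp, schemeInterp, hn]
  refine this.trans ?_
  rw [mul_comm]
  refine mul_le_mul_of_nonneg_left ?_ hC
  have h2 := lt_stepIndex_add_one_mul (T := T) h0 s
  have h3 : max 0 (min t T) - max 0 (min s T) ≤ |t - s| := by
    refine (le_abs_self _).trans ((abs_max_sub_max_le_max _ _ _ _).trans ?_)
    rw [sub_self, abs_zero, max_eq_right (abs_nonneg _)]
    refine (abs_min_sub_min_le_max _ _ _ _).trans ?_
    rw [sub_self, abs_zero, max_eq_left (abs_nonneg _)]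
  rw [hn] at hle
  push_cast at hle
  linarith

end Scheme

/-! ### Compactness -/

lemma ae_tendsto_of_summable_integral {f : ℕ → ℝ → ℝ} {g : ℝ → ℝ}
    (hi : ∀ n, Integrable (fun x => f n x - g x))
    (hs : Summable fun n => ∫ x, |f n x - g x|) :
    ∀ᵐ x, Tendsto (fun n => f n x) atTop (𝓝 (g x)) := by
  have h1 : ∫⁻ x, ∑' n, ‖f n x - g x‖ₑ ≠ ⊤ := by
    rw [lintegral_tsum fun n => (hi n).aestronglyMeasurable.enorm]
    have : ∀ n, ∫⁻ x, ‖f n x - g x‖ₑ = ENNReal.ofReal (∫ x, |f n x - g x|) := fun n =>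
      (ofReal_integral_norm_eq_lintegral_enorm (hi n)).symm
    simp only [this]
    exact hs.tsum_ofReal_ne_top
  have h2 := ae_lt_top' (AEMeasurable.tsum fun n => (hi n).aestronglyMeasurable.enorm) h1
  filter_upwards [h2] with x hx
  have h3 := ENNReal.tendsto_atTop_zero_of_tsum_ne_top hx.ne
  rw [tendsto_iff_edist_tendsto_0]
  simpa only [edist_eq_enorm_sub] using h3

/-- Helly's theorem for families of profiles which are almost equicontinuous in time with values in
`L¹`: a subsequence converges, at every time, almost everywhere and in `L¹`. The limit is first
taken along an ultrafilter; equicontinuity makes this limit uniform in time, so that it is attained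
along a sequence. -/
lemma exists_subseq_tendsto_profile {T R C : ℝ} {F : ℕ → ℝ → ℝ → ℝ} {h : ℕ → ℝ}
    (hh : Tendsto h atTop (𝓝 0)) (hm : ∀ n, Measurable (Function.uncurry (F n)))
    (hF : ∀ n t, IsProfile R (F n t)) (hC : 0 ≤ C) (hT : 0 ≤ T)
    (hequi : ∀ n s t, ∫ x, |F n t x - F n s x| ≤ C * (|t - s| + h n))
    (hclamp : ∀ n t, F n (max 0 (min t T)) = F n t) :
    ∃ φ : ℕ → ℕ, Tendsto φ atTop atTop ∧ ∃ G : ℝ → ℝ → ℝ, Measurable (Function.uncurry G) ∧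
      (∀ t, IsProfile R (G t)) ∧
      (∀ t x, (∃ c, ∀ n, F n t x = c) → ∀ n, G t x = F n t x) ∧
      (∀ t, ∀ᵐ x, Tendsto (fun j => F (φ j) t x) atTop (𝓝 (G t x))) ∧
      ∀ s t, ∫ x, |G t x - G s x| ≤ C * |t - s| := by
  set U : Ultrafilter ℕ := hyperfilter ℕ with hU
  have hUtop : (U : Filter ℕ) ≤ atTop := by
    rw [← Nat.cofinite_eq_atTop]; exact hyperfilter_le_cofinite
  have hlim : ∀ t x, ∃ l, Tendsto (fun n => F n t x) U (𝓝 l) := fun t x => by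
    obtain ⟨l, -, hl⟩ := (isCompact_Icc (a := (-1 / 2 : ℝ)) (b := 1 / 2)).ultrafilter_le_nhds
      (U.map fun n => F n t x) (by
        rw [le_principal_iff, Ultrafilter.mem_coe, Ultrafilter.mem_map]
        exact Filter.univ_mem' fun n => (hF n t).mem_fluxDomain x)
    exact ⟨l, hl⟩
  choose P hP using hlim
  have hPp : ∀ t, IsProfile R (P t) := fun t => by
    refine ⟨fun x y hxy => le_of_tendsto_of_tendsto' (hP t x) (hP t y)
      fun n => (hF n t).mono hxy, fun x hx => ⟨?_, ?_⟩⟩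
    · exact tendsto_nhds_unique (hP t x)
        (tendsto_const_nhds.congr fun n => ((hF n t).tails x hx).1.symm)
    · exact tendsto_nhds_unique (hP t (-x))
        (tendsto_const_nhds.congr fun n => ((hF n t).tails x hx).2.symm)
  have hL1 : ∀ t, Tendsto (fun n => ∫ x, |F n t x - P t x|) U (𝓝 0) := fun t => by
    refine IsProfile.tendsto_integral_abs_sub (.of_forall fun n => hF n t) (hPp t)
      fun x δ hδ η hη => ?_
    have h1 := (hP t x).eventually_lt_const (lt_add_of_pos_right _ hη)
    have h2 := (hP t x).eventually_const_lt (sub_lt_self _ hη)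
    filter_upwards [h1, h2] with n h3 h4
    exact ⟨h3.le.trans (by linarith [(hPp t).mono (show x ≤ x + δ by linarith)]),
      le_trans (by linarith [(hPp t).mono (show x - δ ≤ x by linarith)]) h4.le⟩
  have htri : ∀ a b c d : ℝ → ℝ, IsProfile R a → IsProfile R b → IsProfile R c → IsProfile R d →
      ∫ x, |a x - d x| ≤ (∫ x, |a x - b x|) + (∫ x, |b x - c x|) + ∫ x, |c x - d x| := by
    intro a b c d ha hb hc hd
    have i1 := (ha.integrable_sub hb).abs
    have i2 := (hb.integrable_sub hc).abs
    have i3 := (hc.integrable_sub hd).abs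
    have i12 : Integrable (fun x => |a x - b x| + |b x - c x|) := i1.add i2
    rw [← integral_add i1 i2, ← integral_add i12 i3]
    refine integral_mono (ha.integrable_sub hd).abs (i12.add i3) fun x => ?_
    exact (abs_sub_le _ (c x) _).trans (add_le_add (abs_sub_le _ _ _) le_rfl)
  have hhU : Tendsto h U (𝓝 0) := hh.mono_left hUtop
  have hPequi : ∀ s t, ∫ x, |P t x - P s x| ≤ C * |t - s| := fun s t => by
    have hlim : Tendsto (fun n => (∫ x, |F n t x - P t x|) + C * (|t - s| + h n)
        + ∫ x, |F n s x - P s x|) U (𝓝 (0 + C * (|t - s| + 0) + 0)) :=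
      ((hL1 t).add ((hhU.const_add _).const_mul C)).add (hL1 s)
    simp only [zero_add, add_zero] at hlim
    refine ge_of_tendsto' hlim fun n => ?_
    refine (htri _ (F n t) (F n s) _ (hPp t) (hF n t) (hF n s) (hPp s)).trans ?_
    simp only [abs_sub_comm (P t _)]
    linarith [hequi n s t]
  have hPclamp : ∀ t, P (max 0 (min t T)) = P t := fun t => by
    ext x
    refine tendsto_nhds_unique (hP _ x) ((hP t x).congr fun n => ?_)
    rw [hclamp]
  have hunif : ∀ ε > 0, ∀ᶠ n in (U : Filter ℕ), ∀ t, ∫ x, |F n t x - P t x| ≤ ε := by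
    intro ε hε
    set e := ε / (4 * (C + 1)) with he
    have he0 : 0 < e := by positivity
    obtain ⟨s, -, hsf, hcov⟩ := (isCompact_Icc (a := (0 : ℝ)) (b := T)).finite_cover_balls he0
    have h1 : ∀ᶠ n in (U : Filter ℕ), ∀ i ∈ s, ∫ x, |F n i x - P i x| < ε / 4 :=
      (eventually_all_finite hsf).2 fun i _ => (hL1 i).eventually_lt_const (by positivity)
    have h2 : ∀ᶠ n in (U : Filter ℕ), h n < e := hhU.eventually_lt_const he0
    filter_upwards [h1, h2] with n h3 h4 t
    rw [← hclamp, ← hPclamp]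
    obtain ⟨i, hi, hti⟩ := mem_iUnion₂.1 (hcov (clamp_mem_Icc hT t))
    set τ := max 0 (min t T)
    rw [Metric.mem_ball, Real.dist_eq] at hti
    refine (htri _ (F n i) (P i) _ (hF n τ) (hF n i) (hPp i) (hPp τ)).trans ?_
    have a1 := hequi n i τ
    have a2 := hPequi τ i
    rw [abs_sub_comm] at a2
    have a3 := h3 i hi
    have a4 : C * (|τ - i| + h n) ≤ C * (e + e) := mul_le_mul_of_nonneg_left (by linarith) hC
    have a5 : C * |τ - i| ≤ C * e := mul_le_mul_of_nonneg_left hti.le hC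
    have a6 : C * e ≤ ε / 4 := by
      rw [he, mul_div_assoc', div_le_iff₀ (by positivity)]
      nlinarith
    linarith
  have hsub : ∀ j : ℕ, ∃ n, j ≤ n ∧ ∀ t, ∫ x, |F n t x - P t x| ≤ (1 / 2) ^ j := fun j =>
    (Eventually.and (hUtop (eventually_ge_atTop j)) (hunif _ (by positivity))).exists
  choose φ hφ1 hφ2 using hsub
  have hae : ∀ t, ∀ᵐ x, Tendsto (fun j => F (φ j) t x) atTop (𝓝 (P t x)) := fun t =>
    ae_tendsto_of_summable_integral (fun j => (hF _ t).integrable_sub (hPp t))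
      (summable_geometric_two.of_nonneg_of_le (fun j => integral_nonneg fun _ => abs_nonneg _)
        fun j => hφ2 j t)
  -- unlike the ultrafilter limit, the limit superior is jointly measurable
  set G : ℝ → ℝ → ℝ := fun t x => limsup (fun j => F (φ j) t x) atTop with hG
  have hGP : ∀ t, G t =ᵐ[volume] P t := fun t => (hae t).mono fun x hx => hx.limsup_eq
  have hbdd : ∀ t x, IsBoundedUnder (· ≤ ·) atTop fun j => F (φ j) t x := fun t x =>
    isBoundedUnder_of ⟨1 / 2, fun j => (hF _ t).le_half x⟩
  have hcob : ∀ t x, IsCoboundedUnder (· ≤ ·) atTop fun j => F (φ j) t x := fun t x =>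
    (isBoundedUnder_of ⟨-1 / 2, fun j => (hF _ t).neg_half_le x⟩ :
      IsBoundedUnder (· ≥ ·) atTop fun j => F (φ j) t x).isCoboundedUnder_le
  refine ⟨φ, tendsto_atTop_mono hφ1 tendsto_id, G, ?_, fun t => ⟨fun x y hxy => ?_, fun x hx => ?_⟩,
    ?_, fun t => ?_, fun s t => ?_⟩
  · exact Measurable.limsup fun j => hm (φ j)
  · exact limsup_le_limsup (.of_forall fun j => (hF _ t).mono hxy) (hcob t x) (hbdd t y)
  · constructor
    · simp only [hG, ((hF _ t).tails x hx).1, limsup_const]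
    · simp only [hG, ((hF _ t).tails x hx).2, limsup_const]
  · rintro t x ⟨c, hc⟩ n
    simp only [hG, hc, limsup_const]
  · filter_upwards [hae t, hGP t] with x h1 h2
    rwa [h2]
  · refine (le_of_eq (integral_congr_ae ?_)).trans (hPequi s t)
    filter_upwards [hGP s, hGP t] with x h1 h2
    rw [h1, h2]

end OpinionBurgers

namespace OpinionBurgers

/-! ### Difference quotients of test functions -/

/-- The difference quotient of `χ` in the direction `v` with increment `s`. -/
noncomputable def slopeDir (χ : ℝ × ℝ → ℝ) (v : ℝ × ℝ) (s : ℝ) (z : ℝ × ℝ) : ℝ :=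
  s⁻¹ * (χ (z + s • v) - χ z)

section Slope

variable {χ : ℝ × ℝ → ℝ}

lemma continuous_slopeDir (hχ : Continuous χ) (v : ℝ × ℝ) (s : ℝ) :
    Continuous (slopeDir χ v s) := by
  unfold slopeDir; fun_prop

lemma abs_slopeDir_le {C : NNReal} (hχ : LipschitzWith C χ) {v : ℝ × ℝ} (hv : ‖v‖ ≤ 1) (s : ℝ)
    (z : ℝ × ℝ) : |slopeDir χ v s z| ≤ C := by
  rcases eq_or_ne s 0 with rfl | hs
  · simp [slopeDir]
  have h1 := hχ.dist_le_mul (z + s • v) z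
  rw [Real.dist_eq, dist_eq_norm, add_sub_cancel_left, norm_smul, Real.norm_eq_abs] at h1
  have hs' := abs_pos.2 hs
  rw [slopeDir, abs_mul, abs_inv, inv_mul_le_iff₀ hs']
  refine h1.trans ?_
  have := mul_le_mul_of_nonneg_left hv (mul_nonneg C.coe_nonneg (abs_nonneg s))
  linarith

lemma slopeDir_eq_zero {v z : ℝ × ℝ} (hv : ‖v‖ ≤ 1) {s : ℝ} (hs : |s| ≤ 1)
    (hz : z ∉ Metric.cthickening 1 (tsupport χ)) : slopeDir χ v s z = 0 := by
  have h1 : z ∉ tsupport χ := fun h => hz (Metric.self_subset_cthickening _ h)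
  have h2 : z + s • v ∉ tsupport χ := fun h => by
    refine hz (Metric.mem_cthickening_of_dist_le z _ 1 _ h ?_)
    rw [dist_self_add_right, norm_smul, Real.norm_eq_abs]
    exact mul_le_one₀ hs (norm_nonneg _) hv
  rw [slopeDir, image_eq_zero_of_notMem_tsupport h1, image_eq_zero_of_notMem_tsupport h2]
  simp

lemma tendsto_slopeDir (hχ : Differentiable ℝ χ) (v z : ℝ × ℝ) :
    Tendsto (fun s => slopeDir χ v s z) (𝓝[>] 0) (𝓝 (fderiv ℝ χ z v)) := by
  have := ((hχ z).hasFDerivAt.hasLineDerivAt v).tendsto_slope_zero_right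
  simpa [slopeDir] using this

end Slope

/-! ### Passage to the limit in the scheme -/

section Limit

variable {T R r h : ℝ} {L : NNReal} {S F₀ : ℝ → ℝ} {B : ℝ → ℝ → ℝ} {χ : ℝ × ℝ → ℝ}

/-- The source is continuous with respect to almost everywhere convergence of profiles. -/
lemma tendsto_source {f : ℕ → ℝ → ℝ} {g : ℝ → ℝ} (hf : ∀ n, IsProfile R (f n))
    (hS : IsKernel r S)
    (h : ∀ᵐ x, Tendsto (fun n => f n x) atTop (𝓝 (g x))) {x : ℝ}
    (hx : Tendsto (fun n => f n x) atTop (𝓝 (g x))) :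
    Tendsto (fun n => source S (f n) x) atTop (𝓝 (source S g x)) := by
  have hconv : ∀ φ, IsKernel r φ → ∀ x,
      Tendsto (fun n => conv φ (f n) x) atTop (𝓝 (conv φ g x)) := by
    intro φ hφ x
    refine tendsto_integral_of_dominated_convergence (fun y => |φ (x - y)| * (1 / 2))
      (fun n => (hφ.integrable_conv_integrand (hf n).measurable (hf n).abs_le_half x).1)
      ((hφ.integrable.comp_sub_left x).abs.mul_const _) (fun n => .of_forall fun y => ?_) ?_
    · rw [Real.norm_eq_abs, abs_mul]
      exact mul_le_mul_of_nonneg_left ((hf n).abs_le_half y) (abs_nonneg _)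
    · filter_upwards [h] with y hy using hy.const_mul _
  refine (hx.mul (hconv _ hS.deriv x)).sub ?_
  set M := (∫ y, |deriv (deriv S) y|) / 2
  refine tendsto_integral_of_dominated_convergence
    ((Icc (-R - r) (R + r)).indicator fun _ => 1 / 2 * M)
    (fun n => ((hf n).integrable_mul_conv hS).1.restrict) ?_
    (fun n => .of_forall fun y => ?_) ?_
  · exact ((integrable_indicator_iff measurableSet_Icc).2
      (integrableOn_const (by simp))).integrableOn
  · rw [Real.norm_eq_abs, abs_mul]
    by_cases hy : y ∈ Icc (-R - r) (R + r)
    · rw [indicator_of_mem hy]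
      exact mul_le_mul ((hf n).abs_le_half y) ((hf n).abs_conv_le hS.deriv.deriv y) (abs_nonneg _)
        (by norm_num)
    · rw [indicator_of_notMem hy, (hf n).conv_eq_zero hS.deriv.deriv hS.deriv.integral_deriv
        fun h' => hy (Ioo_subset_Icc_self h'), abs_zero, mul_zero]
  · filter_upwards [ae_restrict_of_ae h] with y hy using hy.mul (hconv _ hS.deriv.deriv y)

/-- The integrand of the discrete entropy inequality. -/
noncomputable def schemeIntegrand (T : ℝ) (S : ℝ → ℝ) (B : ℝ → ℝ → ℝ) (L : NNReal) (F₀ : ℝ → ℝ)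
    (h : ℝ) (χ : ℝ × ℝ → ℝ) (α : ℝ) (z : ℝ × ℝ) : ℝ :=
  -(|schemeInterp T S B L F₀ h z.1 z.2 - α| * slopeDir χ (-1, 0) h z)
    + Real.sign (sourceStep S h (schemeInterp T S B L F₀ h z.1) z.2 - α)
        * source S (schemeInterp T S B L F₀ h z.1) z.2 * χ z
    + |sourceStep S h (schemeInterp T S B L F₀ h z.1) z.2 - α|
        * (L / 2 * (slopeDir χ (0, 1) (h * L) z + slopeDir χ (0, -1) (h * L) z))
    + entropyFlux (B (stepIndex T h z.1 * h)) α
        (sourceStep S h (schemeInterp T S B L F₀ h z.1) z.2)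
        * ((slopeDir χ (0, 1) (h * L) z - slopeDir χ (0, -1) (h * L) z) / 2)

lemma stepIndex_add (hh : 0 < h) {t : ℝ} (ht : 0 ≤ t) (htT : t + h ≤ T) :
    stepIndex T h (t + h) = stepIndex T h t + 1 := by
  rw [stepIndex, stepIndex, min_eq_left htT, min_eq_left (by linarith), max_eq_right ht,
    max_eq_right (by linarith), add_div, div_self hh.ne', Nat.floor_add_one (by positivity)]

/-- The bounds on the coefficients in `schemeIntegrand`, with the measurability needed to
integrate them. -/
lemma schemeInterp_coeffs (hF₀ : IsProfile R F₀) (hS : IsKernel r S)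
    (hodd : ∀ x, S (-x) = -S x) (hB : IsRegularFlux L B) (hL : 0 < L) (h0 : 0 < h)
    (h1 : h * ((∫ z, |deriv S z|) / 2) ≤ 1) (α : ℝ) :
    (Measurable fun z : ℝ × ℝ => |schemeInterp T S B L F₀ h z.1 z.2 - α|) ∧
    (Measurable fun z : ℝ × ℝ => Real.sign (sourceStep S h (schemeInterp T S B L F₀ h z.1) z.2 - α)
        * source S (schemeInterp T S B L F₀ h z.1) z.2) ∧
    (Measurable fun z : ℝ × ℝ => |sourceStep S h (schemeInterp T S B L F₀ h z.1) z.2 - α|) ∧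
    (Measurable fun z : ℝ × ℝ => entropyFlux (B (stepIndex T h z.1 * h)) α
        (sourceStep S h (schemeInterp T S B L F₀ h z.1) z.2)) := by
  have hm := measurable_schemeInterp (T := T) hF₀ hS hodd hB hL h0.le h1
  have hs := measurable_source hS hm
  have hE : Measurable fun z : ℝ × ℝ => sourceStep S h (schemeInterp T S B L F₀ h z.1) z.2 :=
    hm.add (hs.const_mul h)
  have hτ : Measurable fun z : ℝ × ℝ => (stepIndex T h z.1 * h : ℝ) :=
    ((measurable_from_nat (f := fun n : ℕ => (n : ℝ))).comp
      ((measurable_stepIndex T h).comp measurable_fst)).mul_const h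
  have hq : ∀ g : ℝ × ℝ → ℝ, Measurable g →
      Measurable fun z : ℝ × ℝ => B (stepIndex T h z.1 * h) (g z) := fun g hg =>
    hB.cont.measurable.comp (f := fun z : ℝ × ℝ => ((stepIndex T h z.1 * h : ℝ), g z))
      (hτ.prodMk hg)
  exact ⟨(hm.sub_const α).abs, (measurable_sign.comp (hE.sub_const α)).mul hs, (hE.sub_const α).abs,
    (measurable_sign.comp (hE.sub_const α)).mul ((hq _ hE).sub (hq _ measurable_const))⟩

lemma integrable_mul_of_hasCompactSupport {w ζ : ℝ × ℝ → ℝ} {C : ℝ} (hζ : Continuous ζ)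
    (hζc : HasCompactSupport ζ) (hw : Measurable w) (hC : ∀ z, |w z| ≤ C) :
    Integrable (fun z => w z * ζ z) :=
  (hζ.integrable_of_hasCompactSupport hζc).bdd_mul (c := C) hw.aestronglyMeasurable (.of_forall hC)

lemma hasCompactSupport_slopeDir (hχc : HasCompactSupport χ) {v : ℝ × ℝ} (hv : ‖v‖ ≤ 1) {s : ℝ}
    (hs : |s| ≤ 1) : HasCompactSupport (slopeDir χ v s) :=
  HasCompactSupport.intro hχc.isCompact.cthickening fun _ hz => slopeDir_eq_zero hv hs hz

lemma norm_neg_one_zero : ‖((-1, 0) : ℝ × ℝ)‖ ≤ 1 := by simp [Prod.norm_def]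
lemma norm_zero_one : ‖((0, 1) : ℝ × ℝ)‖ ≤ 1 := by simp [Prod.norm_def]
lemma norm_zero_neg_one : ‖((0, -1) : ℝ × ℝ)‖ ≤ 1 := by simp [Prod.norm_def]

/-- The discrete entropy inequality. -/
lemma integral_schemeIntegrand_nonneg (hT : 0 ≤ T) (hF₀ : IsProfile R F₀) (hS : IsKernel r S)
    (hodd : ∀ x, S (-x) = -S x) (hB : IsRegularFlux L B) (hL : 0 < L) (h0 : 0 < h)
    (h1 : h * ((∫ z, |deriv S z|) / 2) ≤ 1) (hh1 : h ≤ 1) (hhL : h * L ≤ 1)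
    (hχ : Continuous χ) (hχc : HasCompactSupport χ) (hχ0 : ∀ z, 0 ≤ χ z)
    (hsupp : ∀ z ∈ tsupport χ, 0 ≤ z.1 ∧ z.1 + h ≤ T) (α : ℝ) :
    0 ≤ ∫ z, schemeIntegrand T S B L F₀ h χ α z := by
  have hL' : (0 : ℝ) < L := hL
  have hδ : 0 < h * L := mul_pos h0 hL'
  set F := schemeInterp T S B L F₀ h with hF
  obtain ⟨m1, m2, m3, m4⟩ := schemeInterp_coeffs (T := T) hF₀ hS hodd hB hL h0 h1 α
  have hp := schemeInterp_isProfile hT hF₀ hS hodd hB hL h0 h1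
  have hEp := fun t => (hp t).isProfile_sourceStep hS hodd h0.le h1
  have habs : ∀ (R' : ℝ) (g : ℝ → ℝ), IsProfile R' g → ∀ x, |g x - α| ≤ 1 / 2 + |α| :=
    fun R' g hg x => (abs_sub _ _).trans (add_le_add (hg.abs_le_half x) le_rfl)
  have b1 : ∀ z : ℝ × ℝ, |(|F z.1 z.2 - α|)| ≤ 1 / 2 + |α| := fun z => by
    rw [abs_abs]; exact habs _ _ (hp z.1) z.2
  have b2 : ∀ z : ℝ × ℝ, |Real.sign (sourceStep S h (F z.1) z.2 - α) * source S (F z.1) z.2|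
      ≤ (∫ z, |deriv S z|) / 2 := fun z => by
    rw [abs_mul]
    exact (mul_le_of_le_one_left (abs_nonneg _) (abs_sign_le _)).trans
      ((hp z.1).abs_source_le hS z.2)
  have b3 : ∀ z : ℝ × ℝ, |(|sourceStep S h (F z.1) z.2 - α|)| ≤ 1 / 2 + |α| := fun z => by
    rw [abs_abs]; exact habs _ _ (hEp z.1) z.2
  have b4 : ∀ z : ℝ × ℝ, |entropyFlux (B (stepIndex T h z.1 * h)) α (sourceStep S h (F z.1) z.2)|
      ≤ L * (1 / 2 + |α|) := fun z =>
    (abs_entropyFlux_le (hB.lip _) α _).trans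
      (mul_le_mul_of_nonneg_left (habs _ _ (hEp z.1) z.2) hL'.le)
  have hsc := fun (v : ℝ × ℝ) (hv : ‖v‖ ≤ 1) (s : ℝ) (hs : |s| ≤ 1) =>
    (⟨continuous_slopeDir hχ v s, hasCompactSupport_slopeDir hχc hv hs⟩ :
      Continuous (slopeDir χ v s) ∧ HasCompactSupport (slopeDir χ v s))
  obtain ⟨c1, c1'⟩ := hsc _ norm_neg_one_zero h (by rwa [abs_of_pos h0])
  obtain ⟨c2, c2'⟩ := hsc _ norm_zero_one (h * L) (by rwa [abs_of_pos hδ])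
  obtain ⟨c3, c3'⟩ := hsc _ norm_zero_neg_one (h * L) (by rwa [abs_of_pos hδ])
  have i1 := integrable_mul_of_hasCompactSupport c1 c1' m1 b1
  have i2 := integrable_mul_of_hasCompactSupport hχ hχc m2 b2
  have i3 := integrable_mul_of_hasCompactSupport
    (ζ := fun z => L / 2 * (slopeDir χ (0, 1) (h * L) z + slopeDir χ (0, -1) (h * L) z))
    (by fun_prop) ((c2'.add c3').mul_left) m3 b3
  have i4 := integrable_mul_of_hasCompactSupport
    (ζ := fun z => (slopeDir χ (0, 1) (h * L) z - slopeDir χ (0, -1) (h * L) z) / 2)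
    (by fun_prop) (by
      simp only [div_eq_mul_inv, sub_eq_add_neg]
      exact (c2'.add c3'.neg).mul_right) m4 b4
  have iF := integrable_mul_of_hasCompactSupport hχ hχc m1 b1
  -- the time translate of the scheme is the next iterate
  set sh : ℝ × ℝ → ℝ := fun z => |F (z.1 + h) z.2 - α| * χ z with hsh
  have hshift : ∀ z : ℝ × ℝ, z + (h, 0) + h • ((-1, 0) : ℝ × ℝ) = z := fun z => by
    ext <;> simp
  have iFm : Integrable (fun z : ℝ × ℝ => |F z.1 z.2 - α| * χ (z + h • (-1, 0))) := by
    have : (fun z : ℝ × ℝ => |F z.1 z.2 - α| * χ (z + h • (-1, 0)))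
        = fun z => h * (|F z.1 z.2 - α| * slopeDir χ (-1, 0) h z) + |F z.1 z.2 - α| * χ z := by
      ext z
      rw [slopeDir]; field_simp; ring
    rw [this]
    exact (i1.const_mul h).add iF
  have ish : Integrable sh := by
    refine (iFm.comp_add_right (h, (0 : ℝ))).congr (.of_forall fun z => ?_)
    simp only [hsh, hshift, Prod.fst_add, Prod.snd_add, add_zero]
  have eshift : ∫ z, sh z = ∫ z : ℝ × ℝ, |F z.1 z.2 - α| * χ (z + h • (-1, 0)) := by
    rw [← integral_add_right_eq_self
      (fun z : ℝ × ℝ => |F z.1 z.2 - α| * χ (z + h • (-1, 0))) ((h, 0) : ℝ × ℝ)]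
    simp only [hsh, hshift, Prod.fst_add, Prod.snd_add, add_zero]
  -- the integrand of the entropy inequality of one step, for each time
  set J : ℝ × ℝ → ℝ := fun z => (|F z.1 z.2 - α| * χ z - sh z)
      + h * (Real.sign (sourceStep S h (F z.1) z.2 - α) * source S (F z.1) z.2 * χ z)
      + h * (|sourceStep S h (F z.1) z.2 - α| * (L / 2 * (slopeDir χ (0, 1) (h * L) z
          + slopeDir χ (0, -1) (h * L) z)))
      + h * (entropyFlux (B (stepIndex T h z.1 * h)) α (sourceStep S h (F z.1) z.2)
        * ((slopeDir χ (0, 1) (h * L) z - slopeDir χ (0, -1) (h * L) z) / 2)) with hJ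
  have iJ : Integrable J :=
    (((iF.sub ish).add (i2.const_mul h)).add (i3.const_mul h)).add (i4.const_mul h)
  have hJ0 : 0 ≤ ∫ z, J z := by
    rw [Measure.volume_eq_prod] at iJ ⊢
    rw [integral_prod _ iJ]
    refine integral_nonneg fun t => ?_
    by_cases ht : ∀ x, χ (t, x) = 0
    · simp [hJ, hsh, ht, slopeDir]
    push Not at ht
    obtain ⟨x₀, hx₀⟩ := ht
    obtain ⟨ht0, htT⟩ := hsupp _ (subset_tsupport χ hx₀)
    have hηc : HasCompactSupport fun x => χ (t, x) :=
      HasCompactSupport.intro (hχc.isCompact.image continuous_snd) fun x hx =>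
        image_eq_zero_of_notMem_tsupport fun h => hx ⟨_, h, rfl⟩
    have key := (hp t).integral_entropy_laxFriedrichs_nonneg hS hodd
      (hB.lip (stepIndex T h t * h)) hL h0.le h1 hδ.le (η := fun x => χ (t, x)) (by fun_prop) hηc
      (fun x => hχ0 _) α
    refine key.trans_eq (integral_congr_ae (.of_forall fun x => ?_))
    have e1 : F (t + h) = laxFriedrichs L (h * L) (B (stepIndex T h t * h))
        (sourceStep S h (F t)) := by
      rw [hF, schemeInterp, stepIndex_add h0 ht0 htT]; rfl
    have e2 : ((t, x) : ℝ × ℝ) + (h * L) • ((0, 1) : ℝ × ℝ) = (t, x + h * L) := by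
      ext <;> simp
    have e3 : ((t, x) : ℝ × ℝ) + (h * L) • ((0, -1) : ℝ × ℝ) = (t, x - h * L) := by
      ext <;> simp [sub_eq_add_neg]
    simp only [hJ, hsh, slopeDir, e1, e2, e3]
    field_simp
    ring
  -- summation by parts in time
  have e5 : ∫ z, J z = h * ∫ z, schemeIntegrand T S B L F₀ h χ α z := by
    have a1 : ∫ z, J z = (∫ z, (|F z.1 z.2 - α| * χ z - sh z))
        + ∫ z, (h * (Real.sign (sourceStep S h (F z.1) z.2 - α) * source S (F z.1) z.2 * χ z)
      + h * (|sourceStep S h (F z.1) z.2 - α| * (L / 2 * (slopeDir χ (0, 1) (h * L) z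
          + slopeDir χ (0, -1) (h * L) z)))
      + h * (entropyFlux (B (stepIndex T h z.1 * h)) α (sourceStep S h (F z.1) z.2)
        * ((slopeDir χ (0, 1) (h * L) z - slopeDir χ (0, -1) (h * L) z) / 2))) := by
      rw [← integral_add]
      · refine integral_congr_ae (.of_forall fun z => ?_)
        simp only [hJ]; ring
      · exact iF.sub ish
      · exact ((i2.const_mul h).add (i3.const_mul h)).add (i4.const_mul h)
    have a2 : ∫ z, (|F z.1 z.2 - α| * χ z - sh z)
        = ∫ z : ℝ × ℝ, -(h * (|F z.1 z.2 - α| * slopeDir χ (-1, 0) h z)) := by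
      rw [integral_sub iF ish, eshift, ← integral_sub iF iFm]
      refine integral_congr_ae (.of_forall fun z => ?_)
      simp only [slopeDir]
      field_simp
      ring
    rw [a1, a2, ← integral_add, ← integral_const_mul]
    · refine integral_congr_ae (.of_forall fun z => ?_)
      simp only [schemeIntegrand, ← hF]; ring
    · exact (i1.const_mul h).neg
    · exact ((i2.const_mul h).add (i3.const_mul h)).add (i4.const_mul h)
  rw [e5] at hJ0
  exact nonneg_of_mul_nonneg_right hJ0 h0

end Limit
end OpinionBurgers

namespace OpinionBurgers

section Bounds

variable {R r : ℝ} {L : NNReal} {S f : ℝ → ℝ} {b : ℝ → ℝ}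

lemma IsProfile.abs_sub_const_le (hf : IsProfile R f) (α x : ℝ) : |f x - α| ≤ 1 / 2 + |α| :=
  (abs_sub _ _).trans (add_le_add (hf.abs_le_half x) le_rfl)

lemma IsProfile.abs_entropyFlux_le (hf : IsProfile R f) (hb : LipschitzWith L b) (α x : ℝ) :
    |entropyFlux b α (f x)| ≤ L * (1 / 2 + |α|) :=
  (OpinionBurgers.abs_entropyFlux_le hb α _).trans
    (mul_le_mul_of_nonneg_left (hf.abs_sub_const_le α x) L.coe_nonneg)

lemma IsProfile.abs_sign_mul_source_le (hf : IsProfile R f) (hS : IsKernel r S) (v x : ℝ) :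
    |Real.sign v * source S f x| ≤ (∫ z, |deriv S z|) / 2 := by
  rw [abs_mul]
  exact (mul_le_of_le_one_left (abs_nonneg _) (abs_sign_le _)).trans (hf.abs_source_le hS x)

lemma abs_mul_le_mul {a b A B : ℝ} (ha : |a| ≤ A) (hb : |b| ≤ B) : |a * b| ≤ A * B := by
  rw [abs_mul]
  exact mul_le_mul ha hb (abs_nonneg _) ((abs_nonneg _).trans ha)

end Bounds

lemma tendsto_sign {ι : Type*} {l : Filter ι} {u : ι → ℝ} {a : ℝ} (hu : Tendsto u l (𝓝 a))
    (ha : a ≠ 0) : Tendsto (fun i => Real.sign (u i)) l (𝓝 (Real.sign a)) := by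
  rcases ha.lt_or_gt with h | h
  · rw [Real.sign_of_neg h]
    refine tendsto_const_nhds.congr' ?_
    filter_upwards [hu.eventually_lt_const h] with i hi using (Real.sign_of_neg hi).symm
  · rw [Real.sign_of_pos h]
    refine tendsto_const_nhds.congr' ?_
    filter_upwards [hu.eventually_const_lt h] with i hi using (Real.sign_of_pos hi).symm

section Limit

variable {T R r : ℝ} {L : NNReal} {S F₀ : ℝ → ℝ} {B G : ℝ → ℝ → ℝ} {χ : ℝ × ℝ → ℝ} {h : ℕ → ℝ}

lemma tendsto_stepIndex_mul (hT : 0 ≤ T) (h0 : ∀ n, 0 < h n) (hh : Tendsto h atTop (𝓝 0)) (t : ℝ) :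
    Tendsto (fun n => (stepIndex T (h n) t * h n : ℝ)) atTop (𝓝 (max 0 (min t T))) := by
  have h2 : Tendsto (fun n => max 0 (min t T) - h n) atTop (𝓝 (max 0 (min t T))) := by
    simpa using tendsto_const_nhds.sub hh
  refine tendsto_of_tendsto_of_tendsto_of_le_of_le h2 tendsto_const_nhds (fun n => ?_)
    fun n => stepIndex_mul_le hT (h0 n) t
  have := lt_stepIndex_add_one_mul (T := T) (h0 n) t
  simp only
  linarith

/-- Pointwise convergence of the integrands of the discrete entropy inequality, at points where the
limit differs from the parameter of the entropy. -/
lemma tendsto_schemeIntegrand (hT : 0 ≤ T) (hF₀ : IsProfile R F₀) (hS : IsKernel r S)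
    (hodd : ∀ x, S (-x) = -S x) (hB : IsRegularFlux L B)
    (hBT : ∀ t, B (max 0 (min t T)) = B t) (hL : 0 < L) (h0 : ∀ n, 0 < h n)
    (h1 : ∀ n, h n * ((∫ z, |deriv S z|) / 2) ≤ 1) (hh : Tendsto h atTop (𝓝 0))
    (hχ : Differentiable ℝ χ) {α : ℝ} {z : ℝ × ℝ}
    (hG : ∀ᵐ x, Tendsto (fun n => schemeInterp T S B L F₀ (h n) z.1 x) atTop (𝓝 (G z.1 x)))
    (hz : Tendsto (fun n => schemeInterp T S B L F₀ (h n) z.1 z.2) atTop (𝓝 (G z.1 z.2)))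
    (hα : G z.1 z.2 ≠ α) :
    Tendsto (fun n => schemeIntegrand T S B L F₀ (h n) χ α z) atTop
      (𝓝 (entropyIntegrand S B G χ α z)) := by
  have hL' : (0 : ℝ) < L := hL
  have hp := fun n => schemeInterp_isProfile hT hF₀ hS hodd hB hL (h0 n) (h1 n)
  have hsrc := tendsto_source (fun n => hp n z.1) hS hG hz
  have hE : Tendsto (fun n => sourceStep S (h n) (schemeInterp T S B L F₀ (h n) z.1) z.2) atTop
      (𝓝 (G z.1 z.2)) := by
    simpa [sourceStep] using hz.add (hh.mul hsrc)
  have hh0 : Tendsto h atTop (𝓝[>] 0) :=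
    tendsto_nhdsWithin_iff.2 ⟨hh, .of_forall h0⟩
  have hhL : Tendsto (fun n => h n * L) atTop (𝓝[>] 0) :=
    tendsto_nhdsWithin_iff.2 ⟨by simpa using hh.mul_const (L : ℝ),
      .of_forall fun n => mul_pos (h0 n) hL'⟩
  have s1 := (tendsto_slopeDir hχ (-1, 0) z).comp hh0
  have s2 := (tendsto_slopeDir hχ (0, 1) z).comp hhL
  have s3 := (tendsto_slopeDir hχ (0, -1) z).comp hhL
  have e1 : fderiv ℝ χ z (-1, 0) = -fderiv ℝ χ z (1, 0) := by
    rw [← map_neg]; simp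
  have e3 : fderiv ℝ χ z (0, -1) = -fderiv ℝ χ z (0, 1) := by
    rw [← map_neg]; simp
  rw [e1] at s1
  rw [e3] at s3
  have hsign := tendsto_sign (hE.sub_const α) (sub_ne_zero.2 hα)
  have hτ := tendsto_stepIndex_mul hT h0 hh z.1
  have hB' : ∀ {u : ℕ → ℝ} {v : ℝ}, Tendsto u atTop (𝓝 v) →
      Tendsto (fun n => B (stepIndex T (h n) z.1 * h n) (u n)) atTop (𝓝 (B z.1 v)) := by
    intro u v hu
    have := (hB.cont.tendsto (max 0 (min z.1 T), v)).comp (hτ.prodMk_nhds hu)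
    rw [Function.uncurry_apply_pair, hBT] at this
    exact this
  have hq := hsign.mul ((hB' hE).sub (hB' (tendsto_const_nhds (x := α))))
  have key := ((((hz.sub_const α).abs.mul s1).neg.add ((hsign.mul hsrc).mul_const (χ z))).add
    ((hE.sub_const α).abs.mul ((s2.add s3).const_mul (L / 2 : ℝ)))).add
    (hq.mul ((s2.sub s3).div_const 2))
  have e : entropyIntegrand S B G χ α z = -(|G z.1 z.2 - α| * -fderiv ℝ χ z (1, 0))
      + Real.sign (G z.1 z.2 - α) * source S (G z.1) z.2 * χ z
      + |G z.1 z.2 - α| * (L / 2 * (fderiv ℝ χ z (0, 1) + -fderiv ℝ χ z (0, 1)))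
      + Real.sign (G z.1 z.2 - α) * (B z.1 (G z.1 z.2) - B z.1 α)
        * ((fderiv ℝ χ z (0, 1) - -fderiv ℝ χ z (0, 1)) / 2) := by
    rw [entropyIntegrand]; ring
  rw [e]
  exact key

/-- The entropy inequality for the limit of the scheme, for those parameters which the limit takes
only on a null set. -/
lemma integral_entropyIntegrand_nonneg_of_null (hT : 0 ≤ T) (hF₀ : IsProfile R F₀)
    (hS : IsKernel r S) (hodd : ∀ x, S (-x) = -S x) (hB : IsRegularFlux L B)
    (hBT : ∀ t, B (max 0 (min t T)) = B t) (hL : 0 < L) (h0 : ∀ n, 0 < h n)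
    (h1 : ∀ n, h n * ((∫ z, |deriv S z|) / 2) ≤ 1) (hh1 : ∀ n, h n ≤ 1) (hhL : ∀ n, h n * L ≤ 1)
    (hh : Tendsto h atTop (𝓝 0)) (hGm : Measurable (Function.uncurry G))
    (hG : ∀ t, ∀ᵐ x, Tendsto (fun n => schemeInterp T S B L F₀ (h n) t x) atTop (𝓝 (G t x)))
    (hχ : ContDiff ℝ ∞ χ) (hχc : HasCompactSupport χ) (hχ0 : ∀ z, 0 ≤ χ z)
    (hsupp : tsupport χ ⊆ Ioo 0 T ×ˢ univ) {α : ℝ} (hα : ∀ᵐ z : ℝ × ℝ, G z.1 z.2 ≠ α) :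
    0 ≤ ∫ z, entropyIntegrand S B G χ α z := by
  have hL' : (0 : ℝ) < L := hL
  obtain ⟨C, hC⟩ := ContDiff.lipschitzWith_of_hasCompactSupport hχc hχ (by simp)
  obtain ⟨M, hM⟩ := hχ.continuous.bounded_above_of_compact_support hχc
  set K := Metric.cthickening 1 (tsupport χ) with hK
  have hKc : IsCompact K := hχc.isCompact.cthickening
  set D : ℝ := (1 / 2 + |α|) * C + (∫ z, |deriv S z|) / 2 * M
    + (1 / 2 + |α|) * (L / 2 * (C + C)) + L * (1 / 2 + |α|) * ((C + C) / 2) with hD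
  have hbound : ∀ n z, |schemeIntegrand T S B L F₀ (h n) χ α z| ≤ D := by
    intro n z
    have hp := schemeInterp_isProfile hT hF₀ hS hodd hB hL (h0 n) (h1 n) z.1
    have hE := hp.isProfile_sourceStep hS hodd (h0 n).le (h1 n)
    have t1 := abs_slopeDir_le hC norm_neg_one_zero (h n) z
    have t2 := abs_slopeDir_le hC norm_zero_one (h n * L) z
    have t3 := abs_slopeDir_le hC norm_zero_neg_one (h n * L) z
    refine (abs_add_le _ _).trans (add_le_add ((abs_add_le _ _).trans (add_le_add
      ((abs_add_le _ _).trans (add_le_add ?_ ?_)) ?_)) ?_)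
    · rw [abs_neg]
      exact abs_mul_le_mul (by rw [abs_abs]; exact hp.abs_sub_const_le α _) t1
    · exact abs_mul_le_mul (hp.abs_sign_mul_source_le hS _ _) (hM z)
    · refine abs_mul_le_mul (by rw [abs_abs]; exact hE.abs_sub_const_le α _) ?_
      exact abs_mul_le_mul (abs_of_nonneg (by positivity)).le
        ((abs_add_le _ _).trans (add_le_add t2 t3))
    · refine abs_mul_le_mul (hE.abs_entropyFlux_le (hB.lip _) α _) ?_
      rw [abs_div, abs_two]
      exact div_le_div_of_nonneg_right ((abs_sub _ _).trans (add_le_add t2 t3)) zero_le_two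
  have hzero : ∀ n z, z ∉ K → schemeIntegrand T S B L F₀ (h n) χ α z = 0 := by
    intro n z hz
    have a1 := abs_of_pos (h0 n)
    have a2 := abs_of_pos (mul_pos (h0 n) hL')
    rw [schemeIntegrand, slopeDir_eq_zero norm_neg_one_zero (a1.le.trans (hh1 n)) hz,
      slopeDir_eq_zero norm_zero_one (a2.le.trans (hhL n)) hz,
      slopeDir_eq_zero norm_zero_neg_one (a2.le.trans (hhL n)) hz,
      image_eq_zero_of_notMem_tsupport fun h => hz (Metric.self_subset_cthickening _ h)]
    simp
  have hmeas : ∀ n, Measurable (schemeIntegrand T S B L F₀ (h n) χ α) := by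
    intro n
    obtain ⟨m1, m2, m3, m4⟩ := schemeInterp_coeffs (T := T) hF₀ hS hodd hB hL (h0 n) (h1 n) α
    have c1 := (continuous_slopeDir hχ.continuous (-1, 0) (h n)).measurable
    have c2 := (continuous_slopeDir hχ.continuous (0, 1) (h n * L)).measurable
    have c3 := (continuous_slopeDir hχ.continuous (0, -1) (h n * L)).measurable
    exact (((m1.mul c1).neg.add (m2.mul hχ.continuous.measurable)).add
      (m3.mul ((c2.add c3).const_mul _))).add (m4.mul ((c2.sub c3).div_const 2))
  have hae : ∀ᵐ z : ℝ × ℝ, Tendsto (fun n => schemeInterp T S B L F₀ (h n) z.1 z.2) atTop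
      (𝓝 (G z.1 z.2)) := by
    rw [Measure.volume_eq_prod, Measure.ae_prod_iff_ae_ae]
    · exact .of_forall hG
    · exact measurableSet_tendsto_fun
        (fun n => measurable_schemeInterp hF₀ hS hodd hB hL (h0 n).le (h1 n)) hGm
  have hlim : Tendsto (fun n => ∫ z, schemeIntegrand T S B L F₀ (h n) χ α z) atTop
      (𝓝 (∫ z, entropyIntegrand S B G χ α z)) := by
    refine tendsto_integral_of_dominated_convergence (K.indicator fun _ => D)
      (fun n => (hmeas n).aestronglyMeasurable) ?_ (fun n => .of_forall fun z => ?_) ?_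
    · exact (integrable_indicator_iff hKc.measurableSet).2
        (integrableOn_const hKc.measure_lt_top.ne)
    · by_cases hz : z ∈ K
      · rw [indicator_of_mem hz]; exact hbound n z
      · rw [indicator_of_notMem hz, hzero n z hz, norm_zero]
    · filter_upwards [hae, hα] with z hz hzα using
        tendsto_schemeIntegrand hT hF₀ hS hodd hB hBT hL h0 h1 hh (hχ.differentiable (by simp))
          (hG z.1) hz hzα
  -- for small time steps, the support of the test function stays away from the final time
  have hev : ∀ᶠ n in atTop, ∀ z ∈ tsupport χ, 0 ≤ z.1 ∧ z.1 + h n ≤ T := by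
    rcases (tsupport χ).eq_empty_or_nonempty with he | hne
    · simp [he]
    · obtain ⟨w, hw, hmax⟩ := hχc.isCompact.exists_isMaxOn hne (f := Prod.fst)
        continuous_fst.continuousOn
      have hwT : 0 < T - w.1 := sub_pos.2 (hsupp hw).1.2
      filter_upwards [hh.eventually_lt_const hwT] with n hn z hz
      have : z.1 ≤ w.1 := hmax hz
      exact ⟨(hsupp hz).1.1.le, by linarith⟩
  refine ge_of_tendsto hlim ?_
  filter_upwards [hev] with n hn using integral_schemeIntegrand_nonneg hT hF₀ hS hodd hB hL (h0 n)
    (h1 n) (hh1 n) (hhL n) hχ.continuous hχc hχ0 hn α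

end Limit

section Levels

variable {T R r : ℝ} {L : NNReal} {S : ℝ → ℝ} {B G : ℝ → ℝ → ℝ} {χ : ℝ × ℝ → ℝ}

lemma tendsto_sign_add_sign {ε : ℕ → ℝ} (hε : ∀ n, 0 < ε n) (h : Tendsto ε atTop (𝓝 0)) (v : ℝ) :
    Tendsto (fun n => Real.sign (v - ε n) + Real.sign (v + ε n)) atTop
      (𝓝 (2 * Real.sign v)) := by
  rcases eq_or_ne v 0 with rfl | hv
  · refine tendsto_const_nhds.congr fun n => ?_
    rw [Real.sign_of_neg (r := 0 - ε n) (by linarith [hε n]),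
      Real.sign_of_pos (r := 0 + ε n) (by linarith [hε n])]
    simp
  · rw [two_mul]
    refine (tendsto_sign ?_ hv).add (tendsto_sign ?_ hv)
    · simpa using tendsto_const_nhds.sub h
    · simpa using tendsto_const_nhds.add h

lemma measurable_entropyIntegrand (hS : IsKernel r S) (hB : IsRegularFlux L B)
    (hGm : Measurable (Function.uncurry G)) (hχ : ContDiff ℝ ∞ χ) (β : ℝ) :
    Measurable (entropyIntegrand S B G χ β) := by
  have hft : ∀ v : ℝ × ℝ, Measurable fun z => fderiv ℝ χ z v := fun v =>
    ((hχ.continuous_fderiv (by simp)).clm_apply continuous_const).measurable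
  have m0 : Measurable fun z : ℝ × ℝ => G z.1 z.2 := hGm
  have m1 := measurable_source hS hGm
  have mσ : Measurable fun z : ℝ × ℝ => Real.sign (G z.1 z.2 - β) :=
    measurable_sign.comp (m0.sub_const β)
  have mB : ∀ g : ℝ × ℝ → ℝ, Measurable g → Measurable fun z : ℝ × ℝ => B z.1 (g z) :=
    fun g hg => hB.cont.measurable.comp (f := fun z : ℝ × ℝ => (z.1, g z))
      (measurable_fst.prodMk hg)
  exact (((m0.sub_const β).abs.mul (hft _)).add
    ((mσ.mul ((mB _ m0).sub (mB _ measurable_const))).mul (hft _))).add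
    ((mσ.mul hχ.continuous.measurable).mul m1)

/-- The integrand of the entropy inequality is bounded, locally uniformly in the parameter. -/
lemma exists_abs_entropyIntegrand_le (hS : IsKernel r S) (hB : IsRegularFlux L B)
    (hG : ∀ t, IsProfile R (G t)) (hχ : ContDiff ℝ ∞ χ) (hχc : HasCompactSupport χ) (a : ℝ) :
    ∃ D, ∀ β, |β| ≤ a → ∀ z, |entropyIntegrand S B G χ β z| ≤ D := by
  have hft : ∀ v : ℝ × ℝ, Continuous fun z => fderiv ℝ χ z v := fun v =>
    (hχ.continuous_fderiv (by simp)).clm_apply continuous_const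
  obtain ⟨C₁, hC₁⟩ := (hft (1, 0)).bounded_above_of_compact_support
    (hχc.fderiv_apply (𝕜 := ℝ) (1, 0))
  obtain ⟨C₂, hC₂⟩ := (hft (0, 1)).bounded_above_of_compact_support
    (hχc.fderiv_apply (𝕜 := ℝ) (0, 1))
  obtain ⟨M, hM⟩ := hχ.continuous.bounded_above_of_compact_support hχc
  refine ⟨(1 / 2 + a) * C₁ + L * (1 / 2 + a) * C₂ + (∫ z, |deriv S z|) / 2 * M,
    fun β hβ z => ?_⟩
  have q1 : 1 / 2 + |β| ≤ 1 / 2 + a := by linarith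
  refine (abs_add_le _ _).trans (add_le_add ((abs_add_le _ _).trans (add_le_add ?_ ?_)) ?_)
  · exact abs_mul_le_mul (by
      rw [abs_abs]; exact ((hG z.1).abs_sub_const_le β _).trans q1) (hC₁ z)
  · exact abs_mul_le_mul (((hG z.1).abs_entropyFlux_le (hB.lip z.1) β _).trans
      (mul_le_mul_of_nonneg_left q1 L.coe_nonneg)) (hC₂ z)
  · rw [mul_right_comm]
    exact abs_mul_le_mul ((hG z.1).abs_sign_mul_source_le hS _ _) (hM z)

lemma integrable_entropyIntegrand (hS : IsKernel r S) (hB : IsRegularFlux L B)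
    (hGm : Measurable (Function.uncurry G)) (hG : ∀ t, IsProfile R (G t)) (hχ : ContDiff ℝ ∞ χ)
    (hχc : HasCompactSupport χ) (β : ℝ) : Integrable (entropyIntegrand S B G χ β) := by
  obtain ⟨D, hD⟩ := exists_abs_entropyIntegrand_le hS hB hG hχ hχc |β|
  exact integrable_of_bounded_of_support hχc.isCompact.measure_lt_top
    (measurable_entropyIntegrand hS hB hGm hχ β).aestronglyMeasurable (hD β le_rfl)
    fun z hz => entropyIntegrand_eq_zero hz β

/-- It suffices to verify the entropy inequality for almost every parameter: a level set of positive
measure is passed by averaging the inequalities on its two sides, because `sgn(0) = 0`. -/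
lemma integral_entropyIntegrand_nonneg_of_forall_null (hS : IsKernel r S) (hB : IsRegularFlux L B)
    (hGm : Measurable (Function.uncurry G)) (hG : ∀ t, IsProfile R (G t)) (hχ : ContDiff ℝ ∞ χ)
    (hχc : HasCompactSupport χ)
    (hnull : ∀ α, (∀ᵐ z : ℝ × ℝ, G z.1 z.2 ≠ α) → 0 ≤ ∫ z, entropyIntegrand S B G χ α z) (α : ℝ) :
    0 ≤ ∫ z, entropyIntegrand S B G χ α z := by
  have hbad : {β : ℝ | 0 < volume {z : ℝ × ℝ | Function.uncurry G z = β}}.Countable :=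
    Measure.countable_meas_level_set_pos hGm
  have hgood : ∀ β, β ∉ {β : ℝ | 0 < volume {z : ℝ × ℝ | Function.uncurry G z = β}} →
      ∀ᵐ z : ℝ × ℝ, G z.1 z.2 ≠ β := by
    intro β hβ
    rw [mem_ofPred, not_lt, nonpos_iff_eq_zero] at hβ
    exact measure_eq_zero_iff_ae_notMem.1 hβ
  set s := {β : ℝ | 0 < volume {z : ℝ × ℝ | Function.uncurry G z = β}} with hs
  have hbad' : ((fun e => α + e) ⁻¹' s ∪ (fun e => α - e) ⁻¹' s).Countable :=
    (hbad.preimage (add_right_injective α)).union (hbad.preimage (sub_right_injective))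
  have hex : ∀ n : ℕ, ∃ e : ℝ, e ∈ Ioo 0 (1 / (n + 1 : ℝ)) ∧ α + e ∉ s ∧ α - e ∉ s := by
    intro n
    obtain ⟨e, he1, he2⟩ := (hbad'.dense_compl ℝ).inter_open_nonempty (Ioo 0 (1 / (n + 1 : ℝ)))
      isOpen_Ioo (nonempty_Ioo.2 (by positivity))
    rw [mem_compl_iff, mem_union, not_or] at he2
    exact ⟨e, he1, he2⟩
  choose ε hε1 hε2 hε3 using hex
  have hε0 : ∀ n, 0 < ε n := fun n => (hε1 n).1
  have hεlim : Tendsto ε atTop (𝓝 0) :=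
    tendsto_of_tendsto_of_tendsto_of_le_of_le tendsto_const_nhds
      tendsto_one_div_add_atTop_nhds_zero_nat (fun n => (hε0 n).le) fun n => (hε1 n).2.le
  have hε1' : ∀ n, ε n ≤ 1 := fun n => (hε1 n).2.le.trans (by
    rw [div_le_one (by positivity)]; linarith [(n.cast_nonneg : (0 : ℝ) ≤ n)])
  have hmeas := measurable_entropyIntegrand hS hB hGm hχ
  have hint := integrable_entropyIntegrand hS hB hGm hG hχ hχc
  obtain ⟨D, hbound⟩ := exists_abs_entropyIntegrand_le hS hB hG hχ hχc (|α| + 1)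
  have hp : ∀ n, |α + ε n| ≤ |α| + 1 := fun n => (abs_add_le _ _).trans
    (add_le_add le_rfl ((abs_of_pos (hε0 n)).le.trans (hε1' n)))
  have hm : ∀ n, |α - ε n| ≤ |α| + 1 := fun n => (abs_sub _ _).trans
    (add_le_add le_rfl ((abs_of_pos (hε0 n)).le.trans (hε1' n)))
  have hlim : Tendsto (fun n => ∫ z, (entropyIntegrand S B G χ (α + ε n) z
      + entropyIntegrand S B G χ (α - ε n) z)) atTop
      (𝓝 (∫ z, 2 * entropyIntegrand S B G χ α z)) := by
    refine tendsto_integral_of_dominated_convergence ((tsupport χ).indicator fun _ => D + D)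
      (fun n => ((hmeas _).add (hmeas _)).aestronglyMeasurable) ?_
      (fun n => .of_forall fun z => ?_) (.of_forall fun z => ?_)
    · exact (integrable_indicator_iff (isClosed_tsupport χ).measurableSet).2
        (integrableOn_const hχc.isCompact.measure_lt_top.ne)
    · by_cases hz : z ∈ tsupport χ
      · rw [indicator_of_mem hz]
        exact (abs_add_le _ _).trans (add_le_add (hbound _ (hp n) z) (hbound _ (hm n) z))
      · rw [indicator_of_notMem hz, entropyIntegrand_eq_zero hz, entropyIntegrand_eq_zero hz]
        simp
    · set v := G z.1 z.2 with hv
      have hεp : Tendsto (fun n => α + ε n) atTop (𝓝 α) := by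
        simpa using tendsto_const_nhds.add hεlim
      have hεm : Tendsto (fun n => α - ε n) atTop (𝓝 α) := by
        simpa using tendsto_const_nhds.sub hεlim
      have hσ := tendsto_sign_add_sign hε0 hεlim (v - α)
      have hcB : Continuous (B z.1) := (hB.lip z.1).continuous
      -- the jump of the sign at `α` is multiplied by an increment of the flux which vanishes
      have herr : ∀ β : ℕ → ℝ, Tendsto β atTop (𝓝 α) →
          Tendsto (fun n => Real.sign (v - β n) * (B z.1 α - B z.1 (β n))) atTop (𝓝 0) := by
        intro β hβ
        have h1 : Tendsto (fun n => B z.1 α - B z.1 (β n)) atTop (𝓝 0) := by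
          simpa using (tendsto_const_nhds (x := B z.1 α)).sub ((hcB.tendsto α).comp hβ)
        exact bdd_le_mul_tendsto_zero' 1 (.of_forall fun n => abs_sign_le _) h1
      have h1 := (tendsto_const_nhds (x := v)).sub hεp |>.abs
      have h2 := (tendsto_const_nhds (x := v)).sub hεm |>.abs
      have key := (((h1.add h2).mul_const (fderiv ℝ χ z (1, 0))).add
        (((hσ.mul_const (B z.1 v - B z.1 α)).add ((herr _ hεp).add (herr _ hεm))).mul_const
          (fderiv ℝ χ z (0, 1)))).add ((hσ.mul_const (χ z)).mul_const (source S (G z.1) z.2))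
      have e1 : ∀ n, v - α - ε n = v - (α + ε n) := fun n => by ring
      have e2 : ∀ n, v - α + ε n = v - (α - ε n) := fun n => by ring
      simp only [e1, e2] at key
      convert key using 2
      · simp only [entropyIntegrand, ← hv]; ring
      · simp only [entropyIntegrand, ← hv]; ring
  have h2 : 0 ≤ ∫ z, 2 * entropyIntegrand S B G χ α z := by
    refine ge_of_tendsto' hlim fun n => ?_
    rw [integral_add (hint _) (hint _)]
    exact add_nonneg (hnull _ (hgood _ (hε2 n))) (hnull _ (hgood _ (hε3 n)))
  rw [integral_const_mul] at h2
  linarith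

end Levels
end OpinionBurgers

namespace OpinionBurgers

/-! ### Bounded variation in space and time -/

section BV

variable {T R K : ℝ} {G : ℝ → ℝ → ℝ} {p : ℝ × ℝ → ℝ} {v : ℝ × ℝ}

/-- An `L¹` bound on the difference quotients in one direction bounds the corresponding
distributional derivative. -/
lemma integral_mul_fderiv_le (hT : 0 ≤ T) (hGm : Measurable (Function.uncurry G))
    (hG : ∀ t, IsProfile R (G t)) (hv : ‖v‖ ≤ 1)
    (hK : ∀ t, ∀ s ∈ Ioc (0 : ℝ) 1, ∫ x, |G (t - s * v.1) (x - s * v.2) - G t x| ≤ K * s)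
    (hp : ContDiff ℝ ∞ p) (hpc : HasCompactSupport p) (hsupp : tsupport p ⊆ Ioo 0 T ×ˢ univ)
    (hp1 : ∀ z, |p z| ≤ 1) : ∫ z : ℝ × ℝ, G z.1 z.2 * fderiv ℝ p z v ≤ K * T := by
  obtain ⟨C, hC⟩ := ContDiff.lipschitzWith_of_hasCompactSupport hpc hp (by simp)
  have hGm' : Measurable fun z : ℝ × ℝ => G z.1 z.2 := hGm
  -- the derivative of the test function is the limit of its difference quotients
  have hlim : Tendsto (fun s => ∫ z : ℝ × ℝ, G z.1 z.2 * slopeDir p v s z) (𝓝[>] 0)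
      (𝓝 (∫ z : ℝ × ℝ, G z.1 z.2 * fderiv ℝ p z v)) := by
    refine tendsto_integral_filter_of_dominated_convergence
      ((Metric.cthickening 1 (tsupport p)).indicator fun _ => 1 / 2 * (C : ℝ))
      (.of_forall fun s => (hGm'.mul
        (continuous_slopeDir hp.continuous v s).measurable).aestronglyMeasurable) ?_ ?_
      (.of_forall fun z => (tendsto_slopeDir (hp.differentiable (by simp)) v z).const_mul _)
    · filter_upwards [Ioc_mem_nhdsGT one_pos] with s hs
      refine .of_forall fun z => ?_
      by_cases hz : z ∈ Metric.cthickening 1 (tsupport p)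
      · rw [indicator_of_mem hz]
        exact abs_mul_le_mul ((hG z.1).abs_le_half z.2) (abs_slopeDir_le hC hv s z)
      · rw [indicator_of_notMem hz, slopeDir_eq_zero hv ((abs_of_pos hs.1).le.trans hs.2) hz]
        simp
    · have hc : IsCompact (Metric.cthickening 1 (tsupport p)) := hpc.isCompact.cthickening
      exact (integrable_indicator_iff hc.measurableSet).2 (integrableOn_const hc.measure_lt_top.ne)
  refine le_of_tendsto hlim ?_
  filter_upwards [Ioc_mem_nhdsGT one_pos] with s hs
  have hv1 : |v.1| ≤ 1 := (norm_fst_le v).trans hv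
  have hv2 : |v.2| ≤ 1 := (norm_snd_le v).trans hv
  set Ω : Set (ℝ × ℝ) := Ioo 0 T ×ˢ univ with hΩ
  have hΩm : MeasurableSet Ω := measurableSet_Ioo.prod MeasurableSet.univ
  set D : ℝ × ℝ → ℝ := fun z => G (z.1 - s * v.1) (z.2 - s * v.2) - G z.1 z.2 with hD
  have hDm : Measurable D :=
    (hGm.comp (f := fun z : ℝ × ℝ => (z.1 - s * v.1, z.2 - s * v.2)) (by fun_prop)).sub hGm'
  have hDi : IntegrableOn D Ω := by
    refine integrable_of_bounded_of_support (K := univ ×ˢ Icc (-(R + 1)) (R + 1))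
      (C := 1 / 2 + 1 / 2)
      ?_ hDm.aestronglyMeasurable
      (fun z => (abs_sub _ _).trans (add_le_add ((hG _).abs_le_half _) ((hG _).abs_le_half _)))
      fun z hz => ?_
    · rw [Measure.restrict_apply (MeasurableSet.univ.prod measurableSet_Icc), hΩ, prod_inter_prod,
        univ_inter, inter_univ, Measure.volume_eq_prod, Measure.prod_prod]
      exact ENNReal.mul_lt_top (by simp) (by simp)
    · have hsv : |s * v.2| ≤ 1 := by
        rw [abs_mul]
        exact mul_le_one₀ ((abs_of_pos hs.1).le.trans hs.2) (abs_nonneg _) hv2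
      have hsv' := abs_le.1 hsv
      have hz' : ¬ (-(R + 1) ≤ z.2 ∧ z.2 ≤ R + 1) := fun h => hz ⟨mem_univ _, h⟩
      rw [not_and_or, not_le, not_le] at hz'
      simp only [hD]
      rcases hz' with h | h
      · rw [(hG _).eq_left (by linarith [hsv'.1]), (hG _).eq_left (by linarith), sub_self]
      · rw [(hG _).eq_right (by linarith [hsv'.2]), (hG _).eq_right (by linarith), sub_self]
  have iGp : Integrable fun z : ℝ × ℝ => G z.1 z.2 * p z :=
    integrable_mul_of_hasCompactSupport hp.continuous hpc hGm' fun z => (hG z.1).abs_le_half z.2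
  have iGs : Integrable fun z : ℝ × ℝ => G z.1 z.2 * p (z + s • v) := by
    refine integrable_mul_of_hasCompactSupport (hp.continuous.comp (by fun_prop)) ?_ hGm'
      fun z => (hG z.1).abs_le_half z.2
    exact hpc.comp_homeomorph (Homeomorph.addRight (s • v))
  have e0 : (fun z : ℝ × ℝ => G (z - s • v).1 (z - s • v).2 * p z)
      = fun z => (fun w : ℝ × ℝ => G w.1 w.2 * p (w + s • v)) (z - s • v) := by
    ext z; simp
  have iGt : Integrable fun z : ℝ × ℝ => G (z - s • v).1 (z - s • v).2 * p z :=
    e0 ▸ iGs.comp_sub_right (s • v)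
  -- move the difference quotient over to `G`
  have e1 : ∫ z : ℝ × ℝ, G z.1 z.2 * slopeDir p v s z = s⁻¹ * ∫ z, D z * p z := by
    have a1 : ∫ z : ℝ × ℝ, G z.1 z.2 * slopeDir p v s z
        = s⁻¹ * ∫ z : ℝ × ℝ, (G z.1 z.2 * p (z + s • v) - G z.1 z.2 * p z) := by
      rw [← integral_const_mul]
      refine integral_congr_ae (.of_forall fun z => ?_)
      simp only [slopeDir]; ring
    have a2 : ∫ z : ℝ × ℝ, G (z - s • v).1 (z - s • v).2 * p z
        = ∫ z : ℝ × ℝ, G z.1 z.2 * p (z + s • v) := by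
      rw [e0, integral_sub_right_eq_self (fun w : ℝ × ℝ => G w.1 w.2 * p (w + s • v))]
    rw [a1, integral_sub iGs iGp, ← a2, ← integral_sub iGt iGp]
    congr 1
    refine integral_congr_ae (.of_forall fun z => ?_)
    simp only [hD, Prod.fst_sub, Prod.snd_sub, Prod.smul_fst, Prod.smul_snd, smul_eq_mul]
    ring
  have e2 : ∫ z, D z * p z = ∫ z in Ω, D z * p z :=
    (setIntegral_eq_integral_of_forall_compl_eq_zero fun z hz => by
      rw [image_eq_zero_of_notMem_tsupport fun h => hz (hsupp h), mul_zero]).symm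
  have e3 : ∫ z in Ω, D z * p z ≤ ∫ z in Ω, |D z| := by
    refine integral_mono (hDi.mul_bdd (c := 1) hp.continuous.aestronglyMeasurable
      (.of_forall hp1)) hDi.abs fun z => (le_abs_self _).trans ?_
    rw [abs_mul]
    exact mul_le_of_le_one_right (abs_nonneg _) (hp1 z)
  have e4 : ∫ z in Ω, |D z| ≤ K * s * T := by
    have hDi' := hDi.abs
    rw [Measure.volume_eq_prod] at hDi' ⊢
    rw [hΩ, setIntegral_prod _ hDi', Measure.restrict_univ]
    have h5 := norm_setIntegral_le_of_norm_le_const (μ := volume) (s := Ioo 0 T) (C := K * s)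
      (f := fun t => ∫ x, |D (t, x)|) (by simp) fun t _ => by
        rw [Real.norm_eq_abs, abs_of_nonneg (integral_nonneg fun _ => abs_nonneg _)]
        exact hK t s hs
    refine (le_abs_self _).trans (h5.trans_eq ?_)
    simp [Measure.real, hT]
  rw [e1, e2, inv_mul_le_iff₀ hs.1]
  linarith

/-- Profiles depending on time in a Lipschitz manner, with respect to the `L¹` distance, have
bounded variation in space and time. -/
lemma isBV_of_integral_abs_sub_le {C : ℝ} (hT : 0 ≤ T) (hGm : Measurable (Function.uncurry G))
    (hG : ∀ t, IsProfile R (G t)) (hC : ∀ s t, ∫ x, |G t x - G s x| ≤ C * |t - s|) :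
    IsBV (Ioo 0 T ×ˢ univ) (fun z => G z.1 z.2) := by
  have hGm' : Measurable fun z : ℝ × ℝ => G z.1 z.2 := hGm
  have hloc : LocallyIntegrable (fun z : ℝ × ℝ => G z.1 z.2) :=
    (locallyIntegrable_const (1 / 2 : ℝ)).mono hGm'.aestronglyMeasurable
      (.of_forall fun z => by
        rw [Real.norm_eq_abs, Real.norm_eq_abs, abs_of_pos (by norm_num : (0 : ℝ) < 1 / 2)]
        exact (hG z.1).abs_le_half z.2)
  refine ⟨hloc.locallyIntegrableOn _, C * T + 1 * T,
    fun p q hp hpc hps hq hqc hqs hpq => ?_⟩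
  have hp1 : ∀ z, |p z| ≤ 1 := fun z =>
    (sq_le_one_iff_abs_le_one _).1 (by nlinarith [hpq z, sq_nonneg (q z)])
  have hq1 : ∀ z, |q z| ≤ 1 := fun z =>
    (sq_le_one_iff_abs_le_one _).1 (by nlinarith [hpq z, sq_nonneg (p z)])
  -- the profiles are Lipschitz in time with constant `C`, and have total variation one in space
  have k1 := integral_mul_fderiv_le (v := (1, 0)) hT hGm hG (by simp [Prod.norm_def])
    (fun t s hs => by
      have := hC t (t - s)
      rw [sub_sub_cancel_left, abs_neg, abs_of_pos hs.1] at this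
      simpa using this) hp hpc hps hp1
  have k2 := integral_mul_fderiv_le (v := (0, 1)) (K := 1) hT hGm hG (by simp [Prod.norm_def])
    (fun t s hs => by
      have := (hG t).integral_abs_comp_add_sub (-s)
      rw [abs_neg, abs_of_pos hs.1] at this
      simpa [sub_eq_add_neg] using this.le) hq hqc hqs hq1
  have hi : ∀ {ζ : ℝ × ℝ → ℝ} (v : ℝ × ℝ), ContDiff ℝ ∞ ζ → HasCompactSupport ζ →
      Integrable fun z : ℝ × ℝ => G z.1 z.2 * fderiv ℝ ζ z v := fun v hζ hζc =>
    integrable_mul_of_hasCompactSupport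
      ((hζ.continuous_fderiv (by simp)).clm_apply continuous_const) (hζc.fderiv_apply (𝕜 := ℝ) v)
      hGm' fun z => (hG z.1).abs_le_half z.2
  have hz : ∀ {ζ : ℝ × ℝ → ℝ} (v : ℝ × ℝ), tsupport ζ ⊆ Ioo 0 T ×ˢ univ →
      ∀ z ∉ Ioo 0 T ×ˢ (univ : Set ℝ), fderiv ℝ ζ z v = 0 := fun v hζ z hz => by
    rw [image_eq_zero_of_notMem_tsupport fun h => hz (hζ (tsupport_fderiv_subset ℝ h))]
    rfl
  rw [setIntegral_eq_integral_of_forall_compl_eq_zero fun z hz' => by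
    rw [hz _ hps z hz', hz _ hqs z hz', add_zero, mul_zero]]
  simp only [mul_add]
  rw [integral_add (hi _ hp hpc) (hi _ hq hqc)]
  exact add_le_add k1 k2

end BV

/-! ### Existence -/

/-- Existence of entropy solutions, as limits of a Lax–Friedrichs scheme. -/
lemma exists_isEntropySolution {T r R : ℝ} {S F₀ : ℝ → ℝ} {A : ℝ → ℝ → ℝ} (hT : 0 < T)
    (hS : IsKernel r S) (hodd : ∀ x, S (-x) = -S x) (hA : IsFlux T A)
    (hF₀ : IsInitialDatum R F₀) : ∃ R' ≥ R, ∃ F : ℝ → ℝ → ℝ, IsEntropySolution T A S F₀ R' F ∧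
      InCL1 T (fun t x => F t x - F₀ x) := by
  obtain ⟨L₀, hB₀⟩ := hA.exists_isRegularFlux hT.le
  set B := clampFlux T A with hBdef
  set L : NNReal := L₀ + 1 with hLdef
  have hB : IsRegularFlux L B := ⟨hB₀.cont, fun t => (hB₀.lip t).weaken (by simp [hLdef])⟩
  have hBT : ∀ t, B (max 0 (min t T)) = B t := fun t => by
    ext v
    simp only [hBdef, clampFlux_eq A (clamp_mem_Icc hT.le t)]
    rfl
  have hL : 0 < L := by positivity
  have hF₀' := hF₀.isProfile
  set K : ℝ := (∫ z, |deriv S z|) / 2 with hK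
  have hK0 : 0 ≤ K := by positivity
  -- time steps small enough for the stability of the source step and of the Lax–Friedrichs step
  set h : ℕ → ℝ := fun n => (1 + K + L)⁻¹ * (1 / (n + 1 : ℝ)) with hh
  have hd : 0 < 1 + K + L := by positivity
  have h0 : ∀ n, 0 < h n := fun n => by positivity
  have hle : ∀ n, h n ≤ (1 + K + L)⁻¹ := fun n =>
    mul_le_of_le_one_right (by positivity) (by
      rw [div_le_one (by positivity)]; linarith [(n.cast_nonneg : (0 : ℝ) ≤ n)])
  have hmul : ∀ n, ∀ c : ℝ, 0 ≤ c → c ≤ 1 + K + L → h n * c ≤ 1 := fun n c hc0 hc =>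
    (mul_le_mul_of_nonneg_right (hle n) hc0).trans (by rwa [inv_mul_le_iff₀ hd, mul_one])
  have h1 : ∀ n, h n * K ≤ 1 := fun n => hmul n K hK0 (by linarith [L.coe_nonneg])
  have hh1 : ∀ n, h n ≤ 1 := fun n => by
    simpa using hmul n 1 zero_le_one (by linarith [L.coe_nonneg])
  have hhL : ∀ n, h n * L ≤ 1 := fun n => hmul n L L.coe_nonneg (by linarith)
  have hlim : Tendsto h atTop (𝓝 0) := by
    simpa [hh] using (tendsto_one_div_add_atTop_nhds_zero_nat (𝕜 := ℝ)).const_mul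
      (1 + K + L : ℝ)⁻¹
  have hR := hF₀'.radius_pos
  have hclamp : ∀ n t, schemeInterp T S B L F₀ (h n) (max 0 (min t T))
      = schemeInterp T S B L F₀ (h n) t := fun n t => by
    have := clamp_mem_Icc hT.le t
    rw [schemeInterp, schemeInterp, stepIndex, stepIndex, min_eq_left this.2, max_eq_right this.1]
  obtain ⟨φ, hφ, G, hGm, hG, hGc, hGlim, hGC⟩ := exists_subseq_tendsto_profile
    (F := fun n => schemeInterp T S B L F₀ (h n)) (C := schemeConst S (R + T * L) L) hlim
    (fun n => measurable_schemeInterp hF₀' hS hodd hB hL (h0 n).le (h1 n))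
    (fun n => schemeInterp_isProfile hT.le hF₀' hS hodd hB hL (h0 n) (h1 n))
    (by unfold schemeConst; positivity) hT.le
    (fun n => integral_abs_schemeInterp_sub_le hT.le hF₀' hS hodd hB hL (h0 n) (h1 n)) hclamp
  set C := schemeConst S (R + T * L) L
  have hinit : ∀ n, schemeInterp T S B L F₀ (h n) 0 = F₀ := fun n => by
    rw [schemeInterp, stepIndex, min_eq_left hT.le, max_self, zero_div, Nat.floor_zero, scheme]
  have hG0 : G 0 = F₀ := by
    ext x
    have := hGc 0 x ⟨F₀ x, fun n => by rw [hinit]⟩ 0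
    rw [this, hinit]
  have hsub : ∀ s t, Integrable fun x => G t x - G s x := fun s t => (hG t).integrable_sub (hG s)
  refine ⟨R + T * L, by have := mul_nonneg hT.le L.coe_nonneg; linarith, G,
    ⟨isBV_of_integral_abs_sub_le hT.le hGm hG hGC, fun t _ => (hG t).tails,
      fun t _ => (hG t).mono, fun η hη hηc => ?_, fun χ hχ hχc hsupp hχ0 α => ?_⟩,
    inCL1_iff.2 ⟨fun t _ => hG0 ▸ hsub 0 t, fun t₀ _ => ?_⟩⟩
  -- the initial datum is attained, since `G` is Lipschitz in time with values in `L¹`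
  · obtain ⟨M, hM⟩ := hη.continuous.bounded_above_of_compact_support hηc
    have hi : ∀ t, Integrable fun x => G t x * η x := fun t =>
      (hη.continuous.integrable_of_hasCompactSupport hηc).bdd_mul (c := 1 / 2)
        (hG t).measurable.aestronglyMeasurable (.of_forall (hG t).abs_le_half)
    rw [← hG0, tendsto_iff_dist_tendsto_zero]
    have hz : Tendsto (fun t : ℝ => C * |t - 0| * M) (𝓝[>] 0) (𝓝 0) := by
      have : Continuous fun t : ℝ => C * |t - 0| * M := by fun_prop
      simpa using (this.tendsto 0).mono_left nhdsWithin_le_nhds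
    refine squeeze_zero (fun _ => dist_nonneg) (fun t => ?_) hz
    rw [Real.dist_eq, ← integral_sub (hi t) (hi 0)]
    refine (abs_integral_le_integral_abs).trans ?_
    have hM0 : 0 ≤ M := (norm_nonneg _).trans (hM 0)
    refine le_trans ?_ (mul_le_mul_of_nonneg_right (hGC 0 t) hM0)
    rw [← integral_mul_const]
    refine integral_mono ((hi t).sub (hi 0)).abs ((hsub 0 t).abs.mul_const M) fun x => ?_
    simp only
    rw [← sub_mul, abs_mul]
    exact mul_le_mul_of_nonneg_left (hM x) (abs_nonneg _)
  -- the entropy inequality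
  · have key := integral_entropyIntegrand_nonneg_of_forall_null hS hB hGm hG hχ hχc
      (fun α hα => integral_entropyIntegrand_nonneg_of_null hT.le hF₀' hS hodd hB hBT hL
        (fun n => h0 (φ n)) (fun n => h1 (φ n)) (fun n => hh1 (φ n)) (fun n => hhL (φ n))
        (hlim.comp hφ) hGm hGlim hχ hχc hχ0 hsupp hα) α
    rw [← setIntegral_eq_integral_of_forall_compl_eq_zero (s := Ioo 0 T ×ˢ (univ : Set ℝ))
      (fun z hz => entropyIntegrand_eq_zero (fun h => hz (hsupp h)) α)] at key
    refine key.trans_eq (setIntegral_congr_fun (measurableSet_Ioo.prod MeasurableSet.univ)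
      fun z hz => ?_)
    simp only [entropyIntegrand, hBdef, clampFlux_eq A (Ioo_subset_Icc_self hz.1)]
  -- continuity in time
  · have hz : Tendsto (fun t : ℝ => C * |t - t₀|) (𝓝[Icc 0 T] t₀) (𝓝 0) := by
      have : Continuous fun t : ℝ => C * |t - t₀| := by fun_prop
      simpa using (this.tendsto t₀).mono_left nhdsWithin_le_nhds
    refine squeeze_zero (fun _ => integral_nonneg fun _ => abs_nonneg _) (fun t => ?_) hz
    simp only [sub_sub_sub_cancel_right]
    exact hGC t₀ t

end OpinionBurgers

namespace OpinionBurgers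

/-! ### Step functions -/

section StepFun

variable {N : ℕ} {x w : Fin N → ℝ}

/-- The right-continuous step function which takes the value `g n` to the right of exactly `n` of
the ordered points `x k`. -/
noncomputable def stepFun (x : Fin N → ℝ) (g : ℕ → ℝ) (y : ℝ) : ℝ :=
  g 0 + ∑ k : Fin N, (g (k + 1) - g k) * heaviside (y - x k)

/-- The sum of the first `n` terms of `u`. -/
noncomputable def cumSum (u : Fin N → ℝ) (n : ℕ) : ℝ := ∑ j : Fin N, if (j : ℕ) < n then u j else 0

/-- The value of the empirical distribution function between the `n`-th and the next particle. -/
noncomputable def level (w : Fin N → ℝ) (n : ℕ) : ℝ := -1 / 2 + cumSum w n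

lemma cumSum_zero (u : Fin N → ℝ) : cumSum u 0 = 0 := by simp [cumSum]

lemma cumSum_succ (u : Fin N → ℝ) (k : Fin N) : cumSum u (k + 1) = cumSum u k + u k := by
  have h : ∀ j : Fin N, (if (j : ℕ) < k + 1 then u j else 0)
      = (if (j : ℕ) < k then u j else 0) + if j = k then u j else 0 := fun j => by
    rcases lt_trichotomy (j : ℕ) k with h | h | h
    · simp [h, h.trans (Nat.lt_succ_self _), Fin.ext_iff, h.ne]
    · simp [Fin.ext_iff, h]
    · rw [if_neg (by omega), if_neg (by omega), if_neg (by rw [Fin.ext_iff]; omega), add_zero]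
  rw [cumSum, cumSum, Finset.sum_congr rfl fun j _ => h j, Finset.sum_add_distrib,
    Finset.sum_ite_eq' Finset.univ k, if_pos (Finset.mem_univ _)]

lemma level_zero (w : Fin N → ℝ) : level w 0 = -1 / 2 := by rw [level, cumSum_zero, add_zero]

lemma level_succ (w : Fin N → ℝ) (k : Fin N) : level w (k + 1) = level w k + w k := by
  rw [level, level, cumSum_succ, add_assoc]

lemma level_mono (hw : ∀ k, 0 ≤ w k) : Monotone (level w) := fun m n hmn => by
  refine add_le_add le_rfl (Finset.sum_le_sum fun j _ => ?_)
  split_ifs with h1 h2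
  · exact le_rfl
  · exact absurd (h1.trans_le hmn) h2
  · exact hw j
  · exact le_rfl

lemma level_of_le (hw : ∑ k, w k = 1) {n : ℕ} (hn : N ≤ n) : level w n = 1 / 2 := by
  rw [level, cumSum, Finset.sum_congr rfl fun j _ => if_pos (j.2.trans_le hn), hw]; norm_num

lemma level_mem_Icc (hw : ∀ k, 0 ≤ w k) (hw1 : ∑ k, w k = 1) (n : ℕ) :
    level w n ∈ Icc (-1 / 2) (1 / 2) :=
  ⟨(level_zero w).symm.le.trans (level_mono hw (zero_le)),
    (level_mono hw (le_max_left n N)).trans (level_of_le hw1 (le_max_right n N)).le⟩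

lemma stepFun_level (x w : Fin N → ℝ) (y : ℝ) :
    stepFun x (level w) y = -1 / 2 + ∑ k, w k * heaviside (y - x k) := by
  simp only [stepFun, level_zero, level_succ, add_sub_cancel_left]

/-- A step function over ordered points takes, at each point of the line, the value `g n` for an
index `n` which does not depend on `g`. -/
lemma exists_stepFun_eq (hx : Monotone x) (y : ℝ) :
    ∃ n ≤ N, ∀ g : ℕ → ℝ, stepFun x g y = g n := by
  classical
  have hex : ∃ n ≤ N, ∀ k : Fin N, (k : ℕ) < n ↔ x k ≤ y := by
    by_cases h : ∃ n, ∃ hn : n < N, y < x ⟨n, hn⟩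
    · obtain ⟨hn, hlt⟩ := Nat.find_spec h
      refine ⟨Nat.find h, hn.le, fun k => ⟨fun hk => ?_, fun hk => ?_⟩⟩
      · by_contra hc
        exact Nat.find_min h hk ⟨k.2, not_le.1 hc⟩
      · by_contra hc
        have : x ⟨Nat.find h, hn⟩ ≤ x k := hx (Fin.mk_le_of_le_val (not_lt.1 hc))
        linarith
    · refine ⟨N, le_rfl, fun k => ⟨fun _ => ?_, fun _ => k.2⟩⟩
      by_contra hc
      exact h ⟨k, k.2, not_le.1 hc⟩
  obtain ⟨n, hn, hk⟩ := hex
  refine ⟨n, hn, fun g => ?_⟩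
  have h1 : ∀ k : Fin N, (g (k + 1) - g k) * heaviside (y - x k)
      = if (k : ℕ) < n then g (k + 1) - g k else 0 := fun k => by
    simp only [heaviside, sub_nonneg, ← hk k, mul_ite, mul_one, mul_zero]
  rw [stepFun, Finset.sum_congr rfl fun k _ => h1 k,
    Fin.sum_univ_eq_sum_range (fun k => if k < n then g (k + 1) - g k else 0) N,
    ← Finset.sum_filter]
  have h2 : (Finset.range N).filter (· < n) = Finset.range n := by
    ext k; simp only [Finset.mem_filter, Finset.mem_range]; omega
  rw [h2, Finset.sum_range_sub]
  ring

lemma integral_heaviside_mul {ζ : ℝ → ℝ} (a : ℝ) :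
    ∫ y, heaviside (y - a) * ζ y = ∫ y in Ioi a, ζ y := by
  rw [← integral_Ici_eq_integral_Ioi, ← integral_indicator measurableSet_Ici]
  congr 1 with y
  by_cases h : a ≤ y
  · simp [heaviside, h]
  · simp [heaviside, h]

lemma integrable_heaviside_mul {ζ : ℝ → ℝ} (hζ : Integrable ζ) (a : ℝ) :
    Integrable fun y => heaviside (y - a) * ζ y := by
  have : (fun y => heaviside (y - a) * ζ y) = (Ici a).indicator ζ := by
    ext y
    by_cases h : a ≤ y
    · simp [heaviside, h]
    · simp [heaviside, h]
  rw [this]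
  exact hζ.indicator measurableSet_Ici

lemma integrable_stepFun_mul (x : Fin N → ℝ) (g : ℕ → ℝ) {ζ : ℝ → ℝ} (hζ : Integrable ζ) :
    Integrable fun y => stepFun x g y * ζ y := by
  simp only [stepFun, add_mul, Finset.sum_mul, mul_assoc]
  exact (hζ.const_mul _).add
    (integrable_finsetSum _ fun k _ => (integrable_heaviside_mul hζ _).const_mul _)

lemma integral_stepFun_mul (x : Fin N → ℝ) (g : ℕ → ℝ) {ζ : ℝ → ℝ} (hζ : Integrable ζ) :
    ∫ y, stepFun x g y * ζ y
      = g 0 * (∫ y, ζ y) + ∑ k : Fin N, (g (k + 1) - g k) * ∫ y in Ioi (x k), ζ y := by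
  have i2 := fun k : Fin N => (integrable_heaviside_mul hζ (x k)).const_mul (g (k + 1) - g k)
  simp only [stepFun, add_mul, Finset.sum_mul, mul_assoc]
  rw [integral_add (hζ.const_mul _) (integrable_finsetSum _ fun k _ => i2 k), integral_const_mul,
    integral_finsetSum _ fun k _ => i2 k]
  simp only [integral_const_mul, integral_heaviside_mul]

end StepFun

/-! ### The entropy production of the particle system -/

section Dissipation

variable {N : ℕ} {x w : Fin N → ℝ}

/-- The flux `-v²`, extended by constants outside `[-1/2, 1/2]`. -/
noncomputable def burgersFlux : ℝ → ℝ := fluxExt fun v => -v ^ 2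

lemma burgersFlux_eq {v : ℝ} (hv : v ∈ Icc (-1 / 2 : ℝ) (1 / 2)) : burgersFlux v = -v ^ 2 :=
  fluxExt_eq _ hv

/-- An upward jump from `a` to `b`, moving with the Rankine–Hugoniot speed `-(a + b)`, is admissible
for the concave flux `-v²`. -/
lemma entropyFlux_sub_le {a b : ℝ} (ha : a ∈ Icc (-1 / 2 : ℝ) (1 / 2))
    (hb : b ∈ Icc (-1 / 2 : ℝ) (1 / 2)) (hab : a ≤ b) (α : ℝ) :
    entropyFlux burgersFlux α b - entropyFlux burgersFlux α a ≤ (|b - α| - |a - α|) * -(a + b) := by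
  have key : ∀ v σ, v ∈ Icc (-1 / 2 : ℝ) (1 / 2) → (v ≠ α → Real.sign (v - α) = σ) →
      entropyFlux burgersFlux α v = σ * (-v ^ 2 - burgersFlux α) := by
    intro v σ hv h
    rcases eq_or_ne v α with rfl | hne
    · rw [entropyFlux, burgersFlux_eq hv]; simp
    · rw [entropyFlux, h hne, burgersFlux_eq hv]
  rcases le_or_gt α a with h | h
  · rw [key a 1 ha fun hne => Real.sign_of_pos (sub_pos.2 (lt_of_le_of_ne h hne.symm)),
      key b 1 hb fun hne => Real.sign_of_pos (sub_pos.2 (lt_of_le_of_ne (h.trans hab) hne.symm)),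
      abs_of_nonneg (by linarith), abs_of_nonneg (by linarith)]
    nlinarith
  rcases le_or_gt b α with h' | h'
  · rw [key a (-1) ha fun hne => Real.sign_of_neg (by linarith),
      key b (-1) hb fun hne => Real.sign_of_neg (sub_neg.2 (lt_of_le_of_ne h' hne)),
      abs_of_nonpos (by linarith), abs_of_nonpos (by linarith)]
    nlinarith
  · rw [key a (-1) ha fun hne => Real.sign_of_neg (by linarith),
      key b 1 hb fun hne => Real.sign_of_pos (by linarith),
      burgersFlux_eq ⟨by linarith [ha.1], by linarith [hb.2]⟩,
      abs_of_pos (by linarith), abs_of_neg (by linarith)]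
    nlinarith [mul_pos (sub_pos.2 h) (sub_pos.2 h')]

/-- The slopes of the convex function `|· - α|` over successive intervals increase. -/
lemma abs_sub_slope_le {a b c d : ℝ} (hab : a ≤ b) (hbc : b ≤ c) (hcd : c ≤ d) (α : ℝ) :
    (|b - α| - |a - α|) * (d - c) ≤ (|d - α| - |c - α|) * (b - a) := by
  have hub : ∀ u v, u ≤ v → |v - α| - |u - α| ≤ v - u := fun u v h => by
    have := abs_sub_abs_le_abs_sub (v - α) (u - α)
    rwa [sub_sub_sub_cancel_right, abs_of_nonneg (sub_nonneg.2 h)] at this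
  have hlb : ∀ u v, u ≤ v → -(v - u) ≤ |v - α| - |u - α| := fun u v h => by
    have := abs_sub_abs_le_abs_sub (u - α) (v - α)
    rw [sub_sub_sub_cancel_right, abs_sub_comm u v, abs_of_nonneg (sub_nonneg.2 h)] at this
    linarith
  rcases le_total α b with h | h
  · have e : |d - α| - |c - α| = d - c := by
      rw [abs_of_nonneg (by linarith), abs_of_nonneg (by linarith)]; ring
    rw [e, mul_comm (d - c)]
    exact mul_le_mul_of_nonneg_right (hub a b hab) (sub_nonneg.2 hcd)
  · have e : |b - α| - |a - α| = -(b - a) := by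
      rw [abs_of_nonpos (by linarith), abs_of_nonpos (by linarith)]; ring
    have := mul_le_mul_of_nonneg_right (hlb c d hcd) (sub_nonneg.2 hab)
    rw [e]
    linarith

/-- The entropy production of the empirical distribution function of ordered particles, moving with
the prescribed velocities. If all positions are distinct, the velocities are the Rankine–Hugoniot
speeds of the jumps. The effect of coinciding positions has a sign, since it slows down the
particles of the lower levels and speeds up those of the higher levels. -/
lemma entropyProduction_nonneg (hx : Monotone x) (hw : ∀ k, 0 < w k) (hw1 : ∑ k, w k = 1)
    {ζ : ℝ → ℝ} (hζ : ∀ y, 0 ≤ ζ y) (α : ℝ) :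
    0 ≤ ∑ k : Fin N, ζ (x k) * ((|level w (k + 1) - α| - |level w k - α|)
        * (∑ j, w j * Real.sign (x j - x k))
      - (entropyFlux burgersFlux α (level w (k + 1)) - entropyFlux burgersFlux α (level w k))) := by
  have hw0 : ∀ k, 0 ≤ w k := fun k => (hw k).le
  have hmem := level_mem_Icc hw0 hw1
  set c : Fin N → ℝ := fun k => |level w (k + 1) - α| - |level w k - α| with hc
  -- the velocities if all positions were distinct
  set s : Fin N → Fin N → ℝ := fun j k =>
    1 - (if (j : ℕ) < k then 1 else 0) - (if (j : ℕ) < k + 1 then 1 else 0) with hs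
  have hv : ∀ k : Fin N, ∑ j, w j * s j k = -(level w k + level w (k + 1)) := fun k => by
    have : ∀ j, w j * s j k = w j - (if (j : ℕ) < k then w j else 0)
        - (if (j : ℕ) < k + 1 then w j else 0) := fun j => by
      simp only [hs]; split_ifs <;> ring
    rw [Finset.sum_congr rfl fun j _ => this j, Finset.sum_sub_distrib, Finset.sum_sub_distrib, hw1,
      level, level, cumSum, cumSum]
    ring
  -- the defect is antisymmetric and lives on pairs of particles at the same position
  set E : Fin N → Fin N → ℝ := fun j k => Real.sign (x j - x k) - s j k with hE
  have hE0 : ∀ j k, x j ≠ x k → E j k = 0 := fun j k hjk => by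
    simp only [hE, hs]
    rcases hjk.lt_or_gt with h | h
    · have h1 : j < k := hx.reflect_lt h
      have h2 : (j : ℕ) < k := h1
      rw [Real.sign_of_neg (sub_neg.2 h), if_pos h2, if_pos (by omega)]; ring
    · have h1 : k < j := hx.reflect_lt h
      have h2 : (k : ℕ) < j := h1
      rw [Real.sign_of_pos (sub_pos.2 h), if_neg (by omega), if_neg (by omega)]; ring
  have hEs : ∀ j k, E j k = -E k j := fun j k => by
    have h1 : Real.sign (x j - x k) = -Real.sign (x k - x j) := by
      rw [← Real.sign_neg, neg_sub]
    simp only [hE, hs, h1]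
    rcases lt_trichotomy (j : ℕ) k with h | h | h
    · rw [if_pos h, if_pos (by omega), if_neg (by omega), if_neg (by omega)]; ring
    · rw [if_neg (by omega), if_pos (by omega), if_neg (by omega), if_pos (by omega)]; ring
    · rw [if_neg (by omega), if_neg (by omega), if_pos h, if_pos (by omega)]; ring
  have hEn : ∀ j k, k < j → E j k ≤ 0 := fun j k hkj => by
    have h2 : (k : ℕ) < j := hkj
    simp only [hE, hs]
    rw [if_neg (by omega), if_neg (by omega)]
    linarith [(abs_le.1 (abs_sign_le (x j - x k))).2]
  -- convexity of `|· - α|`: its chord slopes increase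
  have hcw : ∀ j k, k < j → c k * w j ≤ c j * w k := fun j k hkj => by
    have h2 : (k : ℕ) < j := hkj
    have := abs_sub_slope_le (level_mono hw0 (Nat.le_succ (k : ℕ)))
      (level_mono hw0 (Nat.succ_le_of_lt h2)) (level_mono hw0 (Nat.le_succ (j : ℕ))) α
    simp only [Nat.succ_eq_add_one] at this
    rw [level_succ w j, level_succ w k, add_sub_cancel_left, add_sub_cancel_left] at this
    simp only [hc]
    rw [level_succ w j, level_succ w k]
    exact this
  have hpair : ∀ j k, 0 ≤ ζ (x k) * (E j k * (c k * w j - c j * w k)) := fun j k => by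
    refine mul_nonneg (hζ _) ?_
    rcases lt_trichotomy k j with h | h | h
    · exact mul_nonneg_of_nonpos_of_nonpos (hEn j k h) (sub_nonpos.2 (hcw j k h))
    · rw [h]; simp
    · rw [hEs j k]
      exact mul_nonneg (neg_nonneg.2 (hEn k j h)) (sub_nonneg.2 (hcw k j h))
  -- exchange `j` and `k`; where `E` does not vanish, `ζ` takes the same value at the two particles
  have hsum : ∑ k, ∑ j, ζ (x k) * (c k * (w j * E j k))
      = -∑ k, ∑ j, ζ (x k) * (c j * (w k * E j k)) := by
    rw [Finset.sum_comm, ← Finset.sum_neg_distrib]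
    refine Finset.sum_congr rfl fun j _ => ?_
    rw [← Finset.sum_neg_distrib]
    refine Finset.sum_congr rfl fun k _ => ?_
    rcases eq_or_ne (x j) (x k) with h | h
    · rw [h, hEs j k]; ring
    · rw [hE0 j k h, hE0 k j h.symm]; ring
  have hdefect : 0 ≤ ∑ k, ∑ j, ζ (x k) * (c k * (w j * E j k)) := by
    have h2 : ∑ k, ∑ j, ζ (x k) * (E j k * (c k * w j - c j * w k))
        = 2 * ∑ k, ∑ j, ζ (x k) * (c k * (w j * E j k)) := by
      rw [two_mul]
      conv_rhs => rw [← sub_neg_eq_add]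
      conv_rhs => arg 2; rw [hsum, neg_neg]
      simp only [← Finset.sum_sub_distrib]
      refine Finset.sum_congr rfl fun k _ => Finset.sum_congr rfl fun j _ => by ring
    have h3 := Finset.sum_nonneg fun k (_ : k ∈ Finset.univ) =>
      Finset.sum_nonneg fun j (_ : j ∈ Finset.univ) => hpair j k
    rw [h2] at h3
    linarith
  refine hdefect.trans (Finset.sum_le_sum fun k _ => ?_)
  rw [← Finset.mul_sum, ← Finset.mul_sum]
  refine mul_le_mul_of_nonneg_left ?_ (hζ _)
  have h1 := entropyFlux_sub_le (hmem k) (hmem (k + 1)) (level_mono hw0 (Nat.le_succ (k : ℕ))) α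
  have h2 : ∑ j, w j * E j k
      = (∑ j, w j * Real.sign (x j - x k)) + (level w k + level w (k + 1)) := by
    have : ∀ j, w j * E j k = w j * Real.sign (x j - x k) - w j * s j k := fun j => by
      simp only [hE]; ring
    rw [Finset.sum_congr rfl fun j _ => this j, Finset.sum_sub_distrib, hv]
    ring
  rw [h2]
  simp only [hc]
  linarith

end Dissipation

/-! ### The source of a step function -/

section Source

variable {N : ℕ} {x w : Fin N → ℝ} {r : ℝ} {S φ : ℝ → ℝ}

lemma measurable_heaviside : Measurable heaviside :=
  Measurable.ite measurableSet_Ici measurable_const measurable_const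

/-- Convolution with the derivative of a kernel, in terms of the jumps. -/
lemma conv_deriv_stepFun (hφ : IsKernel r φ) (x w : Fin N → ℝ) (y : ℝ) :
    conv (deriv φ) (stepFun x (level w)) y = ∑ k, w k * φ (y - x k) := by
  have hi : Integrable fun z => deriv φ (y - z) := hφ.deriv.integrable.comp_sub_left y
  have e : ∀ z, deriv φ (y - z) * stepFun x (level w) z
      = stepFun x (level w) z * deriv φ (y - z) := fun z => mul_comm _ _
  rw [conv, integral_congr_ae (.of_forall e), integral_stepFun_mul x _ hi,
    integral_sub_left_eq_self (fun z => deriv φ z), hφ.integral_deriv, mul_zero, zero_add]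
  refine Finset.sum_congr rfl fun k _ => ?_
  rw [level_succ, add_sub_cancel_left]
  congr 1
  have hd : ∀ z ∈ Ici (x k), HasDerivAt (fun z => -φ (y - z)) (deriv φ (y - z)) z := fun z _ => by
    simpa using ((hφ.hasDerivAt (y - z)).comp_const_sub y z).fun_neg
  have hlim : Tendsto (fun z => -φ (y - z)) atTop (𝓝 0) := by
    refine tendsto_const_nhds.congr' ?_
    filter_upwards [eventually_gt_atTop (y + r)] with z hz
    rw [hφ.eq_zero fun h => by linarith [h.1], neg_zero]
  rw [integral_Ioi_of_hasDerivAt_of_tendsto' hd hi.integrableOn hlim]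
  ring

/-- Between two particles, the source is the rate of change of the mass on the left. -/
lemma source_stepFun (hS : IsKernel r S) (x w : Fin N → ℝ) (y : ℝ) :
    source S (stepFun x (level w)) y
      = stepFun x (cumSum fun k => w k * ∑ j, w j * S (x k - x j)) y := by
  set G : ℝ → ℝ := fun z => ∑ j, w j * S (z - x j) with hG
  set G' : ℝ → ℝ := fun z => ∑ j, w j * deriv S (z - x j) with hG'
  have c1 : conv (deriv S) (stepFun x (level w)) = G := funext (conv_deriv_stepFun hS x w)
  have c2 : conv (deriv (deriv S)) (stepFun x (level w)) = G' :=
    funext (conv_deriv_stepFun hS.deriv x w)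
  have hd : ∀ z, HasDerivAt G (G' z) z := fun z =>
    HasDerivAt.fun_sum fun j _ => ((hS.hasDerivAt (z - x j)).comp_sub_const z (x j)).const_mul _
  have hi : Integrable G' :=
    integrable_finsetSum _ fun j _ => (hS.deriv.integrable.comp_sub_right (x j)).const_mul _
  have hlim : Tendsto G atBot (𝓝 0) := by
    have : ∀ j, Tendsto (fun z => w j * S (z - x j)) atBot (𝓝 (w j * 0)) := fun j => by
      refine Tendsto.const_mul _ (tendsto_const_nhds.congr' ?_)
      filter_upwards [eventually_lt_atBot (x j - r)] with z hz
      rw [hS.eq_zero fun h => by linarith [h.1]]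
    simpa using tendsto_finsetSum Finset.univ fun j _ => this j
  have hint : ∫ z in Iic y, G' z = G y := by
    rw [integral_Iic_of_hasDerivAt_of_tendsto' (fun z _ => hd z) hi.integrableOn hlim, sub_zero]
  -- the part of the half-line beyond one jump
  have hH : ∀ a, ∫ z in Iic y, heaviside (z - a) * G' z = heaviside (y - a) * (G y - G a) := by
    intro a
    rw [← integral_indicator measurableSet_Iic]
    by_cases ha : a ≤ y
    · have e : (Iic y).indicator (fun z => heaviside (z - a) * G' z) = (Icc a y).indicator G' := by
        ext z
        by_cases h1 : z ≤ y <;> by_cases h2 : a ≤ z <;> simp [heaviside, indicator, h1, h2]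
      rw [e, integral_indicator measurableSet_Icc, integral_Icc_eq_integral_Ioc,
        ← intervalIntegral.integral_of_le ha,
        intervalIntegral.integral_eq_sub_of_hasDerivAt (fun z _ => hd z) hi.intervalIntegrable]
      simp [heaviside, ha]
    · have e : (Iic y).indicator (fun z => heaviside (z - a) * G' z) = fun _ => 0 := by
        ext z
        by_cases h1 : z ≤ y
        · have h2 : ¬ a ≤ z := by linarith
          simp [heaviside, h2]
        · simp [h1]
      rw [e]
      simp [heaviside, ha]
  have key : ∫ z in Iic y, stepFun x (level w) z * G' z
      = -1 / 2 * G y + ∑ k, w k * (heaviside (y - x k) * (G y - G (x k))) := by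
    simp only [stepFun_level, add_mul, Finset.sum_mul, mul_assoc]
    have i2 : ∀ k, Integrable (fun z => w k * (heaviside (z - x k) * G' z))
        (volume.restrict (Iic y)) := fun k =>
      ((integrable_heaviside_mul hi (x k)).const_mul _).restrict
    rw [integral_add (hi.const_mul _).restrict (integrable_finsetSum _ fun k _ => i2 k),
      integral_const_mul, integral_finsetSum _ fun k _ => i2 k, hint]
    simp only [integral_const_mul, hH]
  rw [source, c1, c2, key, stepFun_level, add_mul, Finset.sum_mul, add_sub_add_left_eq_sub,
    ← Finset.sum_sub_distrib, stepFun, cumSum_zero, zero_add]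
  refine Finset.sum_congr rfl fun k _ => ?_
  rw [cumSum_succ]
  ring

end Source
end OpinionBurgers

namespace OpinionBurgers

/-! ### Integrals over moving half-lines -/

section Tail

variable {χ : ℝ × ℝ → ℝ} {ξ : ℝ → ℝ} {t v a : ℝ}

lemma integral_Ioi_eq_shift (ζ : ℝ → ℝ) (a : ℝ) : ∫ y in Ioi a, ζ y = ∫ y in Ioi 0, ζ (a + y) := by
  rw [← integral_indicator measurableSet_Ioi, ← integral_indicator measurableSet_Ioi,
    ← integral_add_left_eq_self _ a]
  congr 1 with y
  by_cases h : 0 < y <;> simp [indicator, h]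

/-- A radius beyond which a compactly supported function of two variables vanishes. -/
lemma exists_radius (hχc : HasCompactSupport χ) : ∃ ρ > 0, ∀ z ∈ tsupport χ, |z.2| ≤ ρ := by
  obtain ⟨ρ, hρ0, hρ⟩ := hχc.isCompact.isBounded.exists_pos_norm_le
  exact ⟨ρ, hρ0, fun z hz => (norm_snd_le z).trans (hρ z hz)⟩

lemma hasCompactSupport_slice (hχc : HasCompactSupport χ) (t : ℝ) :
    HasCompactSupport fun y => χ (t, y) :=
  HasCompactSupport.intro (hχc.isCompact.image continuous_snd) fun _ hy =>
    image_eq_zero_of_notMem_tsupport fun h => hy ⟨_, h, rfl⟩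

lemma integrable_slice (hχ : Continuous χ) (hχc : HasCompactSupport χ) (t : ℝ) :
    Integrable fun y => χ (t, y) :=
  Continuous.integrable_of_hasCompactSupport (by fun_prop) (hasCompactSupport_slice hχc t)

lemma hasDerivAt_slice (hχ : Differentiable ℝ χ) (t y : ℝ) :
    HasDerivAt (fun y => χ (t, y)) (fderiv ℝ χ (t, y) (0, 1)) y :=
  (hχ (t, y)).hasFDerivAt.comp_hasDerivAt y ((hasDerivAt_const y t).prodMk (hasDerivAt_id y))

lemma continuous_fderiv_apply (hχ : ContDiff ℝ ∞ χ) (v : ℝ × ℝ) :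
    Continuous fun z => fderiv ℝ χ z v :=
  (hχ.continuous_fderiv (by simp)).clm_apply continuous_const

lemma integral_Ioi_fderiv_snd (hχ : ContDiff ℝ ∞ χ) (hχc : HasCompactSupport χ) (t a : ℝ) :
    ∫ y in Ioi a, fderiv ℝ χ (t, y) (0, 1) = -χ (t, a) := by
  have hi : Integrable fun y => fderiv ℝ χ (t, y) (0, 1) :=
    integrable_slice (continuous_fderiv_apply hχ _) (hχc.fderiv_apply (𝕜 := ℝ) (0, 1)) t
  obtain ⟨ρ, -, hρ⟩ := exists_radius hχc
  have hlim : Tendsto (fun y => χ (t, y)) atTop (𝓝 0) := by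
    refine tendsto_const_nhds.congr' ?_
    filter_upwards [eventually_gt_atTop ρ] with y hy
    exact (image_eq_zero_of_notMem_tsupport fun h => by
      have := (le_abs_self _).trans (hρ _ h)
      simp only at this
      linarith).symm
  rw [integral_Ioi_of_hasDerivAt_of_tendsto'
    (fun y _ => hasDerivAt_slice (hχ.differentiable (by simp)) t y) hi.integrableOn hlim, zero_sub]

lemma integral_fderiv_snd (hχ : ContDiff ℝ ∞ χ) (hχc : HasCompactSupport χ) (t : ℝ) :
    ∫ y, fderiv ℝ χ (t, y) (0, 1) = 0 :=
  integral_eq_zero_of_hasDerivAt_of_integrable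
    (fun y => hasDerivAt_slice (hχ.differentiable (by simp)) t y)
    (integrable_slice (continuous_fderiv_apply hχ _) (hχc.fderiv_apply (𝕜 := ℝ) (0, 1)) t)
    (integrable_slice hχ.continuous hχc t)

/-- Reynolds' transport theorem on a moving half-line. -/
lemma hasDerivAt_integral_Ioi (hχ : ContDiff ℝ ∞ χ) (hχc : HasCompactSupport χ)
    (hξ : HasDerivAt ξ v t) : HasDerivAt (fun s => ∫ y in Ioi (ξ s), χ (s, y))
      ((∫ y in Ioi (ξ t), fderiv ℝ χ (t, y) (1, 0)) - v * χ (t, ξ t)) t := by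
  have hdiff : Differentiable ℝ χ := hχ.differentiable (by simp)
  have hcd : Continuous (fderiv ℝ χ) := hχ.continuous_fderiv (by simp)
  obtain ⟨ρ, hρ0, hρ⟩ := exists_radius hχc
  obtain ⟨C, hC⟩ := hcd.bounded_above_of_compact_support (hχc.fderiv ℝ)
  set p : ℝ × ℝ := (t, ξ t) with hp
  set c : ℝ := ρ + |ξ t| + 1 with hc
  have hsh : Integrable fun y : ℝ => χ (t, ξ t + y) :=
    (integrable_slice hχ.continuous hχc t).comp_add_left (ξ t)
  -- time and end point as independent variables, on the fixed half-line `(0, ∞)`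
  have hF : HasFDerivAt (fun q : ℝ × ℝ => ∫ y in Ioi 0, χ (q.1, q.2 + y))
      (∫ y in Ioi 0, fderiv ℝ χ (p.1, p.2 + y)) p := by
    refine hasFDerivAt_integral_of_dominated_of_fderiv_le
      (F := fun (q : ℝ × ℝ) (y : ℝ) => χ (q.1, q.2 + y))
      (F' := fun q y => fderiv ℝ χ (q.1, q.2 + y)) (s := Metric.ball p 1)
      (bound := (Icc (-c) c).indicator fun _ => C) (Metric.ball_mem_nhds p one_pos)
      (.of_forall fun q => ?_) hsh.restrict ?_ (.of_forall fun y q hq => ?_) ?_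
      (.of_forall fun y q _ => ?_)
    · exact (hχ.continuous.comp (f := fun y : ℝ => (q.1, q.2 + y))
        (by fun_prop)).aestronglyMeasurable
    · exact (hcd.comp (f := fun y : ℝ => (p.1, p.2 + y)) (by fun_prop)).aestronglyMeasurable
    · by_cases hy : y ∈ Icc (-c) c
      · rw [indicator_of_mem hy]; exact hC _
      · rw [indicator_of_notMem hy]
        refine (norm_eq_zero.2 (image_eq_zero_of_notMem_tsupport fun h => ?_)).le
        have h1 : |q.2 + y| ≤ ρ := hρ _ (tsupport_fderiv_subset ℝ h)
        have h2 : |q.2 - ξ t| < 1 :=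
          (norm_snd_le (q - p)).trans_lt (by simpa [dist_eq_norm] using hq)
        refine hy (abs_le.1 ?_)
        have h3 : y = (q.2 + y) - (q.2 - ξ t) - ξ t := by ring
        rw [h3]
        refine (abs_sub _ _).trans ?_
        have := abs_sub (q.2 + y) (q.2 - ξ t)
        rw [hc]
        linarith
    · exact ((integrable_indicator_iff measurableSet_Icc).2
        (integrableOn_const (by simp))).restrict
    · have hg : HasFDerivAt (fun q : ℝ × ℝ => (q.1, q.2 + y))
          (ContinuousLinearMap.id ℝ (ℝ × ℝ)) q := by
        have : HasFDerivAt (fun q : ℝ × ℝ => q + (0, y)) (ContinuousLinearMap.id ℝ (ℝ × ℝ)) q :=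
          (hasFDerivAt_id q).add_const _
        convert this using 2 with z
        ext <;> simp
      have := (hdiff (q.1, q.2 + y)).hasFDerivAt.comp q hg
      rwa [ContinuousLinearMap.comp_id] at this
  have hi : Integrable (fun y => fderiv ℝ χ (p.1, p.2 + y)) (volume.restrict (Ioi 0)) := by
    have : HasCompactSupport fun y => fderiv ℝ χ (t, y) :=
      HasCompactSupport.intro (hχc.isCompact.image continuous_snd) fun y hy =>
        image_eq_zero_of_notMem_tsupport fun h => hy ⟨_, tsupport_fderiv_subset ℝ h, rfl⟩
    have h2 : Integrable fun y => fderiv ℝ χ (t, y) :=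
      Continuous.integrable_of_hasCompactSupport (by fun_prop) this
    exact (h2.comp_add_left (ξ t)).restrict
  have key := hF.comp_hasDerivAt t ((hasDerivAt_id t).prodMk hξ)
  have e1 : (fun s => ∫ y in Ioi (ξ s), χ (s, y)) = fun s => ∫ y in Ioi 0, χ (s, ξ s + y) :=
    funext fun s => integral_Ioi_eq_shift (fun y => χ (s, y)) _
  rw [e1]
  refine key.congr_deriv ?_
  rw [ContinuousLinearMap.integral_apply hi]
  have e2 : ((1, v) : ℝ × ℝ) = (1, 0) + v • (0, 1) := by ext <;> simp
  have hi' : ∀ w : ℝ × ℝ, Integrable (fun y => fderiv ℝ χ (p.1, p.2 + y) w)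
      (volume.restrict (Ioi 0)) := fun w => hi.apply_continuousLinearMap w
  simp only [e2, map_add, map_smul, smul_eq_mul]
  rw [integral_add (hi' _) ((hi' _).const_mul v), integral_const_mul,
    ← integral_Ioi_eq_shift (fun y => fderiv ℝ χ (t, y) (1, 0)),
    ← integral_Ioi_eq_shift (fun y => fderiv ℝ χ (t, y) (0, 1)), integral_Ioi_fderiv_snd hχ hχc]
  ring

lemma exists_lipschitzOnWith_integral_Ioi {T R : ℝ} {K : NNReal} (hχ : ContDiff ℝ ∞ χ)
    (hχc : HasCompactSupport χ) (hξ : LipschitzWith K ξ) (hR : ∀ t ∈ Icc 0 T, |ξ t| ≤ R) :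
    ∃ C, LipschitzOnWith C (fun s => ∫ y in Ioi (ξ s), χ (s, y)) (Icc 0 T) := by
  obtain ⟨C, hC⟩ := ContDiff.lipschitzWith_of_hasCompactSupport hχc hχ (by simp)
  obtain ⟨ρ, hρ0, hρ⟩ := exists_radius hχc
  set c : ℝ := ρ + R with hc
  have hi : ∀ s : ℝ, Integrable fun y : ℝ => χ (s, ξ s + y) := fun s =>
    (integrable_slice hχ.continuous hχc s).comp_add_left (ξ s)
  have hz : ∀ s ∈ Icc 0 T, ∀ y ∉ Icc (-c) c, χ (s, ξ s + y) = 0 := fun s hs y hy => by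
    refine image_eq_zero_of_notMem_tsupport fun h => hy (abs_le.1 ?_)
    have h1 : |ξ s + y| ≤ ρ := hρ _ h
    have h2 := abs_sub (ξ s + y) (ξ s)
    rw [add_sub_cancel_left] at h2
    linarith [hR s hs]
  refine ⟨(2 * c * (C * max 1 K)).toNNReal, LipschitzOnWith.of_dist_le_mul fun s hs t ht => ?_⟩
  have hc0 : 0 ≤ c := by
    have := (abs_nonneg _).trans (hR s hs)
    linarith
  rw [Real.coe_toNNReal _ (by positivity), integral_Ioi_eq_shift (fun y => χ (s, y)),
    integral_Ioi_eq_shift (fun y => χ (t, y)), Real.dist_eq,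
    ← integral_sub (hi s).restrict (hi t).restrict]
  refine abs_integral_le_integral_abs.trans
    ((setIntegral_le_integral ((hi s).sub (hi t)).abs (.of_forall fun _ => abs_nonneg _)).trans ?_)
  have hle : ∀ y, |χ (s, ξ s + y) - χ (t, ξ t + y)|
      ≤ (Icc (-c) c).indicator (fun _ => C * max 1 K * dist s t) y := fun y => by
    by_cases hy : y ∈ Icc (-c) c
    · rw [indicator_of_mem hy, mul_assoc]
      refine (hC.dist_le_mul (s, ξ s + y) (t, ξ t + y)).trans
        (mul_le_mul_of_nonneg_left ?_ C.coe_nonneg)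
      rw [Prod.dist_eq, dist_add_right]
      refine max_le ?_ ((hξ.dist_le_mul s t).trans ?_)
      · exact le_mul_of_one_le_left dist_nonneg (le_max_left _ _)
      · exact mul_le_mul_of_nonneg_right (le_max_right _ _) dist_nonneg
    · rw [indicator_of_notMem hy, hz s hs y hy, hz t ht y hy, sub_zero, abs_zero]
  refine (integral_mono ((hi s).sub (hi t)).abs ((integrable_indicator_iff measurableSet_Icc).2
    (integrableOn_const (by simp))) hle).trans_eq ?_
  rw [integral_indicator_const _ measurableSet_Icc, measureReal_def, Real.volume_Icc,
    ENNReal.toReal_ofReal (by linarith), smul_eq_mul]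
  ring

end Tail

lemma hasDerivAt_abs_of_differentiableAt {u : ℝ → ℝ} {u' t : ℝ} (hu : HasDerivAt u u' t)
    (hd : DifferentiableAt ℝ (fun s => |u s|) t) :
    HasDerivAt (fun s => |u s|) (Real.sign (u t) * u') t := by
  rcases lt_trichotomy (u t) 0 with h | h | h
  · rw [Real.sign_of_neg h]
    exact (hasDerivAt_abs_neg h).comp t hu
  · have h0 := hd.hasDerivAt
    have hmin : IsLocalMin (fun s => |u s|) t := .of_forall fun s => by simp [h]
    rw [hmin.hasDerivAt_eq_zero h0] at h0
    simpa [h] using h0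
  · rw [Real.sign_of_pos h]
    exact (hasDerivAt_abs_pos h).comp t hu

end OpinionBurgers

namespace OpinionBurgers

/-! ### The entropy inequality for the particle system -/

/-- Lipschitz paths of positions `X` and weights `W`, ordered and of total weight one at the times
of `[0, T]`, which solve the equations of motion almost everywhere. -/
structure IsParticlePath {N : ℕ} (T R : ℝ) (S : ℝ → ℝ) (X W : ℝ → Fin N → ℝ) : Prop where
  lip_pos : ∃ C, ∀ i, LipschitzWith C fun t => X t i
  lip_weight : ∃ C, ∀ i, LipschitzWith C fun t => W t i
  mono : ∀ t ∈ Icc 0 T, Monotone (X t)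
  abs_lt : ∀ t ∈ Icc 0 T, ∀ i, |X t i| < R
  weight_pos : ∀ t ∈ Icc 0 T, ∀ i, 0 < W t i
  sum_weight : ∀ t ∈ Icc 0 T, ∑ i, W t i = 1
  deriv_pos : ∀ i, ∀ᵐ t, t ∈ Ioo 0 T →
    HasDerivAt (fun s => X s i) (∑ j, W t j * Real.sign (X t j - X t i)) t
  deriv_weight : ∀ i, ∀ t ∈ Ioo 0 T,
    HasDerivAt (fun s => W s i) (W t i * ∑ j, W t j * S (X t i - X t j)) t

section Static

variable {N : ℕ} {x w : Fin N → ℝ} {r R : ℝ} {S : ℝ → ℝ}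

lemma isProfile_stepFun (hR : ∀ k, |x k| < R) (hw : ∀ k, 0 < w k)
    (hw1 : ∑ k, w k = 1) : IsProfile R (stepFun x (level w)) := by
  refine ⟨fun y z hyz => ?_, fun y hy => ⟨?_, ?_⟩⟩
  · rw [stepFun_level, stepFun_level]
    refine add_le_add le_rfl (Finset.sum_le_sum fun k _ => mul_le_mul_of_nonneg_left ?_ (hw k).le)
    simp only [heaviside]
    split_ifs <;> linarith
  · have h : ∀ k, w k * heaviside (y - x k) = w k := fun k => by
      rw [heaviside, if_pos (by linarith [(abs_lt.1 (hR k)).2]), mul_one]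
    rw [stepFun_level, Finset.sum_congr rfl fun k _ => h k, hw1]; norm_num
  · have h : ∀ k, w k * heaviside (-y - x k) = 0 := fun k => by
      rw [heaviside, if_neg (by linarith [(abs_lt.1 (hR k)).1]), mul_zero]
    rw [stepFun_level, Finset.sum_congr rfl fun k _ => h k, Finset.sum_const_zero, add_zero]

/-- The entropy integral of a step function over the line at a fixed time, by summation by parts. -/
lemma integral_entropyIntegrand_stepFun (hx : Monotone x) (hS : IsKernel r S) {χ : ℝ × ℝ → ℝ}
    (hχ : ContDiff ℝ ∞ χ) (hχc : HasCompactSupport χ) (α t : ℝ) {b : ℝ → ℝ} :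
    ∫ y, (|stepFun x (level w) y - α| * fderiv ℝ χ (t, y) (1, 0)
      + Real.sign (stepFun x (level w) y - α) * (b (stepFun x (level w) y) - b α)
        * fderiv ℝ χ (t, y) (0, 1)
      + Real.sign (stepFun x (level w) y - α) * χ (t, y) * source S (stepFun x (level w)) y)
    = |level w 0 - α| * (∫ y, fderiv ℝ χ (t, y) (1, 0))
      + ∑ k : Fin N, ((|level w (k + 1) - α| - |level w k - α|)
          * (∫ y in Ioi (x k), fderiv ℝ χ (t, y) (1, 0))
        - (entropyFlux b α (level w (k + 1)) - entropyFlux b α (level w k)) * χ (t, x k)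
        + (Real.sign (level w (k + 1) - α)
            * cumSum (fun k => w k * ∑ j, w j * S (x k - x j)) (k + 1)
          - Real.sign (level w k - α) * cumSum (fun k => w k * ∑ j, w j * S (x k - x j)) k)
          * ∫ y in Ioi (x k), χ (t, y)) := by
  set u : Fin N → ℝ := fun k => w k * ∑ j, w j * S (x k - x j) with hu
  have i1 : Integrable fun y => fderiv ℝ χ (t, y) (1, 0) :=
    integrable_slice (continuous_fderiv_apply hχ _) (hχc.fderiv_apply (𝕜 := ℝ) (1, 0)) t
  have i2 : Integrable fun y => fderiv ℝ χ (t, y) (0, 1) :=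
    integrable_slice (continuous_fderiv_apply hχ _) (hχc.fderiv_apply (𝕜 := ℝ) (0, 1)) t
  have i3 := integrable_slice hχ.continuous hχc t
  -- each of the three terms is itself a step function times a smooth function
  have e : ∀ y, (|stepFun x (level w) y - α| * fderiv ℝ χ (t, y) (1, 0)
      + Real.sign (stepFun x (level w) y - α) * (b (stepFun x (level w) y) - b α)
        * fderiv ℝ χ (t, y) (0, 1)
      + Real.sign (stepFun x (level w) y - α) * χ (t, y) * source S (stepFun x (level w)) y)
    = stepFun x (fun n => |level w n - α|) y * fderiv ℝ χ (t, y) (1, 0)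
      + stepFun x (fun n => entropyFlux b α (level w n)) y * fderiv ℝ χ (t, y) (0, 1)
      + stepFun x (fun n => Real.sign (level w n - α) * cumSum u n) y * χ (t, y) := fun y => by
    obtain ⟨n, -, hn⟩ := exists_stepFun_eq hx y
    rw [source_stepFun hS]
    simp only [hn, entropyFlux, ← hu]
    ring
  have j1 := integrable_stepFun_mul x (fun n => |level w n - α|) i1
  have j2 := integrable_stepFun_mul x (fun n => entropyFlux b α (level w n)) i2
  have j3 := integrable_stepFun_mul x (fun n => Real.sign (level w n - α) * cumSum u n) i3
  have j12 : Integrable fun y => stepFun x (fun n => |level w n - α|) y * fderiv ℝ χ (t, y) (1, 0)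
      + stepFun x (fun n => entropyFlux b α (level w n)) y * fderiv ℝ χ (t, y) (0, 1) := j1.add j2
  rw [integral_congr_ae (.of_forall e), integral_add j12 j3, integral_add j1 j2,
    integral_stepFun_mul x _ i1, integral_stepFun_mul x _ i2, integral_stepFun_mul x _ i3,
    integral_fderiv_snd hχ hχc, cumSum_zero, mul_zero, mul_zero, zero_mul, zero_add, zero_add,
    add_assoc, add_assoc, ← Finset.sum_add_distrib, ← Finset.sum_add_distrib]
  congr 1
  refine Finset.sum_congr rfl fun k _ => ?_
  rw [integral_Ioi_fderiv_snd hχ hχc]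
  ring

end Static

namespace IsParticlePath

variable {N : ℕ} {T R r : ℝ} {S : ℝ → ℝ} {X W : ℝ → Fin N → ℝ}

lemma isProfile (h : IsParticlePath T R S X W) {t : ℝ} (ht : t ∈ Icc 0 T) :
    IsProfile R (stepFun (X t) (level (W t))) :=
  isProfile_stepFun (h.abs_lt t ht) (h.weight_pos t ht) (h.sum_weight t ht)

lemma measurable (h : IsParticlePath T R S X W) :
    Measurable (Function.uncurry fun t => stepFun (X t) (level (W t))) := by
  obtain ⟨C, hC⟩ := h.lip_pos
  obtain ⟨C', hC'⟩ := h.lip_weight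
  have e : (Function.uncurry fun t => stepFun (X t) (level (W t)))
      = fun z : ℝ × ℝ => -1 / 2 + ∑ k, W z.1 k * heaviside (z.2 - X z.1 k) :=
    funext fun z => stepFun_level _ _ _
  rw [e]
  refine (Finset.measurable_sum _ fun k _ => ?_).const_add _
  refine ((hC' k).continuous.measurable.comp measurable_fst).mul (measurable_heaviside.comp ?_)
  exact measurable_snd.sub ((hC k).continuous.measurable.comp measurable_fst)

lemma exists_lipschitzWith_level (h : IsParticlePath T R S X W) (n : ℕ) :
    ∃ C, LipschitzWith C fun t => level (W t) n := by
  obtain ⟨C, hC⟩ := h.lip_weight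
  refine ⟨N * C, LipschitzWith.of_dist_le_mul fun s t => ?_⟩
  rw [Real.dist_eq, level, level, add_sub_add_left_eq_sub, cumSum, cumSum, ← Finset.sum_sub_distrib]
  refine (Finset.abs_sum_le_sum_abs _ _).trans ((Finset.sum_le_card_nsmul _ _ (C * dist s t)
    fun j _ => ?_).trans_eq ?_)
  · split_ifs
    · exact (hC j).dist_le_mul s t
    · rw [sub_zero, abs_zero]; positivity
  · simp [mul_assoc]

lemma hasDerivAt_level (h : IsParticlePath T R S X W) {t : ℝ} (ht : t ∈ Ioo 0 T) (n : ℕ) :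
    HasDerivAt (fun s => level (W s) n)
      (cumSum (fun k => W t k * ∑ j, W t j * S (X t k - X t j)) n) t := by
  refine (HasDerivAt.fun_sum fun j _ => ?_).const_add _
  split_ifs
  · exact h.deriv_weight j t ht
  · exact hasDerivAt_const _ _

lemma ae_hasDerivAt_abs_level_sub (h : IsParticlePath T R S X W) (α : ℝ) (n : ℕ) :
    ∀ᵐ t, t ∈ Ioo 0 T → HasDerivAt (fun s => |level (W s) n - α|)
      (Real.sign (level (W t) n - α)
        * cumSum (fun k => W t k * ∑ j, W t j * S (X t k - X t j)) n) t := by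
  obtain ⟨C, hC⟩ := h.exists_lipschitzWith_level n
  have hL : LipschitzWith C fun s => |level (W s) n - α| :=
      LipschitzWith.of_dist_le_mul fun s t => by
    refine le_trans ?_ (hC.dist_le_mul s t)
    rw [Real.dist_eq, Real.dist_eq]
    refine (abs_abs_sub_abs_le_abs_sub _ _).trans_eq ?_
    rw [sub_sub_sub_cancel_right]
  filter_upwards [hL.ae_differentiableAt_real] with t hd ht
  exact hasDerivAt_abs_of_differentiableAt ((h.hasDerivAt_level ht n).sub_const α) hd

/-- The empirical distribution function of the particles satisfies the entropy inequality: its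
entropy integral is, up to the integral of a derivative in time, the integral of the entropy
production. -/
lemma integral_entropyIntegrand_nonneg (h : IsParticlePath T R S X W) (hT : 0 < T)
    (hS : IsKernel r S) {L : NNReal} (hB : IsRegularFlux L fun _ => burgersFlux) {χ : ℝ × ℝ → ℝ}
    (hχ : ContDiff ℝ ∞ χ) (hχc : HasCompactSupport χ) (hsupp : tsupport χ ⊆ Ioo 0 T ×ˢ univ)
    (hχ0 : ∀ z, 0 ≤ χ z) (α : ℝ) :
    0 ≤ ∫ z in Ioo 0 T ×ˢ univ, entropyIntegrand S (fun _ => burgersFlux)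
      (fun t => stepFun (X t) (level (W t))) χ α z := by
  set F : ℝ → ℝ → ℝ := fun t => stepFun (X t) (level (W t)) with hF
  set I : ℝ × ℝ → ℝ := entropyIntegrand S (fun _ => burgersFlux) F χ α with hI
  have hI_int : IntegrableOn I (Ioo 0 T ×ˢ univ) := by
    have hcl : Continuous fun t : ℝ => max 0 (min t T) := by fun_prop
    have hGm : Measurable (Function.uncurry fun t => F (max 0 (min t T))) :=
      h.measurable.comp (f := fun z : ℝ × ℝ => (max 0 (min z.1 T), z.2))
        ((hcl.measurable.comp measurable_fst).prodMk measurable_snd)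
    refine (integrable_entropyIntegrand hS hB hGm
      (fun t => h.isProfile (clamp_mem_Icc hT.le t)) hχ hχc α).integrableOn.congr_fun
      (fun z hz => ?_)
      (measurableSet_Ioo.prod MeasurableSet.univ)
    simp only [hI, entropyIntegrand, min_eq_left hz.1.2.le, max_eq_right hz.1.1.le]
  rw [Measure.volume_eq_prod] at hI_int ⊢
  rw [setIntegral_prod _ hI_int, Measure.restrict_univ]
  obtain ⟨CX, hCX⟩ := h.lip_pos
  -- the primitives in time
  set c : Fin N → ℝ → ℝ := fun k s => |level (W s) (k + 1) - α| - |level (W s) k - α| with hc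
  set Q : Fin N → ℝ → ℝ := fun k s => ∫ y in Ioi (X s k), χ (s, y) with hQ
  obtain ⟨ρ, hρ0, hρ⟩ := exists_radius hχc
  set Q₀ : ℝ → ℝ := fun s => ∫ y in Ioi (-ρ - 1), χ (s, y) with hQ₀
  have hend : ∀ s, s ∉ Ioo 0 T → ∀ y, χ (s, y) = 0 := fun s hs y =>
    image_eq_zero_of_notMem_tsupport fun h => hs (hsupp h).1
  have h0 : (0 : ℝ) ∉ Ioo 0 T := fun h => lt_irrefl _ h.1
  have hTT : T ∉ Ioo 0 T := fun h => lt_irrefl _ h.2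
  have acA : ∀ n : ℕ,
      AbsolutelyContinuousOnInterval (fun s => |level (W s) n - α|) 0 T := fun n => by
    obtain ⟨C, hC⟩ := h.exists_lipschitzWith_level n
    refine LipschitzOnWith.absolutelyContinuousOnInterval (K := C)
      (LipschitzOnWith.of_dist_le_mul fun s _ t _ => le_trans ?_ (hC.dist_le_mul s t))
    rw [Real.dist_eq, Real.dist_eq]
    exact (abs_abs_sub_abs_le_abs_sub _ _).trans_eq (by rw [sub_sub_sub_cancel_right])
  have acQ : ∀ k, AbsolutelyContinuousOnInterval (Q k) 0 T := fun k => by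
    obtain ⟨C, hC⟩ := exists_lipschitzOnWith_integral_Ioi hχ hχc (hCX k)
      (fun t ht => (h.abs_lt t ht k).le)
    exact LipschitzOnWith.absolutelyContinuousOnInterval (by rwa [uIcc_of_le hT.le])
  have acQ₀ : AbsolutelyContinuousOnInterval Q₀ 0 T := by
    obtain ⟨C, hC⟩ := exists_lipschitzOnWith_integral_Ioi (T := T) hχ hχc
      (LipschitzWith.const (-ρ - 1)) (fun _ _ => le_rfl)
    exact LipschitzOnWith.absolutelyContinuousOnInterval (by rwa [uIcc_of_le hT.le])
  have acP : ∀ k, AbsolutelyContinuousOnInterval (c k * Q k) 0 T := fun k =>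
    ((acA (k + 1)).sub (acA k)).mul (acQ k)
  -- the primitives vanish at both end points, since the test function does
  have int_zero : ∀ P : ℝ → ℝ, AbsolutelyContinuousOnInterval P 0 T → P 0 = 0 → P T = 0 →
      IntegrableOn (deriv P) (Ioo 0 T) ∧ ∫ s in Ioo 0 T, deriv P s = 0 := fun P hP hP0 hPT => by
    have h1 := hP.intervalIntegrable_deriv
    have h2 := hP.integral_deriv_eq_sub
    rw [intervalIntegrable_iff_integrableOn_Ioo_of_le hT.le] at h1
    rw [intervalIntegral.integral_of_le hT.le, integral_Ioc_eq_integral_Ioo, hP0, hPT,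
      sub_zero] at h2
    exact ⟨h1, h2⟩
  have zP := fun k => int_zero _ (acP k) (by simp [hQ, hend 0 h0]) (by simp [hQ, hend T hTT])
  have zQ₀ := int_zero _ acQ₀ (by simp [hQ₀, hend 0 h0]) (by simp [hQ₀, hend T hTT])
  set J : ℝ → ℝ := fun t => |-1 / 2 - α| * deriv Q₀ t + ∑ k, deriv (c k * Q k) t with hJ
  have hJi : IntegrableOn J (Ioo 0 T) :=
    (zQ₀.1.const_mul _).add (integrable_finsetSum _ fun k _ => (zP k).1)
  have hJ0 : ∫ t in Ioo 0 T, J t = 0 := by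
    rw [hJ, integral_add (zQ₀.1.const_mul _) (integrable_finsetSum _ fun k _ => (zP k).1),
      integral_const_mul, zQ₀.2, integral_finsetSum _ fun k _ => (zP k).1]
    simp [fun k => (zP k).2]
  refine hJ0.symm.le.trans (integral_mono_ae hJi ?_ ?_)
  · rw [IntegrableOn, ← Measure.prod_restrict, Measure.restrict_univ] at hI_int
    exact hI_int.integral_prod_left
  refine (ae_restrict_iff' measurableSet_Ioo).2 ?_
  filter_upwards [ae_all_iff.2 h.deriv_pos, ae_all_iff.2 (h.ae_hasDerivAt_abs_level_sub α)]
    with t hX hA ht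
  have ht' := Ioo_subset_Icc_self ht
  have dQ := fun k => hasDerivAt_integral_Ioi hχ hχc (hX k ht)
  have dP := fun k : Fin N => ((((hA (k + 1) ht).sub (hA k ht)).mul (dQ k)).deriv)
  have dQ₀ : deriv Q₀ t = ∫ y, fderiv ℝ χ (t, y) (1, 0) := by
    have h1 := (hasDerivAt_integral_Ioi hχ hχc (hasDerivAt_const t (-ρ - 1))).deriv
    rw [zero_mul, sub_zero] at h1
    rw [hQ₀, h1]
    refine setIntegral_eq_integral_of_forall_compl_eq_zero fun y hy => ?_
    rw [image_eq_zero_of_notMem_tsupport (f := fderiv ℝ χ) fun h => ?_]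
    · rfl
    · have h2 := neg_abs_le y
      have h3 : |y| ≤ ρ := hρ _ (tsupport_fderiv_subset ℝ h)
      rw [mem_Ioi, not_lt] at hy
      linarith
  have hprod := entropyProduction_nonneg (h.mono t ht') (h.weight_pos t ht') (h.sum_weight t ht')
    (ζ := fun y => χ (t, y)) (fun y => hχ0 _) α
  have key := integral_entropyIntegrand_stepFun (x := X t) (w := W t) (b := burgersFlux)
    (h.mono t ht') hS hχ hχc α t
  -- by Reynolds and summation by parts
  have e1 : ∫ y, I (t, y) = J t + ∑ k : Fin N, χ (t, X t k)
      * ((|level (W t) (k + 1) - α| - |level (W t) k - α|)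
        * (∑ j, W t j * Real.sign (X t j - X t k))
      - (entropyFlux burgersFlux α (level (W t) (k + 1))
        - entropyFlux burgersFlux α (level (W t) k))) := by
    refine key.trans ?_
    rw [hJ, level_zero]
    simp only [dQ₀]
    rw [add_assoc, ← Finset.sum_add_distrib]
    congr 1
    refine Finset.sum_congr rfl fun k _ => ?_
    have e2 : deriv (c k * Q k) t = _ := dP k
    rw [e2]
    simp only [Pi.sub_apply]
    ring
  rw [e1]
  linarith

end IsParticlePath

end OpinionBurgers

namespace OpinionBurgers

/-! ### Solutions of the particle system -/

lemma isFlux_neg_sq (T : ℝ) : IsFlux T (fun _ v => -v ^ 2) := by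
  refine ⟨fun t _ => ?_, fun t₀ _ => ?_⟩
  · have h1 : lipSeminorm (fun v => -v ^ 2) ≤ (1 : NNReal) := by
      rw [lipSeminorm_le_iff]
      intro v hv w hw
      rw [show -v ^ 2 - -w ^ 2 = -(v + w) * (v - w) by ring, abs_mul, abs_neg]
      refine mul_le_mul_of_nonneg_right ?_ (abs_nonneg _)
      rw [NNReal.coe_one]
      exact abs_le.2 ⟨by linarith [hv.1, hw.1], by linarith [hv.2, hw.2]⟩
    have h2 : (⨆ v ∈ fluxDomain, ENNReal.ofReal |(-v ^ 2 : ℝ)|) ≤ ENNReal.ofReal 1 :=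
      iSup₂_le fun v hv => ENNReal.ofReal_le_ofReal (by
        rw [abs_neg, abs_of_nonneg (sq_nonneg v)]
        nlinarith [hv.1, hv.2])
    exact ENNReal.add_lt_top.2 ⟨h2.trans_lt ENNReal.ofReal_lt_top, h1.trans_lt ENNReal.coe_lt_top⟩
  · have : lipNorm (fun v => -v ^ 2 - -v ^ 2) = 0 := by simp [lipNorm, lipSeminorm]
    simp only [this]
    exact tendsto_const_nhds

lemma clampFlux_const (T : ℝ) (g : ℝ → ℝ) (t : ℝ) : clampFlux T (fun _ => g) t = fluxExt g := rfl

lemma lipschitzWith_integral_of_abs_le {g : ℝ → ℝ} {C : ℝ} (hg : Measurable g)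
    (hC : ∀ t, |g t| ≤ C) (a : ℝ) :
    LipschitzWith C.toNNReal fun t => a + ∫ s in (0 : ℝ)..t, g s := by
  have hi : ∀ u v, IntervalIntegrable g volume u v := fun u v =>
    ((measurable_locallyIntegrable hg hC).integrableOn_isCompact isCompact_uIcc).intervalIntegrable
  refine LipschitzWith.of_dist_le_mul fun s t => ?_
  rw [Real.coe_toNNReal _ ((abs_nonneg _).trans (hC 0)), Real.dist_eq, Real.dist_eq,
    add_sub_add_left_eq_sub, intervalIntegral.integral_interval_sub_left (hi _ _) (hi _ _)]
  exact intervalIntegral.norm_integral_le_of_norm_le_const (f := g) fun u _ => hC u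

/-- A continuous function which does not start from a positive value, and does not increase while it
is positive, is never positive. -/
lemma nonpos_of_antitone_while_pos {g : ℝ → ℝ} {T : ℝ} (hg : Continuous g) (h0 : g 0 ≤ 0)
    (h : ∀ s t, 0 ≤ s → s ≤ t → t ≤ T → (∀ r ∈ Ioc s t, 0 < g r) → g t ≤ g s) {t : ℝ}
    (ht : t ∈ Icc 0 T) : g t ≤ 0 := by
  have hK : IsCompact (Icc 0 t ∩ {s | g s ≤ 0}) :=
    isCompact_Icc.inter_right (isClosed_le hg continuous_const)
  obtain ⟨s, ⟨hs, hs0⟩, hmax⟩ :=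
    hK.exists_isMaxOn ⟨0, ⟨le_rfl, ht.1⟩, h0⟩ continuous_id.continuousOn
  refine (h s t hs.1 hs.2 ht.2 fun r hr => ?_).trans hs0
  by_contra hc
  have : r ≤ s := hmax ⟨⟨hs.1.trans hr.1.le, hr.2⟩, not_lt.1 hc⟩
  linarith [hr.1]

lemma sign_le_sign {a b : ℝ} (h : a ≤ b) : Real.sign a ≤ Real.sign b := by
  rcases lt_trichotomy a 0 with ha | ha | ha
  · rw [Real.sign_of_neg ha]
    exact (abs_le.1 (abs_sign_le b)).1
  · subst ha
    rcases h.eq_or_lt with hb | hb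
    · rw [← hb]
    · rw [Real.sign_zero, Real.sign_of_pos hb]; exact zero_le_one
  · rw [Real.sign_of_pos ha, Real.sign_of_pos (ha.trans_le h)]

namespace IsParticleSolution

variable {N : ℕ} {T r : ℝ} {S : ℝ → ℝ} {x m : ℝ → Fin N → ℝ}

/-- Particle solutions extend to Lipschitz paths on the whole line. Weights stay positive because
they solve a linear equation, and their sum is constant because `S` is odd. Particles stay ordered
because the velocity of a particle is a nonincreasing function of its position. -/
lemma exists_isParticlePath (h : IsParticleSolution N T S x m) (hT : 0 < T) (hS : IsKernel r S)
    (hodd : ∀ x, S (-x) = -S x) (hN : 1 ≤ N) (h0 : IsParticleDatum N (x 0) (m 0)) :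
    ∃ (R : ℝ) (X W : ℝ → Fin N → ℝ), IsParticlePath T R S X W ∧
      ∀ t ∈ Icc 0 T, stepFun (X t) (level (W t)) = empiricalCDF N (x t) (m t) := by
  have hN' : (0 : ℝ) < N := by exact_mod_cast hN
  -- the solution, frozen outside the time interval
  have hcl : Continuous fun t : ℝ => max 0 (min t T) := by fun_prop
  have hcle : ∀ t ∈ Icc 0 T, max 0 (min t T) = t := fun t ht => by
    rw [min_eq_left ht.2, max_eq_right ht.1]
  set xc : ℝ → Fin N → ℝ := fun t => x (max 0 (min t T)) with hxc
  set mc : ℝ → Fin N → ℝ := fun t => m (max 0 (min t T)) with hmc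
  have cx : Continuous xc := h.cont_x.comp_continuous hcl fun t => clamp_mem_Icc hT.le t
  have cm : Continuous mc := h.cont_m.comp_continuous hcl fun t => clamp_mem_Icc hT.le t
  have cxi : ∀ i, Continuous fun t => xc t i := fun i => (continuous_apply i).comp cx
  have cmi : ∀ i, Continuous fun t => mc t i := fun i => (continuous_apply i).comp cm
  obtain ⟨Cm, hCm⟩ : ∃ C, ∀ t i, |mc t i| ≤ C := by
    obtain ⟨C, hC⟩ := (isCompact_Icc.image_of_continuousOn h.cont_m).isBounded.exists_norm_le
    exact ⟨C, fun t i => (norm_le_pi_norm _ i).trans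
      (hC _ (mem_image_of_mem m (clamp_mem_Icc hT.le t)))⟩
  obtain ⟨Cx, hCx⟩ : ∃ C, ∀ t i, |xc t i| ≤ C := by
    obtain ⟨C, hC⟩ := (isCompact_Icc.image_of_continuousOn h.cont_x).isBounded.exists_norm_le
    exact ⟨C, fun t i => (norm_le_pi_norm _ i).trans
      (hC _ (mem_image_of_mem x (clamp_mem_Icc hT.le t)))⟩
  obtain ⟨CS, hCS⟩ := hS.continuous.bounded_above_of_compact_support hS.hasCompactSupport
  set V : Fin N → ℝ → ℝ := fun i s =>
    1 / (N : ℝ) * ∑ j, mc s j * Real.sign (xc s j - xc s i) with hV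
  set c : Fin N → ℝ → ℝ := fun i s => 1 / (N : ℝ) * ∑ j, mc s j * S (xc s i - xc s j) with hc
  set U : Fin N → ℝ → ℝ := fun i s =>
    1 / (N : ℝ) * ∑ j, mc s i * mc s j * S (xc s i - xc s j) with hU
  have hUc : ∀ i s, U i s = mc s i * c i s := fun i s => by
    simp only [hU, hc, mul_assoc, ← Finset.mul_sum]; ring
  have cc : ∀ i, Continuous (c i) := fun i => continuous_const.mul
    (continuous_finsetSum _ fun j _ => (cmi j).mul (hS.continuous.comp ((cxi i).sub (cxi j))))
  have cU : ∀ i, Continuous (U i) := fun i => by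
    rw [show U i = fun s => mc s i * c i s from funext (hUc i)]
    exact (cmi i).mul (cc i)
  have mV : ∀ i, Measurable (V i) := fun i => (Finset.measurable_sum _ fun j _ =>
    (cmi j).measurable.mul (measurable_sign.comp ((cxi j).sub (cxi i)).measurable)).const_mul _
  have bV : ∀ i s, |V i s| ≤ 1 / N * ∑ _j : Fin N, Cm * 1 := fun i s =>
    abs_mul_le_mul (abs_of_pos (by positivity)).le ((Finset.abs_sum_le_sum_abs _ _).trans
      (Finset.sum_le_sum fun j _ => abs_mul_le_mul (hCm s j) (abs_sign_le _)))
  have bU : ∀ i s, |U i s| ≤ 1 / N * ∑ _j : Fin N, Cm * Cm * CS := fun i s =>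
    abs_mul_le_mul (abs_of_pos (by positivity)).le ((Finset.abs_sum_le_sum_abs _ _).trans
      (Finset.sum_le_sum fun j _ =>
        abs_mul_le_mul (abs_mul_le_mul (hCm s i) (hCm s j)) (hCS _)))
  have iV : ∀ i u v, IntervalIntegrable (V i) volume u v := fun i u v =>
    ((measurable_locallyIntegrable (mV i) (bV i)).integrableOn_isCompact
      isCompact_uIcc).intervalIntegrable
  set X : ℝ → Fin N → ℝ := fun t i => x 0 i + ∫ s in (0 : ℝ)..t, V i s with hX
  set M : ℝ → Fin N → ℝ := fun t i => m 0 i + ∫ s in (0 : ℝ)..t, U i s with hM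
  have hsub : ∀ t ∈ Icc 0 T, ∀ s ∈ uIcc 0 t, max 0 (min s T) = s := fun t ht s hs => by
    rw [uIcc_of_le ht.1] at hs
    exact hcle s ⟨hs.1, hs.2.trans ht.2⟩
  have hXx : ∀ t ∈ Icc 0 T, X t = x t := fun t ht => by
    ext i
    rw [h.eq_x t ht i]
    simp only [hX, add_right_inj]
    exact intervalIntegral.integral_congr fun s hs => by simp only [hV, hxc, hmc, hsub t ht s hs]
  have hMm : ∀ t ∈ Icc 0 T, M t = m t := fun t ht => by
    ext i
    rw [h.eq_m t ht i]
    simp only [hM, add_right_inj]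
    exact intervalIntegral.integral_congr fun s hs => by simp only [hU, hxc, hmc, hsub t ht s hs]
  have hxcX : ∀ t ∈ Icc 0 T, xc t = X t := fun t ht => by rw [hXx t ht, hxc]; simp only [hcle t ht]
  have hmcM : ∀ t ∈ Icc 0 T, mc t = M t := fun t ht => by rw [hMm t ht, hmc]; simp only [hcle t ht]
  have lX := fun i => lipschitzWith_integral_of_abs_le (mV i) (bV i) (x 0 i)
  have lM := fun i => lipschitzWith_integral_of_abs_le (cU i).measurable (bU i) (m 0 i)
  have dM : ∀ i t, HasDerivAt (fun s => M s i) (U i t) t := fun i t =>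
    ((cU i).integral_hasStrictDerivAt 0 t).hasDerivAt.const_add _
  -- the weight solves a linear equation: multiply by the integrating factor
  have hMpos : ∀ t ∈ Icc 0 T, ∀ i, 0 < M t i := fun t ht i => by
    set g : ℝ → ℝ := fun s => M s i * Real.exp (-∫ u in (0 : ℝ)..s, c i u) with hg
    have dE : ∀ s, HasDerivAt (fun s => Real.exp (-∫ u in (0 : ℝ)..s, c i u))
        (Real.exp (-∫ u in (0 : ℝ)..s, c i u) * -c i s) s := fun s =>
      ((cc i).integral_hasStrictDerivAt 0 s).hasDerivAt.fun_neg.exp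
    have dg : ∀ s, HasDerivAt g (U i s * Real.exp (-∫ u in (0 : ℝ)..s, c i u)
        + M s i * (Real.exp (-∫ u in (0 : ℝ)..s, c i u) * -c i s)) s := fun s =>
      (dM i s).fun_mul (dE s)
    have hconst := constant_of_has_deriv_right_zero (f := g) (a := 0) (b := T)
      (fun s _ => (dg s).continuousAt.continuousWithinAt) (fun s hs => by
        refine ((dg s).congr_deriv ?_).hasDerivWithinAt
        rw [hUc, hmcM s (Ico_subset_Icc_self hs)]
        ring) t ht
    have h1 : g 0 = m 0 i := by simp [hg, hM]
    rw [h1] at hconst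
    have h2 : 0 < g t := hconst ▸ h0.pos i
    exact pos_of_mul_pos_left h2 (Real.exp_pos _).le
  -- the double sum is antisymmetric
  have hUsum : ∀ s, ∑ i, U i s = 0 := fun s => by
    have h1 : ∑ i, ∑ j, mc s i * mc s j * S (xc s i - xc s j)
        = -∑ i, ∑ j, mc s i * mc s j * S (xc s i - xc s j) := by
      conv_lhs => rw [Finset.sum_comm]
      rw [← Finset.sum_neg_distrib]
      refine Finset.sum_congr rfl fun i _ => ?_
      rw [← Finset.sum_neg_distrib]
      refine Finset.sum_congr rfl fun j _ => ?_
      rw [← neg_sub (xc s i) (xc s j), hodd]; ring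
    simp only [hU, ← Finset.mul_sum]
    rw [show ∑ i, ∑ j, mc s i * mc s j * S (xc s i - xc s j) = 0 by linarith, mul_zero]
  have hMsum : ∀ t, ∑ i, M t i = N := fun t => by
    simp only [hM, Finset.sum_add_distrib]
    rw [← intervalIntegral.integral_finsetSum fun i _ => (cU i).intervalIntegrable _ _]
    simp only [hUsum, intervalIntegral.integral_zero, add_zero]
    have := h0.mean_one
    field_simp at this
    exact this
  -- where `X i > X j`, the velocity of `i` is at most that of `j`
  have hmono : ∀ t ∈ Icc 0 T, Monotone (X t) := fun t ht i j hij => by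
    rcases hij.eq_or_lt with rfl | hlt
    · exact le_rfl
    refine sub_nonpos.1 (nonpos_of_antitone_while_pos (g := fun t => X t i - X t j) (T := T)
      ((lX i).continuous.sub (lX j).continuous) ?_ (fun s t hs hst htT hpos => ?_) ht)
    · simpa [hX] using (h0.ordered hlt).le
    · have e : (X t i - X t j) - (X s i - X s j) = ∫ r in s..t, (V i r - V j r) := by
        rw [intervalIntegral.integral_sub (iV _ _ _) (iV _ _ _),
          ← intervalIntegral.integral_interval_sub_left (iV i 0 t) (iV i 0 s),
          ← intervalIntegral.integral_interval_sub_left (iV j 0 t) (iV j 0 s)]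
        simp only [hX]; ring
      have hle : ∫ r in s..t, (V i r - V j r) ≤ 0 := by
        rw [intervalIntegral.integral_of_le hst]
        refine setIntegral_nonpos measurableSet_Ioc fun r hr => sub_nonpos.2 ?_
        have hr' : r ∈ Icc 0 T := ⟨hs.trans hr.1.le, hr.2.trans htT⟩
        refine mul_le_mul_of_nonneg_left (Finset.sum_le_sum fun k _ =>
          mul_le_mul_of_nonneg_left (sign_le_sign ?_) ?_) (by positivity)
        · have := hpos r hr
          rw [hxcX r hr']
          linarith
        · rw [hmcM r hr']; exact (hMpos r hr' k).le
      linarith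
  refine ⟨Cx + 1, X, fun t i => M t i / N, ⟨⟨_, lX⟩, ?_, hmono, fun t ht i => ?_,
    fun t ht i => div_pos (hMpos t ht i) hN', fun t _ => ?_, fun i => ?_, fun i t ht => ?_⟩,
    fun t ht => ?_⟩
  · refine ⟨(1 / N * ∑ _j : Fin N, Cm * Cm * CS).toNNReal,
      fun i => LipschitzWith.of_dist_le_mul fun s t => ?_⟩
    rw [Real.dist_eq, ← sub_div, abs_div, abs_of_pos hN']
    exact (div_le_self (abs_nonneg _) (by exact_mod_cast hN)).trans ((lM i).dist_le_mul s t)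
  · rw [← hxcX t ht]
    exact (hCx t i).trans_lt (by linarith)
  · rw [← Finset.sum_div, hMsum, div_self hN'.ne']
  · filter_upwards [LocallyIntegrable.ae_hasDerivAt_integral
      (measurable_locallyIntegrable (mV i) (bV i))] with t hd ht
    refine ((hd 0).const_add (x 0 i)).congr_deriv ?_
    have ht' := Ioo_subset_Icc_self ht
    simp only [hV]
    rw [hxcX t ht', hmcM t ht', Finset.mul_sum]
    exact Finset.sum_congr rfl fun j _ => by ring
  · refine ((dM i t).div_const _).congr_deriv ?_
    have ht' := Ioo_subset_Icc_self ht
    simp only [hU]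
    rw [hxcX t ht', hmcM t ht', Finset.mul_sum, Finset.mul_sum, Finset.sum_div]
    exact Finset.sum_congr rfl fun j _ => by ring
  · ext y
    rw [stepFun_level, empiricalCDF, hXx t ht, Finset.mul_sum]
    simp only [hMm t ht]
    congr 1
    exact Finset.sum_congr rfl fun j _ => by ring

/-- The empirical distribution functions of the particles are, away from questions of measurability,
entropy solutions for the flux `-v²`. -/
lemma exists_isPreSolution (h : IsParticleSolution N T S x m) (hT : 0 < T) (hS : IsKernel r S)
    (hodd : ∀ x, S (-x) = -S x) (hN : 1 ≤ N) (h0 : IsParticleDatum N (x 0) (m 0)) :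
    ∃ R, IsPreSolution T (clampFlux T fun _ v => -v ^ 2) S R
        (fun t => empiricalCDF N (x t) (m t)) ∧
      (∀ t ∈ Icc 0 T, IsProfile R (empiricalCDF N (x t) (m t))) ∧
      InCL1 T (fun t y => empiricalCDF N (x t) (m t) y - empiricalCDF N (x 0) (m 0) y) := by
  obtain ⟨R, X, W, hp, he⟩ := h.exists_isParticlePath hT hS hodd hN h0
  obtain ⟨L, hB⟩ := (isFlux_neg_sq T).exists_isRegularFlux hT.le
  have hprof : ∀ t ∈ Icc 0 T, IsProfile R (empiricalCDF N (x t) (m t)) := fun t ht =>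
    he t ht ▸ hp.isProfile ht
  have hΩ : MeasurableSet (Ioo 0 T ×ˢ (univ : Set ℝ)) := measurableSet_Ioo.prod MeasurableSet.univ
  have h00 : (0 : ℝ) ∈ Icc 0 T := ⟨le_rfl, hT.le⟩
  refine ⟨R, ⟨?_, fun t ht => hprof t (Ioo_subset_Icc_self ht), fun χ hχ hχc hsupp hχ0 α => ?_⟩,
    hprof, inCL1_iff.2 ⟨fun t ht => (hprof t ht).integrable_sub (hprof 0 h00), fun t₀ ht₀ => ?_⟩⟩
  · refine AEStronglyMeasurable.congr hp.measurable.aestronglyMeasurable ?_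
    refine (ae_restrict_iff' hΩ).2 (.of_forall fun z hz => ?_)
    exact congrFun (he z.1 (Ioo_subset_Icc_self hz.1)) z.2
  · refine (hp.integral_entropyIntegrand_nonneg hT hS hB hχ hχc hsupp hχ0 α).trans_eq
      (setIntegral_congr_fun hΩ fun z hz => ?_)
    simp only [entropyIntegrand, he z.1 (Ioo_subset_Icc_self hz.1)]
    rfl
  · obtain ⟨C, hC⟩ := hp.lip_pos
    obtain ⟨C', hC'⟩ := hp.lip_weight
    have hlim : Tendsto (fun t => 2 * (C * |t - t₀|) + 2 * R * (N * (C' * |t - t₀|)))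
        (𝓝[Icc 0 T] t₀) (𝓝 0) := by
      have : Continuous fun t => 2 * (C * |t - t₀|) + 2 * R * (N * (C' * |t - t₀|)) := by fun_prop
      simpa using (this.tendsto t₀).mono_left nhdsWithin_le_nhds
    refine squeeze_zero' (.of_forall fun t => integral_nonneg fun _ => abs_nonneg _) ?_ hlim
    filter_upwards [self_mem_nhdsWithin] with t ht
    simp only [sub_sub_sub_cancel_right]
    -- the distribution functions at two times are close in the Lévy sense
    have hlevy : ∀ s ∈ Icc 0 T, ∀ t ∈ Icc 0 T, ∀ y,
        stepFun (X s) (level (W s)) y ≤ stepFun (X t) (level (W t)) (y + C * |s - t|)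
          + N * (C' * |s - t|) := fun s _ t ht y => by
      have hk : ∀ k, W s k * heaviside (y - X s k)
          ≤ W t k * heaviside (y + C * |s - t| - X t k) + C' * |s - t| := fun k => by
        have h1 := abs_le.1 ((hC k).dist_le_mul s t)
        have h2 := abs_le.1 ((hC' k).dist_le_mul s t)
        rw [Real.dist_eq] at h1 h2
        have h3 := hp.weight_pos t ht k
        have h4 : 0 ≤ C' * |s - t| := by positivity
        simp only [heaviside]
        split_ifs <;> linarith [h1.1, h1.2, h2.1, h2.2]
      rw [stepFun_level, stepFun_level, add_assoc]
      refine add_le_add le_rfl ((Finset.sum_le_sum fun k _ => hk k).trans_eq ?_)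
      rw [Finset.sum_add_distrib]
      simp
    rw [← he t ht, ← he t₀ ht₀]
    refine (hp.isProfile ht).integral_abs_sub_le (hp.isProfile ht₀) (hlevy t ht t₀ ht₀)
      (fun y => ?_) (by positivity)
    have := hlevy t₀ ht₀ t ht (y - C * |t - t₀|)
    rw [abs_sub_comm t₀ t, sub_add_cancel] at this
    linarith

end IsParticleSolution

end OpinionBurgers

namespace OpinionBurgers

/-! ### The mean field limit -/

lemma tendsto_iSup_normL1 {T r R R' : ℝ} {S F₀ : ℝ → ℝ} {F : ℝ → ℝ → ℝ}
    {x m : (N : ℕ) → ℝ → Fin N → ℝ} (hT : 0 < T) (hS : IsKernel r S)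
    (hodd : ∀ x, S (-x) = -S x) (hF₀ : IsInitialDatum R F₀)
    (hF : IsEntropySolution T (fun _ v => -v ^ 2) S F₀ R' F)
    (hFc : InCL1 T (fun t y => F t y - F₀ y))
    (hxm : ∀ N, 1 ≤ N → IsParticleDatum N (x N 0) (m N 0) ∧ IsParticleSolution N T S (x N) (m N))
    (h0 : Tendsto (fun N => normL1 (fun y => empiricalCDF N (x N 0) (m N 0) y - F₀ y))
      atTop (𝓝 0)) :
    (∀ N, 1 ≤ N → InCL1 T (fun t y => empiricalCDF N (x N t) (m N t) y - F t y)) ∧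
      Tendsto (fun N => ⨆ t ∈ Icc 0 T,
        normL1 (fun y => empiricalCDF N (x N t) (m N t) y - F t y)) atTop (𝓝 0) := by
  have hF₀' := hF₀.isProfile
  obtain ⟨L, hB⟩ := (isFlux_neg_sq T).exists_isRegularFlux hT.le
  set K := sourceConst S (R' + 1) with hK
  have hK0 : 0 ≤ K := sourceConst_nonneg
    (by linarith [(hF.isProfile (t := 0) ⟨le_rfl, hT.le⟩).radius_pos])
  have key : ∀ N, 1 ≤ N → InCL1 T (fun t y => empiricalCDF N (x N t) (m N t) y - F t y) ∧
      (⨆ t ∈ Icc 0 T, normL1 (fun y => empiricalCDF N (x N t) (m N t) y - F t y)) ≤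
        ENNReal.ofReal (Real.exp (K * T)) *
          normL1 (fun y => empiricalCDF N (x N 0) (m N 0) y - F₀ y) := by
    intro N hN
    obtain ⟨hd, hs⟩ := hxm N hN
    obtain ⟨P, hpre, hprof, hc⟩ := hs.exists_isPreSolution hT hS hodd hN hd
    set E : ℝ → ℝ → ℝ := fun t => empiricalCDF N (x N t) (m N t) with hE
    have hE0 : IsProfile P (E 0) := hprof 0 ⟨le_rfl, hT.le⟩
    have hCL : InCL1 T (fun t y => E t y - F t y) := by
      have := (hc.sub hFc).sub_const (hF₀'.integrable_sub hE0)
      convert this using 3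
      simp only [hE]; ring
    refine ⟨hCL, ?_⟩
    have hinit : Tendsto (fun t => ∫ y, |E t y - E 0 y|) (𝓝[>] 0) (𝓝 0) :=
      (((inCL1_iff.1 hc).2 0 ⟨le_rfl, hT.le⟩).mono_left
        (nhdsWithin_le_iff.2 (Icc_mem_nhdsGT hT))).congr fun t => by
          simp only [hE, sub_self, sub_zero]
    have hae := hF.isPreSolution.ae_integral_abs_sub_le hT hS hpre hB hB hF₀' hE0
      (hF.tendsto_initial hT hF₀') hinit (l := 0) (fun ε hε => ⟨1, one_pos, fun s _ t _ _ => by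
        simp only [clampFlux_const, sub_self]
        exact (LipschitzWith.const _).weaken zero_le⟩)
    have hall := le_on_Icc_of_ae hT (hCL.continuousOn.congr fun t _ =>
      integral_congr_ae (.of_forall fun y => abs_sub_comm _ _)) (by fun_prop) hae
    refine iSup₂_le fun t ht => ?_
    have ht' := (hprof t ht).integrable_sub (hF.isProfile ht)
    rw [normL1_eq ht', normL1_eq (hE0.integrable_sub hF₀'),
      ← ENNReal.ofReal_mul (Real.exp_pos _).le]
    refine ENNReal.ofReal_le_ofReal ?_
    have h1 := hall t ht
    simp only [NNReal.coe_zero, mul_zero, add_zero] at h1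
    simp only [abs_sub_comm (F t _), abs_sub_comm (F₀ _)] at h1
    refine h1.trans (mul_le_mul_of_nonneg_right (Real.exp_le_exp.2
      (mul_le_mul_of_nonneg_left ht.2 hK0)) (integral_nonneg fun _ => abs_nonneg _))
  refine ⟨fun N hN => (key N hN).1, ?_⟩
  have hlim : Tendsto (fun N => ENNReal.ofReal (Real.exp (K * T)) *
      normL1 (fun y => empiricalCDF N (x N 0) (m N 0) y - F₀ y)) atTop (𝓝 0) := by
    simpa using ENNReal.Tendsto.const_mul h0 (.inr ENNReal.ofReal_ne_top)
  refine tendsto_of_tendsto_of_tendsto_of_le_of_le' tendsto_const_nhds hlim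
    (.of_forall fun _ => zero_le) ?_
  filter_upwards [eventually_ge_atTop 1] with N hN using (key N hN).2

end OpinionBurgers

theorem mainTheorem1 :
    -- well-posedness
    (∀ (T r R : ℝ) (S : ℝ → ℝ) (A : ℝ → ℝ → ℝ) (F₀ : ℝ → ℝ),
      0 < T → 0 < r → 0 < R → ContDiff ℝ ∞ S → tsupport S ⊆ Icc (-r) r →
      IsFlux T A → IsInitialDatum R F₀ →
      ((∀ x, S (-x) = -S x) →
        ∃ R' ≥ R, ∃ F : ℝ → ℝ → ℝ, IsEntropySolution T A S F₀ R' F ∧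
          InCL1 T (fun t x => F t x - F₀ x)) ∧
      (∀ (R₁ R₂ : ℝ) (F G : ℝ → ℝ → ℝ),
        IsEntropySolution T A S F₀ R₁ F → IsEntropySolution T A S F₀ R₂ G →
        ∀ᵐ t ∂(volume.restrict (Icc 0 T)), F t =ᵐ[volume] G t)) ∧
    -- stability
    (∃ C : ℝ → ℝ → ℝ → ℝ → ℝ, (∀ a b c d, 0 < C a b c d) ∧
      ∀ (T r R : ℝ) (S : ℝ → ℝ) (A A' : ℝ → ℝ → ℝ) (F₀ G₀ : ℝ → ℝ) (F G : ℝ → ℝ → ℝ),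
      0 < T → 0 < r → 0 < R → ContDiff ℝ ∞ S → tsupport S ⊆ Icc (-r) r →
      IsFlux T A → IsFlux T A' → IsInitialDatum R F₀ → IsInitialDatum R G₀ →
      IsEntropySolution T A S F₀ R F → IsEntropySolution T A' S G₀ R G →
      (∀ᵐ t ∂(volume.restrict (Icc 0 T)), StabilityEstimate T
        (C r R (supNorm (deriv (deriv S))) (supNorm (deriv S))) A A' F₀ G₀ F G t) ∧
      (InCL1 T (fun t x => F t x - F₀ x) → InCL1 T (fun t x => G t x - G₀ x) →
        ∀ t ∈ Icc 0 T, StabilityEstimate T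
          (C r R (supNorm (deriv (deriv S))) (supNorm (deriv S))) A A' F₀ G₀ F G t)) ∧
    -- mean field limit
    (∀ (T r R R' : ℝ) (S : ℝ → ℝ) (F₀ : ℝ → ℝ) (F : ℝ → ℝ → ℝ)
      (x m : (N : ℕ) → ℝ → Fin N → ℝ),
      0 < T → 0 < r → 0 < R → ContDiff ℝ ∞ S → tsupport S ⊆ Icc (-r) r →
      (∀ x, S (-x) = -S x) → IsInitialDatum R F₀ →
      IsEntropySolution T (fun _ v => -v ^ 2) S F₀ R' F →
      InCL1 T (fun t y => F t y - F₀ y) →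
      (∀ N, 1 ≤ N → IsParticleDatum N (x N 0) (m N 0) ∧
        IsParticleSolution N T S (x N) (m N)) →
      Tendsto (fun N => normL1 (fun y => empiricalCDF N (x N 0) (m N 0) y - F₀ y)) atTop (𝓝 0) →
      (∀ N, 1 ≤ N → InCL1 T (fun t y => empiricalCDF N (x N t) (m N t) y - F t y)) ∧
      Tendsto (fun N => ⨆ t ∈ Icc 0 T,
        normL1 (fun y => empiricalCDF N (x N t) (m N t) y - F t y)) atTop (𝓝 0)) := by
  refine ⟨fun T r R S A F₀ hT hr hR hS hsupp hA hF₀ => ⟨fun hodd => ?_, fun R₁ R₂ F G hF hG => ?_⟩,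
    ⟨fun a b c d => 1 + |2 * a * d + 2 * (b + 1) * (2 * a * c)|, fun a b c d => by positivity,
      fun T r R S A A' F₀ G₀ F G hT hr hR hS hsupp hA hA' hF₀ hG₀ hF hG => ?_⟩,
    fun T r R R' S F₀ F x m hT hr hR hS hsupp hodd hF₀ hF hFc hxm h0 =>
      tendsto_iSup_normL1 hT ⟨hS, hsupp⟩ hodd hF₀ hF hFc hxm h0⟩
  · exact exists_isEntropySolution hT ⟨hS, hsupp⟩ hodd hA hF₀
  · exact hF.ae_eq hT ⟨hS, hsupp⟩ hA hG hF₀.isProfile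
  · refine hF.stability hT ⟨hS, hsupp⟩ hA hA' hG hF₀.isProfile hG₀.isProfile ?_
    have := IsKernel.sourceConst_le ⟨hS, hsupp⟩ hr (add_pos hR one_pos)
    linarith [le_abs_self (2 * r * supNorm (deriv S)
      + 2 * (R + 1) * (2 * r * supNorm (deriv (deriv S))))]
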